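/- Conventions. A $d$-polytope is a full-dimensional convex polytope in $\mathbb{R}^d$. A polytopal digraph $G(P)$ is a polytope $P$ together with an orientation of every edge of its skeleton. For a face $H$ of $P$, the subdigraph induced by $H$ is formed by the vertices of $P$ in $H$ and the arcs between them. $G(P)$ is an acyclic USO if it has no directed cycle and, for every non-empty face $H$, the subdigraph induced by $H$ has a unique source and a unique sink. $G(P)$ has the Holt–Klee property if it is a USO and, for every $k\ge 0$ and every $k$-face $H$, the subdigraph induced by $H$ contains $k$ distinct directed paths from its source to its sink that pairwise share no other vertex. $G(P)$ has the shelling property if there are a polytope $P^*$ whose face lattice is anti-isomorphic to that of $P$ and a topological sort $v_1,\dots,v_m$ of the vertices in $G(P)$ (no arc goes from a later to an earlier vertex) such that the facets of $P^*$ corresponding to $v_1,\dots,v_m$, in this order, are a shelling of $P^*$. Here an ordering $F_1,\dots,F_s$ of the facets of a polytope $Q$ is a shelling if the facets are points, or if $F_1$ has a shelling and, for every $j>1$, $F_j\cap\bigcup_{i<j}F_i=G_1\cup\dots\cup G_r$ for some shelling $G_1,\dots,G_r,\dots,G_t$ of $F_j$ with $1\le r\le t$. $G(P)$ is an $X$-type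 graph if it is an acyclic USO with the Holt–Klee property that does not have the shelling property. A vertex of a $d$-polytope is simple if it has exactly $d$ neighbours. Two operations on polytopal digraphs are considered. Truncation: let $G(P)$ be an acyclic polytopal digraph of a $4$-polytope $P$ with a unique sink $v$ that is a simple vertex, let $v_1,v_2,v_3,v_4$ be the neighbours of $v$, labelled so that there is no directed path from $v_4$ to $v_3$, and let $u_1,u_2$ be points in the relative interiors of the edges $[v,v_1]$, $[v,v_2]$. The new polytope is the part of $P$ that is not strictly on the same side as $v$ of the hyperplane through $u_1,u_2,v_3,v_4$. The arcs not incident to $v$ are kept, and the new edges are oriented $(v_3,v_4)$ (if this is not already an edge), $(v_1,u_1),(v_3,u_1),(v_4,u_1),(v_2,u_2),(v_3,u_2),(v_4,u_2),(u_1,u_2)$. Pyramid: for a polytopal digraph $G(P)$ of a $d$-polytope $P$, the new $(d+1)$-polytope is the convex hull of $P\times\{0\}$ and a point $v\in\mathbb{R}^{d+1}$ outside $\mathbb{R}^d\times\{0\}$. The arcs of $G(P)$ are kept, and every edge from a vertex of $P\times\{0\}$ to $v$ is directed to $v$. Theorem. Let $P_0$ be a $4$-polytope with $n_0$ vertices that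 has an $X$-type graph $G(P_0)$ whose unique sink is a simple vertex of $P_0$. Then for every $d\ge 4$ and every $n\ge n_0+d-4$ there is a polytopal digraph $G(P)$ of a $d$-polytope $P$ with $n$ vertices which is an $X$-type graph and which is obtained from $G(P_0)$ by a finite sequence of truncation and pyramid operations. -/

import Mathlib

namespace Polytopal

/-- A `d`-polytope in `ℝ^d`: the convex hull of a finite set of points that affinely spans `ℝ^d`. -/
def IsPolytope {d : ℕ} (P : Set (Fin d → ℝ)) : Prop :=
  (∃ S : Finset (Fin d → ℝ), P = convexHull ℝ (S : Set (Fin d → ℝ))) ∧ affineSpan ℝ P = ⊤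

/-- The face lattice `L(P)`, ordered by inclusion. The faces are the sets of maximizers over `P` of
linear functionals (so `P` itself is a face), and the empty set. -/
abbrev FaceLattice {d : ℕ} (P : Set (Fin d → ℝ)) : Type :=
  {F : Set (Fin d → ℝ) // IsExposed ℝ P F}

/-- The dimension of a (non-empty) face. -/
noncomputable def faceDim {d : ℕ} (F : Set (Fin d → ℝ)) : ℕ :=
  Module.finrank ℝ (vectorSpan ℝ F)

/-- The facets of `P` are its inclusion-maximal proper faces. -/
def IsFacet {d : ℕ} (P F : Set (Fin d → ℝ)) : Prop :=
  IsExposed ℝ P F ∧ F ≠ P ∧ ∀ F', IsExposed ℝ P F' → F ⊆ F' → F' = F ∨ F' = P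

/-- `[u, v]` is an edge of `P` with the two distinct endpoints `u`, `v`. -/
def IsEdge {d : ℕ} (P : Set (Fin d → ℝ)) (u v : Fin d → ℝ) : Prop :=
  u ≠ v ∧ IsExposed ℝ P (segment ℝ u v)

/-- A simple vertex of a `d`-polytope: a vertex with exactly `d` neighbours. -/
def IsSimpleVertex {d : ℕ} (P : Set (Fin d → ℝ)) (v : Fin d → ℝ) : Prop :=
  v ∈ P.extremePoints ℝ ∧ {w | IsEdge P v w}.ncard = d

/-! ### Shellings -/

/-- `L` lists every facet of `P` exactly once. -/
def IsFacetOrder {d : ℕ} (P : Set (Fin d → ℝ)) (L : List (Set (Fin d → ℝ))) : Prop :=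
  L.Nodup ∧ ∀ F, F ∈ L ↔ IsFacet P F

/-- `IsShelling P L`: the list `L` is a shelling of the polytope `P`. Either the facets are points
(or `P` is a point and its only proper face is empty), or
* the first facet has a shelling, and
* every later facet `L[j]` has a shelling `M j` such that the intersection of `L[j]` with the union
  of the previous facets is the union of a non-empty beginning segment of `M j`. -/
inductive IsShelling {d : ℕ} : Set (Fin d → ℝ) → List (Set (Fin d → ℝ)) → Prop
  | points (P : Set (Fin d → ℝ)) (L : List (Set (Fin d → ℝ)))
      (order : IsFacetOrder P L) (small : ∀ F ∈ L, F.Subsingleton) : IsShelling P L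
  | step (P : Set (Fin d → ℝ)) (L : List (Set (Fin d → ℝ))) (order : IsFacetOrder P L)
      (M : ℕ → List (Set (Fin d → ℝ))) (r : ℕ → ℕ)
      (shelling : ∀ (j : ℕ) (hj : j < L.length), IsShelling L[j] (M j))
      (segment : ∀ (j : ℕ) (hj : j < L.length), 0 < j →
        1 ≤ r j ∧ r j ≤ (M j).length ∧
          L[j] ∩ (⋃ F ∈ L.take j, F) = ⋃ F ∈ (M j).take (r j), F) : IsShelling P L

/-! ### Polytopal digraphs -/

/-- A polytopal digraph: a `d`-polytope in `ℝ^d` together with an orientation of its skeleton. -/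
structure PolytopalDigraph (d : ℕ) where
  /-- the polytope -/
  carrier : Set (Fin d → ℝ)
  isPolytope : IsPolytope carrier
  /-- `arc u v`: the edge with endpoints `u`, `v` is directed from `u` to `v` -/
  arc : (Fin d → ℝ) → (Fin d → ℝ) → Prop
  isEdge_of_arc : ∀ u v, arc u v → IsEdge carrier u v
  arc_iff_not_arc : ∀ u v, IsEdge carrier u v → (arc u v ↔ ¬ arc v u)

namespace PolytopalDigraph

variable {d : ℕ} (G : PolytopalDigraph d)

/-- The vertices of the polytope. -/
def vertexSet : Set (Fin d → ℝ) := G.carrier.extremePoints ℝ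

/-- No directed cycles. -/
def IsAcyclic : Prop := ∀ v, ¬ Relation.TransGen G.arc v v

/-- `v` is a source of the subdigraph induced by the face `F`. -/
def IsSource (F : Set (Fin d → ℝ)) (v : Fin d → ℝ) : Prop :=
  v ∈ G.vertexSet ∧ v ∈ F ∧ ∀ w ∈ F, ¬ G.arc w v

/-- `v` is a sink of the subdigraph induced by the face `F`. -/
def IsSink (F : Set (Fin d → ℝ)) (v : Fin d → ℝ) : Prop :=
  v ∈ G.vertexSet ∧ v ∈ F ∧ ∀ w ∈ F, ¬ G.arc v w

/-- Unique sink orientation: every non-empty face has a unique source and a unique sink. -/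
def IsUSO : Prop :=
  ∀ F, IsExposed ℝ G.carrier F → F.Nonempty → (∃! s, G.IsSource F s) ∧ (∃! t, G.IsSink F t)

/-- `p` lists the vertices of a directed path from `s` to `t` in the subdigraph induced by `F`. -/
def IsDirectedPath (F : Set (Fin d → ℝ)) (s t : Fin d → ℝ) (p : List (Fin d → ℝ)) : Prop :=
  p.IsChain G.arc ∧ p.Nodup ∧ (∀ x ∈ p, x ∈ G.vertexSet ∧ x ∈ F) ∧
    p.head? = some s ∧ p.getLast? = some t

/-- The Holt-Klee property: `G` is a unique sink orientation, and every `k`-face has `k` distinct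
directed paths from its source to its sink which share no vertex other than these two. -/
def HoltKlee : Prop :=
  G.IsUSO ∧ ∀ F, IsExposed ℝ G.carrier F → F.Nonempty → ∀ s t, G.IsSource F s → G.IsSink F t →
    ∃ p : Fin (faceDim F) → List (Fin d → ℝ), Function.Injective p ∧
      (∀ i, G.IsDirectedPath F s t (p i)) ∧
      ∀ i j, i ≠ j → ∀ x, x ∈ p i → x ∈ p j → x = s ∨ x = t

/-- `r` is a topological sort: it lists every vertex exactly once, and no arc goes from a later
vertex to an earlier one. -/
def IsTopologicalSort (r : List (Fin d → ℝ)) : Prop :=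
  r.Nodup ∧ (∀ v, v ∈ r ↔ v ∈ G.vertexSet) ∧ r.Pairwise fun u v => ¬ G.arc v u

/-- The shelling property: for some combinatorial polar `Q` of the polytope (a polytope whose face
lattice is anti-isomorphic to that of the polytope, through `φ`) and some topological sort `r`, the
facets of `Q` corresponding to the vertices, in the order given by `r`, are a shelling of `Q`. -/
def ShellingProperty : Prop :=
  ∃ (Q : Set (Fin d → ℝ)) (φ : FaceLattice G.carrier ≃o (FaceLattice Q)ᵒᵈ)
    (r : List (Fin d → ℝ)) (L : List (Set (Fin d → ℝ))),
    IsPolytope Q ∧ G.IsTopologicalSort r ∧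
    List.Forall₂ (fun v F => ∃ f : FaceLattice G.carrier,
      f.1 = {v} ∧ (OrderDual.ofDual (φ f)).1 = F) r L ∧
    IsShelling Q L

/-- An `X`-type graph. -/
def IsXType : Prop :=
  G.IsAcyclic ∧ G.IsUSO ∧ G.HoltKlee ∧ ¬ G.ShellingProperty

/-- `G'` is a truncation of the acyclic polytopal digraph `G` of a 4-polytope at its unique sink
`v`, a simple vertex with neighbours `v₁, v₂, v₃, v₄`. The hyperplane through `u₁ ∈ (v, v₁)`,
`u₂ ∈ (v, v₂)`, `v₃`, `v₄` is `{x | f x = c}`, and the side of it that contains `v` is cut off.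
There is no directed path from `v₄` to `v₃`; so if these two are adjacent already in `G`, then the
edge is directed from `v₃` to `v₄` there. -/
def IsTruncation (G G' : PolytopalDigraph 4) : Prop :=
  G.IsAcyclic ∧
  ∃ v v₁ v₂ v₃ v₄ u₁ u₂ : Fin 4 → ℝ,
    G.IsSink G.carrier v ∧ (∀ w, G.IsSink G.carrier w → w = v) ∧
    IsSimpleVertex G.carrier v ∧ {w | IsEdge G.carrier v w} = {v₁, v₂, v₃, v₄} ∧
    u₁ ∈ openSegment ℝ v v₁ ∧ u₂ ∈ openSegment ℝ v v₂ ∧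
    (∃ (f : (Fin 4 → ℝ) →ₗ[ℝ] ℝ) (c : ℝ),
      f u₁ = c ∧ f u₂ = c ∧ f v₃ = c ∧ f v₄ = c ∧ f v < c ∧
      G'.carrier = {x | x ∈ G.carrier ∧ c ≤ f x}) ∧
    ¬ Relation.TransGen G.arc v₄ v₃ ∧
    ∀ a b, G'.arc a b ↔
      (G.arc a b ∧ a ≠ v ∧ b ≠ v) ∨ (a = v₃ ∧ b = v₄) ∨
      (a = v₁ ∧ b = u₁) ∨ (a = v₃ ∧ b = u₁) ∨ (a = v₄ ∧ b = u₁) ∨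
      (a = v₂ ∧ b = u₂) ∨ (a = v₃ ∧ b = u₂) ∨ (a = v₄ ∧ b = u₂) ∨
      (a = u₁ ∧ b = u₂)

/-- The embedding `x ↦ (x, 0)` of `ℝ^d` in `ℝ^(d+1)`. -/
def lift (x : Fin d → ℝ) : Fin (d + 1) → ℝ := Fin.snoc (α := fun _ => ℝ) x 0

/-- `G'` is a pyramid over `G`: the polytope is the convex hull of `P × {0}` and an apex outside
`ℝ^d × {0}`, the arcs of `G` are kept, and all other edges are directed to the apex. -/
def IsPyramid (G : PolytopalDigraph d) (G' : PolytopalDigraph (d + 1)) : Prop :=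
  ∃ apex : Fin (d + 1) → ℝ, apex (Fin.last d) ≠ 0 ∧
    G'.carrier = convexHull ℝ (insert apex (lift '' G.carrier)) ∧
    ∀ a b, G'.arc a b ↔
      (∃ x y, G.arc x y ∧ a = lift x ∧ b = lift y) ∨
      (∃ x ∈ G.vertexSet, a = lift x ∧ b = apex)

/-- `G` arises from the polytopal digraph `G₀` of a 4-polytope by finitely many truncations (these
only act on 4-polytopes, hence come first) and pyramid operations. -/
inductive Extends (G₀ : PolytopalDigraph 4) : (d : ℕ) → PolytopalDigraph d → Prop
  | refl : Extends G₀ 4 G₀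
  | truncation {G G' : PolytopalDigraph 4} :
      Extends G₀ 4 G → IsTruncation G G' → Extends G₀ 4 G'
  | pyramid {d : ℕ} {G : PolytopalDigraph d} {G' : PolytopalDigraph (d + 1)} :
      Extends G₀ d G → IsPyramid G G' → Extends G₀ (d + 1) G'

end PolytopalDigraph

end Polytopal

/-! A truncation removes the sink and adds two vertices, and its new sink `u 3` is simple again; a
pyramid adds one vertex and one dimension. So `n - (n₀ + (d - 4))` truncations followed by `d - 4`
pyramids have the right numbers, and everything rests on both operations preserving the type.
Acyclicity, unique sinks and disjoint paths are checked face by face (`holtKlee_truncate`,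
`holtKlee_pyramid`): the faces of the new polytopes are known, and the old paths can be rerouted to
the new sink. The hard part is that no shelling property may arise.

The shelling property is local. Let `w` be a vertex of a face `F`. In an acyclic unique sink
orientation the source of `F` reaches all vertices of `F`. So, in every topological sort, `F` has a
vertex before `w` exactly if `w` is not the source of `F`, that is, if `F` contains an in-edge of
`w`. Hence the part of the polar facet of `w` that is covered by earlier facets depends neither on
the sort nor on the polar, and the shelling property says that at each vertex the in-edges begin a
shelling of the polar facet (`LocalShell`, `localShell_of_shellingProperty`,
`shellingProperty_of_localShell`). To make this usable, shellings of the polar are rewritten as rank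
functions on the face lattice of the polytope itself (`RShell`), which pull back along embeddings of
upper intervals (`RShell.pullback`). It then suffices that local shellings descend from the new
polytope to the old one.

For a pyramid they do, because the base faces over `w` form a lower set of the faces over the lifted
vertex, and the edge to the apex is an out-edge. For a truncation there are three kinds of old
vertices. At the old sink the polar facet is a simplex, and any order shells it. At a vertex off the
cutting hyperplane the faces above it do not change. The remaining vertices are the two neighbours
`nb 0`, `nb 1` of the sink in the hyperplane. There the polar facet is a 3-polytope, and the
truncation stacks a vertex onto the triangle that is dual to the edge to the sink: three triangles
`z i` take its place. If the two neighbours are adjacent already, one of these three is merged with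
the facet dual to the edge between them.

Shellings of 3-polytopes are governed by connectivity (`LinkShell`, `RShell.linkShell`,
`LinkShell.rshell`), so it is enough to undo the stacking in an order of the facets. The triangle is
put back at about the position of the median of the three new ones (`Placement`,
`CornerLink.linkShell`). At least two of the three new edges are out-edges, so the median position
is not among the in-edges either, as it must be for the edge to the sink. -/

namespace Polytopal
open Set

/-- A (not necessarily full-dimensional) polytope. -/
def IsHull {d : ℕ} (P : Set (Fin d → ℝ)) : Prop :=
  ∃ S : Finset (Fin d → ℝ), P = convexHull ℝ (S : Set (Fin d → ℝ))

/-! ### Faces of polytopes as sets of maximizers of linear functionals. -/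

section Basics

variable {d : ℕ} {P F G : Set (Fin d → ℝ)}

theorem IsPolytope.isHull (h : IsPolytope P) : IsHull P := h.1

theorem IsHull.isCompact (h : IsHull P) : IsCompact P := by
  obtain ⟨S, rfl⟩ := h
  exact S.finite_toSet.isCompact_convexHull (𝕜 := ℝ)

theorem IsHull.convex (h : IsHull P) : Convex ℝ P := by
  obtain ⟨S, rfl⟩ := h
  exact convex_convexHull ℝ _

theorem isHull_of_finite {S : Set (Fin d → ℝ)} (hS : S.Finite) : IsHull (convexHull ℝ S) :=
  ⟨hS.toFinset, by simp⟩

theorem IsHull.finite_extremePoints (h : IsHull P) : (P.extremePoints ℝ).Finite := by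
  obtain ⟨S, rfl⟩ := h
  exact S.finite_toSet.subset extremePoints_convexHull_subset

/-- The Krein–Milman theorem gives a closed hull; the hull of finitely many points is closed
already. -/
theorem convexHull_extremePoints_of_finite (hc : IsCompact P) (hconv : Convex ℝ P)
    (hfin : (P.extremePoints ℝ).Finite) : convexHull ℝ (P.extremePoints ℝ) = P := by
  have h := closure_convexHull_extremePoints hc hconv
  rwa [(hfin.isCompact_convexHull (𝕜 := ℝ)).isClosed.closure_eq] at h

theorem IsHull.convexHull_extremePoints (h : IsHull P) :
    convexHull ℝ (P.extremePoints ℝ) = P :=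
  convexHull_extremePoints_of_finite h.isCompact h.convex h.finite_extremePoints

theorem IsHull.exists_extremePoint (h : IsHull P) (hne : P.Nonempty) :
    ∃ v, v ∈ P.extremePoints ℝ :=
  h.isCompact.extremePoints_nonempty hne

theorem extremePoints_face (hF : IsExposed ℝ P F) :
    F.extremePoints ℝ = F ∩ P.extremePoints ℝ :=
  hF.isExtreme.extremePoints_eq

theorem IsHull.face (h : IsHull P) (hF : IsExposed ℝ P F) : IsHull F := by
  have hfin : (F.extremePoints ℝ).Finite :=
    h.finite_extremePoints.subset hF.isExtreme.extremePoints_subset_extremePoints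
  rw [← convexHull_extremePoints_of_finite (hF.isCompact h.isCompact) (hF.convex h.convex) hfin]
  exact isHull_of_finite hfin

theorem IsHull.face_eq (h : IsHull P) (hF : IsExposed ℝ P F) :
    convexHull ℝ (F ∩ P.extremePoints ℝ) = F := by
  rw [← extremePoints_face hF]
  exact (h.face hF).convexHull_extremePoints

theorem IsHull.exists_vertex_mem (h : IsHull P) (hF : IsExposed ℝ P F) (hne : F.Nonempty) :
    ∃ v ∈ F, v ∈ P.extremePoints ℝ := by
  obtain ⟨v, hv⟩ := (h.face hF).exists_extremePoint hne
  rw [extremePoints_face hF] at hv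
  exact ⟨v, hv.1, hv.2⟩

theorem IsHull.face_subset_iff (h : IsHull P) (hF : IsExposed ℝ P F) (hG : IsExposed ℝ P G) :
    F ⊆ G ↔ ∀ v ∈ P.extremePoints ℝ, v ∈ F → v ∈ G := by
  refine ⟨fun hs v _ hv => hs hv, fun hs => ?_⟩
  rw [← h.face_eq hF]
  exact convexHull_min (fun v hv => hs v hv.2 hv.1) (hG.convex h.convex)

/-- A face is the hull of the vertices in it, so it is determined by a subset of a finite set. -/
theorem IsHull.finite_faces (h : IsHull P) : {F | IsExposed ℝ P F}.Finite := by
  refine Set.Finite.of_finite_image (f := fun F => F ∩ P.extremePoints ℝ)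
    (h.finite_extremePoints.finite_subsets.subset ?_) ?_
  · rintro _ ⟨F, -, rfl⟩
    exact inter_subset_right
  · intro F hF G hG hFG
    dsimp at hFG
    rw [← h.face_eq hF, ← h.face_eq hG, hFG]

theorem IsHull.finite_faceLattice (h : IsHull P) : Finite (FaceLattice P) :=
  h.finite_faces.to_subtype

/-- Faces are cut out by supporting hyperplanes. -/
theorem isExposed_of_le (l : (Fin d → ℝ) →ₗ[ℝ] ℝ) (m : ℝ) (hl : ∀ x ∈ P, l x ≤ m) :
    IsExposed ℝ P {x | x ∈ P ∧ l x = m} := by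
  rintro ⟨w, hwP, hw⟩
  refine ⟨LinearMap.toContinuousLinearMap l, ?_⟩
  ext x
  constructor
  · rintro ⟨hx, hxm⟩
    exact ⟨hx, fun y hy => by simpa [hxm] using hl y hy⟩
  · rintro ⟨hx, hxm⟩
    refine ⟨hx, le_antisymm (hl x hx) ?_⟩
    simpa [hw] using hxm w hwP

theorem exists_functional (hF : IsExposed ℝ P F) (hne : F.Nonempty) :
    ∃ (l : (Fin d → ℝ) →ₗ[ℝ] ℝ) (m : ℝ), (∀ x ∈ P, l x ≤ m) ∧ F = {x | x ∈ P ∧ l x = m} := by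
  obtain ⟨l, hl⟩ := hF hne
  obtain ⟨w, hw⟩ := hne
  have hw' := hw
  rw [hl] at hw'
  refine ⟨l.toLinearMap, l w, fun x hx => hw'.2 x hx, ?_⟩
  rw [hl]
  ext x
  constructor
  · rintro ⟨hx, hxm⟩
    exact ⟨hx, le_antisymm (hw'.2 x hx) (hxm w hw'.1)⟩
  · rintro ⟨hx, hxm⟩
    exact ⟨hx, fun y hy => (hw'.2 y hy).trans hxm.ge⟩

theorem mem_face_of_openSegment (hF : IsExposed ℝ P F) {x a b : Fin d → ℝ} (hx : x ∈ F)
    (ha : a ∈ P) (hb : b ∈ P) (hab : x ∈ openSegment ℝ a b) : a ∈ F ∧ b ∈ F :=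
  ⟨hF.isExtreme.2 ha hb hx hab, hF.isExtreme.right_mem_of_mem_openSegment ha hb hx hab⟩

theorem le_of_le_on_extremePoints (h : IsHull P) {l : (Fin d → ℝ) →ₗ[ℝ] ℝ} {m : ℝ}
    (hl : ∀ x ∈ P.extremePoints ℝ, l x ≤ m) : ∀ x ∈ P, l x ≤ m := by
  intro x hx
  rw [← h.convexHull_extremePoints] at hx
  exact convexHull_min (s := P.extremePoints ℝ) (t := {x | l x ≤ m}) hl
    (convex_halfSpace_le l.isLinear m) hx

/-- A face of a face of a polytope is a face. -/
theorem IsHull.face_trans (h : IsHull P) (hF : IsExposed ℝ P F) (hG : IsExposed ℝ F G) :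
    IsExposed ℝ P G := by
  rcases G.eq_empty_or_nonempty with rfl | hne
  · exact isExposed_empty
  obtain ⟨g, m, hgm, hGeq⟩ := exists_functional hG hne
  obtain ⟨f, c, hfc, hFeq⟩ := exists_functional hF (hne.mono hG.subset)
  -- a large multiple of `f` plus `g`
  obtain ⟨N, hN⟩ : ∃ N : ℝ, ∀ x ∈ P.extremePoints ℝ, x ∉ F → g x - m < N * (c - f x) := by
    have hfin := h.finite_extremePoints
    have hb : BddAbove ((fun x => (g x - m) / (c - f x)) '' P.extremePoints ℝ) :=
      (hfin.image _).bddAbove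
    obtain ⟨N, hN⟩ := hb
    -- The bound on the finitely many ratios is increased by one to make the inequality strict.
    refine ⟨N + 1, fun x hx hxF => ?_⟩
    have h1 := hN ⟨x, hx, rfl⟩
    have hpos : 0 < c - f x := by
      rcases (hfc x hx.1).lt_or_eq with hlt | heq
      · linarith
      · exact absurd (by rw [hFeq]; exact ⟨hx.1, heq⟩) hxF
    rw [div_le_iff₀ hpos] at h1
    nlinarith
  set l : (Fin d → ℝ) →ₗ[ℝ] ℝ := g + N • f with hl
  have hlv : ∀ x, l x = g x + N * f x := fun x => by simp [hl]
  have hval : ∀ x ∈ F, l x = g x + N * c := fun x hx => by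
    rw [hlv]; rw [hFeq] at hx; rw [hx.2]
  have hle : ∀ x ∈ P, l x ≤ m + N * c := by
    apply le_of_le_on_extremePoints h
    intro x hx
    by_cases hxF : x ∈ F
    · rw [hval x hxF]; linarith [hgm x hxF]
    · rw [hlv]; linarith [hN x hx hxF]
  have hE := isExposed_of_le l (m + N * c) hle
  convert hE using 1
  apply Subset.antisymm
  · intro x hx
    have hxF := hG.subset hx
    refine ⟨hF.subset hxF, ?_⟩
    rw [hval x hxF]
    rw [hGeq] at hx
    rw [hx.2]
  · intro x hx
    have hsub : {x | x ∈ P ∧ l x = m + N * c} ⊆ F := by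
      rw [h.face_subset_iff hE hF]
      rintro y hy ⟨-, hy2⟩
      by_contra hyF
      have := hN y hy hyF
      rw [hlv] at hy2
      linarith
    have hxF := hsub hx
    rw [hGeq]
    refine ⟨hxF, ?_⟩
    have := hx.2
    rw [hval x hxF] at this
    linarith

theorem face_of_subset (hG : IsExposed ℝ P G) (hF : IsExposed ℝ P F) (hGF : G ⊆ F) :
    IsExposed ℝ F G :=
  hG.mono hF.subset hGF

/-- The other vertices span a compact convex set that misses a given extreme point, and a separating
functional exposes the point. So extreme and exposed points of a polytope agree. -/
theorem IsHull.isExposed_singleton (h : IsHull P) {v : Fin d → ℝ} :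
    IsExposed ℝ P {v} ↔ v ∈ P.extremePoints ℝ := by
  refine ⟨fun hv => hv.isExtreme.mem_extremePoints, fun hv => ?_⟩
  set W := P.extremePoints ℝ \ {v} with hW
  have hWfin : W.Finite := h.finite_extremePoints.subset sdiff_subset
  have hvW : v ∉ convexHull ℝ W := by
    intro hmem
    have h2 := (h.convex.mem_extremePoints_iff_mem_sdiff_convexHull_sdiff).1 hv
    exact h2.2 (convexHull_mono (sdiff_subset_sdiff_left extremePoints_subset) hmem)
  obtain ⟨l, u, hlu, hul⟩ := geometric_hahn_banach_closed_point (convex_convexHull ℝ W)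
    (hWfin.isCompact_convexHull (𝕜 := ℝ)).isClosed hvW
  have hWlt : ∀ x ∈ P.extremePoints ℝ, x ≠ v → l x < l v := fun x hx hxv =>
    (hlu x (subset_convexHull ℝ _ ⟨hx, hxv⟩)).trans hul
  have hle : ∀ x ∈ P, (l : (Fin d → ℝ) →ₗ[ℝ] ℝ) x ≤ l v := by
    apply le_of_le_on_extremePoints h
    intro x hx
    by_cases hxv : x = v
    · rw [hxv]; rfl
    · exact (hWlt x hx hxv).le
  have hE := isExposed_of_le _ _ hle
  convert hE using 1
  apply Subset.antisymm
  · rintro _ rfl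
    exact ⟨hv.1, rfl⟩
  · intro x hx
    rw [← h.face_eq hE] at hx
    refine convexHull_min ?_ (convex_singleton v) hx
    rintro y ⟨⟨-, hy⟩, hyv⟩
    by_contra hne
    exact (hWlt y hyv hne).ne hy

/-- Every non-empty polytope has a point at which a functional can only attain its maximum if it
is constant. -/
theorem IsHull.exists_center (h : IsHull P) (hne : P.Nonempty) :
    ∃ b ∈ P, ∀ (l : (Fin d → ℝ) →ₗ[ℝ] ℝ) (m : ℝ), (∀ x ∈ P, l x ≤ m) → l b = m →
      ∀ x ∈ P, l x = m := by
  classical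
  obtain ⟨v₀, hv₀⟩ := h.exists_extremePoint hne
  set V := h.finite_extremePoints.toFinset with hV
  have hVm : ∀ x, x ∈ V ↔ x ∈ P.extremePoints ℝ := fun x => by simp [hV]
  have hcard : (0 : ℝ) < V.card := by
    exact_mod_cast Finset.card_pos.2 ⟨v₀, (hVm _).2 hv₀⟩
  -- The barycentre of the vertices: an average attains an upper bound only if all its terms do.
  refine ⟨∑ x ∈ V, (1 / (V.card : ℝ)) • x, ?_, ?_⟩
  · refine h.convex.sum_mem (fun _ _ => by positivity) ?_ (fun x hx => ((hVm x).1 hx).1)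
    rw [Finset.sum_const, nsmul_eq_mul]
    field_simp
  · intro l m hl hb
    have hvert : ∀ x ∈ V, l x = m := by
      by_contra! hcon
      obtain ⟨y, hy, hym⟩ := hcon
      have hlt : ∑ x ∈ V, l x < ∑ x ∈ V, m :=
        Finset.sum_lt_sum (fun x hx => hl x ((hVm x).1 hx).1)
          ⟨y, hy, lt_of_le_of_ne (hl y ((hVm y).1 hy).1) hym⟩
      rw [map_sum] at hb
      simp only [map_smul, smul_eq_mul] at hb
      rw [← Finset.mul_sum] at hb
      rw [Finset.sum_const, nsmul_eq_mul] at hlt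
      field_simp at hb
      linarith
    intro x hx
    refine le_antisymm (hl x hx) ?_
    have := le_of_le_on_extremePoints h (l := -l) (m := -m)
      (fun x hx => by simp [hvert x ((hVm x).2 hx)]) x hx
    simpa using this

/-- Such a point represents its face: membership of the point in another face already means
inclusion of the whole face. -/
theorem IsHull.exists_center_face (h : IsHull P) (hF : IsExposed ℝ P F) (hne : F.Nonempty) :
    ∃ b ∈ F, ∀ G, IsExposed ℝ P G → b ∈ G → F ⊆ G := by
  obtain ⟨b, hb, hbl⟩ := (h.face hF).exists_center hne
  refine ⟨b, hb, fun G hG hbG x hx => ?_⟩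
  obtain ⟨l, m, hl, rfl⟩ := exists_functional hG ⟨b, hbG⟩
  exact ⟨hF.subset hx, hbl l m (fun y hy => hl y (hF.subset hy)) hbG.2 x hx⟩

/-! ### Dimension -/

theorem direction_le_ker {l : (Fin d → ℝ) →ₗ[ℝ] ℝ} {m : ℝ} (hl : ∀ x ∈ F, l x = m) :
    vectorSpan ℝ F ≤ LinearMap.ker l := by
  rw [vectorSpan_def, Submodule.span_le]
  rintro _ ⟨x, hx, y, hy, rfl⟩
  simp [hl x hx, hl y hy]

theorem faceDim_mono (hFG : F ⊆ G) : faceDim F ≤ faceDim G :=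
  Submodule.finrank_mono (vectorSpan_mono ℝ hFG)

/-- A functional that cuts out `F` is constant on `F` but not on `G`, so the directions of `F` form
a proper subspace of those of `G`. -/
theorem faceDim_lt (hF : IsExposed ℝ G F) (hne : F.Nonempty) (hFG : F ≠ G) :
    faceDim F < faceDim G := by
  obtain ⟨l, m, hl, hFeq⟩ := exists_functional hF hne
  obtain ⟨x, hx⟩ := hne
  have hxG := hF.subset hx
  obtain ⟨y, hyG, hyF⟩ : ∃ y ∈ G, y ∉ F := by
    by_contra! hcon
    exact hFG (Subset.antisymm hF.subset hcon)
  refine Submodule.finrank_lt_finrank_of_lt (lt_of_le_of_ne (vectorSpan_mono ℝ hF.subset) ?_)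
  intro heq
  have hker := direction_le_ker (F := F) (l := l) (m := m)
    (fun z hz => by rw [hFeq] at hz; exact hz.2)
  rw [heq] at hker
  have := hker (vsub_mem_vectorSpan ℝ hyG hxG)
  rw [hFeq] at hx
  simp only [vsub_eq_sub, LinearMap.mem_ker, map_sub, hx.2, sub_eq_zero] at this
  exact hyF (by rw [hFeq]; exact ⟨hyG, this⟩)

theorem faceDim_singleton (v : Fin d → ℝ) : faceDim ({v} : Set (Fin d → ℝ)) = 0 := by
  simp [faceDim]

/-- Intervals of length at least two in the face lattice are not empty. -/
theorem IsHull.exists_between (hG : IsHull G) (hF : IsExposed ℝ G F) (hne : F.Nonempty)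
    (hdim : faceDim F + 2 ≤ faceDim G) : ∃ E, IsExposed ℝ G E ∧ F ⊂ E ∧ E ⊂ G := by
  obtain ⟨g, m, hg, hFeq⟩ := exists_functional hF hne
  obtain ⟨x₀, hx₀⟩ := hne
  have hx₀G := hF.subset hx₀
  have hFm : ∀ x ∈ F, g x = m := fun x hx => by rw [hFeq] at hx; exact hx.2
  set D := vectorSpan ℝ G with hD
  set W := vectorSpan ℝ F with hW
  -- a direction of `G` in the kernel of `g`, outside the direction of `F`
  obtain ⟨y, hyD, hyg, hyW⟩ : ∃ y ∈ D, g y = 0 ∧ y ∉ W := by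
    by_contra! hcon
    have hle : D ⊓ LinearMap.ker g ≤ W := fun y hy => hcon y hy.1 hy.2
    -- The kernel of one functional loses at most one dimension, which is too little to fit into
    -- `W`.
    have h1 : Module.finrank ℝ D ≤ Module.finrank ℝ (D ⊓ LinearMap.ker g : Submodule ℝ _) + 1 := by
      have hr := LinearMap.finrank_range_add_finrank_ker (g.domRestrict D)
      have hk : Module.finrank ℝ (LinearMap.ker (g.domRestrict D))
          = Module.finrank ℝ (D ⊓ LinearMap.ker g : Submodule ℝ _) := by
        rw [LinearMap.ker_domRestrict, ← Submodule.finrank_map_subtype_eq, Submodule.map_comap_subtype]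
      have h1 : Module.finrank ℝ (LinearMap.range (g.domRestrict D)) ≤ 1 := by
        simpa using Submodule.finrank_le (LinearMap.range (g.domRestrict D))
      omega
    have h2 := Submodule.finrank_mono hle
    have h3 : Module.finrank ℝ W + 2 ≤ Module.finrank ℝ D := hdim
    omega
  obtain ⟨h₀, hh₀, hWh₀⟩ := Submodule.exists_le_ker_of_notMem hyW
  -- a vertex at which a suitable multiple of the functional exceeds its value on `F`
  obtain ⟨h, hhy, hWh, x₁, hx₁, hx₁lt⟩ : ∃ h : (Fin d → ℝ) →ₗ[ℝ] ℝ, h y ≠ 0 ∧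
      W ≤ LinearMap.ker h ∧ ∃ x₁ ∈ G.extremePoints ℝ, h x₀ < h x₁ := by
    -- If neither `h₀` nor its negative exceeded its value at `x₀` at some vertex, then `h₀` would
    -- be constant on `G` and vanish at `y`.
    by_contra! hcon
    have a1 := le_of_le_on_extremePoints hG (hcon h₀ hh₀ hWh₀)
    have a2 := le_of_le_on_extremePoints hG (hcon (-h₀) (by simpa using hh₀)
      (fun z hz => by simpa using hWh₀ hz))
    have := direction_le_ker (F := G) (l := h₀) (m := h₀ x₀)
      (fun x hx => le_antisymm (a1 x hx) (by simpa using a2 x hx))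
    exact hh₀ (this hyD)
  have hFh : ∀ x ∈ F, h x = h x₀ := fun x hx => by
    have := hWh (vsub_mem_vectorSpan ℝ hx hx₀)
    simpa [sub_eq_zero] using this
  -- the smallest tilt that reaches another vertex
  obtain ⟨x₂, ⟨hx₂, hx₂lt⟩, hmin⟩ :=
    Set.exists_min_image {x | x ∈ G.extremePoints ℝ ∧ h x₀ < h x}
      (fun x => (m - g x) / (h x - h x₀)) (hG.finite_extremePoints.subset fun x hx => hx.1)
      ⟨x₁, hx₁, hx₁lt⟩
  set t := (m - g x₂) / (h x₂ - h x₀) with ht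
  have hx₂F : x₂ ∉ F := fun hx => hx₂lt.ne (hFh x₂ hx).symm
  have hgx₂ : g x₂ < m := lt_of_le_of_ne (hg x₂ hx₂.1) fun heq => hx₂F (by
    rw [hFeq]; exact ⟨hx₂.1, heq⟩)
  have htpos : 0 < t := div_pos (by linarith) (by linarith)
  have hle : ∀ x ∈ G, (g + t • h) x ≤ m + t * h x₀ := by
    apply le_of_le_on_extremePoints hG
    intro x hx
    simp only [LinearMap.add_apply, LinearMap.smul_apply, smul_eq_mul]
    rcases le_or_gt (h x) (h x₀) with hcase | hcase
    · have := hg x hx.1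
      nlinarith
    · have := hmin x ⟨hx, hcase⟩
      rw [le_div_iff₀ (by linarith)] at this
      nlinarith
  have hE := isExposed_of_le _ _ hle
  have hx₂E : (g + t • h) x₂ = m + t * h x₀ := by
    have : t * (h x₂ - h x₀) = m - g x₂ := by
      rw [ht]; field_simp [(by linarith : h x₂ - h x₀ ≠ 0)]
    simp only [LinearMap.add_apply, LinearMap.smul_apply, smul_eq_mul]
    linarith
  refine ⟨_, hE, ⟨fun x hx => ⟨hF.subset hx, ?_⟩, fun hsub => hx₂F (hsub ⟨hx₂.1, hx₂E⟩)⟩,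
    hE.subset, fun hsub => ?_⟩
  · simp [hFm x hx, hFh x hx]
  -- The tilted functional changes along `y`, so it does not expose all of `G`.
  · have := direction_le_ker (F := G) (l := g + t • h) (m := m + t * h x₀)
      (fun x hx => (hsub hx).2)
    have h3 := this hyD
    simp only [LinearMap.mem_ker, LinearMap.add_apply, LinearMap.smul_apply, smul_eq_mul, hyg,
      zero_add, mul_eq_zero] at h3
    exact h3.elim htpos.ne' hhy

end Basics

end Polytopal

namespace Polytopal
open Set

/-! ### Shellings of the dual of a poset, through rank functions -/

/-- The covers of `a`, in the order given by the rank function `ρ`, are a dual shelling of the part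
of the poset above `a`. -/
inductive RShell {α : Type*} [PartialOrder α] : α → (α → ℝ) → Prop
  | points (a : α) (ρ : α → ℝ) (fin : {b | a ⋖ b}.Finite) (inj : InjOn ρ {b | a ⋖ b})
      (small : ∀ b, a ⋖ b → ∀ x y, b < x → ¬ x < y) : RShell a ρ
  | step (a : α) (ρ : α → ℝ) (fin : {b | a ⋖ b}.Finite) (inj : InjOn ρ {b | a ⋖ b})
      (κ : α → α → ℝ) (t : α → ℝ) (shelling : ∀ e, a ⋖ e → RShell e (κ e))
      (segment : ∀ e F, a ⋖ e → e ≤ F →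
        ((∃ e', a ⋖ e' ∧ ρ e' < ρ e ∧ e' ≤ F) ↔ ∃ H, e ⋖ H ∧ κ e H < t e ∧ H ≤ F)) : RShell a ρ

section RShell

variable {α β : Type*} [PartialOrder α] [PartialOrder β]

theorem RShell.injOn {a : α} {ρ : α → ℝ} (h : RShell a ρ) : InjOn ρ {b | a ⋖ b} := by
  cases h <;> assumption

/-- `ψ` embeds the part of `α` above `a` as a lower set of the part of `β` above `ψ a`. -/
def IntervalEmbedding (ψ : α → β) (a : α) : Prop :=
  (∀ x y, a ≤ x → a ≤ y → (ψ x ≤ ψ y ↔ x ≤ y)) ∧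
    ∀ x y, a ≤ x → ψ a ≤ y → y ≤ ψ x → ∃ z, a ≤ z ∧ ψ z = y

namespace IntervalEmbedding

variable {ψ : α → β} {a : α}

theorem mono (h : IntervalEmbedding ψ a) {e : α} (hae : a ≤ e) : IntervalEmbedding ψ e := by
  refine ⟨fun x y hx hy => h.1 x y (hae.trans hx) (hae.trans hy), fun x y hx hy hyx => ?_⟩
  obtain ⟨z, hz, rfl⟩ := h.2 x y (hae.trans hx) (((h.1 a e le_rfl hae).2 hae).trans hy) hyx
  exact ⟨z, (h.1 e z hae hz).1 hy, rfl⟩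

theorem lt_iff (h : IntervalEmbedding ψ a) {x y : α} (hx : a ≤ x) (hy : a ≤ y) :
    ψ x < ψ y ↔ x < y := by
  rw [lt_iff_le_not_ge, lt_iff_le_not_ge, h.1 x y hx hy, h.1 y x hy hx]

theorem inj (h : IntervalEmbedding ψ a) {x y : α} (hx : a ≤ x) (hy : a ≤ y) (hxy : ψ x = ψ y) :
    x = y :=
  le_antisymm ((h.1 x y hx hy).1 hxy.le) ((h.1 y x hy hx).1 hxy.ge)

theorem covBy_iff (h : IntervalEmbedding ψ a) {x y : α} (hx : a ≤ x) (hy : a ≤ y) :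
    ψ x ⋖ ψ y ↔ x ⋖ y := by
  constructor
  · intro hc
    refine ⟨(h.lt_iff hx hy).1 hc.1, fun z hxz hzy => ?_⟩
    have hz := hx.trans hxz.le
    exact hc.2 ((h.lt_iff hx hz).2 hxz) ((h.lt_iff hz hy).2 hzy)
  · intro hc
    refine ⟨(h.lt_iff hx hy).2 hc.1, fun z hxz hzy => ?_⟩
    obtain ⟨z, hz, rfl⟩ := h.2 y z hy (((h.1 a x le_rfl hx).2 hx).trans hxz.le) hzy.le
    exact hc.2 ((h.lt_iff hx hz).1 hxz) ((h.lt_iff hz hy).1 hzy)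

theorem exists_covBy (h : IntervalEmbedding ψ a) {F : α} (hF : a ≤ F) {y : β} (hy : ψ a ⋖ y)
    (hyF : y ≤ ψ F) : ∃ e, a ⋖ e ∧ e ≤ F ∧ ψ e = y := by
  obtain ⟨z, hz, rfl⟩ := h.2 F y hF hy.le hyF
  exact ⟨z, (h.covBy_iff le_rfl hz).1 hy, (h.1 z F hz hF).1 hyF, rfl⟩

end IntervalEmbedding

/-- All conditions of `RShell` concern elements over the base point and under a given element, hence
they survive the restriction to a lower set. This is the means by which shellings pass from one
polytope to another. -/
theorem RShell.pullback (ψ : α → β) {b : β} {ρ : β → ℝ} (h : RShell b ρ) :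
    ∀ a, ψ a = b → IntervalEmbedding ψ a → RShell a (ρ ∘ ψ) := by
  induction h with
  | points b ρ fin inj small =>
    rintro a rfl hψ
    have hinj : InjOn ψ {e | a ⋖ e} := fun x hx y hy hxy => hψ.inj hx.le hy.le hxy
    have hmaps : ∀ e, a ⋖ e → ψ a ⋖ ψ e := fun e he => (hψ.covBy_iff le_rfl he.le).2 he
    refine .points _ _ ?_ (inj.comp hinj hmaps) fun e he x y hex hxy => ?_
    · exact Finite.of_finite_image (fin.subset (image_subset_iff.2 hmaps)) hinj
    · exact small _ (hmaps e he) (ψ x) (ψ y) ((hψ.lt_iff he.le (he.le.trans hex.le)).2 hex)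
        ((hψ.lt_iff (he.le.trans hex.le) (he.le.trans (hex.trans hxy).le)).2 hxy)
  | step b ρ fin inj κ t sh seg ih =>
    rintro a rfl hψ
    have hinj : InjOn ψ {e | a ⋖ e} := fun x hx y hy hxy => hψ.inj hx.le hy.le hxy
    have hmaps : ∀ e, a ⋖ e → ψ a ⋖ ψ e := fun e he => (hψ.covBy_iff le_rfl he.le).2 he
    refine .step _ _ ?_ (inj.comp hinj hmaps) (fun e => κ (ψ e) ∘ ψ) (fun e => t (ψ e))
      (fun e he => ih _ (hmaps e he) e rfl (hψ.mono he.le)) fun e F he hF => ?_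
    · exact Finite.of_finite_image (fin.subset (image_subset_iff.2 hmaps)) hinj
    have haF := he.le.trans hF
    have key := seg (ψ e) (ψ F) (hmaps e he) ((hψ.1 e F he.le haF).2 hF)
    constructor
    · rintro ⟨e', he', hlt, hle⟩
      obtain ⟨H, hH, hHt, hHF⟩ :=
        key.1 ⟨ψ e', hmaps e' he', hlt, (hψ.1 e' F he'.le haF).2 hle⟩
      obtain ⟨H', hH', hHF', rfl⟩ := (hψ.mono he.le).exists_covBy hF hH hHF
      exact ⟨H', hH', hHt, hHF'⟩
    · rintro ⟨H, hH, hHt, hHF⟩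
      have heH := he.le.trans hH.le
      obtain ⟨e', he', hlt, hle⟩ := key.2
        ⟨ψ H, (hψ.covBy_iff he.le heH).2 hH, hHt, (hψ.1 H F heH haF).2 hHF⟩
      obtain ⟨e₁, he₁, hle₁, rfl⟩ := hψ.exists_covBy haF he' hle
      exact ⟨e₁, he₁, hlt, hle₁⟩

/-- Every order is a shelling of a simplex. -/
theorem rshell_finset {ι : Type*} [Fintype ι] [DecidableEq ι] (n : ℕ) :
    ∀ (S : Finset ι) (ρ : Finset ι → ℝ), Sᶜ.card = n → InjOn ρ {b | S ⋖ b} → RShell S ρ := by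
  induction n with
  | zero =>
    intro S ρ hS hinj
    have hno : ∀ b, ¬ S ⋖ b := by
      intro b hb
      have : S = Finset.univ := by simpa using hS
      subst this
      exact hb.1.not_ge (Finset.subset_univ b)
    exact .points S ρ (by simp [hno]) hinj fun b hb => absurd hb (hno b)
  | succ n ih =>
    intro S ρ hS hinj
    have hcov : ∀ (S b : Finset ι), S ⋖ b ↔ ∃ i, i ∉ S ∧ insert i S = b := by
      intro S b
      rw [Finset.covBy_iff_exists_insert]
    -- Over `e`, the cover `insert j e` gets the rank of `insert j S`. With threshold `ρ e` the
    -- initial segment consists of those `j` for which `insert j S` comes before `e`.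
    refine .step S ρ (Set.toFinite _) hinj (fun e H => ρ (S ∪ (H \ e))) (fun e => ρ e)
      ?_ ?_
    · intro e he
      obtain ⟨i, hi, rfl⟩ := (hcov _ _).1 he
      refine ih _ _ ?_ ?_
      · rw [Finset.card_compl, Finset.card_insert_of_notMem hi]
        rw [Finset.card_compl] at hS
        omega
      · intro x hx y hy hxy
        obtain ⟨j, hj, rfl⟩ := (hcov _ _).1 hx
        obtain ⟨k, hk, rfl⟩ := (hcov _ _).1 hy
        have aux : ∀ j, j ∉ insert i S → S ∪ (insert j (insert i S) \ insert i S) = insert j S := by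
          intro j hj
          ext x
          simp only [Finset.mem_union, Finset.mem_sdiff, Finset.mem_insert]
          simp only [Finset.mem_insert, not_or] at hj
          by_cases hxj : x = j
          · subst hxj; simp [hj]
          · simp [hxj]; tauto
        have hxy' := hinj ((hcov S _).2 ⟨j, by simp_all, rfl⟩) ((hcov S _).2 ⟨k, by simp_all, rfl⟩)
          (by simpa only [aux j hj, aux k hk] using hxy)
        have : j ∈ insert k S := hxy' ▸ Finset.mem_insert_self j S
        simp only [Finset.mem_insert, not_or] at this hj
        rw [this.resolve_right hj.2]
    · intro e F he hF
      obtain ⟨i, hi, rfl⟩ := (hcov _ _).1 he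
      have aux : ∀ j, j ∉ insert i S → S ∪ (insert j (insert i S) \ insert i S) = insert j S := by
        intro j hj
        ext x
        simp only [Finset.mem_union, Finset.mem_sdiff, Finset.mem_insert]
        simp only [Finset.mem_insert, not_or] at hj
        by_cases hxj : x = j
        · subst hxj; simp [hj]
        · simp [hxj]; tauto
      constructor
      · rintro ⟨e', he', hlt, hle⟩
        obtain ⟨j, hj, rfl⟩ := (hcov _ _).1 he'
        have hji : j ∉ insert i S := by
          rw [Finset.mem_insert, not_or]
          refine ⟨?_, hj⟩
          rintro rfl
          exact lt_irrefl _ hlt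
        refine ⟨insert j (insert i S), (hcov _ _).2 ⟨j, hji, rfl⟩, by rwa [aux j hji], ?_⟩
        exact Finset.insert_subset (hle (Finset.mem_insert_self j S)) hF
      · rintro ⟨H, hH, hlt, hle⟩
        obtain ⟨j, hj, rfl⟩ := (hcov _ _).1 hH
        rw [aux j hj] at hlt
        refine ⟨insert j S, (hcov _ _).2 ⟨j, by simp_all, rfl⟩, hlt, ?_⟩
        exact (Finset.insert_subset_insert j (Finset.subset_insert i S)).trans hle

end RShell

/-! ### Sorted lists -/

theorem exists_sorted_list {α : Type*} {s : Set α} (hs : s.Finite) (ρ : α → ℝ)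
    (hinj : InjOn ρ s) : ∃ L : List α, L.Nodup ∧ (∀ x, x ∈ L ↔ x ∈ s) ∧
      L.Pairwise fun x y => ρ x < ρ y := by
  classical
  let r : α → α → Prop := fun x y => ρ x ≤ ρ y
  have : Std.Total r := ⟨fun x y => le_total (ρ x) (ρ y)⟩
  have : IsTrans α r := ⟨fun x y z => le_trans⟩
  set L := hs.toFinset.toList.insertionSort r with hL
  have hmem : ∀ x, x ∈ L ↔ x ∈ s := fun x => by simp [hL]
  have hnd : L.Nodup := by
    rw [hL, (List.perm_insertionSort r _).nodup_iff]
    exact Finset.nodup_toList _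
  refine ⟨L, hnd, hmem, ?_⟩
  have hsort : L.Pairwise r := List.pairwise_insertionSort r _
  have := (hsort.and hnd)
  refine List.Pairwise.imp_of_mem ?_ this
  rintro x y hx hy ⟨hle, hne⟩
  exact lt_of_le_of_ne hle fun h => hne (hinj ((hmem x).1 hx) ((hmem y).1 hy) h)

/-- Translates a threshold on ranks into the length of an initial segment. -/
theorem exists_take_iff {α : Type*} (ρ : α → ℝ) (t : ℝ) (L : List α)
    (hL : L.Pairwise fun x y => ρ x < ρ y) :
    ∃ r ≤ L.length, ∀ x, x ∈ L.take r ↔ x ∈ L ∧ ρ x < t := by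
  induction L with
  | nil => exact ⟨0, by simp, by simp⟩
  | cons a L ih =>
    obtain ⟨hall, hL⟩ := List.pairwise_cons.1 hL
    by_cases ha : ρ a < t
    · obtain ⟨r, hr, hmem⟩ := ih hL
      refine ⟨r + 1, by simpa using hr, fun x => ?_⟩
      rw [List.take_succ_cons, List.mem_cons, List.mem_cons, hmem]
      constructor
      · rintro (rfl | h)
        · exact ⟨Or.inl rfl, ha⟩
        · exact ⟨Or.inr h.1, h.2⟩
      · rintro ⟨rfl | h, h2⟩
        · exact Or.inl rfl
        · exact Or.inr ⟨h, h2⟩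
    · refine ⟨0, by simp, fun x => ?_⟩
      simp only [List.take_zero, List.not_mem_nil, List.mem_cons, false_iff, not_and, not_lt]
      push Not at ha
      rintro (rfl | h)
      · exact ha
      · exact ha.trans (hall x h).le

end Polytopal

namespace Polytopal
open Set

/-! ### Dimension as rank function of the face lattice. -/

section Faces

variable {d : ℕ} {P F G : Set (Fin d → ℝ)}

/-- A larger jump in dimension would leave room for a face in between, by `IsHull.exists_between`.
-/
theorem covBy_faceDim (h : IsHull P) {A B : FaceLattice P} (hAB : A ⋖ B) (hne : A.1.Nonempty) :
    faceDim B.1 = faceDim A.1 + 1 := by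
  have hAB' : IsExposed ℝ B.1 A.1 := face_of_subset A.2 B.2 hAB.le
  have hlt := faceDim_lt hAB' hne (fun heq => hAB.ne (Subtype.ext heq))
  by_contra hcon
  obtain ⟨E, hE, h1, h2⟩ := (h.face B.2).exists_between hAB' hne (by omega)
  exact hAB.2 (c := ⟨E, h.face_trans B.2 hE⟩) h1 h2

theorem faceLattice_lt_faceDim {A B : FaceLattice P} (hAB : A < B) (hne : A.1.Nonempty) :
    faceDim A.1 < faceDim B.1 :=
  faceDim_lt (face_of_subset A.2 B.2 hAB.le) hne fun heq => hAB.ne (Subtype.ext heq)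

theorem covBy_of_faceDim {A B : FaceLattice P} (hAB : A ≤ B) (hne : A.1.Nonempty)
    (hdim : faceDim B.1 = faceDim A.1 + 1) : A ⋖ B := by
  refine ⟨lt_of_le_of_ne hAB (fun h => by rw [h] at hdim; omega), fun C h1 h2 => ?_⟩
  have a1 := faceLattice_lt_faceDim h1 hne
  have a2 := faceLattice_lt_faceDim h2 (hne.mono h1.le)
  omega

theorem empty_covBy_iff (h : IsHull P) {A : FaceLattice P} :
    (⟨∅, isExposed_empty⟩ : FaceLattice P) ⋖ A ↔ ∃ v ∈ P.extremePoints ℝ, A.1 = {v} := by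
  constructor
  · intro hA
    have hne : A.1.Nonempty := by
      by_contra hcon
      rw [not_nonempty_iff_eq_empty] at hcon
      exact hA.ne (Subtype.ext hcon.symm)
    obtain ⟨v, hvA, hv⟩ := h.exists_vertex_mem A.2 hne
    refine ⟨v, hv, ?_⟩
    by_contra hcon
    refine hA.2 (c := ⟨{v}, h.isExposed_singleton.2 hv⟩) ?_ ?_
    · exact ⟨empty_subset _, fun hs => hs (mem_singleton v)⟩
    · refine lt_of_le_of_ne (singleton_subset_iff.2 hvA) fun heq => hcon ?_
      rw [← heq]
  · rintro ⟨v, hv, hA⟩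
    refine ⟨⟨empty_subset _, fun hs => ?_⟩, fun C h1 h2 => ?_⟩
    · have : v ∈ (∅ : Set (Fin d → ℝ)) := hs (by rw [hA]; exact mem_singleton v)
      exact this
    · have h3 : C.1 ⊆ {v} := hA ▸ h2.le
      rcases subset_singleton_iff_eq.1 h3 with h4 | h4
      · exact h1.ne (Subtype.ext h4.symm)
      · exact h2.ne (Subtype.ext (h4.trans hA.symm))

/-! ### Edges -/

theorem IsEdge.symm {u v : Fin d → ℝ} (h : IsEdge P u v) : IsEdge P v u :=
  ⟨h.1.symm, by rw [segment_symm]; exact h.2⟩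

theorem extremePoints_segment (u v : Fin d → ℝ) :
    (segment ℝ u v).extremePoints ℝ = {u, v} := by
  apply Subset.antisymm
  · rw [← convexHull_pair]; exact extremePoints_convexHull_subset
  · have key : ∀ u v : Fin d → ℝ, u ∈ (segment ℝ u v).extremePoints ℝ := by
      intro u v
      have hne : (segment ℝ u v).Nonempty := ⟨u, left_mem_segment ℝ u v⟩
      rcases eq_or_ne u v with rfl | huv
      · simp
      have hP : IsHull (segment ℝ u v) := by
        rw [← convexHull_pair]; exact isHull_of_finite (by simp)
      -- Otherwise the other endpoint would be the only extreme point, and the segment its hull.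
      by_contra hu
      have hsub : (segment ℝ u v).extremePoints ℝ ⊆ {v} := by
        intro x hx
        have : x ∈ ({u, v} : Set _) := by
          rw [← convexHull_pair] at hx; exact extremePoints_convexHull_subset hx
        rcases this with rfl | h
        · exact absurd hx hu
        · exact h
      have h2 : segment ℝ u v ⊆ {v} := by
        rw [← hP.convexHull_extremePoints]
        exact convexHull_min hsub (convex_singleton v)
      exact huv (h2 (left_mem_segment ℝ u v))
    rintro x (rfl | rfl)
    · exact key _ _
    · rw [segment_symm]; exact key _ _

theorem IsEdge.vertices {u v : Fin d → ℝ} (h : IsEdge P u v) :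
    segment ℝ u v ∩ P.extremePoints ℝ = {u, v} := by
  rw [← extremePoints_face h.2, extremePoints_segment]

theorem IsEdge.left_mem {u v : Fin d → ℝ} (h : IsEdge P u v) : u ∈ P.extremePoints ℝ := by
  have : u ∈ segment ℝ u v ∩ P.extremePoints ℝ := by rw [h.vertices]; simp
  exact this.2

theorem IsEdge.right_mem {u v : Fin d → ℝ} (h : IsEdge P u v) : v ∈ P.extremePoints ℝ :=
  h.symm.left_mem

theorem faceDim_segment {u v : Fin d → ℝ} (huv : u ≠ v) : faceDim (segment ℝ u v) = 1 := by
  rw [faceDim, vectorSpan_segment]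
  exact finrank_span_singleton (sub_ne_zero.2 huv.symm)

/-- Of three collinear points one lies between the two others, and a vertex cannot lie strictly
between points of the polytope. So there is no third vertex on the line. -/
theorem IsHull.eq_segment (h : IsHull P) (hF : IsExposed ℝ P F) (hdim : faceDim F ≤ 1)
    {u v : Fin d → ℝ} (huF : u ∈ F) (hvF : v ∈ F) (hu : u ∈ P.extremePoints ℝ)
    (hv : v ∈ P.extremePoints ℝ) (huv : u ≠ v) : F = segment ℝ u v := by
  have hcol : Collinear ℝ F := collinear_iff_finrank_le_one.2 hdim
  have hseg : ∀ x y z : Fin d → ℝ, y ∈ P.extremePoints ℝ → x ∈ P → z ∈ P → Wbtw ℝ x y z →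
      y = x ∨ y = z := by
    intro x y z hy hx hz hw
    have hw' : y ∈ segment ℝ x z := mem_segment_iff_wbtw.2 hw
    have := (mem_extremePoints_iff_forall_segment.1 hy).2 x hx z hz hw'
    rcases this with h | h
    · exact Or.inl h.symm
    · exact Or.inr h.symm
  apply Subset.antisymm
  · rw [← h.face_eq hF]
    refine convexHull_min ?_ (convex_segment u v)
    rintro x ⟨hxF, hx⟩
    have hc : Collinear ℝ ({u, v, x} : Set (Fin d → ℝ)) := hcol.subset (by
      rintro y (rfl | rfl | rfl) <;> assumption)
    rcases hc.wbtw_or_wbtw_or_wbtw with hw | hw | hw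
    · rcases hseg _ _ _ hv hu.1 hx.1 hw with h1 | h1
      · exact absurd h1.symm huv
      · rw [← h1]; exact right_mem_segment ℝ u v
    · rcases hseg _ _ _ hx hv.1 hu.1 hw with h1 | h1
      · rw [h1]; exact right_mem_segment ℝ u v
      · rw [h1]; exact left_mem_segment ℝ u v
    · rcases hseg _ _ _ hu hx.1 hv.1 hw with h1 | h1
      · rw [← h1]; exact left_mem_segment ℝ u v
      · exact absurd h1 huv
  · exact (hF.convex h.convex).segment_subset huF hvF

theorem singleton_covBy_iff (h : IsHull P) {A B : FaceLattice P} {w : Fin d → ℝ}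
    (hA : A.1 = {w}) : A ⋖ B ↔ ∃ x, IsEdge P w x ∧ B.1 = segment ℝ w x := by
  have hw : w ∈ P.extremePoints ℝ := h.isExposed_singleton.1 (hA ▸ A.2)
  have hAne : A.1.Nonempty := by rw [hA]; exact singleton_nonempty w
  constructor
  · intro hAB
    have hdim := covBy_faceDim h hAB hAne
    rw [hA, faceDim_singleton] at hdim
    obtain ⟨x, hx, hxB, hxw⟩ : ∃ x ∈ P.extremePoints ℝ, x ∈ B.1 ∧ x ≠ w := by
      by_contra! hcon
      refine hAB.lt.not_ge ((h.face_subset_iff B.2 A.2).2 fun v hv hvB => ?_)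
      rw [hA]
      exact hcon v hv hvB
    have hwB : w ∈ B.1 := hAB.le (by rw [hA]; exact mem_singleton w)
    have heq := h.eq_segment B.2 (by omega) hwB hxB hw hx hxw.symm
    exact ⟨x, ⟨hxw.symm, heq ▸ B.2⟩, heq⟩
  · rintro ⟨x, hx, hB⟩
    refine covBy_of_faceDim ?_ hAne ?_
    · change A.1 ⊆ B.1
      rw [hA, hB, singleton_subset_iff]
      exact left_mem_segment ℝ w x
    · rw [hA, hB, faceDim_singleton, faceDim_segment hx.1]

/-! ### Shellings and the face lattice -/

theorem isFacet_iff (h : IsHull P) (A : FaceLattice P) (X : Set (Fin d → ℝ)) :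
    IsFacet A.1 X ↔ ∃ B : FaceLattice P, B.1 = X ∧ B ⋖ A := by
  constructor
  · rintro ⟨h1, h2, h3⟩
    have hX := h.face_trans A.2 h1
    refine ⟨⟨X, hX⟩, rfl, lt_of_le_of_ne h1.subset fun heq => h2 (congrArg Subtype.val heq),
      fun C hC1 hC2 => ?_⟩
    rcases h3 C.1 (face_of_subset C.2 A.2 hC2.le) hC1.le with h4 | h4
    · exact hC1.ne (Subtype.ext h4.symm)
    · exact hC2.ne (Subtype.ext h4)
  · rintro ⟨B, rfl, hBA⟩
    refine ⟨face_of_subset B.2 A.2 hBA.le, fun heq => hBA.ne (Subtype.ext heq),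
      fun F' hF' hBF' => ?_⟩
    have hF := h.face_trans A.2 hF'
    by_contra! hcon
    exact hBA.2 (c := ⟨F', hF⟩)
      (lt_of_le_of_ne hBF' fun heq => hcon.1 (congrArg Subtype.val heq).symm)
      (lt_of_le_of_ne hF'.subset fun heq => hcon.2 (congrArg Subtype.val heq))

open Classical in
/-- The rank function on faces given by the position in a list of sets. -/
noncomputable def listRank (P : Set (Fin d → ℝ)) (L : List (Set (Fin d → ℝ))) :
    (FaceLattice P)ᵒᵈ → ℝ := fun A => L.idxOf (OrderDual.ofDual A).1

theorem listRank_injOn (h : IsHull P) {A : FaceLattice P} {L : List (Set (Fin d → ℝ))}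
    (hL : IsFacetOrder A.1 L) :
    InjOn (listRank P L) {b | OrderDual.toDual A ⋖ b} := by
  classical
  intro x hx y hy hxy
  have hmem : ∀ z, OrderDual.toDual A ⋖ z → (OrderDual.ofDual z).1 ∈ L := fun z hz =>
    (hL.2 _).2 ((isFacet_iff h A _).2 ⟨_, rfl, hz.ofDual⟩)
  simp only [listRank, Nat.cast_inj] at hxy
  have := (List.idxOf_inj (hmem x hx)).1 hxy
  exact OrderDual.ofDual.injective (Subtype.ext this)

theorem finite_covers (h : IsHull P) (A : (FaceLattice P)ᵒᵈ) : {b | A ⋖ b}.Finite := by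
  have := h.finite_faceLattice
  have : Finite (FaceLattice P)ᵒᵈ := this
  exact Set.toFinite _

/-- A relative interior point of `F` lies in some member of the union, and a face through that point
contains `F`. -/
theorem mem_of_subset_iUnion {L : List (Set (Fin d → ℝ))} (h : IsHull P)
    (hF : IsExposed ℝ P F) (hne : F.Nonempty) (hL : ∀ X ∈ L, IsExposed ℝ P X)
    (hsub : F ⊆ ⋃ X ∈ L, X) : ∃ X ∈ L, F ⊆ X := by
  obtain ⟨b, hb, hbG⟩ := h.exists_center_face hF hne
  have := hsub hb
  simp only [mem_iUnion, exists_prop] at this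
  obtain ⟨X, hX, hbX⟩ := this
  exact ⟨X, hX, hbG X (hL X hX) hbX⟩

/-- In the reversed face lattice the facets of a face are its covers. Two unions of faces are equal
exactly if every face that lies in a member of one family lies in a member of the other, and this is
the condition in `RShell`. -/
theorem rshell_of_isShelling (h : IsHull P) {L : List (Set (Fin d → ℝ))} (hL : IsShelling F L) :
    ∀ A : FaceLattice P, A.1 = F → RShell (OrderDual.toDual A) (listRank P L) := by
  classical
  induction hL with
  | points F L order small =>
    rintro A rfl
    refine .points _ _ (finite_covers h _) (listRank_injOn h order) fun b hb x y hbx hxy => ?_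
    have hbL := (order.2 _).2 ((isFacet_iff h A _).2 ⟨_, rfl, hb.ofDual⟩)
    have hs := small _ hbL
    have h1 : (OrderDual.ofDual x).1 ⊂ (OrderDual.ofDual b).1 := hbx
    have h2 : (OrderDual.ofDual y).1 ⊂ (OrderDual.ofDual x).1 := hxy
    have h3 : (OrderDual.ofDual x).1.Nonempty := by
      by_contra hcon
      rw [not_nonempty_iff_eq_empty] at hcon
      rw [hcon] at h2
      exact h2.2 (empty_subset _)
    obtain ⟨z, hz⟩ := h3
    exact h1.2 fun q hq => hs hq (h1.1 hz) ▸ hz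
  | step F L order M r shelling segment ih =>
    rintro A rfl
    have hmem : ∀ e, OrderDual.toDual A ⋖ e → (OrderDual.ofDual e).1 ∈ L := fun z hz =>
      (order.2 _).2 ((isFacet_iff h A _).2 ⟨_, rfl, hz.ofDual⟩)
    have hLcov : ∀ X ∈ L, ∃ B : FaceLattice P, B.1 = X ∧ B ⋖ A := fun X hX =>
      (isFacet_iff h A X).1 ((order.2 X).1 hX)
    have hord : ∀ (j : ℕ) (hj : j < L.length), IsFacetOrder L[j] (M j) := by
      intro j hj
      cases shelling j hj <;> assumption
    refine .step _ _ (finite_covers h _) (listRank_injOn h order)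
      (fun e => listRank P (M (L.idxOf (OrderDual.ofDual e).1)))
      -- Nothing precedes the first facet, so its initial segment has to be empty; `r 0` is
      -- unconstrained and cannot serve as threshold.
      (fun e => if L.idxOf (OrderDual.ofDual e).1 = 0 then 0
        else r (L.idxOf (OrderDual.ofDual e).1)) ?_ ?_
    · intro e he
      have hj := List.idxOf_lt_length_of_mem (hmem e he)
      exact ih _ hj (OrderDual.ofDual e) (List.getElem_idxOf hj).symm
    · intro e K he heK
      have hj := List.idxOf_lt_length_of_mem (hmem e he)
      have hget : L[L.idxOf (OrderDual.ofDual e).1] = (OrderDual.ofDual e).1 := List.getElem_idxOf hj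
      set j := L.idxOf (OrderDual.ofDual e).1 with hjdef
      have hMj : IsFacetOrder (OrderDual.ofDual e).1 (M j) := hget ▸ hord j hj
      rcases Nat.eq_zero_or_pos j with hj0 | hj0
      · simp only [hj0, if_true]
        constructor
        · rintro ⟨e', -, hlt, -⟩
          simp only [listRank, ← hjdef, hj0] at hlt
          exact absurd hlt (by simp)
        · rintro ⟨H, -, hlt, -⟩
          simp only [listRank] at hlt
          exact absurd hlt (by simp)
      · obtain ⟨hr1, hr2, hseg⟩ := segment j hj hj0
        rw [hget] at hseg
        simp only [hj0.ne', if_false]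
        have hKe : (OrderDual.ofDual K).1 ⊆ (OrderDual.ofDual e).1 := heK
        constructor
        · rintro ⟨e', he', hlt, hle⟩
          simp only [listRank, Nat.cast_lt, ← hjdef] at hlt
          have he'L := (List.mem_take_iff_idxOf_lt (hmem e' he')).2 hlt
          have hKe' : (OrderDual.ofDual K).1 ⊆ (OrderDual.ofDual e').1 := hle
          obtain ⟨X, hX, hKX⟩ : ∃ X ∈ (M j).take (r j), (OrderDual.ofDual K).1 ⊆ X := by
            -- The empty face has no interior point, but it lies in any member, and there is one
            -- because `1 ≤ r j`.
            rcases (OrderDual.ofDual K).1.eq_empty_or_nonempty with hemp | hne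
            · have : 0 < ((M j).take (r j)).length := by
                rw [List.length_take]; omega
              exact ⟨_, List.getElem_mem this, by rw [hemp]; exact empty_subset _⟩
            · refine mem_of_subset_iUnion h (OrderDual.ofDual K).2 hne (fun X hX => ?_) ?_
              · exact h.face_trans (OrderDual.ofDual e).2
                  ((hMj.2 X).1 (List.mem_of_mem_take hX)).1
              · rw [← hseg]
                refine subset_inter hKe (hKe'.trans ?_)
                exact subset_biUnion_of_mem (u := fun F : Set (Fin d → ℝ) => F) he'L
          have hXM := List.mem_of_mem_take hX
          obtain ⟨B, rfl, hB⟩ := (isFacet_iff h (OrderDual.ofDual e) X).1 ((hMj.2 X).1 hXM)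
          refine ⟨OrderDual.toDual B, hB.toDual, ?_, hKX⟩
          simp only [listRank, Nat.cast_lt]
          exact (List.mem_take_iff_idxOf_lt hXM).1 hX
        · rintro ⟨H, hH, hlt, hle⟩
          have hKH : (OrderDual.ofDual K).1 ⊆ (OrderDual.ofDual H).1 := hle
          have hHM : (OrderDual.ofDual H).1 ∈ M j :=
            (hMj.2 _).2 ((isFacet_iff h _ _).2 ⟨_, rfl, hH.ofDual⟩)
          simp only [listRank, Nat.cast_lt] at hlt
          have hHt := (List.mem_take_iff_idxOf_lt hHM).2 hlt
          obtain ⟨X, hX, hKX⟩ : ∃ X ∈ L.take j, (OrderDual.ofDual K).1 ⊆ X := by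
            rcases (OrderDual.ofDual K).1.eq_empty_or_nonempty with hemp | hne
            · have : 0 < (L.take j).length := by
                rw [List.length_take]; omega
              exact ⟨_, List.getElem_mem this, by rw [hemp]; exact empty_subset _⟩
            · refine mem_of_subset_iUnion h (OrderDual.ofDual K).2 hne (fun X hX => ?_) ?_
              · obtain ⟨B, rfl, -⟩ := hLcov X (List.mem_of_mem_take hX)
                exact B.2
              · refine hKH.trans (Subset.trans ?_ (inter_subset_right
                  (s := (OrderDual.ofDual e).1)))
                rw [hseg]
                exact subset_biUnion_of_mem (u := fun F : Set (Fin d → ℝ) => F) hHt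
          have hXL := List.mem_of_mem_take hX
          obtain ⟨B, rfl, hB⟩ := hLcov X hXL
          refine ⟨OrderDual.toDual B, hB.toDual, ?_, hKX⟩
          simp only [listRank, Nat.cast_lt, ← hjdef]
          exact (List.mem_take_iff_idxOf_lt hXL).1 hX

theorem exists_facetOrder (h : IsHull P) (A : (FaceLattice P)ᵒᵈ) (ρ : (FaceLattice P)ᵒᵈ → ℝ)
    (hinj : InjOn ρ {b | A ⋖ b}) : ∃ L : List (FaceLattice P)ᵒᵈ,
      (∀ b, b ∈ L ↔ A ⋖ b) ∧ (L.Pairwise fun x y => ρ x < ρ y) ∧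
      IsFacetOrder (OrderDual.ofDual A).1 (L.map fun b => (OrderDual.ofDual b).1) := by
  obtain ⟨L, hnd, hmem, hsort⟩ := exists_sorted_list (finite_covers h A) ρ hinj
  refine ⟨L, hmem, hsort, ?_, fun X => ?_⟩
  · exact hnd.map fun x y hxy => OrderDual.ofDual.injective (Subtype.ext hxy)
  · rw [isFacet_iff h, List.mem_map]
    constructor
    · rintro ⟨b, hb, rfl⟩
      exact ⟨OrderDual.ofDual b, rfl, ((hmem b).1 hb).ofDual⟩
    · rintro ⟨B, rfl, hB⟩
      exact ⟨OrderDual.toDual B, (hmem _).2 hB.toDual, rfl⟩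

/-- The converse of `rshell_of_isShelling`: ranks are turned into sorted lists and thresholds into
lengths of initial segments. -/
theorem isShelling_of_rshell (h : IsHull P) {A : (FaceLattice P)ᵒᵈ} {ρ : (FaceLattice P)ᵒᵈ → ℝ}
    (hA : RShell A ρ) : ∀ L : List (FaceLattice P)ᵒᵈ, (∀ b, b ∈ L ↔ A ⋖ b) →
      (L.Pairwise fun x y => ρ x < ρ y) →
      IsFacetOrder (OrderDual.ofDual A).1 (L.map fun b => (OrderDual.ofDual b).1) →
      IsShelling (OrderDual.ofDual A).1 (L.map fun b => (OrderDual.ofDual b).1) := by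
  classical
  induction hA with
  | points A ρ fin inj small =>
    intro L hL hsort hord
    refine .points _ _ hord ?_
    rintro X hX
    obtain ⟨b, hb, rfl⟩ := List.mem_map.1 hX
    by_contra hcon
    rw [not_subsingleton_iff] at hcon
    obtain ⟨v, hvb, hv⟩ := h.exists_vertex_mem (OrderDual.ofDual b).2 hcon.nonempty
    refine small b ((hL b).1 hb) (OrderDual.toDual ⟨{v}, h.isExposed_singleton.2 hv⟩)
      (OrderDual.toDual ⟨∅, isExposed_empty⟩) ?_ ?_
    · change ({v} : Set (Fin d → ℝ)) ⊂ (OrderDual.ofDual b).1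
      refine ⟨singleton_subset_iff.2 hvb, fun hs => ?_⟩
      exact (not_subsingleton_iff.2 hcon) (subsingleton_singleton.anti hs)
    · change (∅ : Set (Fin d → ℝ)) ⊂ {v}
      exact (singleton_nonempty v).empty_ssubset
  | step A ρ fin inj κ t sh seg ih =>
    intro L hL hsort hord
    have hex : ∀ e, ∃ N : List (FaceLattice P)ᵒᵈ, ∃ r : ℕ, A ⋖ e →
        IsShelling (OrderDual.ofDual e).1 (N.map fun b => (OrderDual.ofDual b).1) ∧
        r ≤ N.length ∧ ∀ x, x ∈ N.take r ↔ e ⋖ x ∧ κ e x < t e := by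
      intro e
      by_cases he : A ⋖ e
      · obtain ⟨N, hN, hNs, hNo⟩ := exists_facetOrder h e (κ e) (sh e he).injOn
        obtain ⟨r, hr, hrm⟩ := exists_take_iff (κ e) (t e) N hNs
        exact ⟨N, r, fun _ => ⟨ih e he N hN hNs hNo, hr, fun x => by rw [hrm, hN]⟩⟩
      · exact ⟨[], 0, fun h => absurd h he⟩
    choose N r hN using hex
    have hget : ∀ (j : ℕ) (hj : j < (L.map fun b => (OrderDual.ofDual b).1).length),
        ∃ hj' : j < L.length, (L.map fun b => (OrderDual.ofDual b).1)[j] =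
          (OrderDual.ofDual L[j]).1 ∧ L[j]? = some L[j] := fun j hj => by
      have : j < L.length := by simpa using hj
      exact ⟨this, by simp, by simp [this]⟩
    refine .step _ _ hord (fun j => (L[j]?.map fun e => (N e).map
      fun b => (OrderDual.ofDual b).1).getD []) (fun j => (L[j]?.map r).getD 0) ?_ ?_
    · intro j hj
      obtain ⟨hj', h1, h2⟩ := hget j hj
      rw [h1]
      simp only [h2, Option.map_some, Option.getD_some]
      exact (hN L[j] ((hL _).1 (List.getElem_mem hj'))).1
    · intro j hj hj0
      obtain ⟨hj', h1, h2⟩ := hget j hj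
      rw [h1]
      simp only [h2, Option.map_some, Option.getD_some]
      set e := L[j] with he
      have heA : A ⋖ e := (hL _).1 (List.getElem_mem hj')
      obtain ⟨-, hr, hrm⟩ := hN e heA
      have hprev : ∀ x, x ∈ L.take j ↔ A ⋖ x ∧ ρ x < ρ e := by
        intro x
        rw [List.pairwise_iff_getElem] at hsort
        constructor
        · intro hx
          obtain ⟨i, hi, rfl⟩ := List.mem_iff_getElem.1 hx
          rw [List.length_take] at hi
          rw [List.getElem_take]
          exact ⟨(hL _).1 (List.getElem_mem _), hsort i j (by omega) hj' (by omega)⟩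
        · rintro ⟨hx, hlt⟩
          obtain ⟨i, hi, rfl⟩ := List.mem_iff_getElem.1 ((hL x).2 hx)
          rw [List.mem_take_iff_getElem]
          refine ⟨i, ?_, rfl⟩
          rw [lt_min_iff]
          refine ⟨?_, hi⟩
          by_contra hcon
          push Not at hcon
          rcases hcon.lt_or_eq with hlt' | heq
          · exact lt_asymm hlt (hsort j i hj' hi hlt')
          · subst heq; exact lt_irrefl _ hlt
      have hkey : ∀ K, e ≤ K → ((∃ x ∈ L.take j, x ≤ K) ↔ ∃ x ∈ (N e).take (r e), x ≤ K) := by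
        intro K hK
        have := seg e K heA hK
        constructor
        · rintro ⟨x, hx, hxK⟩
          obtain ⟨H, hH, hHt, hHK⟩ := this.1 ⟨x, ((hprev x).1 hx).1, ((hprev x).1 hx).2, hxK⟩
          exact ⟨H, (hrm H).2 ⟨hH, hHt⟩, hHK⟩
        · rintro ⟨x, hx, hxK⟩
          obtain ⟨H, hH, hHt, hHK⟩ := this.2 ⟨x, ((hrm x).1 hx).1, ((hrm x).1 hx).2, hxK⟩
          exact ⟨H, (hprev H).2 ⟨hH, hHt⟩, hHK⟩
      refine ⟨?_, by simpa using hr, ?_⟩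
      -- The condition at the empty face, which lies in the first facet, shows that the initial
      -- segment is not empty.
      · by_contra hcon
        have hr0 : r e = 0 := by omega
        have h0 : L[0] ∈ L.take j := by
          rw [List.mem_take_iff_getElem]
          exact ⟨0, by rw [lt_min_iff]; omega, rfl⟩
        obtain ⟨x, hx, -⟩ := (hkey (OrderDual.toDual ⟨∅, isExposed_empty⟩) (empty_subset _)).1
          ⟨_, h0, empty_subset _⟩
        rw [hr0] at hx
        simp at hx
      · rw [← List.map_take, ← List.map_take]
        ext z
        simp only [mem_inter_iff, mem_iUnion, List.mem_map, exists_prop, exists_exists_and_eq_and]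
        constructor
        · rintro ⟨hze, x, hx, hzx⟩
          -- The intersection with an earlier facet is itself a face, so it lies in a single member
          -- of the initial segment.
          obtain ⟨H, hH, hHK⟩ := (hkey (OrderDual.toDual
            ⟨_, (OrderDual.ofDual e).2.inter (OrderDual.ofDual x).2⟩) inter_subset_left).1
            ⟨x, hx, inter_subset_right⟩
          exact ⟨H, hH, hHK ⟨hze, hzx⟩⟩
        · rintro ⟨H, hH, hzH⟩
          have hHe : (OrderDual.ofDual H).1 ⊆ (OrderDual.ofDual e).1 := ((hrm H).1 hH).1.le
          obtain ⟨x, hx, hxK⟩ := (hkey H ((hrm H).1 hH).1.le).2 ⟨H, hH, le_rfl⟩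
          exact ⟨hHe hzH, x, hx, hxK hzH⟩

end Faces

end Polytopal

namespace Polytopal
open Set Filter Topology

/-! ### Existence of combinatorial polars. -/

section Polar

variable {d : ℕ} {P : Set (Fin d → ℝ)}

theorem exists_dotProduct (l : (Fin d → ℝ) →ₗ[ℝ] ℝ) : ∃ a : Fin d → ℝ, ∀ x, l x = x ⬝ᵥ a := by
  refine ⟨fun i => l (Pi.single i 1), fun x => ?_⟩
  rw [LinearMap.pi_apply_eq_sum_univ l x]
  simp only [dotProduct, smul_eq_mul]
  refine Finset.sum_congr rfl fun i _ => ?_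
  congr 2
  ext j
  simp [Pi.single_apply, eq_comm]

/-- The functional `x ↦ x ⬝ᵥ a`. -/
noncomputable def dotLin (a : Fin d → ℝ) : (Fin d → ℝ) →ₗ[ℝ] ℝ where
  toFun x := x ⬝ᵥ a
  map_add' := by simp [add_dotProduct]
  map_smul' := by simp [smul_dotProduct]

@[simp] theorem dotLin_apply (a x : Fin d → ℝ) : dotLin a x = x ⬝ᵥ a := rfl

/-- From an interior point one can move a little away from `x`. If the functional were smaller at
`x`, it would exceed its maximum there. -/
theorem eq_of_max_interior {A : Set (Fin d → ℝ)} {p : Fin d → ℝ} (hp : p ∈ interior A)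
    {l : (Fin d → ℝ) →ₗ[ℝ] ℝ} {m : ℝ} (hl : ∀ x ∈ A, l x ≤ m) (hpm : l p = m) :
    ∀ x ∈ A, l x = m := by
  intro x hx
  refine le_antisymm (hl x hx) ?_
  have hc : Tendsto (fun t : ℝ => p + t • (p - x)) (𝓝[>] 0) (𝓝 p) := by
    have : Continuous fun t : ℝ => p + t • (p - x) := by fun_prop
    have h2 := this.tendsto 0
    simp only [zero_smul, add_zero] at h2
    exact h2.mono_left nhdsWithin_le_nhds
  have hev := hc.eventually (mem_interior_iff_mem_nhds.1 hp)
  obtain ⟨t, htA, ht⟩ := (hev.and self_mem_nhdsWithin).exists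
  have := hl _ htA
  simp only [map_add, map_smul, map_sub, smul_eq_mul, hpm] at this
  have ht' : (0 : ℝ) < t := ht
  nlinarith

/-- The polar of `P` with respect to the point `p`. -/
def polar (P : Set (Fin d → ℝ)) (p : Fin d → ℝ) : Set (Fin d → ℝ) :=
  {y | ∀ x ∈ P, (x - p) ⬝ᵥ y ≤ 1}

theorem convex_polar (p : Fin d → ℝ) : Convex ℝ (polar P p) := by
  intro y hy z hz a b ha hb hab x hx
  rw [dotProduct_add, dotProduct_smul, dotProduct_smul, smul_eq_mul, smul_eq_mul]
  have h1 := hy x hx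
  have h2 := hz x hx
  nlinarith

theorem isClosed_polar (p : Fin d → ℝ) : IsClosed (polar P p) := by
  have : polar P p = ⋂ x ∈ P, {y | (x - p) ⬝ᵥ y ≤ 1} := by
    ext y; simp [polar]
  rw [this]
  refine isClosed_biInter fun x _ => isClosed_le ?_ continuous_const
  exact Continuous.dotProduct continuous_const continuous_id

theorem isCompact_polar {p : Fin d → ℝ} (hp : p ∈ interior P) : IsCompact (polar P p) := by
  refine Metric.isCompact_of_isClosed_isBounded (isClosed_polar p) ?_
  obtain ⟨ε, hε, hball⟩ := Metric.mem_nhds_iff.1 (mem_interior_iff_mem_nhds.1 hp)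
  have hmem : ∀ (i : Fin d) (s : ℝ), |s| < ε → p + Pi.single i s ∈ P := by
    intro i s hs
    apply hball
    rw [mem_ball_iff_norm, add_sub_cancel_left]
    refine (pi_norm_lt_iff hε).2 fun j => ?_
    by_cases hij : j = i
    · subst hij; simpa using hs
    · simpa [hij] using hε
  refine (Metric.isBounded_closedBall (x := (0 : Fin d → ℝ)) (r := 2 / ε)).subset fun y hy => ?_
  rw [mem_closedBall_zero_iff]
  refine (pi_norm_le_iff_of_nonneg (by positivity)).2 fun i => ?_
  rw [Real.norm_eq_abs, abs_le]
  have h1 := hy _ (hmem i (ε / 2) (by rw [abs_of_pos (by linarith)]; linarith))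
  have h2 := hy _ (hmem i (-(ε / 2)) (by rw [abs_neg, abs_of_pos (by linarith)]; linarith))
  rw [add_sub_cancel_left, single_dotProduct] at h1 h2
  constructor
  · rw [neg_le, le_div_iff₀ hε]; linarith
  · rw [le_div_iff₀ hε]; linarith

theorem zero_mem_interior_polar (hP : IsCompact P) (p : Fin d → ℝ) :
    (0 : Fin d → ℝ) ∈ interior (polar P p) := by
  obtain ⟨R, hR⟩ := hP.isBounded.exists_norm_le
  set R' := (d : ℝ) * (|R| + ‖p‖) + 1 with hR'
  have hRpos : 0 < R' := by positivity
  rw [mem_interior_iff_mem_nhds]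
  refine Metric.mem_nhds_iff.2 ⟨1 / R', by positivity, fun y hy x hx => ?_⟩
  rw [mem_ball_zero_iff] at hy
  have hx' : ‖x - p‖ ≤ |R| + ‖p‖ :=
    (norm_sub_le x p).trans (add_le_add ((hR x hx).trans (le_abs_self R)) le_rfl)
  have hsum : (x - p) ⬝ᵥ y ≤ ∑ i : Fin d, (|R| + ‖p‖) * (1 / R') := by
    refine Finset.sum_le_sum fun i _ => ?_
    refine (le_abs_self _).trans ?_
    rw [abs_mul]
    refine mul_le_mul ?_ ?_ (abs_nonneg _) (by positivity)
    · exact (norm_le_pi_norm (x - p) i).trans hx'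
    · exact (norm_le_pi_norm y i).trans hy.le
  refine hsum.trans ?_
  rw [Finset.sum_const, Finset.card_univ, Fintype.card_fin, nsmul_eq_mul]
  rw [mul_one_div, ← mul_div_assoc, div_le_one hRpos]
  linarith

theorem polar_eq (h : IsHull P) (p : Fin d → ℝ) :
    polar P p = {y | ∀ x ∈ P.extremePoints ℝ, (x - p) ⬝ᵥ y ≤ 1} := by
  ext y
  refine ⟨fun hy x hx => hy x hx.1, fun hy x hx => ?_⟩
  have := le_of_le_on_extremePoints h (l := dotLin y) (m := 1 + p ⬝ᵥ y) (fun x hx => by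
    have := hy x hx
    rw [sub_dotProduct] at this
    rw [dotLin_apply]; linarith) x hx
  rw [dotLin_apply] at this
  rw [sub_dotProduct]; linarith

/-- An extreme point of the polar is determined by the vertices of `P` at which its inequality is
tight: if `y` and `y'` had the same ones, then `y` could be moved both ways along `y - y'`. -/
theorem finite_extremePoints_polar (h : IsHull P) (p : Fin d → ℝ) :
    ((polar P p).extremePoints ℝ).Finite := by
  refine Set.Finite.of_finite_image
    (f := fun y => {x | x ∈ P.extremePoints ℝ ∧ (x - p) ⬝ᵥ y = 1})
    (h.finite_extremePoints.finite_subsets.subset ?_) ?_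
  · rintro _ ⟨y, -, rfl⟩
    exact fun x hx => hx.1
  · intro y hy y' hy' heq
    by_contra hne
    dsimp only at heq
    have htight : ∀ x ∈ P.extremePoints ℝ, (x - p) ⬝ᵥ y = 1 → (x - p) ⬝ᵥ (y - y') = 0 := by
      intro x hx hxy
      have : x ∈ {x | x ∈ P.extremePoints ℝ ∧ (x - p) ⬝ᵥ y' = 1} := by
        rw [← heq]; exact ⟨hx, hxy⟩
      rw [dotProduct_sub, hxy, this.2, sub_self]
    have hsmall : ∀ z : Fin d → ℝ,
        (∀ x ∈ P.extremePoints ℝ, (x - p) ⬝ᵥ y = 1 → (x - p) ⬝ᵥ z = 0) →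
        ∀ᶠ t : ℝ in 𝓝[>] 0, y + t • z ∈ polar P p := by
      intro z hz
      have : ∀ᶠ t : ℝ in 𝓝[>] 0, ∀ x ∈ P.extremePoints ℝ, (x - p) ⬝ᵥ (y + t • z) ≤ 1 := by
        rw [eventually_all_finite h.finite_extremePoints]
        intro x hx
        rcases (hy.1 x hx.1).lt_or_eq with hlt | heq
        · have hc : Tendsto (fun t : ℝ => (x - p) ⬝ᵥ (y + t • z)) (𝓝[>] 0)
              (𝓝 ((x - p) ⬝ᵥ y)) := by
            have : Continuous fun t : ℝ => (x - p) ⬝ᵥ y + t * ((x - p) ⬝ᵥ z) := by fun_prop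
            have h2 := (this.tendsto 0).mono_left (nhdsWithin_le_nhds (s := Ioi 0))
            simp only [zero_mul, add_zero] at h2
            simpa [dotProduct_add, dotProduct_smul] using h2
          exact (hc.eventually (gt_mem_nhds hlt)).mono fun t ht => le_of_lt ht
        · refine Eventually.of_forall fun t => ?_
          rw [dotProduct_add, dotProduct_smul, hz x hx heq, heq]
          simp
      rw [polar_eq h]
      exact this
    have h1 := hsmall (y - y') htight
    have h2 := hsmall (-(y - y')) (fun x hx hxy => by rw [dotProduct_neg, htight x hx hxy, neg_zero])
    obtain ⟨t, ⟨ht1, ht2⟩, ht⟩ := ((h1.and h2).and self_mem_nhdsWithin).exists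
    have ht' : (0 : ℝ) < t := ht
    have hmem : y ∈ openSegment ℝ (y + t • (y - y')) (y + t • -(y - y')) := by
      refine ⟨1 / 2, 1 / 2, by norm_num, by norm_num, by norm_num, ?_⟩
      module
    have := (mem_extremePoints.1 hy).2 _ ht1 _ ht2 hmem
    have h3 : t • (y - y') = 0 := by simpa using this.1
    rcases smul_eq_zero.1 h3 with h4 | h4
    · exact ht'.ne' h4
    · exact hne (sub_eq_zero.1 h4)

theorem isPolytope_of_interior {Q : Set (Fin d → ℝ)} (hQ : IsHull Q) (hne : (interior Q).Nonempty) :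
    IsPolytope Q := by
  refine ⟨hQ, ?_⟩
  exact affineSpan_eq_top_of_nonempty_interior
    (by rwa [hQ.convex.convexHull_eq])

theorem IsPolytope.interior_nonempty (h : IsPolytope P) : (interior P).Nonempty := by
  have := interior_convexHull_nonempty_iff_affineSpan_eq_top.2 h.2
  rwa [h.isHull.convex.convexHull_eq] at this

theorem isHull_polar (h : IsHull P) {p : Fin d → ℝ} (hp : p ∈ interior P) :
    IsHull (polar P p) := by
  rw [← convexHull_extremePoints_of_finite (isCompact_polar hp) (convex_polar p)
    (finite_extremePoints_polar h p)]
  exact isHull_of_finite (finite_extremePoints_polar h p)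

/-- The face of the polar that corresponds to a face of the polytope. -/
def polarFace (P : Set (Fin d → ℝ)) (p : Fin d → ℝ) (F : Set (Fin d → ℝ)) : Set (Fin d → ℝ) :=
  {y | y ∈ polar P p ∧ ∀ x ∈ F, (x - p) ⬝ᵥ y = 1}

/-- The face of the polytope that corresponds to a face of the polar. -/
def copolarFace (P : Set (Fin d → ℝ)) (p : Fin d → ℝ) (G : Set (Fin d → ℝ)) : Set (Fin d → ℝ) :=
  {x | x ∈ P ∧ ∀ y ∈ G, (x - p) ⬝ᵥ y = 1}

/-- The equations for all points of `F` follow from the one at a relative interior point, so a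
single functional exposes the polar face. -/
theorem isExposed_polarFace (h : IsHull P) (p : Fin d → ℝ) {F : Set (Fin d → ℝ)}
    (hF : IsExposed ℝ P F) : IsExposed ℝ (polar P p) (polarFace P p F) := by
  rcases F.eq_empty_or_nonempty with rfl | hne
  · have : polarFace P p ∅ = polar P p := by ext y; simp [polarFace]
    rw [this]
  · obtain ⟨b, hb, hbl⟩ := (h.face hF).exists_center hne
    convert isExposed_of_le (P := polar P p) (dotLin (b - p)) 1 (fun y hy => by
      rw [dotLin_apply, dotProduct_comm]; exact hy b (hF.subset hb)) using 1
    ext y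
    simp only [polarFace, mem_ofPred_eq, dotLin_apply]
    refine and_congr_right fun hy => ⟨fun hyF => ?_, fun hyb x hx => ?_⟩
    · rw [dotProduct_comm]; exact hyF b hb
    · have := hbl (dotLin y) (1 + p ⬝ᵥ y) (fun x hx => by
        have := hy x (hF.subset hx)
        rw [sub_dotProduct] at this; rw [dotLin_apply]; linarith) (by
        rw [dotProduct_comm, sub_dotProduct] at hyb; rw [dotLin_apply]; linarith) x hx
      rw [dotLin_apply] at this
      rw [sub_dotProduct]; linarith

theorem isExposed_copolarFace {p : Fin d → ℝ} (h : IsHull (polar P p))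
    {G : Set (Fin d → ℝ)} (hG : IsExposed ℝ (polar P p) G) :
    IsExposed ℝ P (copolarFace P p G) := by
  rcases G.eq_empty_or_nonempty with rfl | hne
  · have : copolarFace P p ∅ = P := by ext y; simp [copolarFace]
    rw [this]
  · obtain ⟨b, hb, hbl⟩ := (h.face hG).exists_center hne
    convert isExposed_of_le (P := P) (dotLin b) (1 + p ⬝ᵥ b) (fun x hx => by
      have := hG.subset hb x hx
      rw [sub_dotProduct] at this; rw [dotLin_apply]; linarith) using 1
    ext x
    simp only [copolarFace, mem_ofPred_eq, dotLin_apply]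
    refine and_congr_right fun hx => ⟨fun hxG => ?_, fun hxb y hy => ?_⟩
    · have := hxG b hb
      rw [sub_dotProduct] at this; linarith
    · have := hbl (dotLin (x - p)) 1 (fun y hy => by
        rw [dotLin_apply, dotProduct_comm]; exact hG.subset hy x hx) (by
        rw [dotLin_apply, dotProduct_comm, sub_dotProduct]; linarith) y hy
      rw [dotLin_apply, dotProduct_comm] at this
      exact this

/-- A functional that exposes `F`, taken relative to `p` and rescaled to be 1 on `F`, is a point of
the polar face, and this point alone recovers `F`. The rescaling fails only if the functional is
maximal at the interior point `p`, and then it is constant on `P`. -/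
theorem copolarFace_polarFace {p : Fin d → ℝ} (hp : p ∈ interior P) {F : Set (Fin d → ℝ)}
    (hF : IsExposed ℝ P F) : copolarFace P p (polarFace P p F) = F := by
  apply Subset.antisymm
  · rintro x ⟨hx, hxF⟩
    rcases F.eq_empty_or_nonempty with rfl | hne
    · have := hxF 0 ⟨fun z _ => by simp, by simp⟩
      simp at this
    obtain ⟨l, m, hl, rfl⟩ := exists_functional hF hne
    rcases (hl p (interior_subset hp)).lt_or_eq with hlt | heq
    · obtain ⟨a, ha⟩ := exists_dotProduct l
      have hval : ∀ z, (z - p) ⬝ᵥ ((m - l p)⁻¹ • a) = (m - l p)⁻¹ * (l z - l p) := fun z => by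
        rw [dotProduct_smul, ← ha, map_sub, smul_eq_mul]
      have hpos : 0 < m - l p := by linarith
      have h1 := hxF ((m - l p)⁻¹ • a) ⟨fun z hz => by
        rw [hval, inv_mul_le_iff₀ hpos]; linarith [hl z hz], fun z hz => by
        rw [hval, hz.2, inv_mul_cancel₀ hpos.ne']⟩
      rw [hval, inv_mul_eq_one₀ hpos.ne'] at h1
      exact ⟨hx, by linarith⟩
    · exact ⟨hx, eq_of_max_interior hp hl heq x hx⟩
  · exact fun x hx => ⟨hF.subset hx, fun y hy => hy.2 x hx⟩

/-- The bipolar theorem: a functional that separates a point from `P` can be rescaled to a point of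
the polar. -/
theorem mem_of_forall_polar (h : IsHull P) {p : Fin d → ℝ} (hp : p ∈ interior P)
    {x : Fin d → ℝ} (hx : ∀ y ∈ polar P p, (x - p) ⬝ᵥ y ≤ 1) : x ∈ P := by
  by_contra hxP
  obtain ⟨l, u, hlu, hux⟩ := geometric_hahn_banach_closed_point h.convex h.isCompact.isClosed hxP
  obtain ⟨a, ha⟩ := exists_dotProduct (l : (Fin d → ℝ) →ₗ[ℝ] ℝ)
  have hpu := hlu p (interior_subset hp)
  have hpos : 0 < u - l p := by linarith
  have ha' : ∀ z, l z = z ⬝ᵥ a := ha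
  have hval : ∀ z, (z - p) ⬝ᵥ ((u - l p)⁻¹ • a) = (u - l p)⁻¹ * (l z - l p) := fun z => by
    rw [dotProduct_smul, ← ha', map_sub, smul_eq_mul]
  have := hx ((u - l p)⁻¹ • a) fun z hz => by
    rw [hval, inv_mul_le_iff₀ hpos]; linarith [hlu z hz]
  rw [hval, inv_mul_le_iff₀ hpos] at this
  linarith

theorem polarFace_copolarFace (h : IsHull P) {p : Fin d → ℝ} (hp : p ∈ interior P)
    {G : Set (Fin d → ℝ)} (hG : IsExposed ℝ (polar P p) G) :
    polarFace P p (copolarFace P p G) = G := by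
  apply Subset.antisymm
  · rintro y ⟨hy, hyG⟩
    rcases G.eq_empty_or_nonempty with rfl | hne
    · have := hyG p ⟨interior_subset hp, by simp⟩
      simp at this
    obtain ⟨l, m, hl, rfl⟩ := exists_functional hG hne
    have h0 : (0 : Fin d → ℝ) ∈ polar P p := fun z _ => by simp
    have h0m : 0 ≤ m := by simpa using hl 0 h0
    rcases h0m.lt_or_eq with hpos | heq
    · obtain ⟨a, ha⟩ := exists_dotProduct l
      have hval : ∀ z, (p + m⁻¹ • a - p) ⬝ᵥ z = m⁻¹ * l z := fun z => by
        rw [add_sub_cancel_left, smul_dotProduct, dotProduct_comm, ← ha, smul_eq_mul]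
      have hmem : p + m⁻¹ • a ∈ P := mem_of_forall_polar h hp fun z hz => by
        rw [hval, inv_mul_le_iff₀ hpos]; linarith [hl z hz]
      have h1 := hyG (p + m⁻¹ • a) ⟨hmem, fun z hz => by
        rw [hval, hz.2, inv_mul_cancel₀ hpos.ne']⟩
      rw [hval, inv_mul_eq_one₀ hpos.ne'] at h1
      exact ⟨hy, h1.symm⟩
    · exact ⟨hy, eq_of_max_interior (zero_mem_interior_polar h.isCompact p) hl
        (by rw [map_zero]; exact heq) y hy⟩
  · exact fun y hy => ⟨hG.subset hy, fun x hx => hx.2 y hy⟩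

/-- Every polytope has a combinatorial polar. -/
theorem IsPolytope.exists_polar (h : IsPolytope P) :
    ∃ Q : Set (Fin d → ℝ), IsPolytope Q ∧ Nonempty (FaceLattice P ≃o (FaceLattice Q)ᵒᵈ) := by
  obtain ⟨p, hp⟩ := h.interior_nonempty
  have hQ := isHull_polar h.isHull hp
  refine ⟨polar P p, isPolytope_of_interior hQ ⟨0, zero_mem_interior_polar h.isHull.isCompact p⟩,
    ⟨?_⟩⟩
  refine
    { toFun := fun F => OrderDual.toDual ⟨polarFace P p F.1, isExposed_polarFace h.isHull p F.2⟩
      invFun := fun G => ⟨copolarFace P p (OrderDual.ofDual G).1,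
        isExposed_copolarFace hQ (OrderDual.ofDual G).2⟩
      left_inv := fun F => Subtype.ext (copolarFace_polarFace hp F.2)
      right_inv := fun G => OrderDual.ofDual.injective
        (Subtype.ext (polarFace_copolarFace h.isHull hp (OrderDual.ofDual G).2))
      map_rel_iff' := ?_ }
  intro F F'
  change polarFace P p F'.1 ⊆ polarFace P p F.1 ↔ F.1 ⊆ F'.1
  constructor
  · intro hs
    rw [← copolarFace_polarFace hp F.2, ← copolarFace_polarFace hp F'.2]
    exact fun x hx => ⟨hx.1, fun y hy => hx.2 y (hs hy)⟩
  · exact fun hs y hy => ⟨hy.1, fun x hx => hy.2 x (hs hx)⟩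

end Polar

end Polytopal

namespace Polytopal
open Set

/-! ### Acyclic orientations and reachability inside faces. -/

namespace PolytopalDigraph

variable {d : ℕ} {G : PolytopalDigraph d}

theorem isHull (G : PolytopalDigraph d) : IsHull G.carrier := G.isPolytope.isHull

theorem faceDim_carrier (G : PolytopalDigraph d) : faceDim G.carrier = d := by
  rw [faceDim, ← direction_affineSpan, G.isPolytope.2, AffineSubspace.direction_top, finrank_top]
  simp

theorem finite_vertexSet (G : PolytopalDigraph d) : G.vertexSet.Finite :=
  G.isHull.finite_extremePoints

theorem arc_left {u v : Fin d → ℝ} (h : G.arc u v) : u ∈ G.vertexSet :=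
  (G.isEdge_of_arc u v h).left_mem

theorem arc_right {u v : Fin d → ℝ} (h : G.arc u v) : v ∈ G.vertexSet :=
  (G.isEdge_of_arc u v h).right_mem

theorem arc_or_arc {u v : Fin d → ℝ} (h : IsEdge G.carrier u v) : G.arc u v ∨ G.arc v u := by
  by_cases h1 : G.arc v u
  · exact Or.inr h1
  · exact Or.inl ((G.arc_iff_not_arc u v h).2 h1)

theorem arc_ne {u v : Fin d → ℝ} (h : G.arc u v) : u ≠ v := (G.isEdge_of_arc u v h).1

theorem mem_vertexSet_of_transGen_left {u v : Fin d → ℝ} (h : Relation.TransGen G.arc u v) :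
    u ∈ G.vertexSet := by
  induction h with
  | single h => exact arc_left h
  | tail _ _ ih => exact ih

/-- The number of vertices from which a vertex can be reached is a height: it serves for inductions
and for sorting. -/
theorem IsAcyclic.height_lt (h : G.IsAcyclic) {u v : Fin d → ℝ} (huv : G.arc u v) :
    {x | Relation.TransGen G.arc x u}.ncard < {x | Relation.TransGen G.arc x v}.ncard := by
  refine Set.ncard_lt_ncard ⟨fun x hx => hx.tail huv, fun hs => ?_⟩
    (G.finite_vertexSet.subset fun x hx => mem_vertexSet_of_transGen_left hx)
  exact h u (hs (Relation.TransGen.single huv))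

theorem IsAcyclic.induction_source (h : G.IsAcyclic) {p : (Fin d → ℝ) → Prop}
    (step : ∀ v ∈ G.vertexSet, (∀ u, G.arc u v → p u) → p v) : ∀ v ∈ G.vertexSet, p v := by
  have : ∀ n, ∀ v ∈ G.vertexSet, {x | Relation.TransGen G.arc x v}.ncard = n → p v := by
    intro n
    induction n using Nat.strong_induction_on with
    | _ n ih =>
      rintro v hv rfl
      exact step v hv fun u hu => ih _ (h.height_lt hu) u (arc_left hu) rfl
  exact fun v hv => this _ v hv rfl

theorem IsAcyclic.induction_sink (h : G.IsAcyclic) {p : (Fin d → ℝ) → Prop}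
    (step : ∀ v ∈ G.vertexSet, (∀ u, G.arc v u → p u) → p v) : ∀ v ∈ G.vertexSet, p v := by
  intro v hv
  by_contra hcon
  -- a counterexample of the largest height
  obtain ⟨w, ⟨hw, hwp⟩, hmax⟩ := Set.exists_max_image {x | x ∈ G.vertexSet ∧ ¬ p x}
    (fun v => {x | Relation.TransGen G.arc x v}.ncard)
    (G.finite_vertexSet.subset fun x hx => hx.1) ⟨v, hv, hcon⟩
  refine hwp (step w hw fun u hu => ?_)
  by_contra hu'
  exact (h.height_lt hu).not_ge (hmax u ⟨arc_right hu, hu'⟩)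

/-- The arcs inside a face. -/
def ArcIn (G : PolytopalDigraph d) (F : Set (Fin d → ℝ)) (u v : Fin d → ℝ) : Prop :=
  G.arc u v ∧ u ∈ F ∧ v ∈ F

theorem reach_sink (h : G.IsAcyclic) {F : Set (Fin d → ℝ)} {t : Fin d → ℝ}
    (ht : ∀ t', G.IsSink F t' → t' = t) :
    ∀ w ∈ G.vertexSet, w ∈ F → Relation.ReflTransGen (G.ArcIn F) w t := by
  refine h.induction_sink fun v hv ih hvF => ?_
  by_cases hs : G.IsSink F v
  · rw [ht v hs]
  · have : ∃ w ∈ F, G.arc v w := by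
      by_contra! hcon
      exact hs ⟨hv, hvF, hcon⟩
    obtain ⟨w, hwF, hw⟩ := this
    exact Relation.ReflTransGen.head ⟨hw, hvF, hwF⟩ (ih w hw hwF)

/-- Going back along arcs inside `F` ends at a source, and only one is available. Hence the source
of a face precedes all its vertices in every topological sort. -/
theorem reach_source (h : G.IsAcyclic) {F : Set (Fin d → ℝ)} {s : Fin d → ℝ}
    (hs : ∀ s', G.IsSource F s' → s' = s) :
    ∀ w ∈ G.vertexSet, w ∈ F → Relation.ReflTransGen (G.ArcIn F) s w := by
  refine h.induction_source fun v hv ih hvF => ?_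
  by_cases hsv : G.IsSource F v
  · rw [hs v hsv]
  · have : ∃ w ∈ F, G.arc w v := by
      by_contra! hcon
      exact hsv ⟨hv, hvF, hcon⟩
    obtain ⟨w, hwF, hw⟩ := this
    exact Relation.ReflTransGen.tail (ih w hw hwF) ⟨hw, hwF, hvF⟩

theorem reflTransGen_of_arcIn {F : Set (Fin d → ℝ)} {u v : Fin d → ℝ}
    (h : Relation.ReflTransGen (G.ArcIn F) u v) : Relation.ReflTransGen G.arc u v :=
  Relation.ReflTransGen.mono (fun _ _ h => h.1) _ _ h

/-! ### Topological sorts -/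

theorem IsAcyclic.exists_topologicalSort (h : G.IsAcyclic) : ∃ r, G.IsTopologicalSort r := by
  classical
  let ρ : (Fin d → ℝ) → ℕ := fun v => {x | Relation.TransGen G.arc x v}.ncard
  let R : (Fin d → ℝ) → (Fin d → ℝ) → Prop := fun x y => ρ x ≤ ρ y
  have : Std.Total R := ⟨fun x y => le_total (ρ x) (ρ y)⟩
  have : IsTrans _ R := ⟨fun x y z => le_trans⟩
  refine ⟨G.finite_vertexSet.toFinset.toList.insertionSort R, ?_, fun v => by simp, ?_⟩
  · rw [(List.perm_insertionSort R _).nodup_iff]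
    exact Finset.nodup_toList _
  · refine (List.pairwise_insertionSort R _).imp fun {u v} huv harc => ?_
    exact (h.height_lt harc).not_ge huv

open Classical in
theorem IsTopologicalSort.idxOf_lt {r : List (Fin d → ℝ)} (hr : G.IsTopologicalSort r)
    {u v : Fin d → ℝ} (h : G.arc u v) : r.idxOf u < r.idxOf v := by
  have hu := (hr.2.1 u).2 (arc_left h)
  have hv := (hr.2.1 v).2 (arc_right h)
  have hul := List.idxOf_lt_length_of_mem hu
  have hvl := List.idxOf_lt_length_of_mem hv
  by_contra hcon
  push Not at hcon
  rcases hcon.lt_or_eq with hlt | heq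
  · have := List.pairwise_iff_getElem.1 hr.2.2 _ _ hvl hul hlt
    rw [List.getElem_idxOf, List.getElem_idxOf] at this
    exact this h
  · exact arc_ne h ((List.idxOf_inj hu).1 heq.symm)

open Classical in
theorem IsTopologicalSort.idxOf_le {r : List (Fin d → ℝ)} (hr : G.IsTopologicalSort r)
    {u v : Fin d → ℝ} (h : Relation.ReflTransGen G.arc u v) : r.idxOf u ≤ r.idxOf v := by
  induction h with
  | refl => exact le_rfl
  | tail _ h ih => exact ih.trans (hr.idxOf_lt h).le

/-! ### The shelling property as a condition on the single vertices -/

/-- The in-edges of the vertex `w` begin a shelling of the facet of the polar that corresponds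
to `w`. -/
def LocalShell (G : PolytopalDigraph d) (w : Fin d → ℝ) : Prop :=
  ∃ (κ : FaceLattice G.carrier → ℝ) (t : ℝ), ∀ A : FaceLattice G.carrier, A.1 = {w} →
    RShell A κ ∧ ∀ e, A ⋖ e → (κ e < t ↔ ∃ x, G.arc x w ∧ e.1 = segment ℝ w x)

/-- The empty face. -/
def emptyFace (P : Set (Fin d → ℝ)) : FaceLattice P := ⟨∅, isExposed_empty⟩

theorem emptyFace_le {P : Set (Fin d → ℝ)} (A : FaceLattice P) : emptyFace P ≤ A := empty_subset _

theorem orderIso_emptyFace {P Q : Set (Fin d → ℝ)} (φ : FaceLattice P ≃o (FaceLattice Q)ᵒᵈ) :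
    (OrderDual.ofDual (φ (emptyFace P))).1 = Q := by
  apply Subset.antisymm
  · exact (OrderDual.ofDual (φ (emptyFace P))).2.subset
  · have h : φ (emptyFace P) ≤ OrderDual.toDual ⟨Q, IsExposed.refl Q⟩ := by
      rw [← φ.le_symm_apply]
      exact emptyFace_le _
    exact h

theorem intervalEmbedding_orderIso {α β : Type*} [PartialOrder α] [PartialOrder β] (φ : α ≃o β)
    (a : α) : IntervalEmbedding φ a :=
  ⟨fun x y _ _ => φ.le_iff_le, fun x y _ hy _ => ⟨φ.symm y, by rwa [φ.le_symm_apply], by simp⟩⟩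

-- The vertex `w` is a facet of the polar, and the shelling of the polar contains a shelling of this
-- facet. Evaluating the condition of `RShell` at an edge over `w` shows that the initial segment
-- consists of the edges whose other end is earlier, that is, of the in-edges.
open Classical in
theorem localShell_of_shellingProperty (hd : 2 ≤ d) (h : G.ShellingProperty) :
    ∀ w ∈ G.vertexSet, G.LocalShell w := by
  obtain ⟨Q, φ, r, L, hQ, hr, hrL, hsh⟩ := h
  have hGh := G.isHull
  set E := emptyFace G.carrier with hE
  have hcarr := orderIso_emptyFace φ
  have hR : RShell E (listRank Q L ∘ φ) := by
    have h1 := rshell_of_isShelling hQ.isHull hsh (OrderDual.ofDual (φ E)) hcarr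
    exact h1.pullback φ E rfl (intervalEmbedding_orderIso φ E)
  have hLnd : L.Nodup := by cases hsh with
    | points _ _ o _ => exact o.1
    | step _ _ o _ _ _ _ => exact o.1
  have hidx : ∀ v ∈ G.vertexSet, ∀ A : FaceLattice G.carrier, A.1 = {v} →
      (listRank Q L ∘ φ) A = r.idxOf v := by
    intro v hv A hA
    rw [List.forall₂_iff_get] at hrL
    have hvr := (hr.2.1 v).2 hv
    have hi := List.idxOf_lt_length_of_mem hvr
    have hi2 := hrL.1 ▸ hi
    obtain ⟨f, hf, hfL⟩ := hrL.2 _ hi hi2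
    have hg : r.get ⟨r.idxOf v, hi⟩ = v := List.getElem_idxOf hi
    rw [hg] at hf
    have hAf : A = f := Subtype.ext (hA.trans hf.symm)
    subst hAf
    simp only [Function.comp, listRank, hfL]
    have := hLnd.idxOf_getElem (r.idxOf v) hi2
    exact_mod_cast this
  intro w hw
  have hwE := hGh.isExposed_singleton.2 hw
  set W : FaceLattice G.carrier := ⟨{w}, hwE⟩ with hW
  have hEW : E ⋖ W := (empty_covBy_iff hGh).2 ⟨w, hw, rfl⟩
  generalize hρ : listRank Q L ∘ φ = ρ at hR hidx
  cases hR with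
  | points _ _ fin inj small =>
    -- In dimension at least two there is a proper face strictly over `w`, so the facets of the
    -- polar are not points.
    exfalso
    have h1 : IsExposed ℝ G.carrier {w} := hwE
    obtain ⟨K, hK, hK1, hK2⟩ := hGh.exists_between h1 (singleton_nonempty w) (by
      rw [faceDim_singleton, faceDim_carrier]; omega)
    exact small W hEW ⟨K, hK⟩ ⟨G.carrier, IsExposed.refl _⟩ hK1 hK2
  | step _ _ fin inj κ t sh seg =>
    refine ⟨κ W, t W, fun A hA => ?_⟩
    obtain rfl : A = W := Subtype.ext hA
    refine ⟨sh _ hEW, fun e he => ?_⟩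
    have := seg W e hEW he.le
    -- The only cover of `W` below an edge `e` at `w` is `e` itself.
    have h2 : κ W e < t W ↔ ∃ H, W ⋖ H ∧ κ W H < t W ∧ H ≤ e := by
      refine ⟨fun hlt => ⟨e, he, hlt, le_rfl⟩, ?_⟩
      rintro ⟨H, hH, hlt, hHe⟩
      have : H = e := by
        by_contra hne
        exact he.2 hH.lt (lt_of_le_of_ne hHe hne)
      rwa [← this]
    rw [h2, ← this]
    obtain ⟨y, hy, hye⟩ := (singleton_covBy_iff hGh rfl).1 he
    constructor
    · rintro ⟨e', he', hlt, hle⟩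
      obtain ⟨x, hx, hxe'⟩ := (empty_covBy_iff hGh).1 he'
      rw [hidx x hx e' hxe', hidx w hw W rfl, Nat.cast_lt] at hlt
      have hxw : x ≠ w := by rintro rfl; exact lt_irrefl _ hlt
      have hxe : x ∈ segment ℝ w y ∩ G.carrier.extremePoints ℝ := by
        rw [← hye]; exact ⟨hle (by rw [hxe']; exact mem_singleton x), hx⟩
      rw [hy.vertices] at hxe
      have hxy : x = y := hxe.resolve_left hxw
      subst hxy
      refine ⟨x, ?_, hye⟩
      rcases arc_or_arc hy with h1 | h1
      · exact absurd (hr.idxOf_lt h1) (by omega)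
      · exact h1
    · rintro ⟨x, hx, hxe⟩
      have hxV := arc_left hx
      refine ⟨⟨{x}, hGh.isExposed_singleton.2 hxV⟩, (empty_covBy_iff hGh).2 ⟨x, hxV, rfl⟩, ?_, ?_⟩
      · rw [hidx x hxV _ rfl, hidx w hw W rfl, Nat.cast_lt]
        exact hr.idxOf_lt hx
      · change {x} ⊆ e.1
        rw [hxe, singleton_subset_iff]
        exact right_mem_segment ℝ w x

-- In a topological sort, a face over `w` has a vertex before `w` exactly if it contains an in-edge
-- of `w`. So the local shellings fit together to a shelling, whichever sort and polar are chosen.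
open Classical in
theorem shellingProperty_of_localShell (hac : G.IsAcyclic) (huso : G.IsUSO)
    (h : ∀ w ∈ G.vertexSet, G.LocalShell w) : G.ShellingProperty := by
  have hGh := G.isHull
  obtain ⟨r, hr⟩ := hac.exists_topologicalSort
  obtain ⟨Q, hQ, ⟨φ⟩⟩ := G.isPolytope.exists_polar
  set E := emptyFace G.carrier with hE
  have hcarr := orderIso_emptyFace φ
  let vf : (Fin d → ℝ) → FaceLattice G.carrier := fun v =>
    if hv : IsExposed ℝ G.carrier {v} then ⟨{v}, hv⟩ else E
  have hvf : ∀ v ∈ G.vertexSet, (vf v).1 = {v} := fun v hv => by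
    simp only [vf, dif_pos (hGh.isExposed_singleton.2 hv)]
  have hvfinj : ∀ v ∈ G.vertexSet, ∀ w ∈ G.vertexSet, vf v = vf w → v = w := by
    intro v hv w hw hvw
    have := congrArg Subtype.val hvw
    rw [hvf v hv, hvf w hw] at this
    exact singleton_injective this
  have hcov : ∀ A, E ⋖ A ↔ ∃ v ∈ G.vertexSet, A = vf v := by
    intro A
    refine (empty_covBy_iff hGh).trans ?_
    constructor
    · rintro ⟨v, hv, hA⟩
      exact ⟨v, hv, Subtype.ext (hA.trans (hvf v hv).symm)⟩
    · rintro ⟨v, hv, rfl⟩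
      exact ⟨v, hv, hvf v hv⟩
  obtain ⟨ρ, hρ⟩ : ∃ ρ : FaceLattice G.carrier → ℝ, ∀ v ∈ G.vertexSet, ρ (vf v) = r.idxOf v := by
    refine ⟨fun A => if hA : ∃ v ∈ G.vertexSet, A = vf v then (r.idxOf hA.choose : ℝ) else 0,
      fun v hv => ?_⟩
    have hex : ∃ w ∈ G.vertexSet, vf v = vf w := ⟨v, hv, rfl⟩
    dsimp only
    rw [dif_pos hex]
    have := hex.choose_spec
    rw [← hvfinj v hv _ this.1 this.2]
  have hfin : Finite (FaceLattice G.carrier) := hGh.finite_faceLattice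
  have hinj : InjOn ρ {b | E ⋖ b} := by
    intro x hx y hy hxy
    obtain ⟨v, hv, rfl⟩ := (hcov x).1 hx
    obtain ⟨w, hw, rfl⟩ := (hcov y).1 hy
    rw [hρ v hv, hρ w hw, Nat.cast_inj] at hxy
    rw [(List.idxOf_inj ((hr.2.1 v).2 hv)).1 hxy]
  have hloc : ∀ A : FaceLattice G.carrier, ∃ (κ : FaceLattice G.carrier → ℝ) (t : ℝ),
      ∀ v ∈ G.vertexSet, A = vf v → RShell A κ ∧
        ∀ e, A ⋖ e → (κ e < t ↔ ∃ x, G.arc x v ∧ e.1 = segment ℝ v x) := by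
    intro A
    by_cases hA : ∃ v ∈ G.vertexSet, A = vf v
    · obtain ⟨v, hv, hAv⟩ := hA
      obtain ⟨κ, t, hκ⟩ := h v hv
      refine ⟨κ, t, fun w hw hAw => ?_⟩
      obtain rfl := hvfinj v hv w hw (hAv.symm.trans hAw)
      exact hκ A (by rw [hAv, hvf v hv])
    · exact ⟨0, 0, fun v hv hAv => absurd ⟨v, hv, hAv⟩ hA⟩
  choose κ t hκ using hloc
  have hR : RShell E ρ := by
    refine .step E ρ (Set.toFinite _) hinj κ t (fun e he => ?_) fun e F he heF => ?_
    · obtain ⟨v, hv, hev⟩ := (hcov e).1 he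
      exact (hκ e v hv hev).1
    · obtain ⟨w, hw, hew⟩ := (hcov e).1 he
      have hin := (hκ e w hw hew).2
      have hwF : w ∈ F.1 := heF (by rw [hew, hvf w hw]; exact mem_singleton w)
      constructor
      · rintro ⟨e', he', hlt, hle⟩
        obtain ⟨x, hx, rfl⟩ := (hcov e').1 he'
        rw [hew, hρ x hx, hρ w hw, Nat.cast_lt] at hlt
        have hxF : x ∈ F.1 := hle (by rw [hvf x hx]; exact mem_singleton x)
        obtain ⟨⟨s, hs, hsu⟩, -⟩ := huso F.1 F.2 ⟨w, hwF⟩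
        -- As the source of `F`, the vertex `w` would reach `x` and could not come after it.
        have hns : ¬ G.IsSource F.1 w := by
          intro hws
          have := reach_source hac (fun s' hs' => (hsu s' hs').trans (hsu w hws).symm) x hx hxF
          have := hr.idxOf_le (reflTransGen_of_arcIn this)
          omega
        have : ∃ y ∈ F.1, G.arc y w := by
          by_contra! hcon
          exact hns ⟨hw, hwF, hcon⟩
        obtain ⟨y, hyF, hy⟩ := this
        have hedge := (G.isEdge_of_arc y w hy).symm
        have heH : e ⋖ (⟨_, hedge.2⟩ : FaceLattice G.carrier) :=
          (singleton_covBy_iff hGh (by rw [hew, hvf w hw])).2 ⟨y, hedge, rfl⟩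
        refine ⟨_, heH, (hin _ heH).2 ⟨y, hy, rfl⟩, ?_⟩
        exact (F.2.convex hGh.convex).segment_subset hwF hyF
      · rintro ⟨H, hH, hlt, hle⟩
        obtain ⟨x, hx, hxH⟩ := (hin H hH).1 hlt
        have hxV := arc_left hx
        refine ⟨vf x, (hcov _).2 ⟨x, hxV, rfl⟩, ?_, ?_⟩
        · rw [hew, hρ x hxV, hρ w hw, Nat.cast_lt]
          exact hr.idxOf_lt hx
        · change (vf x).1 ⊆ F.1
          rw [hvf x hxV, singleton_subset_iff]
          exact hle (by rw [hxH]; exact right_mem_segment ℝ w x)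
  have hR' : RShell (φ E) (ρ ∘ φ.symm) :=
    hR.pullback φ.symm (φ E) (by simp) (intervalEmbedding_orderIso φ.symm _)
  have hrv : ∀ v, v ∈ r ↔ v ∈ G.vertexSet := hr.2.1
  have hφcov : ∀ x y, x ⋖ y ↔ φ x ⋖ φ y := fun x y =>
    ((intervalEmbedding_orderIso φ x).covBy_iff le_rfl |> fun h => ⟨fun hxy => (h hxy.le).2 hxy,
      fun hxy => (h (φ.le_iff_le.1 hxy.le)).1 hxy⟩)
  have hmem : ∀ b, b ∈ r.map (fun v => φ (vf v)) ↔ φ E ⋖ b := by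
    intro b
    rw [List.mem_map]
    constructor
    · rintro ⟨v, hv, rfl⟩
      exact (hφcov _ _).1 ((hcov _).2 ⟨v, (hrv v).1 hv, rfl⟩)
    · intro hb
      have := (hφcov E (φ.symm b)).2 (by simpa using hb)
      obtain ⟨v, hv, hvb⟩ := (hcov _).1 this
      exact ⟨v, (hrv v).2 hv, by rw [← hvb]; simp⟩
  have hsort : (r.map (fun v => φ (vf v))).Pairwise
      fun x y => (ρ ∘ φ.symm) x < (ρ ∘ φ.symm) y := by
    rw [List.pairwise_map, List.pairwise_iff_getElem]
    intro i j hi hj hij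
    have h1 := (hrv _).1 (List.getElem_mem hi)
    have h2 := (hrv _).1 (List.getElem_mem hj)
    simp only [Function.comp, OrderIso.symm_apply_apply, hρ _ h1, hρ _ h2]
    rw [hr.1.idxOf_getElem, hr.1.idxOf_getElem]
    exact_mod_cast hij
  have hord : IsFacetOrder (OrderDual.ofDual (φ E)).1
      ((r.map fun v => φ (vf v)).map fun b => (OrderDual.ofDual b).1) := by
    constructor
    · have hnd : (r.map fun v => φ (vf v)).Nodup := by
        refine hr.1.map_on fun v hv w hw hvw => ?_
        exact hvfinj v ((hrv v).1 hv) w ((hrv w).1 hw) (φ.injective hvw)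
      exact hnd.map fun x y hxy => OrderDual.ofDual.injective (Subtype.ext hxy)
    · intro X
      rw [isFacet_iff hQ.isHull, List.mem_map]
      constructor
      · rintro ⟨b, hb, rfl⟩
        exact ⟨OrderDual.ofDual b, rfl, ((hmem b).1 hb).ofDual⟩
      · rintro ⟨B, rfl, hB⟩
        exact ⟨OrderDual.toDual B, (hmem _).2 hB.toDual, rfl⟩
  have hfinal := isShelling_of_rshell hQ.isHull hR' _ hmem hsort hord
  rw [hcarr] at hfinal
  refine ⟨Q, φ, r, _, hQ, hr, ?_, hfinal⟩
  rw [List.map_map, List.forall₂_map_right_iff, List.forall₂_same]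
  exact fun v hv => ⟨vf v, hvf v ((hrv v).1 hv), rfl⟩

end PolytopalDigraph

end Polytopal

namespace Polytopal
open Set

namespace PolytopalDigraph

/-! ### Faces of a pyramid. -/

section Lift

variable {d : ℕ}

@[simp] theorem lift_castSucc (x : Fin d → ℝ) (i : Fin d) : lift x i.castSucc = x i := by
  simp [lift]

@[simp] theorem lift_last (x : Fin d → ℝ) : lift x (Fin.last d) = 0 := by
  simp [lift]

/-- The embedding of `ℝ^d` in `ℝ^(d+1)` as a linear map. -/
noncomputable def liftLin (d : ℕ) : (Fin d → ℝ) →ₗ[ℝ] (Fin (d + 1) → ℝ) where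
  toFun := lift
  map_add' x y := by
    ext i
    refine Fin.lastCases ?_ (fun i => ?_) i <;> simp
  map_smul' c x := by
    ext i
    refine Fin.lastCases ?_ (fun i => ?_) i <;> simp

@[simp] theorem liftLin_apply (x : Fin d → ℝ) : liftLin d x = lift x := rfl

/-- The projection of `ℝ^(d+1)` to `ℝ^d`. -/
noncomputable def projLin (d : ℕ) : (Fin (d + 1) → ℝ) →ₗ[ℝ] (Fin d → ℝ) where
  toFun x i := x i.castSucc
  map_add' _ _ := rfl
  map_smul' _ _ := rfl

@[simp] theorem projLin_lift (x : Fin d → ℝ) : projLin d (lift x) = x := by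
  ext i; simp [projLin]

theorem lift_injective : Function.Injective (lift (d := d)) :=
  Function.LeftInverse.injective (g := projLin d) projLin_lift

/-- The height above `ℝ^d`. -/
noncomputable def heightLin (d : ℕ) : (Fin (d + 1) → ℝ) →ₗ[ℝ] ℝ := LinearMap.proj (Fin.last d)

@[simp] theorem heightLin_lift (x : Fin d → ℝ) : heightLin d (lift x) = 0 := by
  simp [heightLin]

/-- The apex. -/
noncomputable def apex (d : ℕ) : Fin (d + 1) → ℝ := Pi.single (Fin.last d) 1

@[simp] theorem heightLin_apex : heightLin d (apex d) = 1 := by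
  simp [heightLin, apex]

@[simp] theorem projLin_apex : projLin d (apex d) = 0 := by
  ext i; simp [projLin, apex]

theorem lift_ne_apex (x : Fin d → ℝ) : lift x ≠ apex d := by
  intro h
  have := congrArg (heightLin d) h
  simp at this

theorem image_lift_segment (x y : Fin d → ℝ) :
    lift '' segment ℝ x y = segment ℝ (lift x) (lift y) :=
  image_segment ℝ (liftLin d).toAffineMap x y

/-- The pyramid over `P`. -/
noncomputable def pyr (P : Set (Fin d → ℝ)) : Set (Fin (d + 1) → ℝ) :=
  convexHull ℝ (insert (apex d) (lift '' P))

variable {P : Set (Fin d → ℝ)}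

theorem mem_pyr (hP : Convex ℝ P) (hne : P.Nonempty) {x : Fin (d + 1) → ℝ} :
    x ∈ pyr P ↔ ∃ y ∈ P, ∃ s : ℝ, 0 ≤ s ∧ s ≤ 1 ∧ x = (1 - s) • lift y + s • apex d := by
  have hc : convexHull ℝ (lift '' P) = lift '' P := (hP.linear_image (liftLin d)).convexHull_eq
  rw [pyr, convexHull_insert (hne.image _), hc]
  simp only [mem_convexJoin, mem_singleton_iff, exists_eq_left, exists_mem_image]
  constructor
  · rintro ⟨y, hy, a, b, ha, hb, hab, rfl⟩
    exact ⟨y, hy, a, ha, by linarith, by rw [← hab, add_sub_cancel_left]; exact add_comm _ _⟩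
  · rintro ⟨y, hy, s, hs0, hs1, rfl⟩
    exact ⟨y, hy, s, 1 - s, hs0, by linarith, by ring, add_comm _ _⟩

theorem lift_mem_pyr {x : Fin d → ℝ} (hx : x ∈ P) : lift x ∈ pyr P :=
  subset_convexHull ℝ _ (mem_insert_of_mem _ (mem_image_of_mem _ hx))

theorem apex_mem_pyr : apex d ∈ pyr P := subset_convexHull ℝ _ (mem_insert _ _)

/-- The functional of `F` is extended to take the value `m - 1` at the apex, which is below its
maximum `m`. -/
theorem isExposed_lift (hP : Convex ℝ P) {F : Set (Fin d → ℝ)} (hF : IsExposed ℝ P F) :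
    IsExposed ℝ (pyr P) (lift '' F) := by
  rcases F.eq_empty_or_nonempty with rfl | hne
  · rw [image_empty]; exact isExposed_empty
  have hPne := hne.mono hF.subset
  obtain ⟨l, m, hl, rfl⟩ := exists_functional hF hne
  have hval : ∀ (y : Fin d → ℝ) (s : ℝ), (l ∘ₗ projLin d + (m - 1) • heightLin d)
      ((1 - s) • lift y + s • apex d) = (1 - s) * l y + s * (m - 1) := by
    intro y s
    simp only [LinearMap.add_apply, LinearMap.comp_apply, LinearMap.smul_apply, map_add, map_smul,
      projLin_lift, projLin_apex, heightLin_lift, heightLin_apex, smul_eq_mul, map_zero]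
    ring
  convert isExposed_of_le (l ∘ₗ projLin d + (m - 1) • heightLin d) m (fun x hx => ?_) using 1
  · ext x
    constructor
    · rintro ⟨y, ⟨hy, hym⟩, rfl⟩
      refine ⟨lift_mem_pyr hy, ?_⟩
      simp [hym]
    · rintro ⟨hx, hxm⟩
      obtain ⟨y, hy, s, hs0, hs1, rfl⟩ := (mem_pyr hP hPne).1 hx
      rw [hval] at hxm
      have := hl y hy
      have hs : s = 0 := by nlinarith
      subst hs
      exact ⟨y, ⟨hy, by linarith⟩, by simp⟩
  · obtain ⟨y, hy, s, hs0, hs1, rfl⟩ := (mem_pyr hP hPne).1 hx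
    rw [hval]
    have := hl y hy
    nlinarith

theorem isExposed_apex (hP : Convex ℝ P) (hne : P.Nonempty) : IsExposed ℝ (pyr P) {apex d} := by
  convert isExposed_of_le (heightLin d) 1 (fun x hx => ?_) using 1
  · ext x
    constructor
    · rintro rfl
      exact ⟨apex_mem_pyr, heightLin_apex⟩
    · rintro ⟨hx, hxm⟩
      obtain ⟨y, hy, s, hs0, hs1, rfl⟩ := (mem_pyr hP hne).1 hx
      simp at hxm
      simp [hxm]
  · obtain ⟨y, hy, s, hs0, hs1, rfl⟩ := (mem_pyr hP hne).1 hx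
    simpa using hs1

/-- Here the extended functional takes its maximum at the apex as well. -/
theorem isExposed_lift_apex (hP : Convex ℝ P) {v : Fin d → ℝ} (hv : IsExposed ℝ P {v}) :
    IsExposed ℝ (pyr P) (segment ℝ (lift v) (apex d)) := by
  have hvP : v ∈ P := hv.subset (mem_singleton v)
  obtain ⟨l, m, hl, hveq⟩ := exists_functional hv (singleton_nonempty v)
  have hvm : l v = m := (hveq ▸ mem_singleton v : v ∈ {x | x ∈ P ∧ l x = m}).2
  have hval : ∀ (y : Fin d → ℝ) (s : ℝ), (l ∘ₗ projLin d + m • heightLin d)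
      ((1 - s) • lift y + s • apex d) = (1 - s) * l y + s * m := by
    intro y s
    simp only [LinearMap.add_apply, LinearMap.comp_apply, LinearMap.smul_apply, map_add, map_smul,
      projLin_lift, projLin_apex, heightLin_lift, heightLin_apex, smul_eq_mul, map_zero]
    ring
  convert isExposed_of_le (l ∘ₗ projLin d + m • heightLin d) m (fun x hx => ?_) using 1
  · ext x
    constructor
    · rintro ⟨a, b, ha, hb, hab, rfl⟩
      have ha' : a = 1 - b := by linarith
      subst ha'
      refine ⟨(mem_pyr hP ⟨v, hvP⟩).2 ⟨v, hvP, b, hb, by linarith, rfl⟩, ?_⟩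
      rw [hval, hvm]; ring
    · rintro ⟨hx, hxm⟩
      obtain ⟨y, hy, s, hs0, hs1, rfl⟩ := (mem_pyr hP ⟨v, hvP⟩).1 hx
      rw [hval] at hxm
      rcases hs1.lt_or_eq with hlt | rfl
      · have hym : l y = m := by
          have : (1 - s) * (l y - m) = 0 := by linarith
          rcases mul_eq_zero.1 this with h | h <;> linarith
        have : y ∈ ({v} : Set (Fin d → ℝ)) := by rw [hveq]; exact ⟨hy, hym⟩
        rw [mem_singleton_iff.1 this]
        exact ⟨1 - s, s, by linarith, hs0, by ring, rfl⟩
      · simpa using right_mem_segment ℝ (lift v) (apex d)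
  · obtain ⟨y, hy, s, hs0, hs1, rfl⟩ := (mem_pyr hP ⟨v, hvP⟩).1 hx
    rw [hval]
    have := hl y hy
    nlinarith

theorem isExposed_preimage_lift {X : Set (Fin (d + 1) → ℝ)} (hX : IsExposed ℝ (pyr P) X)
    (hsub : lift ⁻¹' X ⊆ P) : IsExposed ℝ P (lift ⁻¹' X) := by
  rcases (lift ⁻¹' X).eq_empty_or_nonempty with hemp | ⟨y, hy⟩
  · rw [hemp]; exact isExposed_empty
  obtain ⟨l, m, hl, rfl⟩ := exists_functional hX ⟨_, hy⟩
  convert isExposed_of_le (l ∘ₗ liftLin d) m (fun x hx => hl _ (lift_mem_pyr hx)) using 1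
  ext x
  exact ⟨fun hx => ⟨hsub hx, hx.2⟩, fun hx => ⟨lift_mem_pyr hx.1, hx.2⟩⟩

theorem mem_of_lift_mem_pyr (hP : Convex ℝ P) (hne : P.Nonempty) {x : Fin d → ℝ}
    (hx : lift x ∈ pyr P) : x ∈ P := by
  obtain ⟨y, hy, s, hs0, hs1, heq⟩ := (mem_pyr hP hne).1 hx
  have h1 := congrArg (heightLin d) heq
  simp at h1
  have h2 := congrArg (projLin d) heq
  simp [← h1] at h2
  rwa [h2]

theorem isHull_pyr (hP : IsHull P) : IsHull (pyr P) := by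
  have : pyr P = convexHull ℝ (insert (apex d) (lift '' P.extremePoints ℝ)) := by
    apply Subset.antisymm
    · refine convexHull_min ?_ (convex_convexHull ℝ _)
      rintro x (rfl | ⟨y, hy, rfl⟩)
      · exact subset_convexHull ℝ _ (mem_insert _ _)
      · rw [← hP.convexHull_extremePoints] at hy
        have h1 : lift y ∈ convexHull ℝ (lift '' P.extremePoints ℝ) := by
          have := (liftLin d).image_convexHull (P.extremePoints ℝ)
          have h2 : lift y ∈ liftLin d '' convexHull ℝ (P.extremePoints ℝ) := ⟨y, hy, rfl⟩
          rw [this] at h2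
          exact h2
        exact convexHull_mono (subset_insert _ _) h1
    · exact convexHull_mono (insert_subset_insert (image_mono extremePoints_subset))
  rw [this]
  exact isHull_of_finite ((hP.finite_extremePoints.image _).insert _)

theorem extremePoints_pyr (hP : IsHull P) (hne : P.Nonempty) :
    (pyr P).extremePoints ℝ = insert (apex d) (lift '' P.extremePoints ℝ) := by
  have hh := isHull_pyr hP
  apply Subset.antisymm
  · intro x hx
    have h1 : x ∈ insert (apex d) (lift '' P) := extremePoints_convexHull_subset hx
    rcases h1 with rfl | ⟨y, hy, rfl⟩
    · exact mem_insert _ _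
    · refine mem_insert_of_mem _ ⟨y, ?_, rfl⟩
      rw [← hP.isExposed_singleton]
      rw [← hh.isExposed_singleton] at hx
      have heq : lift ⁻¹' {lift y} = ({y} : Set (Fin d → ℝ)) := by
        ext z; simp [lift_injective.eq_iff]
      rw [← heq]
      exact isExposed_preimage_lift hx (by rw [heq]; simpa using hy)
  · rintro x (rfl | ⟨y, hy, rfl⟩)
    · rw [← hh.isExposed_singleton]
      exact isExposed_apex hP.convex hne
    · rw [← hh.isExposed_singleton, ← image_singleton]
      exact isExposed_lift hP.convex (hP.isExposed_singleton.2 hy)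

theorem isPolytope_pyr (hP : IsPolytope P) (hne : P.Nonempty) : IsPolytope (pyr P) := by
  refine ⟨isHull_pyr hP.isHull, ?_⟩
  obtain ⟨p, hp⟩ := hne
  have hnonempty : (affineSpan ℝ (pyr P) : Set (Fin (d + 1) → ℝ)).Nonempty :=
    ⟨_, subset_affineSpan ℝ _ apex_mem_pyr⟩
  rw [← AffineSubspace.direction_eq_top_iff_of_nonempty hnonempty, direction_affineSpan]
  set D := vectorSpan ℝ (pyr P) with hD
  have hlift : ∀ u, lift u ∈ D := by
    intro u
    have h1 : vectorSpan ℝ P ≤ D.comap (liftLin d) := by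
      rw [vectorSpan_def, Submodule.span_le]
      rintro _ ⟨x, hx, y, hy, rfl⟩
      simp only [vsub_eq_sub, SetLike.mem_coe, Submodule.mem_comap, map_sub, liftLin_apply]
      exact vsub_mem_vectorSpan ℝ (lift_mem_pyr hx) (lift_mem_pyr hy)
    have h2 : vectorSpan ℝ P = ⊤ := by
      rw [← direction_affineSpan, hP.2, AffineSubspace.direction_top]
    rw [h2] at h1
    exact h1 (Submodule.mem_top (x := u))
  have hapex : apex d ∈ D := by
    have h1 : apex d - lift p ∈ D := vsub_mem_vectorSpan ℝ apex_mem_pyr (lift_mem_pyr hp)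
    have := D.add_mem h1 (hlift p)
    simpa using this
  rw [eq_top_iff]
  intro x _
  have hx : x = lift (projLin d x) + (heightLin d x) • apex d := by
    ext i
    refine Fin.lastCases ?_ (fun i => ?_) i
    · simp [heightLin, apex]
    · simp [projLin, apex]
  rw [hx]
  exact D.add_mem (hlift _) (D.smul_mem _ hapex)

end Lift

/-! ### The pyramid over a polytopal digraph -/

variable {d : ℕ} (G : PolytopalDigraph d)

theorem carrier_nonempty (hd : 0 < d) : G.carrier.Nonempty := by
  by_contra hcon
  rw [not_nonempty_iff_eq_empty] at hcon
  have := G.faceDim_carrier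
  rw [hcon, faceDim, vectorSpan_empty, finrank_bot] at this
  omega

/-- The arcs of the pyramid. -/
def pyrArc (a b : Fin (d + 1) → ℝ) : Prop :=
  (∃ x y, G.arc x y ∧ a = lift x ∧ b = lift y) ∨ (∃ x ∈ G.vertexSet, a = lift x ∧ b = apex d)

variable {G}

@[simp] theorem pyrArc_lift {x y : Fin d → ℝ} : G.pyrArc (lift x) (lift y) ↔ G.arc x y := by
  constructor
  · rintro (⟨x', y', h, hx, hy⟩ | ⟨x', -, -, hy⟩)
    · rwa [lift_injective hx, lift_injective hy]
    · exact absurd hy (lift_ne_apex y)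
  · exact fun h => Or.inl ⟨x, y, h, rfl, rfl⟩

@[simp] theorem pyrArc_apex {x : Fin d → ℝ} : G.pyrArc (lift x) (apex d) ↔ x ∈ G.vertexSet := by
  constructor
  · rintro (⟨x', y', h, hx, hy⟩ | ⟨x', h, hx, -⟩)
    · exact absurd hy.symm (lift_ne_apex y')
    · rwa [lift_injective hx]
  · exact fun h => Or.inr ⟨x, h, rfl, rfl⟩

@[simp] theorem not_pyrArc_apex {b : Fin (d + 1) → ℝ} : ¬ G.pyrArc (apex d) b := by
  rintro (⟨x, y, -, hx, -⟩ | ⟨x, -, hx, -⟩) <;> exact lift_ne_apex x hx.symm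

variable (G) in
/-- The pyramid over a polytopal digraph, all new edges directed to the apex. -/
noncomputable def pyramid (hne : G.carrier.Nonempty) : PolytopalDigraph (d + 1) where
  carrier := pyr G.carrier
  isPolytope := isPolytope_pyr G.isPolytope hne
  arc := G.pyrArc
  isEdge_of_arc := by
    rintro _ _ (⟨x, y, h, rfl, rfl⟩ | ⟨x, h, rfl, rfl⟩)
    · have := G.isEdge_of_arc x y h
      refine ⟨lift_injective.ne this.1, ?_⟩
      rw [← image_lift_segment]
      exact isExposed_lift G.isHull.convex this.2
    · exact ⟨lift_ne_apex x, isExposed_lift_apex G.isHull.convex (G.isHull.isExposed_singleton.2 h)⟩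
  arc_iff_not_arc := by
    intro u v huv
    have hu := huv.left_mem
    have hv := huv.right_mem
    rw [extremePoints_pyr G.isHull hne] at hu hv
    rcases hu with rfl | ⟨x, hx, rfl⟩ <;> rcases hv with rfl | ⟨y, hy, rfl⟩
    · exact absurd rfl huv.1
    · simp [show y ∈ G.vertexSet from hy]
    · simp [show x ∈ G.vertexSet from hx]
    · rw [pyrArc_lift, pyrArc_lift]
      apply G.arc_iff_not_arc
      refine ⟨fun h => huv.1 (h ▸ rfl), ?_⟩
      have h2 := huv.2
      rw [← image_lift_segment] at h2
      have heq := preimage_image_eq (segment ℝ x y) lift_injective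
      rw [← heq]
      refine isExposed_preimage_lift h2 ?_
      rw [heq]
      exact G.isHull.convex.segment_subset hx.1 hy.1

section Pyramid

variable {hne : G.carrier.Nonempty}

theorem isPyramid_pyramid : G.IsPyramid (G.pyramid hne) := by
  refine ⟨apex d, ?_, rfl, fun a b => Iff.rfl⟩
  have : heightLin d (apex d) ≠ 0 := by simp
  exact this

theorem vertexSet_pyramid :
    (G.pyramid hne).vertexSet = insert (apex d) (lift '' G.vertexSet) :=
  extremePoints_pyr G.isHull hne

theorem lift_mem_vertexSet_pyramid {x : Fin d → ℝ} :
    lift x ∈ (G.pyramid hne).vertexSet ↔ x ∈ G.vertexSet := by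
  rw [vertexSet_pyramid, mem_insert_iff, or_iff_right (lift_ne_apex x),
    lift_injective.mem_set_image]

theorem apex_mem_vertexSet_pyramid : apex d ∈ (G.pyramid hne).vertexSet := by
  rw [vertexSet_pyramid]; exact mem_insert _ _

theorem ncard_vertexSet_pyramid :
    (G.pyramid hne).vertexSet.ncard = G.vertexSet.ncard + 1 := by
  rw [vertexSet_pyramid, ncard_insert_of_notMem _ (G.finite_vertexSet.image _),
    ncard_image_of_injective _ lift_injective]
  rintro ⟨x, -, hx⟩
  exact lift_ne_apex x hx

theorem isAcyclic_pyramid (h : G.IsAcyclic) : (G.pyramid hne).IsAcyclic := by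
  intro v hv
  have key : ∀ y z, Relation.TransGen G.pyrArc (lift y) z →
      z = apex d ∨ ∃ w, z = lift w ∧ Relation.TransGen G.arc y w := by
    intro y z hz
    induction hz with
    | single h =>
      rcases h with ⟨x, w, h, hx, rfl⟩ | ⟨x, h, hx, rfl⟩
      · exact Or.inr ⟨w, rfl, .single (lift_injective hx ▸ h)⟩
      · exact Or.inl rfl
    | tail _ h ih =>
      rcases ih with rfl | ⟨w, rfl, hw⟩
      · exact absurd h not_pyrArc_apex
      · rcases h with ⟨x, w', h, hx, rfl⟩ | ⟨x, h, hx, rfl⟩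
        · exact Or.inr ⟨w', rfl, hw.tail (lift_injective hx ▸ h)⟩
        · exact Or.inl rfl
  have hv' : Relation.TransGen G.pyrArc v v := hv
  obtain ⟨w, hw, -⟩ := Relation.TransGen.head'_iff.1 hv'
  rcases hw with ⟨x, y, -, rfl, -⟩ | ⟨x, -, rfl, -⟩
  all_goals
    rcases key _ _ hv' with h1 | ⟨w', h1, h2⟩
    · exact lift_ne_apex _ h1
    · rw [← lift_injective h1] at h2
      exact h x h2

theorem isExposed_preimage {X : Set (Fin (d + 1) → ℝ)}
    (hX : IsExposed ℝ (G.pyramid hne).carrier X) : IsExposed ℝ G.carrier (lift ⁻¹' X) :=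
  isExposed_preimage_lift hX fun _ hx => mem_of_lift_mem_pyr G.isHull.convex hne (hX.subset hx)

end Pyramid

end PolytopalDigraph

end Polytopal

namespace Polytopal
open Set

namespace PolytopalDigraph

variable {d : ℕ} {G : PolytopalDigraph d}

/-! ### Directed paths -/

/-- Reduces the count of paths to an upper bound for the dimension of the face; surplus paths are
dropped. -/
theorem exists_paths {ι : Type*} [Fintype ι] {F : Set (Fin d → ℝ)} {s t : Fin d → ℝ}
    (q : ι → List (Fin d → ℝ)) (hinj : Function.Injective q)
    (hpath : ∀ i, G.IsDirectedPath F s t (q i))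
    (hdisj : ∀ i j, i ≠ j → ∀ x, x ∈ q i → x ∈ q j → x = s ∨ x = t)
    (hcard : faceDim F ≤ Fintype.card ι) :
    ∃ p : Fin (faceDim F) → List (Fin d → ℝ), Function.Injective p ∧
      (∀ i, G.IsDirectedPath F s t (p i)) ∧
      ∀ i j, i ≠ j → ∀ x, x ∈ p i → x ∈ p j → x = s ∨ x = t := by
  let e : Fin (faceDim F) → ι := fun i => (Fintype.equivFin ι).symm (Fin.castLE hcard i)
  have he : Function.Injective e := (Fintype.equivFin ι).symm.injective.comp
    (Fin.castLE_injective hcard)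
  exact ⟨q ∘ e, hinj.comp he, fun i => hpath _, fun i j hij => hdisj _ _ (he.ne hij)⟩

theorem IsDirectedPath.exists_append {F : Set (Fin d → ℝ)} {s t : Fin d → ℝ}
    {p : List (Fin d → ℝ)} (h : G.IsDirectedPath F s t p) (hst : s ≠ t) :
    ∃ q, p = q ++ [t] ∧ q.IsChain G.arc ∧ q.Nodup ∧ t ∉ q ∧ q.head? = some s ∧
      (∀ x ∈ q.getLast?, G.arc x t) ∧ ∀ x ∈ q, x ∈ G.vertexSet ∧ x ∈ F := by
  obtain ⟨h1, h2, h3, h4, h5⟩ := h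
  obtain ⟨q, rfl⟩ := List.getLast?_eq_some_iff.1 h5
  rw [List.isChain_append] at h1
  rw [List.nodup_append] at h2
  refine ⟨q, rfl, h1.1, h2.1, fun ht => h2.2.2 t ht t (by simp) rfl, ?_,
    fun x hx => h1.2.2 x hx t (by simp), fun x hx => h3 x (by simp [hx])⟩
  cases q with
  | nil => simp at h4; exact absurd h4.symm hst
  | cons a q => simpa using h4

/-- Every vertex of `F` reaches the only sink, but a source has no in-arcs. -/
theorem eq_of_source_eq_sink (hac : G.IsAcyclic) {F : Set (Fin d → ℝ)} {s : Fin d → ℝ}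
    (hs : G.IsSource F s) (hs' : ∀ t, G.IsSink F t → t = s) :
    ∀ w ∈ G.vertexSet, w ∈ F → w = s := by
  intro w hw hwF
  have h := reach_sink hac hs' w hw hwF
  rcases Relation.ReflTransGen.cases_tail h with h | ⟨b, -, hb⟩
  · exact h.symm
  · exact absurd hb.1 (hs.2.2 b hb.2.1)

theorem faceDim_eq_zero_of_source_eq_sink (hac : G.IsAcyclic) {F : Set (Fin d → ℝ)}
    (hF : IsExposed ℝ G.carrier F) {s : Fin d → ℝ}
    (hs : G.IsSource F s) (hs' : ∀ t, G.IsSink F t → t = s) : faceDim F = 0 := by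
  have hsub : F ⊆ {s} := by
    rw [← G.isHull.face_eq hF]
    refine convexHull_min ?_ (convex_singleton s)
    rintro w ⟨hwF, hw⟩
    exact eq_of_source_eq_sink hac hs hs' w hw hwF
  have h := faceDim_mono hsub
  rw [faceDim_singleton] at h
  omega

theorem IsUSO.sink_eq (h : G.IsUSO) {F : Set (Fin d → ℝ)} (hF : IsExposed ℝ G.carrier F)
    {t t' : Fin d → ℝ} (ht : G.IsSink F t) (ht' : G.IsSink F t') : t = t' :=
  (h F hF ⟨t, ht.2.1⟩).2.unique ht ht'

theorem IsUSO.source_eq (h : G.IsUSO) {F : Set (Fin d → ℝ)} (hF : IsExposed ℝ G.carrier F)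
    {t t' : Fin d → ℝ} (ht : G.IsSource F t) (ht' : G.IsSource F t') : t = t' :=
  (h F hF ⟨t, ht.2.1⟩).1.unique ht ht'

/-! ### Unique sinks and disjoint paths in the pyramid -/

section Pyramid

variable {hne : G.carrier.Nonempty} {X : Set (Fin (d + 1) → ℝ)}

theorem isSource_pyramid_lift {x : Fin d → ℝ} :
    (G.pyramid hne).IsSource X (lift x) ↔ G.IsSource (lift ⁻¹' X) x := by
  constructor
  · rintro ⟨h1, h2, h3⟩
    exact ⟨lift_mem_vertexSet_pyramid.1 h1, h2, fun w hw hwx => h3 _ hw (pyrArc_lift.2 hwx)⟩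
  · rintro ⟨h1, h2, h3⟩
    refine ⟨lift_mem_vertexSet_pyramid.2 h1, h2, ?_⟩
    rintro w hw (⟨y, z, h, rfl, hz⟩ | ⟨y, -, -, hy⟩)
    · exact h3 y hw (lift_injective hz ▸ h)
    · exact lift_ne_apex x hy

theorem isSink_pyramid_lift {x : Fin d → ℝ} :
    (G.pyramid hne).IsSink X (lift x) ↔ apex d ∉ X ∧ G.IsSink (lift ⁻¹' X) x := by
  constructor
  · rintro ⟨h1, h2, h3⟩
    have hx := lift_mem_vertexSet_pyramid.1 h1
    exact ⟨fun ha => h3 _ ha (pyrArc_apex.2 hx), hx, h2, fun w hw hwx => h3 _ hw (pyrArc_lift.2 hwx)⟩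
  · rintro ⟨ha, h1, h2, h3⟩
    refine ⟨lift_mem_vertexSet_pyramid.2 h1, h2, ?_⟩
    rintro w hw (⟨y, z, h, hy, rfl⟩ | ⟨y, -, -, rfl⟩)
    · exact h3 z hw (lift_injective hy ▸ h)
    · exact ha hw

theorem isSink_pyramid_apex : (G.pyramid hne).IsSink X (apex d) ↔ apex d ∈ X :=
  ⟨fun h => h.2.1, fun h => ⟨apex_mem_vertexSet_pyramid, h, fun _ _ => not_pyrArc_apex⟩⟩

theorem isSource_pyramid_apex (hX : IsExposed ℝ (G.pyramid hne).carrier X) :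
    (G.pyramid hne).IsSource X (apex d) ↔ apex d ∈ X ∧ lift ⁻¹' X = ∅ := by
  constructor
  · rintro ⟨-, h2, h3⟩
    refine ⟨h2, ?_⟩
    by_contra hcon
    rw [← ne_eq, ← nonempty_iff_ne_empty] at hcon
    obtain ⟨x, hxX, hx⟩ := G.isHull.exists_vertex_mem (isExposed_preimage hX) hcon
    exact h3 _ hxX (pyrArc_apex.2 hx)
  · rintro ⟨h2, h3⟩
    refine ⟨apex_mem_vertexSet_pyramid, h2, ?_⟩
    rintro w hw (⟨y, z, -, -, hz⟩ | ⟨y, -, rfl, -⟩)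
    · exact lift_ne_apex z hz.symm
    · have : y ∈ lift ⁻¹' X := hw
      rw [h3] at this
      exact this

theorem isUSO_pyramid (h : G.IsUSO) : (G.pyramid hne).IsUSO := by
  intro X hX hXne
  have hF := isExposed_preimage hX
  obtain ⟨v, hvX, hv⟩ := (G.pyramid hne).isHull.exists_vertex_mem hX hXne
  have hsrcV : ∀ s, (G.pyramid hne).IsSource X s → s = apex d ∨ ∃ x, s = lift x := fun s hs => by
    have := hs.1
    rw [vertexSet_pyramid] at this
    rcases this with h | ⟨x, -, rfl⟩
    · exact Or.inl h
    · exact Or.inr ⟨x, rfl⟩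
  have hsnkV : ∀ s, (G.pyramid hne).IsSink X s → s = apex d ∨ ∃ x, s = lift x := fun s hs => by
    have := hs.1
    rw [vertexSet_pyramid] at this
    rcases this with h | ⟨x, -, rfl⟩
    · exact Or.inl h
    · exact Or.inr ⟨x, rfl⟩
  have hv' : v = apex d ∨ ∃ x, v = lift x := by
    change v ∈ (G.pyramid hne).vertexSet at hv
    rw [vertexSet_pyramid] at hv
    rcases hv with h | ⟨x, -, rfl⟩
    · exact Or.inl h
    · exact Or.inr ⟨x, rfl⟩
  constructor
  · rcases (lift ⁻¹' X).eq_empty_or_nonempty with hemp | hFne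
    · have ha : apex d ∈ X := by
        rcases hv' with rfl | ⟨x, rfl⟩
        · exact hvX
        · have : x ∈ lift ⁻¹' X := hvX
          rw [hemp] at this
          exact absurd this (notMem_empty x)
      refine ⟨apex d, (isSource_pyramid_apex hX).2 ⟨ha, hemp⟩, fun s hs => ?_⟩
      rcases hsrcV s hs with h1 | ⟨x, rfl⟩
      · exact h1
      · have : x ∈ lift ⁻¹' X := hs.2.1
        rw [hemp] at this
        exact absurd this (notMem_empty x)
    · obtain ⟨s, hs, hsu⟩ := (h _ hF hFne).1
      refine ⟨lift s, isSource_pyramid_lift.2 hs, fun s' hs' => ?_⟩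
      rcases hsrcV s' hs' with rfl | ⟨x, rfl⟩
      · rw [isSource_pyramid_apex hX] at hs'
        exact absurd hs'.2 hFne.ne_empty
      · rw [hsu x (isSource_pyramid_lift.1 hs')]
  · by_cases ha : apex d ∈ X
    · refine ⟨apex d, isSink_pyramid_apex.2 ha, fun t ht => ?_⟩
      rcases hsnkV t ht with h1 | ⟨x, rfl⟩
      · exact h1
      · exact absurd ha (isSink_pyramid_lift.1 ht).1
    · have hFne : (lift ⁻¹' X).Nonempty := by
        rcases hv' with rfl | ⟨x, rfl⟩
        · exact absurd hvX ha
        · exact ⟨x, hvX⟩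
      obtain ⟨s, hs, hsu⟩ := (h _ hF hFne).2
      refine ⟨lift s, isSink_pyramid_lift.2 ⟨ha, hs⟩, fun s' hs' => ?_⟩
      rcases hsnkV s' hs' with rfl | ⟨x, rfl⟩
      · exact absurd (isSink_pyramid_apex.1 hs') ha
      · rw [hsu x (isSink_pyramid_lift.1 hs').2]

theorem face_subset_of_pyramid (hX : IsExposed ℝ (G.pyramid hne).carrier X) :
    X ⊆ convexHull ℝ (insert (apex d) (lift '' (lift ⁻¹' X))) := by
  rw [← (G.pyramid hne).isHull.face_eq hX]
  refine convexHull_mono ?_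
  rintro x ⟨hxX, hx⟩
  change x ∈ (G.pyramid hne).vertexSet at hx
  rw [vertexSet_pyramid] at hx
  rcases hx with rfl | ⟨y, -, rfl⟩
  · exact mem_insert _ _
  · refine mem_insert_of_mem _ ⟨y, ?_, rfl⟩
    rw [(G.pyramid hne).isHull.face_eq hX]
    exact hxX

theorem faceDim_convexHull {k : ℕ} (S : Set (Fin k → ℝ)) :
    faceDim (convexHull ℝ S) = faceDim S := by
  rw [faceDim, faceDim, ← direction_affineSpan, affineSpan_convexHull, direction_affineSpan]

theorem faceDim_image_lift_le (F : Set (Fin d → ℝ)) : faceDim (lift '' F) ≤ faceDim F := by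
  have h : vectorSpan ℝ (lift '' F) = (vectorSpan ℝ F).map (liftLin d) :=
    (AffineMap.map_vectorSpan (liftLin d).toAffineMap (s := F)).symm
  rw [faceDim, h]
  exact Submodule.finrank_map_le _ _

theorem faceDim_insert_le {k : ℕ} (p : Fin k → ℝ) (S : Set (Fin k → ℝ)) :
    faceDim (insert p S) ≤ faceDim S + 1 :=
  finrank_vectorSpan_insert_le_set ℝ S p

theorem isDirectedPath_lift {s t : Fin d → ℝ} {p : List (Fin d → ℝ)}
    (h : G.IsDirectedPath (lift ⁻¹' X) s t p) :
    (G.pyramid hne).IsDirectedPath X (lift s) (lift t) (p.map lift) := by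
  obtain ⟨h1, h2, h3, h4, h5⟩ := h
  refine ⟨?_, h2.map lift_injective, ?_, by simp [h4], by simp [h5]⟩
  · rw [List.isChain_map]
    exact h1.imp fun a b hab => pyrArc_lift.2 hab
  · intro x hx
    obtain ⟨y, hy, rfl⟩ := List.mem_map.1 hx
    exact ⟨lift_mem_vertexSet_pyramid.2 (h3 y hy).1, (h3 y hy).2⟩

theorem isDirectedPath_append_apex (ha : apex d ∈ X) {s : Fin d → ℝ} {q : List (Fin d → ℝ)}
    (h1 : q.IsChain G.arc) (h2 : q.Nodup) (h3 : ∀ x ∈ q, x ∈ G.vertexSet ∧ lift x ∈ X)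
    (h4 : q.head? = some s) :
    (G.pyramid hne).IsDirectedPath X (lift s) (apex d) (q.map lift ++ [apex d]) := by
  refine ⟨?_, ?_, ?_, ?_, by simp⟩
  · rw [List.isChain_append]
    refine ⟨?_, by simp, ?_⟩
    · rw [List.isChain_map]
      exact h1.imp fun a b hab => pyrArc_lift.2 hab
    · intro x hx y hy
      simp only [List.head?_cons, Option.mem_def, Option.some.injEq] at hy
      subst hy
      obtain ⟨z, hz, rfl⟩ := List.mem_map.1 (List.mem_of_getLast? hx)
      exact pyrArc_apex.2 (h3 z hz).1
  · rw [List.nodup_append]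
    refine ⟨h2.map lift_injective, by simp, ?_⟩
    intro a ha' b hb
    obtain ⟨z, hz, rfl⟩ := List.mem_map.1 ha'
    simp only [List.mem_singleton] at hb
    subst hb
    exact lift_ne_apex z
  · intro x hx
    rw [List.mem_append, List.mem_map, List.mem_singleton] at hx
    rcases hx with ⟨y, hy, rfl⟩ | rfl
    · exact ⟨lift_mem_vertexSet_pyramid.2 (h3 y hy).1, (h3 y hy).2⟩
    · exact ⟨apex_mem_vertexSet_pyramid, ha⟩
  · cases q with
    | nil => simp at h4
    | cons a q => simp at h4; simp [h4]

theorem lift_mem_append_apex {q : List (Fin d → ℝ)} {x : Fin d → ℝ} :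
    lift x ∈ q.map lift ++ [apex d] ↔ x ∈ q := by
  simp [lift_injective.eq_iff, lift_ne_apex]

theorem append_apex_injective {q q' : List (Fin d → ℝ)}
    (h : q.map lift ++ [apex d] = q'.map lift ++ [apex d]) : q = q' :=
  lift_injective.list_map (List.append_cancel_right h)

/-- A face through the apex whose base has dimension `k` needs up to `k + 1` paths. The `k` paths of
the base are led to the apex right before they enter the old sink `t`, and the arc from the source
to the apex is the additional path. It coincides with a shortened path that consists of the source
only; such a path keeps `t`, which is harmless because at most one path does. -/
theorem holtKlee_pyramid (hac : G.IsAcyclic) (h : G.HoltKlee) : (G.pyramid hne).HoltKlee := by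
  classical
  refine ⟨isUSO_pyramid h.1, fun X hX hXne s' t' hs' ht' => ?_⟩
  have hF := isExposed_preimage hX
  have huso := isUSO_pyramid (hne := hne) h.1
  by_cases ha : apex d ∈ X
  · obtain rfl : t' = apex d := huso.sink_eq hX ht' (isSink_pyramid_apex.2 ha)
    rcases (lift ⁻¹' X).eq_empty_or_nonempty with hemp | hFne
    · refine exists_paths (ι := Fin 0) (fun i => i.elim0) (fun i => i.elim0) (fun i => i.elim0)
        (fun i => i.elim0) ?_
      have h1 := faceDim_mono (face_subset_of_pyramid hX)
      rw [hemp, faceDim_convexHull, image_empty, insert_empty_eq, faceDim_singleton] at h1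
      exact h1
    · obtain ⟨s, hs, hsu⟩ := (h.1 _ hF hFne).1
      obtain ⟨t, ht, htu⟩ := (h.1 _ hF hFne).2
      obtain rfl : s' = lift s := huso.source_eq hX hs' (isSource_pyramid_lift.2 hs)
      have hpaths := h.2 _ hF hFne s t hs ht
      obtain ⟨k, hk⟩ : ∃ k, k = faceDim (lift ⁻¹' X) := ⟨_, rfl⟩
      rw [← hk] at hpaths
      obtain ⟨p, hpinj, hp, hpd⟩ := hpaths
      have hdim : faceDim X ≤ k + 1 := by
        have h1 := faceDim_mono (face_subset_of_pyramid hX)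
        rw [faceDim_convexHull] at h1
        have h2 := faceDim_insert_le (apex d) (lift '' (lift ⁻¹' X))
        have h3 := faceDim_image_lift_le (lift ⁻¹' X)
        omega
      have hst : ∀ _ : Fin k, s ≠ t := by
        rintro i rfl
        have := faceDim_eq_zero_of_source_eq_sink hac hF hs htu
        exact (Fin.pos i).ne' (hk.trans this)
      choose q hq using fun i : Fin k => (hp i).exists_append (hst i)
      -- the path that keeps the old sink
      let sp : Fin k → Prop := fun i => q i = [s] ∨ ((∀ j, q j ≠ [s]) ∧ i.val = 0)
      have hqinj : ∀ i j, q i = q j → i = j := fun i j hij => hpinj (by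
        rw [(hq i).1, (hq j).1, hij])
      have hspu : ∀ i j, sp i → sp j → i = j := by
        rintro i j (hi | ⟨hi, hi0⟩) (hj | ⟨hj, hj0⟩)
        · exact hqinj i j (hi.trans hj.symm)
        · exact absurd hi (hj i)
        · exact absurd hj (hi j)
        · exact Fin.ext (hi0.trans hj0.symm)
      have htq : ∀ i, t ∉ q i := fun i => (hq i).2.2.2.1
      have hqp : ∀ i x, x ∈ q i → x ∈ p i := fun i x hx => by rw [(hq i).1]; simp [hx]
      let Q : Option (Fin k) → List (Fin d → ℝ) := fun o =>
        match o with
        | none => [s]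
        | some i => if sp i then p i else q i
      have hQsome : ∀ i x, x ∈ Q (some i) → x ∈ p i ∧ (x = t → sp i) := by
        intro i x hx
        by_cases hsi : sp i
        · simp only [Q, if_pos hsi] at hx
          exact ⟨hx, fun _ => hsi⟩
        · simp only [Q, if_neg hsi] at hx
          exact ⟨hqp i x hx, fun hxt => absurd (hxt ▸ hx) (htq i)⟩
      have hQdisj : ∀ o o', o ≠ o' → ∀ x, x ∈ Q o → x ∈ Q o' → x = s := by
        rintro (_ | i) (_ | j) hij x hxi hxj
        · exact absurd rfl hij
        · simpa [Q] using hxi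
        · simpa [Q] using hxj
        · have hij' : i ≠ j := fun h => hij (h ▸ rfl)
          have h1 := hQsome i x hxi
          have h2 := hQsome j x hxj
          rcases hpd i j hij' x h1.1 h2.1 with h3 | h3
          · exact h3
          · exact absurd (hspu i j (h1.2 h3) (h2.2 h3)) hij'
      have hQinj : Function.Injective Q := by
        rintro (_ | i) (_ | j) hij
        · rfl
        · exfalso
          by_cases hsj : sp j
          · simp only [Q, if_pos hsj] at hij
            have : t ∈ p j := by rw [(hq j).1]; simp
            rw [← hij] at this
            exact hst j (by simpa using this : t = s).symm
          · simp only [Q, if_neg hsj] at hij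
            exact hsj (Or.inl hij.symm)
        · exfalso
          by_cases hsj : sp i
          · simp only [Q, if_pos hsj] at hij
            have : t ∈ p i := by rw [(hq i).1]; simp
            rw [hij] at this
            exact hst i (by simpa using this : t = s).symm
          · simp only [Q, if_neg hsj] at hij
            exact hsj (Or.inl hij)
        · by_cases hsi : sp i <;> by_cases hsj : sp j
          · rw [hspu i j hsi hsj]
          · simp only [Q, if_pos hsi, if_neg hsj] at hij
            have : t ∈ p i := by rw [(hq i).1]; simp
            rw [hij] at this
            exact absurd this (htq j)
          · simp only [Q, if_neg hsi, if_pos hsj] at hij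
            have : t ∈ p j := by rw [(hq j).1]; simp
            rw [← hij] at this
            exact absurd this (htq i)
          · simp only [Q, if_neg hsi, if_neg hsj] at hij
            rw [hqinj i j hij]
      have hQpath : ∀ o, (G.pyramid hne).IsDirectedPath X (lift s) (apex d)
          ((Q o).map lift ++ [apex d]) := by
        rintro (_ | i)
        · refine isDirectedPath_append_apex ha ?_ ?_ ?_ ?_
          · simp [Q]
          · simp [Q]
          · intro x hx
            have : x = s := by simpa [Q] using hx
            subst this
            exact ⟨hs.1, hs.2.1⟩
          · simp [Q]
        · by_cases hsi : sp i
          · obtain ⟨a1, a2, a3, a4, a5⟩ := hp i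
            simp only [Q, if_pos hsi]
            exact isDirectedPath_append_apex ha a1 a2 a3 a4
          · obtain ⟨-, a1, a2, -, a4, -, a3⟩ := hq i
            simp only [Q, if_neg hsi]
            exact isDirectedPath_append_apex ha a1 a2 a3 a4
      refine exists_paths (ι := Option (Fin k)) (fun o => (Q o).map lift ++ [apex d])
        (fun o o' hoo => hQinj (append_apex_injective hoo)) hQpath ?_ ?_
      · intro o o' hoo x hx hx'
        rw [List.mem_append, List.mem_map, List.mem_singleton] at hx
        rcases hx with ⟨y, hy, rfl⟩ | rfl
        · rw [lift_mem_append_apex] at hx'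
          exact Or.inl (by rw [hQdisj o o' hoo y hy hx'])
        · exact Or.inr rfl
      · rw [Fintype.card_option, Fintype.card_fin]
        exact hdim
  · obtain ⟨v, hvX, hv⟩ := (G.pyramid hne).isHull.exists_vertex_mem hX hXne
    have hFne : (lift ⁻¹' X).Nonempty := by
      change v ∈ (G.pyramid hne).vertexSet at hv
      rw [vertexSet_pyramid] at hv
      rcases hv with rfl | ⟨x, -, rfl⟩
      · exact absurd hvX ha
      · exact ⟨x, hvX⟩
    obtain ⟨s, hs, hsu⟩ := (h.1 _ hF hFne).1
    obtain ⟨t, ht, htu⟩ := (h.1 _ hF hFne).2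
    obtain rfl : s' = lift s := huso.source_eq hX hs' (isSource_pyramid_lift.2 hs)
    obtain rfl : t' = lift t := huso.sink_eq hX ht' (isSink_pyramid_lift.2 ⟨ha, ht⟩)
    obtain ⟨p, hpinj, hp, hpd⟩ := h.2 _ hF hFne s t hs ht
    refine exists_paths (fun i => (p i).map lift) (fun i j hij =>
      hpinj (lift_injective.list_map hij)) (fun i => isDirectedPath_lift (hp i)) ?_ ?_
    · intro i j hij x hx hx'
      obtain ⟨y, hy, rfl⟩ := List.mem_map.1 hx
      have hy' := (List.mem_map_of_injective lift_injective).1 hx'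
      rcases hpd i j hij y hy hy' with rfl | rfl
      · exact Or.inl rfl
      · exact Or.inr rfl
    · rw [Fintype.card_fin]
      have hsub : X ⊆ lift '' (lift ⁻¹' X) := by
        have hconv : Convex ℝ (lift '' (lift ⁻¹' X)) :=
          (hF.convex G.isHull.convex).linear_image (liftLin d)
        conv_lhs => rw [← (G.pyramid hne).isHull.face_eq hX]
        refine convexHull_min ?_ hconv
        rintro x ⟨hxX, hx⟩
        change x ∈ (G.pyramid hne).vertexSet at hx
        rw [vertexSet_pyramid] at hx
        rcases hx with rfl | ⟨y, -, rfl⟩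
        · exact absurd hxX ha
        · exact ⟨y, hxX, rfl⟩
      exact (faceDim_mono hsub).trans (faceDim_image_lift_le _)

/-! ### The pyramid does not get the shelling property -/

theorem intervalEmbedding_lift (A : FaceLattice G.carrier) :
    IntervalEmbedding (fun F : FaceLattice G.carrier =>
      (⟨lift '' F.1, isExposed_lift G.isHull.convex F.2⟩ : FaceLattice (G.pyramid hne).carrier))
      A := by
  refine ⟨fun x y _ _ => image_subset_image_iff lift_injective, fun x y hx hy hyx => ?_⟩
  have hyx' : y.1 ⊆ lift '' x.1 := hyx
  have heq : lift '' (lift ⁻¹' y.1) = y.1 := by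
    rw [image_preimage_eq_iff]
    exact hyx'.trans (image_subset_range _ _)
  refine ⟨⟨lift ⁻¹' y.1, isExposed_preimage y.2⟩, ?_, Subtype.ext heq⟩
  intro z hz
  exact hy (mem_image_of_mem _ hz)

/-- No in-arc of a base vertex comes from the apex, so the in-edges are the same, and the base faces
over the vertex form a lower set of all faces over it. -/
theorem localShell_of_pyramid {w : Fin d → ℝ}
    (h : (G.pyramid hne).LocalShell (lift w)) : G.LocalShell w := by
  obtain ⟨κ, t, hκ⟩ := h
  let ψ : FaceLattice G.carrier → FaceLattice (G.pyramid hne).carrier := fun F =>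
    ⟨lift '' F.1, isExposed_lift G.isHull.convex F.2⟩
  refine ⟨κ ∘ ψ, t, fun A hA => ?_⟩
  have hψ : IntervalEmbedding ψ A := intervalEmbedding_lift A
  have hψA : (ψ A).1 = {lift w} := by simp [ψ, hA]
  obtain ⟨h1, h2⟩ := hκ (ψ A) hψA
  refine ⟨h1.pullback ψ A rfl hψ, fun e he => ?_⟩
  rw [Function.comp_apply, h2 (ψ e) ((hψ.covBy_iff le_rfl he.le).2 he)]
  constructor
  · rintro ⟨x', hx', heq⟩
    rcases hx' with ⟨x, y, hxy, rfl, hy⟩ | ⟨y, -, -, hy⟩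
    · obtain rfl := lift_injective hy
      refine ⟨x, hxy, ?_⟩
      rw [← image_lift_segment] at heq
      exact lift_injective.image_injective heq
    · exact absurd hy (lift_ne_apex w)
  · rintro ⟨x, hx, heq⟩
    refine ⟨lift x, pyrArc_lift.2 hx, ?_⟩
    rw [← image_lift_segment, ← heq]

theorem isXType_pyramid (hd : 2 ≤ d) (h : G.IsXType) : (G.pyramid hne).IsXType := by
  obtain ⟨hac, huso, hhk, hsh⟩ := h
  refine ⟨isAcyclic_pyramid hac, isUSO_pyramid huso, holtKlee_pyramid hac hhk, fun hcon => hsh ?_⟩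
  refine shellingProperty_of_localShell hac huso fun w hw => localShell_of_pyramid (hne := hne) ?_
  exact localShell_of_shellingProperty (by omega) hcon _ (lift_mem_vertexSet_pyramid.2 hw)

end Pyramid

end PolytopalDigraph

end Polytopal

namespace Polytopal
open Set
open scoped NNReal

/-! ### The cone at a vertex. -/

variable {d : ℕ} {P : Set (Fin d → ℝ)}

/-- A nonempty proper face lies in a cover of a smaller one. -/
theorem IsHull.exists_edge_subset (h : IsHull P) {F : Set (Fin d → ℝ)} (hF : IsExposed ℝ P F)
    {v : Fin d → ℝ} (hv : v ∈ P.extremePoints ℝ) (hvF : v ∈ F) (hne : F ≠ {v}) :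
    ∃ w, IsEdge P v w ∧ w ∈ F := by
  have := h.finite_faceLattice
  let A : FaceLattice P := ⟨{v}, h.isExposed_singleton.2 hv⟩
  have hlt : A < ⟨F, hF⟩ := lt_of_le_of_ne (singleton_subset_iff.2 hvF) fun heq =>
    hne (congrArg Subtype.val heq).symm
  obtain ⟨B, hAB, hBF⟩ := exists_covBy_le_of_lt hlt
  obtain ⟨w, hw, hB⟩ := (singleton_covBy_iff h (A := A) rfl).1 hAB
  exact ⟨w, hw, hBF (by rw [hB]; exact right_mem_segment ℝ v w)⟩

/-- A polytope lies in the cone spanned by the edges at a vertex. -/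
theorem IsHull.sub_mem_span (h : IsHull P) {v : Fin d → ℝ} (hv : v ∈ P.extremePoints ℝ)
    {x : Fin d → ℝ} (hx : x ∈ P) :
    x - v ∈ Submodule.span ℝ≥0 ((fun w => w - v) '' {w | IsEdge P v w}) := by
  set C := Submodule.span ℝ≥0 ((fun w => w - v) '' {w | IsEdge P v w}) with hC
  have hsmul : ∀ (c : ℝ) (_ : 0 ≤ c) y, y ∈ C → c • y ∈ C := fun c hc y hy =>
    C.smul_mem ⟨c, hc⟩ hy
  have hconvC : Convex ℝ (C : Set (Fin d → ℝ)) := fun a ha b hb s t hs ht _ =>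
    C.add_mem (hsmul s hs a ha) (hsmul t ht b hb)
  obtain ⟨l, m, hl, hlv⟩ := exists_functional (h.isExposed_singleton.2 hv) (singleton_nonempty v)
  have hvm : v ∈ P ∧ l v = m := by
    have : v ∈ {x | x ∈ P ∧ l x = m} := hlv ▸ mem_singleton v
    exact this
  have hlt : ∀ z ∈ P, z ≠ v → 0 < m - l z := by
    intro z hz hzv
    have h1 := hl z hz
    have h2 : l z ≠ m := fun heq => hzv (by
      have : z ∈ ({v} : Set (Fin d → ℝ)) := by rw [hlv]; exact ⟨hz, heq⟩
      exact this)
    have := lt_of_le_of_ne h1 h2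
    linarith
  -- Directions from `v`, scaled so that `l` is `-1` on them. Their hull is a vertex figure, and its
  -- extreme points will turn out to be directions of edges.
  let p : (Fin d → ℝ) → (Fin d → ℝ) := fun z => (m - l z)⁻¹ • (z - v)
  set W := P.extremePoints ℝ \ {v} with hW
  have hWfin : W.Finite := h.finite_extremePoints.subset sdiff_subset
  have hK : IsHull (convexHull ℝ (p '' W)) := isHull_of_finite (hWfin.image p)
  have hKC : convexHull ℝ (p '' W) ⊆ C := by
    rw [← hK.convexHull_extremePoints]
    refine convexHull_min (fun q hq => ?_) hconvC
    obtain ⟨y, hy, rfl⟩ := extremePoints_convexHull_subset hq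
    obtain ⟨g, M, hg, hgq⟩ := exists_functional (hK.isExposed_singleton.2 hq)
      (singleton_nonempty _)
    -- As `l` is `-1` on the figure, the difference of `g + M • l` to its value at `v` is a positive
    -- multiple of `g - M` there. So a vertex of the figure, exposed by `g`, yields a face of `P`
    -- through `v`, and this contains an edge.
    have hval : ∀ z ∈ W, (g + M • l) z = (g + M • l) v + (m - l z) * (g (p z) - M) := by
      intro z hz
      have h1 := hlt z hz.1.1 hz.2
      have h2 : g (p z) = (m - l z)⁻¹ * (g z - g v) := by
        simp only [p, map_smul, map_sub, smul_eq_mul]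
      rw [h2]
      simp only [LinearMap.add_apply, LinearMap.smul_apply, smul_eq_mul]
      rw [mul_sub, ← mul_assoc, mul_inv_cancel₀ h1.ne', hvm.2]
      ring
    have hle : ∀ x ∈ P, (g + M • l) x ≤ (g + M • l) v := by
      refine le_of_le_on_extremePoints h fun z hz => ?_
      by_cases hzv : z = v
      · rw [hzv]
      · have hzW : z ∈ W := ⟨hz, hzv⟩
        rw [hval z hzW]
        have h1 := hlt z hz.1 hzv
        have h2 : g (p z) ≤ M := hg _ (subset_convexHull ℝ _ (mem_image_of_mem p hzW))
        nlinarith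
    have hF := isExposed_of_le _ _ hle
    have hgy : g (p y) = M := by
      have : p y ∈ {x | x ∈ convexHull ℝ (p '' W) ∧ g x = M} := hgq ▸ mem_singleton _
      exact this.2
    obtain ⟨w, hw, hwF⟩ := h.exists_edge_subset hF hv ⟨hvm.1, rfl⟩ (fun heq => hy.2 (by
      rw [← heq]
      exact ⟨hy.1.1, by rw [hval y hy, hgy]; ring⟩))
    have hwW : w ∈ W := ⟨hw.right_mem, hw.1.symm⟩
    have hwpos := hlt w hwW.1.1 hwW.2
    have hgw : g (p w) = M := by
      have h1 := hval w hwW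
      rw [hwF.2] at h1
      have h2 : (m - l w) * (g (p w) - M) = 0 := by linarith
      rcases mul_eq_zero.1 h2 with h3 | h3
      · exact absurd h3 hwpos.ne'
      · linarith
    have hpw : p w = p y := by
      have : p w ∈ ({p y} : Set (Fin d → ℝ)) := by
        rw [hgq]
        exact ⟨subset_convexHull ℝ _ (mem_image_of_mem p hwW), hgw⟩
      exact this
    rw [SetLike.mem_coe, ← hpw]
    exact hsmul _ (inv_nonneg.2 hwpos.le) _ (Submodule.subset_span ⟨w, hw, rfl⟩)
  have hPC : P ⊆ {x | x - v ∈ C} := by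
    rw [← h.convexHull_extremePoints]
    refine convexHull_min (fun z hz => ?_) ?_
    · by_cases hzv : z = v
      · simp [hzv]
      · have h1 := hlt z hz.1 hzv
        have h2 := hKC (subset_convexHull ℝ _ (mem_image_of_mem p ⟨hz, hzv⟩))
        have h3 := hsmul _ h1.le _ h2
        simp only [p] at h3
        rwa [smul_smul, mul_inv_cancel₀ h1.ne', one_smul] at h3
    · intro a ha b hb s t hs ht hst
      have := hconvC ha hb hs ht hst
      have heq : s • a + t • b - v = s • (a - v) + t • (b - v) := by
        rw [smul_sub, smul_sub, sub_add_sub_comm, ← add_smul, hst, one_smul]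
      change s • a + t • b - v ∈ C
      rw [heq]; exact this
  exact hPC hx

/-- The data of a truncation: a simple vertex `v` of a 4-polytope and the points `v + b i` on the
four edges at `v` through which the hyperplane cuts. These are the first two neighbours and the
midpoints of the two other edges. -/
structure Corner (P : Set (Fin 4 → ℝ)) where
  isPolytope : IsPolytope P
  v : Fin 4 → ℝ
  b : Module.Basis (Fin 4) ℝ (Fin 4 → ℝ)
  edge : ∀ i, IsEdge P v (v + (![1, 1, 2, 2] i : ℝ) • b i)
  nonneg : ∀ x ∈ P, ∀ i, 0 ≤ b.repr (x - v) i

/-- The cone spanned by the edges contains all of `P - v`, so four edge directions span the space.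
They form a basis in which `P` has nonnegative coordinates. -/
theorem exists_corner {P : Set (Fin 4 → ℝ)} (hP : IsPolytope P) {v : Fin 4 → ℝ}
    (hv : v ∈ P.extremePoints ℝ) (w : Fin 4 → (Fin 4 → ℝ)) (hw : range w = {x | IsEdge P v x}) :
    ∃ C : Corner P, C.v = v ∧ ∀ i, w i = v + (![1, 1, 2, 2] i : ℝ) • C.b i := by
  have hcone : ∀ x ∈ P, ∃ c : Fin 4 → ℝ≥0, ∑ i, c i • (w i - v) = x - v := by
    intro x hx
    have h1 := hP.isHull.sub_mem_span hv hx
    rw [← hw, ← range_comp] at h1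
    exact (Submodule.mem_span_range_iff_exists_fun _).1 h1
  have hspan : ⊤ ≤ Submodule.span ℝ (range fun i => w i - v) := by
    have h1 : vectorSpan ℝ P = ⊤ := by
      rw [← direction_affineSpan, hP.2, AffineSubspace.direction_top]
    rw [← h1, vectorSpan_eq_span_vsub_set_right ℝ hv.1]
    refine Submodule.span_le.2 ?_
    rintro _ ⟨x, hx, rfl⟩
    obtain ⟨c, hc⟩ := hcone x hx
    change x - v ∈ _
    rw [← hc]
    exact Submodule.sum_mem _ fun i _ => Submodule.smul_mem _ (c i : ℝ)
      (Submodule.subset_span ⟨i, rfl⟩)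
  have hk : ∀ i : Fin 4, (![1, 1, 2, 2] i : ℝ) ≠ 0 := by
    intro i; fin_cases i <;> simp
  let b₀ := basisOfTopLeSpanOfCardEqFinrank (fun i => w i - v) hspan (by simp)
  have hb₀ : ∀ i, b₀ i = w i - v := fun i => by simp [b₀]
  let b := b₀.unitsSMul fun i => (Units.mk0 _ (hk i))⁻¹
  have hb : ∀ i, w i - v = (![1, 1, 2, 2] i : ℝ) • b i := by
    intro i
    rw [Module.Basis.unitsSMul_apply, hb₀, Units.smul_def, Units.val_inv_eq_inv_val, smul_smul,
      Units.val_mk0, mul_inv_cancel₀ (hk i), one_smul]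
  have hwv : ∀ i, w i = v + (![1, 1, 2, 2] i : ℝ) • b i := fun i => by rw [← hb]; abel
  refine ⟨⟨hP, v, b, fun i => ?_, fun x hx i => ?_⟩, rfl, hwv⟩
  · rw [← hwv]
    have : w i ∈ {x | IsEdge P v x} := hw ▸ mem_range_self i
    exact this
  · obtain ⟨c, hc⟩ := hcone x hx
    rw [← hc, map_sum, Finsupp.finsetSum_apply]
    refine Finset.sum_nonneg fun j _ => ?_
    rw [hb, NNReal.smul_def, map_smul, map_smul, Module.Basis.repr_self]
    simp only [Finsupp.smul_apply, smul_eq_mul]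
    refine mul_nonneg (c j).2 (mul_nonneg ?_ ?_)
    · fin_cases j <;> simp
    · rw [Finsupp.single_apply]; split_ifs <;> simp

end Polytopal

namespace Polytopal
open Set

/-! ### The corner in coordinates and the faces of the truncated polytope. -/

namespace Corner

variable {P : Set (Fin 4 → ℝ)} (C : Corner P)

/-- The scaling factors: the hyperplane passes through the first two neighbours and through the
midpoints of the two other edges. -/
def k (i : Fin 4) : ℝ := (![1, 1, 2, 2] i : ℝ)

/-- The neighbours of the vertex. -/
noncomputable def nb (i : Fin 4) : Fin 4 → ℝ := C.v + k i • C.b i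

/-- The vertices of the cutting face. -/
noncomputable def u (i : Fin 4) : Fin 4 → ℝ := C.v + C.b i

/-- The coordinates in which the corner becomes the positive orthant. -/
noncomputable def mu (i : Fin 4) (x : Fin 4 → ℝ) : ℝ := C.b.repr (x - C.v) i

/-- The height above the vertex; the cutting hyperplane has height 1. -/
noncomputable def ht (x : Fin 4 → ℝ) : ℝ := ∑ i, C.mu i x

/-- The truncated polytope. -/
def cut : Set (Fin 4 → ℝ) := {x | x ∈ P ∧ 1 ≤ C.ht x}

/-- The faces of the cutting face. -/
def tri (S : Finset (Fin 4)) : Set (Fin 4 → ℝ) :=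
  {x | x ∈ P ∧ C.ht x = 1 ∧ ∀ i, i ∉ S → C.mu i x = 0}

theorem k_eq_one {i : Fin 4} (hi : i < 2) : k i = 1 := by
  fin_cases i <;> simp_all [k]

theorem k_eq_two {i : Fin 4} (hi : 2 ≤ i) : k i = 2 := by
  fin_cases i <;> simp_all [k]

theorem k_pos (i : Fin 4) : 0 < k i := by
  rcases lt_or_ge i 2 with h | h
  · rw [k_eq_one h]; norm_num
  · rw [k_eq_two h]; norm_num

theorem isHull (C : Corner P) : IsHull P := C.isPolytope.isHull

theorem isEdge_nb (i : Fin 4) : IsEdge P C.v (C.nb i) := C.edge i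

theorem v_vertex : C.v ∈ P.extremePoints ℝ := (C.isEdge_nb 0).left_mem

theorem nb_vertex (i : Fin 4) : C.nb i ∈ P.extremePoints ℝ := (C.isEdge_nb i).right_mem

theorem mu_nonneg {x : Fin 4 → ℝ} (hx : x ∈ P) (i : Fin 4) : 0 ≤ C.mu i x := C.nonneg x hx i

theorem u_eq_nb {i : Fin 4} (hi : i < 2) : C.u i = C.nb i := by
  rw [u, nb, k_eq_one hi, one_smul]

theorem u_mem_openSegment {i : Fin 4} (hi : 2 ≤ i) : C.u i ∈ openSegment ℝ C.v (C.nb i) := by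
  refine ⟨1 / 2, 1 / 2, by norm_num, by norm_num, by norm_num, ?_⟩
  rw [u, nb, k_eq_two hi, smul_add, smul_smul, ← add_assoc, ← add_smul]
  norm_num

theorem u_mem_segment (i : Fin 4) : C.u i ∈ segment ℝ C.v (C.nb i) := by
  rcases lt_or_ge i 2 with h | h
  · rw [C.u_eq_nb h]; exact right_mem_segment ℝ _ _
  · exact openSegment_subset_segment ℝ _ _ (C.u_mem_openSegment h)

theorem u_mem (i : Fin 4) : C.u i ∈ P :=
  (C.isEdge_nb i).2.subset (C.u_mem_segment i)

theorem v_mem : C.v ∈ P := C.v_vertex.1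

theorem mu_v (i : Fin 4) : C.mu i C.v = 0 := by simp [mu]

theorem mu_u (i j : Fin 4) : C.mu i (C.u j) = if i = j then 1 else 0 := by
  simp [mu, u, Finsupp.single_apply, eq_comm]

theorem mu_nb (i j : Fin 4) : C.mu i (C.nb j) = if i = j then k j else 0 := by
  simp [mu, nb, Finsupp.single_apply, eq_comm]

theorem mu_combo (i : Fin 4) {s t : ℝ} (hst : s + t = 1) (x y : Fin 4 → ℝ) :
    C.mu i (s • x + t • y) = s * C.mu i x + t * C.mu i y := by
  have h : s • x + t • y - C.v = s • (x - C.v) + t • (y - C.v) := by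
    rw [smul_sub, smul_sub, sub_add_sub_comm, ← add_smul, hst, one_smul]
  simp [mu, h]

theorem ht_combo {s t : ℝ} (hst : s + t = 1) (x y : Fin 4 → ℝ) :
    C.ht (s • x + t • y) = s * C.ht x + t * C.ht y := by
  simp only [ht, C.mu_combo _ hst, Finset.sum_add_distrib, Finset.mul_sum]

theorem ht_v : C.ht C.v = 0 := by simp [ht, mu_v]

theorem ht_u (i : Fin 4) : C.ht (C.u i) = 1 := by simp [ht, mu_u]

theorem ht_nb (i : Fin 4) : C.ht (C.nb i) = k i := by simp [ht, mu_nb]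

theorem eq_sum (x : Fin 4 → ℝ) : x = C.v + ∑ i, C.mu i x • C.b i := by
  simp only [mu]; rw [C.b.sum_repr]; abel

theorem apply_eq (g : (Fin 4 → ℝ) →ₗ[ℝ] ℝ) (x : Fin 4 → ℝ) :
    g x = g C.v + ∑ i, C.mu i x * (g (C.u i) - g C.v) := by
  conv_lhs => rw [C.eq_sum x]
  simp [u]

theorem ht_nonneg {x : Fin 4 → ℝ} (hx : x ∈ P) : 0 ≤ C.ht x :=
  Finset.sum_nonneg fun i _ => C.mu_nonneg hx i

theorem eq_v_of_ht_eq_zero {x : Fin 4 → ℝ} (hx : x ∈ P) (h : C.ht x = 0) : x = C.v := by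
  rw [ht, Finset.sum_eq_zero_iff_of_nonneg fun i _ => C.mu_nonneg hx i] at h
  rw [C.eq_sum x, Finset.sum_eq_zero fun i hi => by rw [h i hi, zero_smul], add_zero]

theorem exists_muLin (i : Fin 4) : ∃ g : (Fin 4 → ℝ) →ₗ[ℝ] ℝ, ∀ x, C.mu i x = g x - g C.v :=
  ⟨C.b.coord i, fun x => by simp [mu]⟩

theorem exists_htLin : ∃ g : (Fin 4 → ℝ) →ₗ[ℝ] ℝ, ∀ x, C.ht x = g x - g C.v := by
  refine ⟨∑ i, C.b.coord i, fun x => ?_⟩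
  simp [ht, mu, Finset.sum_sub_distrib]

theorem u_injective : Function.Injective C.u := fun i j h => by
  have h1 := C.mu_u i j
  rw [← h, C.mu_u, if_pos rfl] at h1
  by_contra hij
  rw [if_neg hij] at h1
  norm_num at h1

theorem nb_injective : Function.Injective C.nb := fun i j h => by
  have h1 := C.mu_nb i j
  rw [← h, C.mu_nb, if_pos rfl] at h1
  by_contra hij
  rw [if_neg hij] at h1
  exact (k_pos i).ne' h1

theorem u_ne_v (i : Fin 4) : C.u i ≠ C.v := fun h => by
  have := C.ht_u i
  rw [h, C.ht_v] at this
  norm_num at this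

theorem nb_ne_v (i : Fin 4) : C.nb i ≠ C.v := (C.isEdge_nb i).1.symm

/-! ### Faces at the vertex -/

variable {F : Set (Fin 4 → ℝ)}

/-- A functional that is maximal at `v` does not increase along any edge at `v`. If it is maximal at
`x` too, it is constant along all edges for which `x` has a positive coordinate. -/
theorem u_mem_face (hF : IsExposed ℝ P F) (hv : C.v ∈ F) {x : Fin 4 → ℝ} (hx : x ∈ F) {i : Fin 4}
    (hi : 0 < C.mu i x) : C.u i ∈ F := by
  obtain ⟨g, M, hg, rfl⟩ := exists_functional hF ⟨x, hx⟩
  refine ⟨C.u_mem i, ?_⟩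
  have hle : ∀ j ∈ Finset.univ, 0 ≤ C.mu j x * (g C.v - g (C.u j)) := fun j _ =>
    mul_nonneg (C.mu_nonneg hx.1 j) (by rw [hv.2]; linarith [hg _ (C.u_mem j)])
  have h0 : ∑ j, C.mu j x * (g C.v - g (C.u j)) = 0 := by
    have h1 := C.apply_eq g x
    have h2 : ∑ j, C.mu j x * (g C.v - g (C.u j)) = -∑ j, C.mu j x * (g (C.u j) - g C.v) := by
      rw [← Finset.sum_neg_distrib]
      exact Finset.sum_congr rfl fun _ _ => by ring
    rw [hx.2, hv.2] at h1
    rw [h2, hv.2]; linarith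
  have h3 := (Finset.sum_eq_zero_iff_of_nonneg hle).1 h0 i (Finset.mem_univ i)
  rcases mul_eq_zero.1 h3 with h4 | h4
  · exact absurd h4 hi.ne'
  · rw [hv.2] at h4; linarith

theorem nb_mem_of_u_mem (hF : IsExposed ℝ P F) {i : Fin 4} (hi : C.u i ∈ F) : C.nb i ∈ F := by
  rcases lt_or_ge i 2 with h | h
  · rwa [← C.u_eq_nb h]
  · exact (mem_face_of_openSegment hF hi C.v_mem (C.nb_vertex i).1 (C.u_mem_openSegment h)).2

theorem v_mem_of_u_mem (hF : IsExposed ℝ P F) {i : Fin 4} (h : 2 ≤ i) (hi : C.u i ∈ F) :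
    C.v ∈ F :=
  (mem_face_of_openSegment hF hi C.v_mem (C.nb_vertex i).1 (C.u_mem_openSegment h)).1

theorem u_mem_of_nb_mem (hF : IsExposed ℝ P F) (hv : C.v ∈ F) {i : Fin 4} (hi : C.nb i ∈ F) :
    C.u i ∈ F :=
  (hF.convex C.isHull.convex).segment_subset hv hi (C.u_mem_segment i)

theorem exists_nb_mem (hF : IsExposed ℝ P F) (hv : C.v ∈ F) {x : Fin 4 → ℝ} (hx : x ∈ F)
    (hxv : x ≠ C.v) : ∃ i, C.u i ∈ F := by
  by_contra hcon
  push Not at hcon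
  refine hxv ?_
  have h0 : ∀ i, C.mu i x = 0 := fun i => by
    by_contra hi
    exact hcon i (C.u_mem_face hF hv hx
      (lt_of_le_of_ne (C.mu_nonneg (hF.subset hx) i) (Ne.symm hi)))
  exact C.eq_v_of_ht_eq_zero (hF.subset hx) (by simp [ht, h0])

/-- A functional with value `M` on the face is less than `M` at `v` and at most `M` at the points `u
i` of height 1. By linearity in the coordinates it cannot reach `M` at smaller height. In particular
`v` is the only vertex that is cut off. -/
theorem one_lt_ht_of_not_mem (hF : IsExposed ℝ P F) (hv : C.v ∉ F) {x : Fin 4 → ℝ} (hx : x ∈ F) :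
    1 ≤ C.ht x := by
  obtain ⟨g, M, hg, rfl⟩ := exists_functional hF ⟨x, hx⟩
  have hvM : g C.v < M := lt_of_le_of_ne (hg _ C.v_mem) fun h => hv ⟨C.v_mem, h⟩
  have h1 := C.apply_eq g x
  have h2 : ∑ i, C.mu i x * (g (C.u i) - g C.v) ≤ ∑ i, C.mu i x * (M - g C.v) :=
    Finset.sum_le_sum fun i _ => mul_le_mul_of_nonneg_left
      (by linarith [hg _ (C.u_mem i)]) (C.mu_nonneg hx.1 i)
  rw [← Finset.sum_mul] at h2
  change _ ≤ C.ht x * _ at h2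
  rw [hx.2] at h1
  by_contra hcon
  nlinarith

theorem face_subset_cut (hF : IsExposed ℝ P F) (hv : C.v ∉ F) : F ⊆ C.cut := fun _ hx =>
  ⟨hF.subset hx, C.one_lt_ht_of_not_mem hF hv hx⟩

theorem one_le_ht_of_vertex {x : Fin 4 → ℝ} (hx : x ∈ P.extremePoints ℝ) (hxv : x ≠ C.v) :
    1 ≤ C.ht x :=
  C.one_lt_ht_of_not_mem (C.isHull.isExposed_singleton.2 hx) (fun h => hxv (mem_singleton_iff.1 h).symm) rfl

theorem exists_between_v {x : Fin 4 → ℝ} (hx : x ∈ P) (h : 1 < C.ht x) :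
    ∃ y ∈ openSegment ℝ C.v x, C.ht y = 1 ∧ y ∈ P := by
  have h0 : 0 < C.ht x := by linarith
  have hseg : (1 - (C.ht x)⁻¹) • C.v + (C.ht x)⁻¹ • x ∈ openSegment ℝ C.v x :=
    ⟨_, _, by rw [sub_pos]; exact inv_lt_one_of_one_lt₀ h, inv_pos.2 h0, by ring, rfl⟩
  refine ⟨_, hseg, ?_, C.isHull.convex.openSegment_subset C.v_mem hx hseg⟩
  rw [C.ht_combo (by ring), C.ht_v, inv_mul_cancel₀ h0.ne']; ring

/-- Faces are determined by their part in the truncated polytope, unless they lie in the part that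
is cut off. -/
theorem subset_of_inter_cut_subset {F' : Set (Fin 4 → ℝ)} (hF : IsExposed ℝ P F)
    (hF' : IsExposed ℝ P F') (h : C.v ∉ F ∨ ∃ x ∈ F, 1 < C.ht x) (hsub : F ∩ C.cut ⊆ F') :
    F ⊆ F' := by
  rw [← C.isHull.face_eq hF]
  refine convexHull_min ?_ (hF'.convex C.isHull.convex)
  rintro x ⟨hxF, hx⟩
  by_cases hxv : x = C.v
  · subst hxv
    obtain ⟨y, hyF, hy⟩ := h.resolve_left (not_not.2 hxF)
    have hyP := hF.subset hyF
    obtain ⟨z, hz, hz1, hzP⟩ := C.exists_between_v hyP hy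
    have hzF : z ∈ F :=
      (hF.convex C.isHull.convex).openSegment_subset hxF hyF hz
    exact (mem_face_of_openSegment hF' (hsub ⟨hzF, hzP, hz1.ge⟩) C.v_mem hyP hz).1
  · exact hsub ⟨hxF, hx.1, C.one_le_ht_of_vertex hx hxv⟩

/-! ### The truncated polytope -/

theorem cut_subset : C.cut ⊆ P := fun _ hx => hx.1

theorem u_mem_cut (i : Fin 4) : C.u i ∈ C.cut := ⟨C.u_mem i, (C.ht_u i).ge⟩

theorem v_notMem_cut : C.v ∉ C.cut := fun h => by
  have := h.2
  rw [C.ht_v] at this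
  norm_num at this

theorem convex_cut : Convex ℝ C.cut := by
  intro x hx y hy s t hs ht' hst
  refine ⟨C.isHull.convex hx.1 hy.1 hs ht' hst, ?_⟩
  rw [C.ht_combo hst]
  nlinarith [hx.2, hy.2]

theorem isCompact_cut : IsCompact C.cut := by
  obtain ⟨g, hg⟩ := C.exists_htLin
  refine C.isHull.isCompact.inter_right (t := {x | 1 ≤ C.ht x}) (isClosed_le continuous_const ?_)
  rw [show C.ht = fun x => g x - g C.v from funext hg]
  exact (g.continuous_of_finiteDimensional).sub continuous_const

theorem tri_subset (S : Finset (Fin 4)) : C.tri S ⊆ convexHull ℝ (C.u '' S) := by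
  rintro x ⟨hx, h1, h0⟩
  have hsum : ∑ i ∈ S, C.mu i x = 1 := by
    rw [← h1, ht, Finset.sum_subset (Finset.subset_univ S) fun i _ hi => h0 i hi]
  have hx' : x = ∑ i ∈ S, C.mu i x • C.u i := by
    simp only [u, smul_add, Finset.sum_add_distrib, ← Finset.sum_smul, hsum, one_smul]
    conv_lhs => rw [C.eq_sum x]
    rw [Finset.sum_subset (Finset.subset_univ S) fun i _ hi => by rw [h0 i hi, zero_smul]]
  rw [hx']
  exact (convex_convexHull ℝ _).sum_mem (fun i _ => C.mu_nonneg hx i) hsum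
    fun i hi => subset_convexHull ℝ _ (mem_image_of_mem _ hi)

theorem u_mem_tri {S : Finset (Fin 4)} {i : Fin 4} : C.u i ∈ C.tri S ↔ i ∈ S := by
  constructor
  · intro h
    by_contra hi
    have := h.2.2 i hi
    rw [C.mu_u, if_pos rfl] at this
    norm_num at this
  · intro hi
    refine ⟨C.u_mem i, C.ht_u i, fun j hj => ?_⟩
    rw [C.mu_u, if_neg fun h : j = i => hj (h ▸ hi)]

/-- Above the hyperplane, a segment of `P` through `x` can be shrunk towards `x` into the truncated
polytope, so `x` is extreme in `P` as well. The part in the hyperplane is the simplex spanned by the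
`u i`. -/
theorem extremePoints_cut : C.cut.extremePoints ℝ = (P.extremePoints ℝ \ {C.v}) ∪ range C.u := by
  apply Subset.antisymm
  · intro x hx
    rcases hx.1.2.eq_or_lt with h1 | h1
    · right
      have hT : x ∈ C.tri Finset.univ := ⟨hx.1.1, h1.symm, fun i hi => absurd (Finset.mem_univ i) hi⟩
      have hsub : convexHull ℝ (C.u '' (Finset.univ : Finset (Fin 4))) ⊆ C.cut :=
        convexHull_min (by rintro _ ⟨i, -, rfl⟩; exact C.u_mem_cut i) C.convex_cut
      obtain ⟨i, -, hi⟩ := extremePoints_convexHull_subset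
        (inter_extremePoints_subset_extremePoints_of_subset hsub ⟨C.tri_subset _ hT, hx⟩)
      exact ⟨i, hi⟩
    · left
      refine ⟨?_, fun h => C.v_notMem_cut (by rw [← mem_singleton_iff.1 h]; exact hx.1)⟩
      rw [mem_extremePoints]
      refine ⟨hx.1.1, fun a ha b hb hab => ?_⟩
      obtain ⟨s, t, hs, ht', hst, hxab⟩ := hab
      have hht := C.ht_combo hst a b
      rw [hxab] at hht
      have key : ∀ z ∈ P, ∃ ε : ℝ, 0 < ε ∧ ε ≤ 1 ∧ (1 - ε) • x + ε • z ∈ C.cut := by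
        intro z hz
        -- This ratio moves even a point of height 0 up to height 1.
        refine ⟨(C.ht x - 1) / C.ht x, div_pos (by linarith) (by linarith),
          by rw [div_le_one (by linarith)]; linarith, ?_⟩
        have e0 : 0 ≤ (C.ht x - 1) / C.ht x := div_nonneg (by linarith) (by linarith)
        have e1 : 1 - (C.ht x - 1) / C.ht x = 1 / C.ht x := by
          field_simp; ring
        refine ⟨C.isHull.convex hx.1.1 hz (by rw [e1]; positivity) e0 (by ring), ?_⟩
        rw [C.ht_combo (by ring), e1]
        have := C.ht_nonneg hz
        have h2 : 1 / C.ht x * C.ht x = 1 := by field_simp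
        rw [h2]
        nlinarith [mul_nonneg e0 this]
      obtain ⟨ε, hε, hε1, hεa⟩ := key a ha
      obtain ⟨δ, hδ, hδ1, hδb⟩ := key b hb
      have hmem : x ∈ openSegment ℝ ((1 - ε) • x + ε • a) ((1 - δ) • x + δ • b) := by
        have hpos : 0 < s * δ + t * ε := by positivity
        refine ⟨s * δ / (s * δ + t * ε), t * ε / (s * δ + t * ε), by positivity, by positivity,
          by field_simp, ?_⟩
        ext i
        have hxi : x i = s * a i + t * b i := by rw [← hxab]; simp
        simp only [Pi.add_apply, Pi.smul_apply, smul_eq_mul]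
        field_simp
        have : s = 1 - t := by linarith
        subst this
        linear_combination (-ε * δ) * hxi
      have h2 := (mem_extremePoints.1 hx).2 _ hεa _ hδb hmem
      have h3 : a = x := by
        ext i
        have := congrFun h2.1 i
        simp only [Pi.add_apply, Pi.smul_apply, smul_eq_mul] at this
        have h4 : ε * (a i - x i) = 0 := by linarith
        rcases mul_eq_zero.1 h4 with h5 | h5
        · exact absurd h5 hε.ne'
        · linarith
      have h3' : b = x := by
        ext i
        have := congrFun h2.2 i
        simp only [Pi.add_apply, Pi.smul_apply, smul_eq_mul] at this
        have h4 : δ * (b i - x i) = 0 := by linarith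
        rcases mul_eq_zero.1 h4 with h5 | h5
        · exact absurd h5 hδ.ne'
        · linarith
      exact ⟨h3, h3'⟩
  · rintro x (⟨hx, hxv⟩ | ⟨i, rfl⟩)
    · exact inter_extremePoints_subset_extremePoints_of_subset C.cut_subset
        ⟨⟨hx.1, C.one_le_ht_of_vertex hx hxv⟩, hx⟩
    · rw [mem_extremePoints]
      refine ⟨C.u_mem_cut i, fun a ha b hb hab => ?_⟩
      obtain ⟨s, t, hs, ht', hst, hxab⟩ := hab
      have hht := C.ht_combo hst a b
      rw [hxab, C.ht_u] at hht
      have ha1 : C.ht a = 1 := by nlinarith [ha.2, hb.2]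
      have hb1 : C.ht b = 1 := by nlinarith [ha.2, hb.2]
      have hz : ∀ j, j ≠ i → C.mu j a = 0 ∧ C.mu j b = 0 := by
        intro j hj
        have h1 := C.mu_combo j hst a b
        rw [hxab, C.mu_u, if_neg hj] at h1
        have h2 := C.mu_nonneg ha.1 j
        have h3 := C.mu_nonneg hb.1 j
        constructor <;> nlinarith [mul_nonneg hs.le h2, mul_nonneg ht'.le h3]
      have key : ∀ z, C.ht z = 1 → (∀ j, j ≠ i → C.mu j z = 0) → z = C.u i := by
        intro z hz1 hz0
        have h1 : C.mu i z = 1 := by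
          rw [← hz1, ht, Finset.sum_eq_single i (fun j _ hj => hz0 j hj) (by simp)]
        rw [C.eq_sum z, Finset.sum_eq_single i (fun j _ hj => by rw [hz0 j hj, zero_smul])
          (by simp), h1, one_smul, u]
      exact ⟨key a ha1 fun j hj => (hz j hj).1, key b hb1 fun j hj => (hz j hj).2⟩

theorem isHull_cut : IsHull C.cut := by
  have hfin : (C.cut.extremePoints ℝ).Finite := by
    rw [C.extremePoints_cut]
    exact (C.isHull.finite_extremePoints.subset sdiff_subset).union (finite_range _)
  rw [← convexHull_extremePoints_of_finite C.isCompact_cut C.convex_cut hfin]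
  exact isHull_of_finite hfin

theorem nb_mem_cut (i : Fin 4) : C.nb i ∈ C.cut :=
  ⟨(C.nb_vertex i).1, C.one_le_ht_of_vertex (C.nb_vertex i) (C.nb_ne_v i)⟩

theorem isPolytope_cut : IsPolytope C.cut := by
  refine ⟨C.isHull_cut, ?_⟩
  have hne : C.cut.Nonempty := ⟨_, C.u_mem_cut 0⟩
  rw [← AffineSubspace.direction_eq_top_iff_of_nonempty ((affineSpan_nonempty ℝ).2 hne),
    direction_affineSpan, eq_top_iff, ← C.b.span_eq, Submodule.span_le]
  -- The rest of the edge from `u 2` to `nb 2` supplies a direction that leaves the hyperplane.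
  have h2 : C.b 2 ∈ vectorSpan ℝ C.cut := by
    have := vsub_mem_vectorSpan ℝ (C.nb_mem_cut 2) (C.u_mem_cut 2)
    rw [nb, u, k_eq_two le_rfl, vsub_eq_sub, two_smul] at this
    simpa using this
  rintro _ ⟨i, rfl⟩
  have := vsub_mem_vectorSpan ℝ (C.u_mem_cut i) (C.u_mem_cut 2)
  rw [u, u, vsub_eq_sub, add_sub_add_left_eq_sub] at this
  have h3 := Submodule.add_mem _ this h2
  rwa [sub_add_cancel] at h3

theorem isExposed_inter_cut (hF : IsExposed ℝ P F) : IsExposed ℝ C.cut (F ∩ C.cut) := by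
  rcases F.eq_empty_or_nonempty with rfl | hne
  · rw [empty_inter]; exact isExposed_empty
  obtain ⟨g, M, hg, rfl⟩ := exists_functional hF hne
  convert isExposed_of_le g M (fun x hx => hg x (C.cut_subset hx)) using 1
  ext x
  constructor
  · rintro ⟨h1, h2⟩; exact ⟨h2, h1.2⟩
  · rintro ⟨h1, h2⟩; exact ⟨⟨C.cut_subset h1, h2⟩, h1⟩

theorem isExposed_tri (S : Finset (Fin 4)) : IsExposed ℝ C.cut (C.tri S) := by
  obtain ⟨g, hg⟩ := C.exists_htLin
  choose m hm using C.exists_muLin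
  have hval : ∀ x, (-g - ∑ i ∈ Sᶜ, m i) x =
      (-g - ∑ i ∈ Sᶜ, m i) C.v - C.ht x - ∑ i ∈ Sᶜ, C.mu i x := by
    intro x
    simp only [hg, hm, LinearMap.sub_apply, LinearMap.neg_apply, LinearMap.sum_apply,
      Finset.sum_sub_distrib]
    ring
  have hle : ∀ x ∈ C.cut, (-g - ∑ i ∈ Sᶜ, m i) x ≤ (-g - ∑ i ∈ Sᶜ, m i) C.v - 1 := by
    intro x hx
    rw [hval]
    have := Finset.sum_nonneg (s := Sᶜ) fun i _ => C.mu_nonneg hx.1 i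
    linarith [hx.2]
  convert isExposed_of_le _ _ hle using 1
  ext x
  constructor
  · rintro ⟨h1, h2, h3⟩
    refine ⟨⟨h1, h2.ge⟩, ?_⟩
    rw [hval, h2, Finset.sum_eq_zero fun i hi => h3 i (by simpa using hi)]; ring
  · rintro ⟨h1, h2⟩
    rw [hval] at h2
    have h3 := Finset.sum_nonneg (s := Sᶜ) fun i _ => C.mu_nonneg h1.1 i
    have h4 := h1.2
    have h5 : ∑ i ∈ Sᶜ, C.mu i x = 0 := by linarith
    rw [Finset.sum_eq_zero_iff_of_nonneg fun i _ => C.mu_nonneg h1.1 i] at h5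
    exact ⟨h1.1, by linarith [Finset.sum_eq_zero h5], fun i hi => h5 i (by simpa using hi)⟩

/-- The faces of the truncated polytope. -/
theorem face_cut {E : Set (Fin 4 → ℝ)} (hE : IsExposed ℝ C.cut E) (hne : E.Nonempty) :
    (∃ S, S.Nonempty ∧ E = C.tri S) ∨
      ∃ F, IsExposed ℝ P F ∧ E = F ∩ C.cut ∧ ∃ x ∈ E, 1 < C.ht x := by
  classical
  obtain ⟨g, M, hg, rfl⟩ := exists_functional hE hne
  by_cases hcase : ∃ x ∈ {x | x ∈ C.cut ∧ g x = M}, 1 < C.ht x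
  · right
    obtain ⟨x, ⟨hx, hxM⟩, hx1⟩ := hcase
    -- The segment from `v` to `x` crosses the hyperplane at a point where `g` is at most `M`. Since
    -- `x` lies beyond it with value `M`, the value at `v` is at most `M`, and `M` is the maximum of
    -- `g` on all of `P`.
    have hvM : g C.v ≤ M := by
      obtain ⟨y, ⟨s, t, hs, ht', hst, rfl⟩, hy1, hyP⟩ := C.exists_between_v hx.1 hx1
      have := hg _ ⟨hyP, hy1.ge⟩
      rw [map_add, map_smul, map_smul, hxM, smul_eq_mul, smul_eq_mul] at this
      have hs' : t = 1 - s := by linarith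
      subst hs'
      nlinarith
    have hle : ∀ x ∈ P, g x ≤ M := by
      refine le_of_le_on_extremePoints C.isHull fun z hz => ?_
      by_cases hzv : z = C.v
      · rwa [hzv]
      · exact hg z ⟨hz.1, C.one_le_ht_of_vertex hz hzv⟩
    refine ⟨_, isExposed_of_le g M hle, ?_, x, ⟨hx, hxM⟩, hx1⟩
    ext z
    constructor
    · rintro ⟨h1, h2⟩; exact ⟨⟨C.cut_subset h1, h2⟩, h1⟩
    · rintro ⟨h1, h2⟩; exact ⟨h2, h1.2⟩
  · left
    push Not at hcase
    obtain ⟨z, hz⟩ := hne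
    -- All maximizers lie in the hyperplane, where `g` is a weighted average of its values at the `u
    -- i`.
    have heq : {x | x ∈ C.cut ∧ g x = M} =
        C.tri (Finset.univ.filter fun i => g (C.u i) = M) := by
      have hdiff : ∀ x, C.ht x = 1 → M - g x = ∑ i, C.mu i x * (M - g (C.u i)) := by
        intro x h1
        rw [C.apply_eq g x]
        simp only [mul_sub, Finset.sum_sub_distrib, ← Finset.sum_mul]
        change _ = C.ht x * M - _
        change M - (_ + (_ - C.ht x * _)) = _
        rw [h1]; ring
      ext x
      constructor
      · intro hx
        have h1 : C.ht x = 1 := le_antisymm (hcase x hx) hx.1.2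
        refine ⟨hx.1.1, h1, fun i hi => ?_⟩
        have h2 := hdiff x h1
        rw [hx.2, sub_self] at h2
        have h3 := (Finset.sum_eq_zero_iff_of_nonneg fun i _ => mul_nonneg (C.mu_nonneg hx.1.1 i)
          (sub_nonneg.2 (hg _ (C.u_mem_cut i)))).1 h2.symm i (Finset.mem_univ i)
        rcases mul_eq_zero.1 h3 with h4 | h4
        · exact h4
        · exact absurd (by linarith : g (C.u i) = M) (by simpa using hi)
      · rintro ⟨h1, h2, h3⟩
        refine ⟨⟨h1, h2.ge⟩, ?_⟩
        have h4 := hdiff x h2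
        rw [Finset.sum_eq_zero fun i _ => ?_] at h4
        · linarith
        · by_cases hi : g (C.u i) = M
          · rw [hi, sub_self, mul_zero]
          · rw [h3 i (by simpa using hi), zero_mul]
    refine ⟨_, ?_, heq⟩
    by_contra hS
    rw [Finset.not_nonempty_iff_eq_empty] at hS
    rw [heq, hS] at hz
    have := C.tri_subset ∅ hz
    simp at this

end Corner

end Polytopal

namespace Polytopal
open Set

/-! ### Edges of the truncated polytope. -/

namespace Corner

variable {P : Set (Fin 4 → ℝ)} (C : Corner P) {F : Set (Fin 4 → ℝ)}

theorem u_vertex_cut (i : Fin 4) : C.u i ∈ C.cut.extremePoints ℝ := by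
  rw [C.extremePoints_cut]; exact Or.inr ⟨i, rfl⟩

theorem vertex_cut {x : Fin 4 → ℝ} (hx : x ∈ P.extremePoints ℝ) (hxv : x ≠ C.v) :
    x ∈ C.cut.extremePoints ℝ := by
  rw [C.extremePoints_cut]; exact Or.inl ⟨hx, hxv⟩

theorem vertex_cut_cases {x : Fin 4 → ℝ} (hx : x ∈ C.cut.extremePoints ℝ) :
    (x ∈ P.extremePoints ℝ ∧ x ≠ C.v) ∨ ∃ i, 2 ≤ i ∧ x = C.u i := by
  rw [C.extremePoints_cut] at hx
  rcases hx with hx | ⟨i, rfl⟩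
  · exact Or.inl hx
  · rcases lt_or_ge i 2 with h | h
    · rw [C.u_eq_nb h]
      exact Or.inl ⟨C.nb_vertex i, C.nb_ne_v i⟩
    · exact Or.inr ⟨i, h, rfl⟩

theorem u_not_vertex {i : Fin 4} (hi : 2 ≤ i) : C.u i ∉ P.extremePoints ℝ := fun h =>
  C.u_ne_v i (mem_extremePoints.1 h |>.2 _ C.v_mem _ (C.nb_vertex i).1
    (C.u_mem_openSegment hi) |>.1.symm)

theorem u_lt_two_of_vertex {i : Fin 4} (h : C.u i ∈ P.extremePoints ℝ) : i < 2 := by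
  by_contra hi
  exact C.u_not_vertex (not_lt.1 hi) h

theorem mem_tri_vertex {x : Fin 4 → ℝ} {S : Finset (Fin 4)} (hx : x ∈ C.cut.extremePoints ℝ)
    (hxS : x ∈ C.tri S) : ∃ i ∈ S, x = C.u i := by
  have h : x ∈ (C.tri S).extremePoints ℝ := by
    rw [extremePoints_face (C.isExposed_tri S)]; exact ⟨hxS, hx⟩
  have hconv : convexHull ℝ (C.u '' S) ⊆ C.cut :=
    convexHull_min (by rintro _ ⟨i, -, rfl⟩; exact C.u_mem_cut i) C.convex_cut
  obtain ⟨i, hi, rfl⟩ := extremePoints_convexHull_subset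
    (inter_extremePoints_subset_extremePoints_of_subset hconv ⟨C.tri_subset _ hxS, hx⟩)
  exact ⟨i, hi, rfl⟩

theorem tri_pair (i j : Fin 4) : C.tri {i, j} = segment ℝ (C.u i) (C.u j) := by
  apply Subset.antisymm
  · refine (C.tri_subset _).trans ?_
    rw [Finset.coe_pair, image_pair, convexHull_pair]
  · refine ((C.isExposed_tri _).convex C.convex_cut).segment_subset ?_ ?_ <;> simp [C.u_mem_tri]

theorem segment_inter_cut {i : Fin 4} (hi : 2 ≤ i) :
    segment ℝ C.v (C.nb i) ∩ C.cut = segment ℝ (C.u i) (C.nb i) := by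
  apply Subset.antisymm
  · rintro x ⟨⟨s, t, hs, ht', hst, rfl⟩, hx⟩
    have h := hx.2
    rw [C.ht_combo hst, C.ht_v, C.ht_nb, k_eq_two hi] at h
    refine ⟨2 - 2 * t, 2 * t - 1, by linarith, by linarith, by ring, ?_⟩
    have hs' : s = 1 - t := by linarith
    subst hs'
    ext j
    simp only [u, nb, k_eq_two hi, Pi.add_apply, Pi.smul_apply, smul_eq_mul]
    ring
  · refine (((C.isEdge_nb i).2.convex C.isHull.convex).inter C.convex_cut).segment_subset ?_ ?_
    · exact ⟨C.u_mem_segment i, C.u_mem_cut i⟩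
    · exact ⟨right_mem_segment ℝ _ _, C.nb_mem_cut i⟩

theorem u_ne_nb {i : Fin 4} (hi : 2 ≤ i) (j : Fin 4) : C.u i ≠ C.nb j := fun h =>
  C.u_not_vertex hi (h ▸ C.nb_vertex j)

theorem isExposed_cut_of_notMem (hF : IsExposed ℝ P F) (hv : C.v ∉ F) : IsExposed ℝ C.cut F := by
  have := C.isExposed_inter_cut hF
  rwa [inter_eq_left.2 (C.face_subset_cut hF hv)] at this

theorem vertex_iff_of_face (hF : IsExposed ℝ P F) (hv : C.v ∉ F) {x : Fin 4 → ℝ} (hx : x ∈ F) :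
    x ∈ C.cut.extremePoints ℝ ↔ x ∈ P.extremePoints ℝ := by
  have h1 := extremePoints_face hF
  rw [extremePoints_face (C.isExposed_cut_of_notMem hF hv)] at h1
  have h2 := Set.ext_iff.1 h1 x
  simpa [hx] using h2

theorem isEdge_cut_iff {x y : Fin 4 → ℝ} : IsEdge C.cut x y ↔
    (IsEdge P x y ∧ x ≠ C.v ∧ y ≠ C.v) ∨ (∃ i j, i ≠ j ∧ x = C.u i ∧ y = C.u j) ∨
      ∃ i, 2 ≤ i ∧ ((x = C.nb i ∧ y = C.u i) ∨ (x = C.u i ∧ y = C.nb i)) := by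
  constructor
  · intro h
    rcases C.face_cut h.2 ⟨x, left_mem_segment ℝ x y⟩ with ⟨S, -, hS⟩ | ⟨F, hF, hE, z, hz, hz1⟩
    · obtain ⟨i, -, rfl⟩ := C.mem_tri_vertex h.left_mem (hS ▸ left_mem_segment ℝ x y)
      obtain ⟨j, -, rfl⟩ := C.mem_tri_vertex h.right_mem (hS ▸ right_mem_segment ℝ _ y)
      exact Or.inr (Or.inl ⟨i, j, fun hij => h.1 (hij ▸ rfl), rfl, rfl⟩)
    · by_cases hv : C.v ∈ F
      · right; right
        -- The segment from `v` to `y` crosses the hyperplane within the edge. As `y` is above the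
        -- hyperplane, this can only happen at `x`; so `x` lies strictly between `v` and `y` and is
        -- not a vertex of `P`.
        have key : ∀ x y, IsEdge C.cut x y → segment ℝ x y = F ∩ C.cut → 1 < C.ht y →
            ∃ i, 2 ≤ i ∧ x = C.u i ∧ y = C.nb i := by
          intro x y h hE hy1
          have hyF : y ∈ F ∩ C.cut := hE ▸ right_mem_segment ℝ x y
          obtain ⟨w, hw, hw1, hwP⟩ := C.exists_between_v hyF.2.1 hy1
          have hwF : w ∈ F :=
            (hF.convex C.isHull.convex).openSegment_subset hv hyF.1 hw
          have hwE : w ∈ segment ℝ x y := hE ▸ ⟨hwF, hwP, hw1.ge⟩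
          obtain ⟨s, t, hs, ht', hst, rfl⟩ := hwE
          have hxc : x ∈ F ∩ C.cut := hE ▸ left_mem_segment ℝ x y
          have ht0 : t = 0 := by
            rw [C.ht_combo hst] at hw1
            have h1 := hxc.2.2
            by_contra hcon
            have h2 : 0 < t := lt_of_le_of_ne ht' (Ne.symm hcon)
            have h3 : s = 1 - t := by linarith
            subst h3
            nlinarith
          obtain rfl : s = 1 := by linarith
          subst ht0
          rw [one_smul, zero_smul, add_zero] at hw hw1
          have hxP : x ∉ P.extremePoints ℝ := fun hx => by
            have := (mem_extremePoints.1 hx).2 _ C.v_mem _ hyF.2.1 hw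
            rw [← this.1, C.ht_v] at hw1
            norm_num at hw1
          rcases C.vertex_cut_cases h.left_mem with ⟨hx, -⟩ | ⟨i, hi, rfl⟩
          · exact absurd hx hxP
          refine ⟨i, hi, rfl, ?_⟩
          have hn : C.nb i ∈ segment ℝ (C.u i) y ∩ C.cut.extremePoints ℝ := by
            refine ⟨?_, C.vertex_cut (C.nb_vertex i) (C.nb_ne_v i)⟩
            rw [hE]
            exact ⟨C.nb_mem_of_u_mem hF hxc.1, C.nb_mem_cut i⟩
          rw [h.vertices] at hn
          rcases hn with hn | hn
          · exact absurd hn.symm (C.u_ne_nb hi i)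
          · exact (mem_singleton_iff.1 hn).symm
        by_cases hy1 : 1 < C.ht y
        · obtain ⟨i, hi, h1⟩ := key x y h hE hy1
          exact ⟨i, hi, Or.inr h1⟩
        · have hx1 : 1 < C.ht x := by
            obtain ⟨s, t, hs, ht', hst, rfl⟩ := hz
            rw [C.ht_combo hst] at hz1
            by_contra hx1
            nlinarith
          obtain ⟨i, hi, h1⟩ := key y x h.symm (by rw [segment_symm]; exact hE) hx1
          exact ⟨i, hi, Or.inl h1.symm⟩
      · left
        rw [inter_eq_left.2 (C.face_subset_cut hF hv)] at hE
        refine ⟨⟨h.1, hE ▸ hF⟩, ?_, ?_⟩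
        · rintro rfl; exact hv (hE ▸ left_mem_segment ℝ _ y)
        · rintro rfl; exact hv (hE ▸ right_mem_segment ℝ x _)
  · rintro (⟨h, hx, hy⟩ | ⟨i, j, hij, rfl, rfl⟩ | ⟨i, hi, h⟩)
    · refine ⟨h.1, C.isExposed_cut_of_notMem h.2 fun hv => ?_⟩
      have : C.v ∈ segment ℝ x y ∩ P.extremePoints ℝ := ⟨hv, C.v_vertex⟩
      rw [h.vertices] at this
      rcases this with h1 | h1
      · exact hx h1.symm
      · exact hy h1.symm
    · exact ⟨fun h => hij (C.u_injective h), C.tri_pair i j ▸ C.isExposed_tri _⟩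
    · have : IsEdge C.cut (C.u i) (C.nb i) :=
        ⟨C.u_ne_nb hi i, C.segment_inter_cut hi ▸ C.isExposed_inter_cut (C.isEdge_nb i).2⟩
      rcases h with ⟨rfl, rfl⟩ | ⟨rfl, rfl⟩
      · exact this.symm
      · exact this

/-- If a face contains the first two neighbours, but not the vertex, then they are adjacent. -/
theorem isEdge_nb_nb (hF : IsExposed ℝ P F) (hv : C.v ∉ F) (h0 : C.nb 0 ∈ F) (h1 : C.nb 1 ∈ F) :
    IsEdge P (C.nb 0) (C.nb 1) := by
  refine ⟨fun h => absurd (C.nb_injective h) (by decide), ?_⟩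
  rw [← C.u_eq_nb (by decide), ← C.u_eq_nb (by decide), ← C.tri_pair]
  rw [← C.u_eq_nb (by decide)] at h0 h1
  obtain ⟨g, M, hg, rfl⟩ := exists_functional hF ⟨_, h0⟩
  have hvM : g C.v < M := lt_of_le_of_ne (hg _ C.v_mem) fun h => hv ⟨C.v_mem, h⟩
  obtain ⟨m2, hm2⟩ := C.exists_muLin 2
  obtain ⟨m3, hm3⟩ := C.exists_muLin 3
  -- Subtracting the last two coordinates does not affect the two neighbours and excludes all points
  -- with a positive last coordinate. Where both vanish, `g = M` amounts to height 1.
  have hval : ∀ x, (g - (m2 + m3)) x = g x - (C.mu 2 x + C.mu 3 x) + (g - (m2 + m3)) C.v - g C.v := by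
    intro x
    simp only [LinearMap.sub_apply, LinearMap.add_apply, hm2, hm3]; ring
  have hle : ∀ x ∈ P, (g - (m2 + m3)) x ≤ M + (g - (m2 + m3)) C.v - g C.v := by
    intro x hx
    rw [hval]
    linarith [hg x hx, C.mu_nonneg hx 2, C.mu_nonneg hx 3]
  convert isExposed_of_le _ _ hle using 1
  ext x
  have hgx : g x = g C.v + (C.mu 0 x + C.mu 1 x) * (M - g C.v) +
      C.mu 2 x * (g (C.u 2) - g C.v) + C.mu 3 x * (g (C.u 3) - g C.v) := by
    rw [C.apply_eq g x, Fin.sum_univ_four, h0.2, h1.2]; ring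
  have hht : C.ht x = C.mu 0 x + C.mu 1 x + C.mu 2 x + C.mu 3 x := by
    rw [ht, Fin.sum_univ_four]
  constructor
  · rintro ⟨hx, hx1, hx0⟩
    have e2 := hx0 2 (by decide)
    have e3 := hx0 3 (by decide)
    refine ⟨hx, ?_⟩
    rw [hval, hgx, e2, e3]
    rw [e2, e3] at hht
    have : C.mu 0 x + C.mu 1 x = 1 := by linarith
    rw [this]; ring
  · rintro ⟨hx, hx1⟩
    rw [hval] at hx1
    have p2 := C.mu_nonneg hx 2
    have p3 := C.mu_nonneg hx 3
    have hgM := hg x hx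
    have e2 : C.mu 2 x = 0 := by linarith
    have e3 : C.mu 3 x = 0 := by linarith
    refine ⟨hx, ?_, ?_⟩
    · rw [e2, e3] at hgx hx1
      have : (C.mu 0 x + C.mu 1 x - 1) * (M - g C.v) = 0 := by linarith
      rcases mul_eq_zero.1 this with h2 | h2
      · rw [hht, e2, e3]; linarith
      · linarith
    · intro i hi
      fin_cases i
      · simp at hi
      · simp at hi
      · exact e2
      · exact e3

end Corner

/-! ### The truncated digraph and its acyclicity. -/

namespace PolytopalDigraph

variable {G : PolytopalDigraph 4} (C : Corner G.carrier)

/-- The arcs of the truncated digraph. -/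
def truncArc (x y : Fin 4 → ℝ) : Prop :=
  (G.arc x y ∧ x ≠ C.v ∧ y ≠ C.v) ∨ (∃ i j, i < j ∧ x = C.u i ∧ y = C.u j) ∨
    ∃ i, 2 ≤ i ∧ x = C.nb i ∧ y = C.u i

variable {C}

/-- Apart from the arcs into `u 2` and `u 3`, only the arc from `nb 0` to `nb 1` can be new. -/
theorem truncArc_cases {x y : Fin 4 → ℝ} (h : truncArc C x y) :
    (y = C.u 2 ∨ y = C.u 3) ∨ G.arc x y ∨ (x = C.nb 0 ∧ y = C.nb 1) := by
  rcases h with ⟨h, -, -⟩ | ⟨i, j, hij, rfl, rfl⟩ | ⟨i, hi, rfl, rfl⟩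
  · exact Or.inr (Or.inl h)
  · fin_cases j
    · exact absurd hij (Fin.not_lt_zero i)
    · obtain rfl : i = 0 := by fin_cases i <;> simp_all
      exact Or.inr (Or.inr ⟨C.u_eq_nb (by decide), C.u_eq_nb (by decide)⟩)
    · simp
    · simp
  · fin_cases i <;> simp_all

theorem truncArc_u {i : Fin 4} (hi : 2 ≤ i) {y : Fin 4 → ℝ} (h : truncArc C (C.u i) y) :
    i = 2 ∧ y = C.u 3 := by
  rcases h with ⟨h, -, -⟩ | ⟨i', j, hij, h, rfl⟩ | ⟨i', hi', h, rfl⟩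
  · exact absurd (arc_left h) (C.u_not_vertex hi)
  · obtain rfl := C.u_injective h
    have hj : j = 3 := by omega
    have hi2 : i = 2 := by omega
    exact ⟨hi2, by rw [hj]⟩
  · exact absurd h (C.u_ne_nb hi i')


/-- The vertices `u 2`, `u 3` have no arcs back to old vertices, and the arc from `nb 0` to `nb 1`
is used at most once because `nb 0` cannot be reached from `nb 1`. -/
theorem transGen_truncArc (hno : ¬ Relation.TransGen G.arc (C.nb 1) (C.nb 0)) {x y : Fin 4 → ℝ} (h : Relation.TransGen (truncArc C) x y) :
    (y = C.u 2 ∨ y = C.u 3) ∨ Relation.TransGen G.arc x y ∨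
      (Relation.ReflTransGen G.arc x (C.nb 0) ∧ Relation.ReflTransGen G.arc (C.nb 1) y) := by
  have hno' : ¬ Relation.ReflTransGen G.arc (C.nb 1) (C.nb 0) := fun h => by
    rcases Relation.reflTransGen_iff_eq_or_transGen.1 h with h1 | h1
    · exact absurd (C.nb_injective h1) (by decide)
    · exact hno h1
  induction h with
  | single h =>
    rcases truncArc_cases h with h | h | ⟨rfl, rfl⟩
    · exact Or.inl h
    · exact Or.inr (Or.inl (.single h))
    · exact Or.inr (Or.inr ⟨.refl, .refl⟩)
  | tail _ hbc ih =>
    rcases truncArc_cases hbc with h | h | ⟨rfl, rfl⟩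
    · exact Or.inl h
    · rcases ih with (rfl | rfl) | ih | ⟨h1, h2⟩
      · exact absurd (arc_left h) (C.u_not_vertex le_rfl)
      · exact absurd (arc_left h) (C.u_not_vertex (by decide))
      · exact Or.inr (Or.inl (ih.tail h))
      · exact Or.inr (Or.inr ⟨h1, h2.tail h⟩)
    · rcases ih with (h | h) | ih | ⟨h1, h2⟩
      · exact absurd h.symm (C.u_ne_nb le_rfl 0)
      · exact absurd h.symm (C.u_ne_nb (by decide) 0)
      · exact Or.inr (Or.inr ⟨ih.to_reflTransGen, .refl⟩)
      · exact absurd h2 hno'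

theorem truncArc_acyclic (hac : G.IsAcyclic)
    (hno : ¬ Relation.TransGen G.arc (C.nb 1) (C.nb 0)) (x : Fin 4 → ℝ) : ¬ Relation.TransGen (truncArc C) x x := by
  intro h
  have hu3 : ∀ y, ¬ Relation.TransGen (truncArc C) (C.u 3) y := by
    intro y hy
    obtain ⟨z, hz, -⟩ := Relation.TransGen.head'_iff.1 hy
    exact absurd (truncArc_u (by decide) hz).1 (by decide)
  have hu2 : ¬ Relation.TransGen (truncArc C) (C.u 2) (C.u 2) := by
    intro hy
    obtain ⟨z, hz, hz2⟩ := Relation.TransGen.head'_iff.1 hy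
    obtain ⟨-, rfl⟩ := truncArc_u le_rfl hz
    rcases Relation.reflTransGen_iff_eq_or_transGen.1 hz2 with h1 | h1
    · exact absurd (C.u_injective h1) (by decide)
    · exact hu3 _ h1
  rcases transGen_truncArc hno h with (rfl | rfl) | h1 | ⟨h1, h2⟩
  · exact hu2 h
  · exact hu3 _ h
  · exact hac x h1
  · rcases Relation.reflTransGen_iff_eq_or_transGen.1 (h2.trans h1) with h1 | h1
    · exact absurd (C.nb_injective h1) (by decide)
    · exact hno h1

/-- The truncated digraph. -/
def truncate (hac : G.IsAcyclic) (hno : ¬ Relation.TransGen G.arc (C.nb 1) (C.nb 0)) :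
    PolytopalDigraph 4 where
  carrier := C.cut
  isPolytope := C.isPolytope_cut
  arc := truncArc C
  isEdge_of_arc x y h := by
    rw [C.isEdge_cut_iff]
    rcases h with ⟨h, hx, hy⟩ | ⟨i, j, hij, h⟩ | ⟨i, hi, h⟩
    · exact Or.inl ⟨G.isEdge_of_arc x y h, hx, hy⟩
    · exact Or.inr (Or.inl ⟨i, j, hij.ne, h⟩)
    · exact Or.inr (Or.inr ⟨i, hi, Or.inl h⟩)
  arc_iff_not_arc x y h := by
    constructor
    · intro h1 h2
      exact truncArc_acyclic hac hno x (.tail (.single h1) h2)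
    · intro h1
      rw [C.isEdge_cut_iff] at h
      rcases h with ⟨h, hx, hy⟩ | ⟨i, j, hij, rfl, rfl⟩ | ⟨i, hi, ⟨rfl, rfl⟩ | ⟨rfl, rfl⟩⟩
      · refine Or.inl ⟨(G.arc_iff_not_arc x y h).2 fun h2 => h1 (Or.inl ⟨h2, hy, hx⟩), hx, hy⟩
      · rcases lt_or_gt_of_ne hij with h | h
        · exact Or.inr (Or.inl ⟨i, j, h, rfl, rfl⟩)
        · exact absurd (Or.inr (Or.inl ⟨j, i, h, rfl, rfl⟩)) h1
      · exact Or.inr (Or.inr ⟨i, hi, rfl, rfl⟩)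
      · exact absurd (Or.inr (Or.inr ⟨i, hi, rfl, rfl⟩)) h1

theorem isAcyclic_truncate (hac : G.IsAcyclic)
    (hno : ¬ Relation.TransGen G.arc (C.nb 1) (C.nb 0)) : (truncate hac hno).IsAcyclic := truncArc_acyclic hac hno

end PolytopalDigraph

end Polytopal

namespace Polytopal
open Set

/-! ### Orientation of the single faces after a truncation. -/

namespace Corner

variable {P : Set (Fin 4 → ℝ)} (C : Corner P) {F : Set (Fin 4 → ℝ)}

theorem exists_eq_nb {w : Fin 4 → ℝ} (h : IsEdge P C.v w) : ∃ i, w = C.nb i := by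
  obtain ⟨i, hi⟩ := C.exists_nb_mem h.2 (left_mem_segment ℝ _ w) (right_mem_segment ℝ _ w) h.1.symm
  have hn : C.nb i ∈ segment ℝ C.v w ∩ P.extremePoints ℝ := ⟨C.nb_mem_of_u_mem h.2 hi, C.nb_vertex i⟩
  rw [h.vertices] at hn
  rcases hn with hn | hn
  · exact absurd hn (C.nb_ne_v i)
  · exact ⟨i, (mem_singleton_iff.1 hn).symm⟩

/-- Such a face has no points with positive last coordinates, so it lies in the plane of `v`, `nb 0`
and `nb 1`. A functional that exposes the edge between the neighbours confines it to the triangle.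
-/
theorem ht_le_one (h : IsEdge P (C.nb 0) (C.nb 1)) (hF : IsExposed ℝ P F) (hv : C.v ∈ F)
    (hlt : ∀ i, C.u i ∈ F → i < 2) {x : Fin 4 → ℝ} (hx : x ∈ F) : C.ht x ≤ 1 := by
  obtain ⟨g, M, hg, hgE⟩ := exists_functional h.2 ⟨_, left_mem_segment ℝ _ _⟩
  have h0 : C.nb 0 ∈ {x | x ∈ P ∧ g x = M} := hgE ▸ left_mem_segment ℝ _ _
  have h1 : C.nb 1 ∈ {x | x ∈ P ∧ g x = M} := hgE ▸ right_mem_segment ℝ _ _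
  have hvM : g C.v < M := lt_of_le_of_ne (hg _ C.v_mem) fun hvM => by
    have : C.v ∈ segment ℝ (C.nb 0) (C.nb 1) ∩ P.extremePoints ℝ :=
      ⟨by rw [hgE]; exact ⟨C.v_mem, hvM⟩, C.v_vertex⟩
    rw [h.vertices] at this
    rcases this with h2 | h2
    · exact C.nb_ne_v 0 h2.symm
    · exact C.nb_ne_v 1 (mem_singleton_iff.1 h2).symm
  have hxP := hF.subset hx
  have hz : ∀ i : Fin 4, 2 ≤ i → C.mu i x = 0 := fun i hi => by
    by_contra hcon
    exact absurd (hlt i (C.u_mem_face hF hv hx (lt_of_le_of_ne (C.mu_nonneg hxP i) (Ne.symm hcon))))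
      (not_lt.2 hi)
  have hgx : g x = g C.v + (C.mu 0 x + C.mu 1 x) * (M - g C.v) := by
    rw [C.apply_eq g x, Fin.sum_univ_four, hz 2 (by decide), hz 3 (by decide),
      C.u_eq_nb (by decide), C.u_eq_nb (by decide), h0.2, h1.2]; ring
  rw [ht, Fin.sum_univ_four, hz 2 (by decide), hz 3 (by decide)]
  have := hg x hxP
  by_contra hcon
  nlinarith

end Corner

namespace PolytopalDigraph

variable {G : PolytopalDigraph 4} {C : Corner G.carrier} {F : Set (Fin 4 → ℝ)}

theorem exists_eq_nb_of_arc {x : Fin 4 → ℝ} (h : G.arc x C.v) : ∃ i, x = C.nb i :=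
  C.exists_eq_nb (G.isEdge_of_arc _ _ h).symm

theorem arc_nb (hsink : G.IsSink G.carrier C.v) (i : Fin 4) : G.arc (C.nb i) C.v :=
  (arc_or_arc (C.isEdge_nb i)).resolve_left (hsink.2.2 _ (C.nb_vertex i).1)

theorem isSink_face (hsink : G.IsSink G.carrier C.v) (hF : IsExposed ℝ G.carrier F)
    (hv : C.v ∈ F) : G.IsSink F C.v := ⟨hsink.1, hv, fun w hw => hsink.2.2 w (hF.subset hw)⟩

/-! ### Faces that do not contain the old sink -/

section Away

variable (hac : G.IsAcyclic) (hno : ¬ Relation.TransGen G.arc (C.nb 1) (C.nb 0))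

/-- A face that contains `u 2` or `u 3` contains `v`. If a face without `v` contains `nb 0` and `nb
1`, these are adjacent in the old polytope, and `hno` determines the old direction. -/
theorem truncArc_iff_of_face (hF : IsExposed ℝ G.carrier F) (hv : C.v ∉ F)
    (hno : ¬ Relation.TransGen G.arc (C.nb 1) (C.nb 0)) {x y : Fin 4 → ℝ} (hx : x ∈ F)
    (hy : y ∈ F) : truncArc C x y ↔ G.arc x y := by
  constructor
  · rintro (⟨h, -, -⟩ | ⟨i, j, hij, rfl, rfl⟩ | ⟨i, hi, rfl, rfl⟩)
    · exact h
    · have hj : j < 2 := by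
        by_contra hj
        exact hv (C.v_mem_of_u_mem hF (not_lt.1 hj) hy)
      obtain rfl : i = 0 := by omega
      obtain rfl : j = 1 := by omega
      rw [C.u_eq_nb (by decide)] at hx hy ⊢
      rw [C.u_eq_nb (by decide)]
      exact (arc_or_arc (C.isEdge_nb_nb hF hv hx hy)).resolve_right fun h => hno (.single h)
    · exact absurd (C.v_mem_of_u_mem hF hi hy) hv
  · intro h
    exact Or.inl ⟨h, fun h => hv (h ▸ hx), fun h => hv (h ▸ hy)⟩

theorem isSource_truncate_of_face (hF : IsExposed ℝ G.carrier F) (hv : C.v ∉ F)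
    {x : Fin 4 → ℝ} :
    (truncate hac hno).IsSource F x ↔ G.IsSource F x := by
  constructor
  · rintro ⟨h1, h2, h3⟩
    exact ⟨(C.vertex_iff_of_face hF hv h2).1 h1, h2, fun w hw h =>
      h3 w hw ((truncArc_iff_of_face hF hv hno hw h2).2 h)⟩
  · rintro ⟨h1, h2, h3⟩
    exact ⟨(C.vertex_iff_of_face hF hv h2).2 h1, h2, fun w hw h =>
      h3 w hw ((truncArc_iff_of_face hF hv hno hw h2).1 h)⟩

theorem isSink_truncate_of_face (hF : IsExposed ℝ G.carrier F) (hv : C.v ∉ F)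
    {x : Fin 4 → ℝ} :
    (truncate hac hno).IsSink F x ↔ G.IsSink F x := by
  constructor
  · rintro ⟨h1, h2, h3⟩
    exact ⟨(C.vertex_iff_of_face hF hv h2).1 h1, h2, fun w hw h =>
      h3 w hw ((truncArc_iff_of_face hF hv hno h2 hw).2 h)⟩
  · rintro ⟨h1, h2, h3⟩
    exact ⟨(C.vertex_iff_of_face hF hv h2).2 h1, h2, fun w hw h =>
      h3 w hw ((truncArc_iff_of_face hF hv hno h2 hw).1 h)⟩

theorem isDirectedPath_truncate_of_face (hF : IsExposed ℝ G.carrier F) (hv : C.v ∉ F)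
    {s t : Fin 4 → ℝ} {p : List (Fin 4 → ℝ)}
    (h : G.IsDirectedPath F s t p) : (truncate hac hno).IsDirectedPath F s t p := by
  obtain ⟨h1, h2, h3, h4⟩ := h
  exact ⟨h1.imp_of_mem_imp fun x y hx hy hxy =>
    (truncArc_iff_of_face hF hv hno (h3 x hx).2 (h3 y hy).2).2 hxy, h2,
    fun x hx => ⟨(C.vertex_iff_of_face hF hv (h3 x hx).2).2 (h3 x hx).1, (h3 x hx).2⟩, h4⟩

end Away

/-! ### The faces of the cutting face -/

section Tri

variable (hac : G.IsAcyclic) (hno : ¬ Relation.TransGen G.arc (C.nb 1) (C.nb 0))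

theorem truncArc_u_iff (hac : G.IsAcyclic) (hno : ¬ Relation.TransGen G.arc (C.nb 1) (C.nb 0))
    {i j : Fin 4} : truncArc C (C.u i) (C.u j) ↔ i < j := by
  refine ⟨fun h => ?_, fun h => Or.inr (Or.inl ⟨i, j, h, rfl, rfl⟩)⟩
  by_contra hij
  rcases (not_lt.1 hij).lt_or_eq with h1 | rfl
  · exact truncArc_acyclic hac hno _
      (.tail (.single h) (Or.inr (Or.inl ⟨j, i, h1, rfl, rfl⟩)))
  · exact truncArc_acyclic hac hno _ (.single h)

theorem isSource_tri {S : Finset (Fin 4)} {x : Fin 4 → ℝ} :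
    (truncate hac hno).IsSource (C.tri S) x ↔ ∃ i ∈ S, (∀ j ∈ S, i ≤ j) ∧ x = C.u i := by
  constructor
  · rintro ⟨h1, h2, h3⟩
    obtain ⟨i, hi, rfl⟩ := C.mem_tri_vertex h1 h2
    refine ⟨i, hi, fun j hj => not_lt.1 fun hji => ?_, rfl⟩
    exact h3 _ (C.u_mem_tri.2 hj) ((truncArc_u_iff hac hno).2 hji)
  · rintro ⟨i, hi, hmin, rfl⟩
    refine ⟨C.u_vertex_cut i, C.u_mem_tri.2 hi, fun w hw h => ?_⟩
    obtain ⟨j, hj, rfl⟩ := C.mem_tri_vertex (arc_left (G := truncate hac hno) h) hw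
    exact absurd ((truncArc_u_iff hac hno).1 h) (not_lt.2 (hmin j hj))

theorem isSink_tri {S : Finset (Fin 4)} {x : Fin 4 → ℝ} :
    (truncate hac hno).IsSink (C.tri S) x ↔ ∃ i ∈ S, (∀ j ∈ S, j ≤ i) ∧ x = C.u i := by
  constructor
  · rintro ⟨h1, h2, h3⟩
    obtain ⟨i, hi, rfl⟩ := C.mem_tri_vertex h1 h2
    refine ⟨i, hi, fun j hj => not_lt.1 fun hji => ?_, rfl⟩
    exact h3 _ (C.u_mem_tri.2 hj) ((truncArc_u_iff hac hno).2 hji)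
  · rintro ⟨i, hi, hmin, rfl⟩
    refine ⟨C.u_vertex_cut i, C.u_mem_tri.2 hi, fun w hw h => ?_⟩
    obtain ⟨j, hj, rfl⟩ := C.mem_tri_vertex (arc_right (G := truncate hac hno) h) hw
    exact absurd ((truncArc_u_iff hac hno).1 h) (not_lt.2 (hmin j hj))

/-- In a linearly ordered simplex each vertex other than the source yields a path: through this
vertex, or directly if it is the sink. -/
theorem exists_paths_tri {S : Finset (Fin 4)} {s t : Fin 4 → ℝ}
    (hs : (truncate hac hno).IsSource (C.tri S) s) (ht : (truncate hac hno).IsSink (C.tri S) t) :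
    ∃ p : Fin (faceDim (C.tri S)) → List (Fin 4 → ℝ), Function.Injective p ∧
      (∀ i, (truncate hac hno).IsDirectedPath (C.tri S) s t (p i)) ∧
      ∀ i j, i ≠ j → ∀ x, x ∈ p i → x ∈ p j → x = s ∨ x = t := by
  obtain ⟨a, ha, hamin, rfl⟩ := (isSource_tri hac hno).1 hs
  obtain ⟨z, hz, hzmax, rfl⟩ := (isSink_tri hac hno).1 ht
  let q : {i // i ∈ S.erase a} → List (Fin 4 → ℝ) := fun i =>
    if i.1 = z then [C.u a, C.u z] else [C.u a, C.u i.1, C.u z]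
  have hmem : ∀ (i : {i // i ∈ S.erase a}) x, x ∈ q i → x = C.u a ∨ x = C.u i.1 ∨ x = C.u z := by
    intro i x hx
    by_cases hi : i.1 = z
    · simp only [q, if_pos hi] at hx
      simp only [List.mem_cons, List.not_mem_nil, or_false] at hx
      tauto
    · simp only [q, if_neg hi] at hx
      simpa using hx
  have hpos : ∀ i : {i // i ∈ S.erase a}, a < i.1 := fun i =>
    lt_of_le_of_ne (hamin _ (Finset.mem_of_mem_erase i.2)) (Finset.ne_of_mem_erase i.2).symm
  refine exists_paths q ?_ ?_ ?_ ?_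
  · rintro ⟨i, hi⟩ ⟨j, hj⟩ hij
    by_cases h1 : i = z <;> by_cases h2 : j = z
    · exact Subtype.ext (h1.trans h2.symm)
    · simp [q, h1, h2] at hij
    · simp [q, h1, h2] at hij
    · simp only [q, if_neg h1, if_neg h2, List.cons.injEq, true_and, and_true] at hij
      exact Subtype.ext (C.u_injective hij)
  · rintro ⟨i, hi⟩
    have hai := hpos ⟨i, hi⟩
    have hiS := Finset.mem_of_mem_erase hi
    refine ⟨?_, ?_, ?_, ?_, ?_⟩
    · by_cases h1 : i = z
      · simp only [q, if_pos h1]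
        have h2 : (truncate hac hno).arc (C.u a) (C.u z) := (truncArc_u_iff hac hno).2 (h1 ▸ hai)
        simpa using h2
      · simp only [q, if_neg h1]
        have hiz : i < z := lt_of_le_of_ne (hzmax i hiS) h1
        have h2 : (truncate hac hno).arc (C.u a) (C.u i) := (truncArc_u_iff hac hno).2 hai
        have h3 : (truncate hac hno).arc (C.u i) (C.u z) := (truncArc_u_iff hac hno).2 hiz
        simpa using ⟨h2, h3⟩
    · by_cases h1 : i = z
      · simp only [q, if_pos h1]
        have : a ≠ z := (h1 ▸ hai : a < z).ne
        simp [C.u_injective.eq_iff, this]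
      · simp only [q, if_neg h1]
        have hiz : i < z := lt_of_le_of_ne (hzmax i hiS) h1
        simp [C.u_injective.eq_iff, hai.ne, h1, (hai.trans hiz).ne]
    · intro x hx
      rcases hmem _ x hx with rfl | rfl | rfl
      · exact ⟨C.u_vertex_cut _, C.u_mem_tri.2 ha⟩
      · exact ⟨C.u_vertex_cut _, C.u_mem_tri.2 hiS⟩
      · exact ⟨C.u_vertex_cut _, C.u_mem_tri.2 hz⟩
    · by_cases h1 : i = z <;> simp [q, h1]
    · by_cases h1 : i = z <;> simp [q, h1]
  · intro i j hij x hx hy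
    rcases hmem i x hx with h1 | h1 | h1
    · exact Or.inl h1
    · rcases hmem j x hy with h2 | h2 | h2
      · exact Or.inl h2
      · exact absurd (Subtype.ext (C.u_injective (h1.symm.trans h2))) hij
      · exact Or.inr h2
    · exact Or.inr h1
  · rw [Fintype.card_coe, Finset.card_erase_of_mem ha]
    refine (faceDim_mono (C.tri_subset S)).trans ?_
    rw [faceDim_convexHull, faceDim]
    have := finrank_vectorSpan_image_finset_le ℝ C.u S (n := S.card - 1)
      (by have := Finset.card_pos.2 ⟨a, ha⟩; omega)
    rwa [Finset.coe_image] at this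

end Tri

end PolytopalDigraph

end Polytopal

namespace Polytopal
open Set

/-! ### Unique sinks and disjoint paths in faces through the old sink. -/

namespace PolytopalDigraph

theorem reflTransGen_getLast {α : Type*} {r : α → α → Prop} {l : List α} (h : l.IsChain r) {x y : α}
    (hx : x ∈ l) (hy : l.getLast? = some y) : Relation.ReflTransGen r x y := by
  induction l generalizing x with
  | nil => simp at hx
  | cons a l ih =>
    cases l with
    | nil =>
      simp only [List.mem_singleton] at hx
      simp only [List.getLast?_singleton, Option.some.injEq] at hy
      rw [hx, hy]
    | cons b l =>
      rw [List.isChain_cons_cons] at h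
      rw [List.getLast?_cons_cons] at hy
      rcases List.mem_cons.1 hx with rfl | hx
      · exact .head h.1 (ih h.2 (by simp) hy)
      · exact ih h.2 hx hy

theorem eq_singleton_of_forall_eq {α : Type*} {l : List α} (h : l.Nodup) {s : α}
    (hs : l.head? = some s) (hall : ∀ x ∈ l, x = s) : l = [s] := by
  cases l with
  | nil => simp at hs
  | cons a l =>
    simp only [List.head?_cons, Option.some.injEq] at hs
    subst hs
    cases l with
    | nil => rfl
    | cons b l =>
      have := hall b (by simp)
      subst this
      simp at h

theorem eq_singleton_of_head_eq_getLast {α : Type*} {l : List α} (h : l.Nodup) {s : α}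
    (hs : l.head? = some s) (hl : l.getLast? = some s) : l = [s] := by
  cases l with
  | nil => simp at hs
  | cons a l =>
    simp only [List.head?_cons, Option.some.injEq] at hs
    subst hs
    cases l with
    | nil => rfl
    | cons b l =>
      rw [List.getLast?_cons_cons] at hl
      exact absurd (List.mem_of_getLast? hl) (List.nodup_cons.1 h).1

variable {G : PolytopalDigraph 4} {C : Corner G.carrier} {F : Set (Fin 4 → ℝ)}

theorem ne_v_of_mem_cut {x : Fin 4 → ℝ} (h : x ∈ C.cut) : x ≠ C.v := fun hx =>
  C.v_notMem_cut (hx ▸ h)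

theorem u_eq_nb_of_vertex {i : Fin 4} (h : C.u i ∈ G.carrier.extremePoints ℝ) :
    C.u i = C.nb i := C.u_eq_nb (C.u_lt_two_of_vertex h)

/-- Every vertex of `F` reaches `v` inside `F`, finally through some `nb j` with `j ≤ m`. An arc
from `nb m` to a vertex other than `v` therefore continues to `nb j`, which is a cycle if `j = m`
and a forbidden path from `nb 1` to `nb 0` otherwise. -/
theorem eq_v_of_arc_last (hac : G.IsAcyclic) (hno : ¬ Relation.TransGen G.arc (C.nb 1) (C.nb 0))
    (huso : G.IsUSO) (hsink : G.IsSink G.carrier C.v) (hF : IsExposed ℝ G.carrier F)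
    (hv : C.v ∈ F) {m : Fin 4} (hmax : ∀ j, C.u j ∈ F → j ≤ m) (hm : m < 2) {y : Fin 4 → ℝ}
    (hy : y ∈ F) (h : G.arc (C.nb m) y) : y = C.v := by
  have hsF := isSink_face hsink hF hv
  have hr := reach_sink hac (fun t ht => huso.sink_eq hF ht hsF) y (arc_right h) hy
  rcases Relation.ReflTransGen.cases_tail hr with hr | ⟨c, hyc, hc⟩
  · exact hr.symm
  · exfalso
    obtain ⟨j, rfl⟩ := exists_eq_nb_of_arc hc.1
    have hj := hmax j (C.u_mem_of_nb_mem hF hv hc.2.1)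
    have hT : Relation.TransGen G.arc (C.nb m) (C.nb j) :=
      Relation.TransGen.head' h (reflTransGen_of_arcIn hyc)
    rcases hj.lt_or_eq with hj | rfl
    · obtain rfl : j = 0 := by omega
      obtain rfl : m = 1 := by omega
      exact hno hT
    · exact hac _ hT

section Through

variable (hac : G.IsAcyclic) (hno : ¬ Relation.TransGen G.arc (C.nb 1) (C.nb 0))

theorem isSource_of_truncate (hno : ¬ Relation.TransGen G.arc (C.nb 1) (C.nb 0))
    (hsink : G.IsSink G.carrier C.v) (hF : IsExposed ℝ G.carrier F)
    (hac : G.IsAcyclic) {x : Fin 4 → ℝ}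
    (h : (truncate hac hno).IsSource (F ∩ C.cut) x) : G.IsSource F x := by
  obtain ⟨h1, h2, h3⟩ := h
  rcases C.vertex_cut_cases h1 with ⟨hx, hxv⟩ | ⟨i, hi, rfl⟩
  · refine ⟨hx, h2.1, fun w hw hwx => ?_⟩
    have hwv : w ≠ C.v := by rintro rfl; exact hsink.2.2 x hx.1 hwx
    exact h3 w ⟨hw, (C.vertex_cut (arc_left hwx) hwv).1⟩ (Or.inl ⟨hwx, hwv, hxv⟩)
  · exact absurd (Or.inr (Or.inr ⟨i, hi, rfl, rfl⟩))
      (h3 (C.nb i) ⟨C.nb_mem_of_u_mem hF h2.1, C.nb_mem_cut i⟩)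

theorem isSource_truncate (huso : G.IsUSO) (hF : IsExposed ℝ G.carrier F)
    {x : Fin 4 → ℝ} (h : G.IsSource F x) (hxv : x ≠ C.v) :
    (truncate hac hno).IsSource (F ∩ C.cut) x := by
  refine ⟨C.vertex_cut h.1 hxv, ⟨h.2.1, (C.vertex_cut h.1 hxv).1⟩, fun w hw hwx => ?_⟩
  rcases hwx with ⟨hwx, -, -⟩ | ⟨i, j, hij, rfl, rfl⟩ | ⟨i, hi, rfl, rfl⟩
  · exact h.2.2 w hw.1 hwx
  · have hj := C.u_lt_two_of_vertex h.1
    obtain rfl : i = 0 := by omega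
    obtain rfl : j = 1 := by omega
    have hr := reflTransGen_of_arcIn (reach_source hac (fun s hs => huso.source_eq hF hs h)
      (C.nb 0) (C.nb_vertex 0) (C.nb_mem_of_u_mem hF hw.1))
    rw [C.u_eq_nb hj] at hr
    rcases Relation.reflTransGen_iff_eq_or_transGen.1 hr with h1 | h1
    · exact absurd (C.nb_injective h1) (by decide)
    · exact hno h1
  · exact C.u_not_vertex hi h.1

theorem isSink_truncate_max (huso : G.IsUSO) (hsink : G.IsSink G.carrier C.v)
    (hF : IsExposed ℝ G.carrier F) (hv : C.v ∈ F) {m : Fin 4} (hm : C.u m ∈ F)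
    (hmax : ∀ j, C.u j ∈ F → j ≤ m) : (truncate hac hno).IsSink (F ∩ C.cut) (C.u m) := by
  refine ⟨C.u_vertex_cut m, ⟨hm, C.u_mem_cut m⟩, fun w hw h => ?_⟩
  rcases h with ⟨h, -, hwv⟩ | ⟨i, j, hij, h, rfl⟩ | ⟨i, hi, h, rfl⟩
  · have hm2 := C.u_lt_two_of_vertex (arc_left h)
    rw [C.u_eq_nb hm2] at h
    exact hwv (eq_v_of_arc_last hac hno huso hsink hF hv hmax hm2 hw.1 h)
  · obtain rfl := C.u_injective h
    exact absurd (hmax j hw.1) (not_le.2 hij)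
  · have hm2 := C.u_lt_two_of_vertex (h ▸ C.nb_vertex i)
    rw [C.u_eq_nb hm2] at h
    obtain rfl := C.nb_injective h
    exact absurd hi (not_le.2 hm2)

/-- A vertex of `F` other than `v` has an out-arc in `F`. If this arc leads to `v`, either the
vertex is one of the `u i` itself or the arc to its `u i` replaces it; and from the `u i` in `F` an
arc leads to the one of largest index. -/
theorem isSink_truncate_unique (huso : G.IsUSO) (hsink : G.IsSink G.carrier C.v)
    (hF : IsExposed ℝ G.carrier F) (hv : C.v ∈ F) {m : Fin 4} (hm : C.u m ∈ F)
    (hmax : ∀ j, C.u j ∈ F → j ≤ m) {x : Fin 4 → ℝ}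
    (h : (truncate hac hno).IsSink (F ∩ C.cut) x) : x = C.u m := by
  obtain ⟨h1, h2, h3⟩ := h
  have hu : ∀ i, x = C.u i → x = C.u m := by
    rintro i rfl
    rcases (hmax i h2.1).lt_or_eq with hi | rfl
    · exact absurd (Or.inr (Or.inl ⟨i, m, hi, rfl, rfl⟩)) (h3 (C.u m) ⟨hm, C.u_mem_cut m⟩)
    · rfl
  rcases C.vertex_cut_cases h1 with ⟨hx, hxv⟩ | ⟨i, hi, rfl⟩
  · have hns : ¬ G.IsSink F x := fun hs => hxv (huso.sink_eq hF hs (isSink_face hsink hF hv))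
    have : ∃ y ∈ F, G.arc x y := by
      by_contra! hcon
      exact hns ⟨hx, h2.1, hcon⟩
    obtain ⟨y, hy, hxy⟩ := this
    by_cases hyv : y = C.v
    · subst hyv
      obtain ⟨i, rfl⟩ := exists_eq_nb_of_arc hxy
      rcases lt_or_ge i 2 with hi | hi
      · exact hu i (C.u_eq_nb hi).symm
      · exact absurd (Or.inr (Or.inr ⟨i, hi, rfl, rfl⟩))
          (h3 (C.u i) ⟨C.u_mem_of_nb_mem hF hv h2.1, C.u_mem_cut i⟩)
    · exact absurd (Or.inl ⟨hxy, hxv, hyv⟩) (h3 y ⟨hy, (C.vertex_cut (arc_right hxy) hyv).1⟩)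
  · exact hu i rfl

theorem exists_max_u (hF : IsExposed ℝ G.carrier F) (hv : C.v ∈ F)
    (hx : ∃ x ∈ F, x ≠ C.v) : ∃ m, C.u m ∈ F ∧ ∀ j, C.u j ∈ F → j ≤ m := by
  classical
  obtain ⟨x, hxF, hxv⟩ := hx
  obtain ⟨i, hi⟩ := C.exists_nb_mem hF hv hxF hxv
  obtain ⟨m, hm, hmax⟩ := (Finset.univ.filter fun i => C.u i ∈ F).exists_max_image id
    ⟨i, by simpa using hi⟩
  exact ⟨m, by simpa using hm, fun j hj => hmax j (by simpa using hj)⟩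

theorem isUSO_truncate (huso : G.IsUSO) (hsink : G.IsSink G.carrier C.v) :
    (truncate hac hno).IsUSO := by
  intro E hE hne
  rcases C.face_cut hE hne with ⟨S, hS, rfl⟩ | ⟨F, hF, rfl, x, hx, hx1⟩
  · constructor
    · obtain ⟨a, ha, hmin⟩ := S.exists_min_image id hS
      refine ⟨C.u a, (isSource_tri hac hno).2 ⟨a, ha, hmin, rfl⟩, fun y hy => ?_⟩
      obtain ⟨b, hb, hb', rfl⟩ := (isSource_tri hac hno).1 hy
      exact congrArg C.u (le_antisymm (hb' a ha) (hmin b hb))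
    · obtain ⟨a, ha, hmin⟩ := S.exists_max_image id hS
      refine ⟨C.u a, (isSink_tri hac hno).2 ⟨a, ha, hmin, rfl⟩, fun y hy => ?_⟩
      obtain ⟨b, hb, hb', rfl⟩ := (isSink_tri hac hno).1 hy
      exact congrArg C.u (le_antisymm (hmin b hb) (hb' a ha))
  · by_cases hv : C.v ∈ F
    · obtain ⟨m, hm, hmax⟩ := exists_max_u hF hv ⟨x, hx.1, ne_v_of_mem_cut hx.2⟩
      constructor
      · obtain ⟨s, hs, hsu⟩ := (huso F hF ⟨x, hx.1⟩).1
        refine ⟨s, isSource_truncate hac hno huso hF hs ?_, fun y hy =>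
          hsu y (isSource_of_truncate hno hsink hF hac hy)⟩
        -- If `v` were the source as well as the sink of `F`, it would be the only vertex, but `nb
        -- m` is another.
        rintro rfl
        have := eq_of_source_eq_sink hac hs (fun t ht =>
          huso.sink_eq hF ht (isSink_face hsink hF hv)) _ (C.nb_vertex m) (C.nb_mem_of_u_mem hF hm)
        exact C.nb_ne_v m this
      · exact ⟨C.u m, isSink_truncate_max hac hno huso hsink hF hv hm hmax, fun y hy =>
          isSink_truncate_unique hac hno huso hsink hF hv hm hmax hy⟩
    · rw [inter_eq_left.2 (C.face_subset_cut hF hv)]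
      have := huso F hF ⟨x, hx.1⟩
      simpa only [isSource_truncate_of_face hac hno hF hv, isSink_truncate_of_face hac hno hF hv]

/-- The end of a path in the truncated digraph that reaches the cut at the edge `c`. -/
noncomputable def pathEnd (C : Corner G.carrier) (m c : Fin 4) : List (Fin 4 → ℝ) :=
  -- For an index below 2 the point `u c` is `nb c`, the last vertex of the old path, and must not
  -- be repeated.
  if c = m then if m < 2 then [] else [C.u m] else if c < 2 then [C.u m] else [C.u c, C.u m]

theorem mem_pathEnd {m c : Fin 4} {x : Fin 4 → ℝ} (h : x ∈ pathEnd C m c) :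
    x = C.u m ∨ (x = C.u c ∧ 2 ≤ c) := by
  unfold pathEnd at h
  split_ifs at h <;> simp at h
  · exact Or.inl h
  · exact Or.inl h
  · rcases h with h | h
    · exact Or.inr ⟨h, by omega⟩
    · exact Or.inl h

theorem isChain_append_pathEnd {m c : Fin 4} (hc : c ≤ m) {q : List (Fin 4 → ℝ)}
    (hq : q.IsChain (truncArc C)) (hl : q.getLast? = some (C.nb c)) :
    (q ++ pathEnd C m c).IsChain (truncArc C) := by
  have h1 : ∀ i, 2 ≤ i → truncArc C (C.nb i) (C.u i) := fun i hi =>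
    Or.inr (Or.inr ⟨i, hi, rfl, rfl⟩)
  have h2 : ∀ i j, i < j → truncArc C (C.u i) (C.u j) := fun i j hij =>
    Or.inr (Or.inl ⟨i, j, hij, rfl, rfl⟩)
  rw [List.isChain_append]
  refine ⟨hq, ?_, ?_⟩
  · unfold pathEnd
    split_ifs with a b b
    · simp
    · simp
    · simp
    · simpa using h2 c m (lt_of_le_of_ne hc a)
  · intro x hx y hy
    rw [hl, Option.mem_some_iff] at hx
    subst hx
    unfold pathEnd at hy
    split_ifs at hy with a b b
    · simp at hy
    · simp at hy; subst hy; subst a; exact h1 c (not_lt.1 b)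
    · simp at hy; subst hy; rw [← C.u_eq_nb b]; exact h2 c m (lt_of_le_of_ne hc a)
    · simp at hy; subst hy; exact h1 c (not_lt.1 b)

theorem getLast_append_pathEnd {m c : Fin 4} {q : List (Fin 4 → ℝ)}
    (hl : q.getLast? = some (C.nb c)) : (q ++ pathEnd C m c).getLast? = some (C.u m) := by
  unfold pathEnd
  split_ifs with a b b
  · subst a; rw [List.append_nil, hl, C.u_eq_nb b]
  · simp
  · simp
  · simp

/-- The paths of `F` enter `v` from different neighbours. Each is stopped there and led on through
its point of the cutting simplex to the new sink `u m`, so the new ends share only the sink. Two of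
the resulting paths could coincide only if `F` were a triangle with vertices `v`, `nb 0` and `nb 1`,
and this has no point above the hyperplane. -/
theorem exists_paths_through (huso : G.IsUSO) (hhk : G.HoltKlee) (hsink : G.IsSink G.carrier C.v)
    (hF : IsExposed ℝ G.carrier F) (hv : C.v ∈ F) (hx : ∃ x ∈ F, 1 < C.ht x) {s t : Fin 4 → ℝ}
    (hs : (truncate hac hno).IsSource (F ∩ C.cut) s)
    (ht : (truncate hac hno).IsSink (F ∩ C.cut) t) :
    ∃ p : Fin (faceDim (F ∩ C.cut)) → List (Fin 4 → ℝ), Function.Injective p ∧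
      (∀ i, (truncate hac hno).IsDirectedPath (F ∩ C.cut) s t (p i)) ∧
      ∀ i j, i ≠ j → ∀ x, x ∈ p i → x ∈ p j → x = s ∨ x = t := by
  obtain ⟨m, hm, hmax⟩ := exists_max_u (C := C) hF hv (by
    obtain ⟨x, hx, hx1⟩ := hx
    refine ⟨x, hx, fun h => ?_⟩
    rw [h, C.ht_v] at hx1
    norm_num at hx1)
  obtain rfl := isSink_truncate_unique hac hno huso hsink hF hv hm hmax ht
  have hsF := isSource_of_truncate hno hsink hF hac hs
  have htF := isSink_face hsink hF hv
  have hsv : s ≠ C.v := ne_v_of_mem_cut hs.2.1.2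
  obtain ⟨p, hpinj, hp, hpd⟩ := hhk.2 F hF ⟨_, hv⟩ s C.v hsF htF
  choose q hpq hqc hqn hvq hqh hqa hqF using fun i => (hp i).exists_append hsv
  have hc : ∀ i, ∃ c, (q i).getLast? = some (C.nb c) := by
    intro i
    obtain ⟨x, hx⟩ : ∃ x, (q i).getLast? = some x := by
      cases hq : (q i).getLast? with
      | none =>
        rw [List.getLast?_eq_none_iff] at hq
        have := hqh i
        rw [hq] at this
        simp at this
      | some x => exact ⟨x, rfl⟩
    obtain ⟨c, rfl⟩ := exists_eq_nb_of_arc (hqa i x hx)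
    exact ⟨c, hx⟩
  choose c hc using hc
  have hcm : ∀ i, C.nb (c i) ∈ q i := fun i => List.mem_of_getLast? (hc i)
  have hcF : ∀ i, C.u (c i) ∈ F := fun i => C.u_mem_of_nb_mem hF hv (hqF i _ (hcm i)).2
  have hcle : ∀ i, c i ≤ m := fun i => hmax _ (hcF i)
  have hqi : ∀ i j, q i = q j → i = j := fun i j hij => hpinj (by rw [hpq i, hpq j, hij])
  have hqd : ∀ i j, i ≠ j → ∀ x, x ∈ q i → x ∈ q j → x = s := by
    intro i j hij x hx hx'
    rcases hpd i j hij x (by rw [hpq]; simp [hx]) (by rw [hpq]; simp [hx']) with h | h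
    · exact h
    · exact absurd (h ▸ hx) (hvq i)
  -- A common last neighbour must be the source, and then both shortened paths consist of the source
  -- only.
  have hci : ∀ i j, c i = c j → i = j := by
    intro i j hij
    by_contra hne
    have h1 := hqd i j hne _ (hcm i) (hij ▸ hcm j)
    have h2 := eq_singleton_of_head_eq_getLast (hqn i) (hqh i) (h1 ▸ hc i)
    have h3 := eq_singleton_of_head_eq_getLast (hqn j) (hqh j) (by rw [hc j, ← hij, h1])
    exact hne (hqi i j (h2.trans h3.symm))
  have hqv : ∀ i x, x ∈ q i → x ≠ C.v := fun i x hx h => hvq i (h ▸ hx)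
  have hqu : ∀ i j, C.u j ∈ q i → j < 2 := fun i j h => C.u_lt_two_of_vertex (hqF i _ h).1
  -- Here `u m` is `nb m`. A path that continues from there to another neighbour in `F` would lead
  -- from `nb 1` to `nb 0`.
  have hqm : ∀ i, C.u m ∈ q i → c i = m := by
    intro i h
    have hm2 := hqu i m h
    by_contra hcon
    have hlt := lt_of_le_of_ne (hcle i) hcon
    have hc0 : c i = 0 := by omega
    obtain rfl : m = 1 := by omega
    rw [C.u_eq_nb hm2] at h
    have hr := reflTransGen_getLast (hqc i) h (hc i)
    rw [hc0] at hr
    rcases Relation.reflTransGen_iff_eq_or_transGen.1 hr with h1 | h1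
    · exact absurd (C.nb_injective h1) (by decide)
    · exact hno h1
  -- the case of a triangle is excluded
  have hkey : ∀ i j, i ≠ j → c j = m → q i ++ pathEnd C m (c i) ≠ q j ++ pathEnd C m (c j) := by
    intro i j hij hcj heq
    have hci' : c i ≠ m := fun h => hij (hci i j (h.trans hcj.symm))
    have hall : ∀ x ∈ q i, x = s := by
      intro x hx
      have h1 : x ∈ q j ++ pathEnd C m (c j) := heq ▸ List.mem_append_left _ hx
      rcases List.mem_append.1 h1 with h1 | h1
      · exact hqd i j hij x hx h1
      · rcases mem_pathEnd h1 with rfl | ⟨rfl, h2⟩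
        · exact absurd (hqm i hx) hci'
        · exact absurd (hqu i _ hx) (not_lt.2 h2)
    have hqis := eq_singleton_of_forall_eq (hqn i) (hqh i) hall
    have hsc : s = C.nb (c i) := (hall _ (hcm i)).symm
    rw [hqis, hcj] at heq
    rcases lt_or_ge m 2 with hm2 | hm2
    · have hlt := lt_of_le_of_ne (hcle i) hci'
      have hc0 : c i = 0 := by omega
      obtain rfl : m = 1 := by omega
      have h1 : pathEnd C 1 (c i) = [C.u 1] := by rw [hc0]; simp [pathEnd]
      have h2 : pathEnd C 1 1 = [] := by simp [pathEnd]
      rw [h1, h2, List.append_nil, hsc, hc0, C.u_eq_nb (by decide)] at heq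
      have h3 := hqc j
      rw [← heq] at h3
      have h4 : G.arc (C.nb 0) (C.nb 1) := by simpa using h3
      obtain ⟨x, hx, hx1⟩ := hx
      exact absurd (C.ht_le_one (G.isEdge_of_arc _ _ h4) hF hv
        (fun k hk => lt_of_le_of_lt (hmax k hk) (by decide)) hx) (not_le.2 hx1)
    · have h2 : pathEnd C m m = [C.u m] := by simp [pathEnd, not_lt.2 hm2]
      have h3 : ∀ x ∈ q j, x = s ∨ x = C.u (c i) := by
        intro x hx
        have h4 : x ∈ [s] ++ pathEnd C m (c i) := by rw [heq]; exact List.mem_append_left _ hx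
        rcases List.mem_append.1 h4 with h4 | h4
        · exact Or.inl (by simpa using h4)
        · rcases mem_pathEnd h4 with rfl | ⟨h5, -⟩
          · exact absurd (hqu j _ hx) (not_lt.2 hm2)
          · exact Or.inr h5
      rcases h3 _ (hcm j) with h4 | h4
      · have : c j = c i := C.nb_injective (h4.trans hsc)
        exact hci' (this ▸ hcj)
      · rw [hcj] at h4
        have h5 : C.u (c i) ∈ G.carrier.extremePoints ℝ := h4 ▸ C.nb_vertex m
        rw [u_eq_nb_of_vertex h5] at h4
        exact hci' (C.nb_injective h4).symm
  refine exists_paths (fun i => q i ++ pathEnd C m (c i)) ?_ ?_ ?_ ?_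
  · intro i j hij
    by_contra hne
    by_cases hcj : c j = m
    · exact hkey i j hne hcj hij
    by_cases hci' : c i = m
    · exact hkey j i (Ne.symm hne) hci' hij.symm
    -- both paths leave through other edges
    have hall : ∀ i j, i ≠ j → c i ≠ m → q i ++ pathEnd C m (c i) = q j ++ pathEnd C m (c j) →
        q i = [s] := by
      intro i j hij hci' heq
      refine eq_singleton_of_forall_eq (hqn i) (hqh i) fun x hx => ?_
      have h1 : x ∈ q j ++ pathEnd C m (c j) := heq ▸ List.mem_append_left _ hx
      rcases List.mem_append.1 h1 with h1 | h1
      · exact hqd i j hij x hx h1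
      · rcases mem_pathEnd h1 with rfl | ⟨rfl, h2⟩
        · exact absurd (hqm i hx) hci'
        · exact absurd (hqu i _ hx) (not_lt.2 h2)
    exact hne (hqi i j ((hall i j hne hci' hij).trans (hall j i (Ne.symm hne) hcj hij.symm).symm))
  · intro i
    have hsub : (q i).IsChain (truncArc C) := (hqc i).imp_of_mem_imp fun x y hx hy hxy =>
      Or.inl ⟨hxy, hqv i x hx, hqv i y hy⟩
    refine ⟨isChain_append_pathEnd (hcle i) hsub (hc i), ?_, ?_, ?_, getLast_append_pathEnd (hc i)⟩
    · rw [List.nodup_append]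
      refine ⟨hqn i, ?_, ?_⟩
      · unfold pathEnd
        split_ifs with a b b
        · simp
        · simp
        · simp
        · simpa [C.u_injective.eq_iff] using a
      · rintro x hx y hy rfl
        rcases mem_pathEnd hy with rfl | ⟨rfl, h2⟩
        · have h1 := hqm i hx
          have h2 := hqu i _ hx
          rw [h1, pathEnd, if_pos rfl, if_pos h2] at hy
          simp at hy
        · exact absurd (hqu i _ hx) (not_lt.2 h2)
    · intro x hx
      rcases List.mem_append.1 hx with h1 | h1
      · have h2 := C.vertex_cut (hqF i x h1).1 (hqv i x h1)
        exact ⟨h2, (hqF i x h1).2, h2.1⟩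
      · rcases mem_pathEnd h1 with rfl | ⟨rfl, -⟩
        · exact ⟨C.u_vertex_cut _, hm, C.u_mem_cut _⟩
        · exact ⟨C.u_vertex_cut _, hcF i, C.u_mem_cut _⟩
    · rw [List.head?_append, hqh i]; rfl
  · intro i j hij x hx hx'
    rcases List.mem_append.1 hx with h1 | h1 <;> rcases List.mem_append.1 hx' with h2 | h2
    · exact Or.inl (hqd i j hij x h1 h2)
    · rcases mem_pathEnd h2 with h3 | ⟨rfl, h3⟩
      · exact Or.inr h3
      · exact absurd (hqu i _ h1) (not_lt.2 h3)
    · rcases mem_pathEnd h1 with h3 | ⟨rfl, h3⟩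
      · exact Or.inr h3
      · exact absurd (hqu j _ h2) (not_lt.2 h3)
    · rcases mem_pathEnd h1 with h3 | ⟨rfl, h3⟩
      · exact Or.inr h3
      · rcases mem_pathEnd h2 with h4 | ⟨h4, -⟩
        · exact Or.inr h4
        · exact absurd (hci i j (C.u_injective h4)) hij
  · rw [Fintype.card_fin]
    exact faceDim_mono inter_subset_left

theorem holtKlee_truncate (hhk : G.HoltKlee) (hsink : G.IsSink G.carrier C.v) :
    (truncate hac hno).HoltKlee := by
  refine ⟨isUSO_truncate hac hno hhk.1 hsink, fun E hE hne s t hs ht => ?_⟩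
  rcases C.face_cut hE hne with ⟨S, -, rfl⟩ | ⟨F, hF, rfl, x, hx, hx1⟩
  · exact exists_paths_tri hac hno hs ht
  · by_cases hv : C.v ∈ F
    · exact exists_paths_through hac hno hhk.1 hhk hsink hF hv ⟨x, hx.1, hx1⟩ hs ht
    · rw [inter_eq_left.2 (C.face_subset_cut hF hv)] at hs ht ⊢
      rw [isSource_truncate_of_face hac hno hF hv] at hs
      rw [isSink_truncate_of_face hac hno hF hv] at ht
      obtain ⟨p, hpinj, hp, hpd⟩ := hhk.2 F hF ⟨x, hx.1⟩ s t hs ht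
      exact ⟨p, hpinj, fun i => isDirectedPath_truncate_of_face hac hno hF hv (hp i), hpd⟩

end Through

end PolytopalDigraph

end Polytopal

namespace Polytopal
open Set

/-! ### Choice of the labels, number of vertices and the new simple sink. -/

namespace PolytopalDigraph

variable {G : PolytopalDigraph 4} {C : Corner G.carrier}

theorem setOf_isEdge_v (C : Corner G.carrier) : {w | IsEdge G.carrier C.v w} = range C.nb := by
  ext w
  constructor
  · intro h
    obtain ⟨i, rfl⟩ := C.exists_eq_nb h
    exact ⟨i, rfl⟩
  · rintro ⟨i, rfl⟩
    exact C.isEdge_nb i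

/-- By acyclicity two neighbours are not joined by paths in both directions, so swapping the first
two labels, if necessary, meets the requirement. -/
theorem exists_corner_of_isSimpleVertex (hac : G.IsAcyclic) {v : Fin 4 → ℝ}
    (hv : IsSimpleVertex G.carrier v) :
    ∃ C : Corner G.carrier, C.v = v ∧ ¬ Relation.TransGen G.arc (C.nb 1) (C.nb 0) := by
  obtain ⟨hv, hcard⟩ := hv
  have hfin : {w | IsEdge G.carrier v w}.Finite := finite_of_ncard_pos (by rw [hcard]; norm_num)
  have := hfin.fintype
  have hc : Fintype.card {w | IsEdge G.carrier v w} = 4 := by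
    rw [← Nat.card_eq_fintype_card]; exact hcard
  let e := (Fintype.equivFinOfCardEq hc).symm
  have key : ∀ σ : Equiv.Perm (Fin 4), ∃ C : Corner G.carrier, C.v = v ∧
      ∀ i, C.nb i = (e (σ i) : Fin 4 → ℝ) := by
    intro σ
    obtain ⟨C, rfl, hC⟩ := exists_corner G.isPolytope hv (fun i => (e (σ i) : Fin 4 → ℝ)) (by
      ext w
      constructor
      · rintro ⟨i, rfl⟩
        exact (e (σ i)).2
      · intro hw
        exact ⟨σ.symm (e.symm ⟨w, hw⟩), by simp⟩)
    exact ⟨C, rfl, fun i => (hC i).symm⟩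
  by_cases h : Relation.TransGen G.arc (e 1 : Fin 4 → ℝ) (e 0)
  · obtain ⟨C, hCv, hC⟩ := key (Equiv.swap 0 1)
    refine ⟨C, hCv, fun h' => hac (e 1 : Fin 4 → ℝ) ?_⟩
    rw [hC, hC, Equiv.swap_apply_left, Equiv.swap_apply_right] at h'
    exact h.trans h'
  · obtain ⟨C, hCv, hC⟩ := key (Equiv.refl _)
    refine ⟨C, hCv, ?_⟩
    rw [hC, hC]
    exact h

variable (hac : G.IsAcyclic) (hno : ¬ Relation.TransGen G.arc (C.nb 1) (C.nb 0))

theorem ncard_vertexSet_truncate :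
    (truncate hac hno).vertexSet.ncard = G.vertexSet.ncard + 1 := by
  have h : (truncate hac hno).vertexSet = (G.vertexSet \ {C.v}) ∪ {C.u 2, C.u 3} := by
    ext x
    constructor
    · intro hx
      rcases C.vertex_cut_cases hx with hx | ⟨i, hi, rfl⟩
      · exact Or.inl hx
      · right
        have : i = 2 ∨ i = 3 := by omega
        rcases this with rfl | rfl <;> simp
    · rintro (hx | rfl | rfl)
      · exact C.vertex_cut hx.1 hx.2
      · exact C.u_vertex_cut 2
      · exact C.u_vertex_cut 3
  have hne : C.u 2 ≠ C.u 3 := fun h => absurd (C.u_injective h) (by decide)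
  rw [h, ncard_union_eq ?_ (G.finite_vertexSet.subset sdiff_subset) (by simp), ncard_pair hne]
  · have := ncard_sdiff_singleton_add_one (s := G.vertexSet) C.v_vertex G.finite_vertexSet
    omega
  · rw [Set.disjoint_left]
    rintro x hx (rfl | rfl)
    · exact C.u_not_vertex le_rfl hx.1
    · exact C.u_not_vertex (by decide) hx.1

theorem isSink_truncate_u :
    (truncate hac hno).IsSink (truncate hac hno).carrier (C.u 3) := by
  refine ⟨C.u_vertex_cut 3, C.u_mem_cut 3, fun w _ h => ?_⟩
  exact absurd (truncArc_u (C := C) (by decide) h).1 (by decide)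

theorem isSimpleVertex_truncate_u : IsSimpleVertex (truncate hac hno).carrier (C.u 3) := by
  refine ⟨C.u_vertex_cut 3, ?_⟩
  have h : {w | IsEdge (truncate hac hno).carrier (C.u 3) w} =
      insert (C.nb 3) (C.u '' ({0, 1, 2} : Finset (Fin 4))) := by
    ext w
    change IsEdge C.cut (C.u 3) w ↔ _
    rw [C.isEdge_cut_iff]
    constructor
    · rintro (⟨h, -, -⟩ | ⟨i, j, hij, h, rfl⟩ | ⟨i, hi, ⟨h, -⟩ | ⟨h, rfl⟩⟩)
      · exact absurd h.left_mem (C.u_not_vertex (by decide))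
      · obtain rfl := C.u_injective h
        refine Or.inr ⟨j, ?_, rfl⟩
        fin_cases j <;> simp_all
      · exact absurd h (C.u_ne_nb (by decide) i)
      · obtain rfl := C.u_injective h
        exact Or.inl rfl
    · rintro (rfl | ⟨j, hj, rfl⟩)
      · exact Or.inr (Or.inr ⟨3, by decide, Or.inr ⟨rfl, rfl⟩⟩)
      · refine Or.inr (Or.inl ⟨3, j, ?_, rfl, rfl⟩)
        rintro rfl
        simp at hj
  rw [h, ncard_insert_of_notMem, ncard_image_of_injective _ C.u_injective, ncard_coe_finset]
  · rfl
  · rintro ⟨j, hj, h⟩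
    have hj2 := C.u_lt_two_of_vertex (h ▸ C.nb_vertex 3)
    rw [C.u_eq_nb hj2] at h
    obtain rfl := C.nb_injective h
    exact absurd hj2 (by decide)

theorem isTruncation_truncate (huso : G.IsUSO) (hsink : G.IsSink G.carrier C.v)
    (hv : IsSimpleVertex G.carrier C.v) : IsTruncation G (truncate hac hno) := by
  obtain ⟨g, hg⟩ := C.exists_htLin
  have hu0 := C.u_eq_nb (i := 0) (by decide)
  have hu1 := C.u_eq_nb (i := 1) (by decide)
  have hgu : ∀ i, g (C.u i) = 1 + g C.v := fun i => by
    have := hg (C.u i)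
    rw [C.ht_u] at this
    linarith
  -- The neighbours `v₃`, `v₄` through which the hyperplane passes have the indices 0 and 1; the
  -- edges to `v₁`, `v₂` have the indices 2 and 3.
  refine ⟨hac, C.v, C.nb 2, C.nb 3, C.nb 0, C.nb 1, C.u 2, C.u 3, hsink,
    fun w hw => huso.sink_eq (IsExposed.refl _) hw hsink, hv, ?_,
    C.u_mem_openSegment le_rfl, C.u_mem_openSegment (by decide), ⟨g, 1 + g C.v, hgu 2, hgu 3,
      by rw [← hu0]; exact hgu 0, by rw [← hu1]; exact hgu 1, by linarith, ?_⟩, hno, ?_⟩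
  · rw [setOf_isEdge_v]
    ext w
    constructor
    · rintro ⟨i, rfl⟩
      fin_cases i <;> simp
    · rintro (rfl | rfl | rfl | rfl) <;> exact mem_range_self _
  · ext x
    change x ∈ G.carrier ∧ 1 ≤ C.ht x ↔ x ∈ G.carrier ∧ _
    rw [hg]
    constructor <;> rintro ⟨h1, h2⟩ <;> exact ⟨h1, by linarith⟩
  · intro a b
    change truncArc C a b ↔ _
    rw [← hu0, ← hu1]
    constructor
    · rintro (h | ⟨i, j, hij, rfl, rfl⟩ | ⟨i, hi, rfl, rfl⟩)
      · exact Or.inl h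
      · right
        fin_cases i <;> fin_cases j <;> simp_all
      · right
        fin_cases i <;> simp_all
    · have h2 : ∀ i j, i < j → truncArc C (C.u i) (C.u j) := fun i j hij =>
        Or.inr (Or.inl ⟨i, j, hij, rfl, rfl⟩)
      rintro (h | ⟨rfl, rfl⟩ | ⟨rfl, rfl⟩ | ⟨rfl, rfl⟩ | ⟨rfl, rfl⟩ | ⟨rfl, rfl⟩ | ⟨rfl, rfl⟩ |
        ⟨rfl, rfl⟩ | ⟨rfl, rfl⟩)
      · exact Or.inl h
      · exact h2 0 1 (by decide)
      · exact Or.inr (Or.inr ⟨2, le_rfl, rfl, rfl⟩)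
      · exact h2 0 2 (by decide)
      · exact h2 1 2 (by decide)
      · exact Or.inr (Or.inr ⟨3, by decide, rfl, rfl⟩)
      · exact h2 0 3 (by decide)
      · exact h2 1 3 (by decide)
      · exact h2 2 3 (by decide)

end PolytopalDigraph

end Polytopal

namespace Polytopal
open Set

/-! ### Dual shellings of rank three, in terms of connectivity -/

section LinkShell

variable {α : Type*} [PartialOrder α] [OrderTop α]

/-- Two elements are adjacent if they have a common upper bound that is not the largest element. -/
def FaceAdj (x y : α) : Prop := ∃ Z, Z ≠ ⊤ ∧ x ≤ Z ∧ y ≤ Z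

theorem FaceAdj.symm {x y : α} : FaceAdj x y → FaceAdj y x := fun ⟨Z, h, hx, hy⟩ => ⟨Z, h, hy, hx⟩

/-- Connectedness with respect to `FaceAdj`. -/
def Conn (I : Set α) : Prop :=
  ∀ X ⊆ I, X.Nonempty → (I \ X).Nonempty → ∃ x ∈ X, ∃ y ∈ I \ X, FaceAdj x y

/-- Below `X` there is a cover of `w` of rank less than `k`. -/
def Early (w : α) (ρ : α → ℝ) (X : α) (k : ℝ) : Prop := ∃ e, w ⋖ e ∧ ρ e < k ∧ e ≤ X

/-- A description of `RShell` in rank three: at each cover `e` of `w`, the covers of `e` that lie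
over an earlier cover of `w` are connected, and they are found in each element over `e` that lies
over an earlier cover. -/
structure LinkShell (w : α) (ρ : α → ℝ) : Prop where
  fin : {e | w ⋖ e}.Finite
  inj : InjOn ρ {e | w ⋖ e}
  conn : ∀ e, w ⋖ e → Conn {K | e ⋖ K}
  conn_early : ∀ e, w ⋖ e → Conn {K | e ⋖ K ∧ Early w ρ K (ρ e)}
  reach : ∀ e X, w ⋖ e → e ≤ X → Early w ρ X (ρ e) → ∃ K, e ⋖ K ∧ K ≤ X ∧ Early w ρ K (ρ e)

theorem CovBy.eq_of_le' {α : Type*} [PartialOrder α] {w x y : α} (hx : w ⋖ x) (hy : w ⋖ y) (h : x ≤ y) : x = y :=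
  h.eq_of_not_lt fun hlt => hy.2 hx.1 hlt

theorem Conn.of_covers_empty {I : Set α} (h : I = ∅) : Conn I := by
  rintro X hX ⟨x, hx⟩
  rw [h] at hX
  exact absurd (hX hx) (notMem_empty x)

/-- In a shelling each element but the first is adjacent to an earlier one, so every beginning part
`p` of the order is connected: of two complementary parts take the one without the first element,
and in it the earliest element. -/
theorem RShell.conn {e : α} {κ : α → ℝ} (h : RShell e κ) (hdeep : ∀ K, e ⋖ K → ∃ Z, K < Z ∧ Z < ⊤)
    {p : α → Prop} (hp : ∀ K K', e ⋖ K → e ⋖ K' → p K → κ K' < κ K → p K') :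
    Conn {K | e ⋖ K ∧ p K} := by
  cases h with
  | points _ _ fin inj small =>
    refine Conn.of_covers_empty (eq_empty_iff_forall_notMem.2 ?_)
    rintro K ⟨hK, -⟩
    obtain ⟨Z, h1, h2⟩ := hdeep K hK
    exact small K hK Z ⊤ h1 h2
  | step _ _ fin inj κ' t sh seg =>
    set I := {K | e ⋖ K ∧ p K} with hI
    have hIfin : I.Finite := fin.subset fun K hK => hK.1
    -- the first element of a part that does not contain the first element of `I`
    have key : ∀ X ⊆ I, X.Nonempty → ∀ m ∈ I, (∀ x ∈ I, κ m ≤ κ x) → m ∉ X →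
        ∃ x ∈ X, ∃ y ∈ I \ X, FaceAdj x y := by
      intro X hX hXne m hm hmin hmX
      obtain ⟨x, hx, hxmin⟩ := exists_min_image X κ (hIfin.subset hX) hXne
      have hxI := hX hx
      have hmx : κ m < κ x := lt_of_le_of_ne (hmin x hxI) fun h =>
        hmX (inj hm.1 hxI.1 h ▸ hx)
      -- The condition at `⊤`, dually the empty face, provides a member `Y` of the initial segment
      -- over `x`. The condition at `Y` then provides an earlier element below `Y`.
      obtain ⟨Y, hY, hYt, -⟩ := (seg x ⊤ hxI.1 le_top).1 ⟨m, hm.1, hmx, le_top⟩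
      obtain ⟨y, hy, hyx, hyY⟩ := (seg x Y hxI.1 hY.le).2 ⟨Y, hY, hYt, le_rfl⟩
      refine ⟨x, hx, y, ⟨⟨hy, hp x y hxI.1 hy hxI.2 hyx⟩, fun hyX => ?_⟩, Y, ?_, hY.le, hyY⟩
      · exact (hxmin y hyX).not_gt hyx
      · rintro rfl
        obtain ⟨Z, h1, h2⟩ := hdeep x hxI.1
        exact hY.2 h1 h2
    intro X hX hXne hYne
    obtain ⟨m, hm, hmin⟩ := exists_min_image I κ hIfin (hXne.mono hX)
    by_cases hmX : m ∈ X
    · obtain ⟨x, hx, y, hy, hxy⟩ := key (I \ X) sdiff_subset hYne m hm hmin fun h => h.2 hmX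
      refine ⟨y, ?_, x, hx, hxy.symm⟩
      by_contra hyX
      exact hy.2 ⟨hy.1, hyX⟩
    · exact key X hX hXne m hm hmin hmX

/-- The initial segment of the shelling over `e` consists of the early covers of `e`, so
`RShell.conn` applies to it. The field `reach` is one direction of the condition on segments. -/
theorem RShell.linkShell [IsStronglyAtomic α] {w : α} {ρ : α → ℝ} (h : RShell w ρ)
    (hdeep : ∀ e K, w ⋖ e → e ⋖ K → ∃ Z, K < Z ∧ Z < ⊤) : LinkShell w ρ := by
  cases h with
  | points _ _ fin inj small =>
    have hno : ∀ e, w ⋖ e → ∀ K, ¬ e ⋖ K := fun e he K hK => by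
      obtain ⟨Z, h1, h2⟩ := hdeep e K he hK
      exact small e he K Z hK.1 h1
    refine ⟨fin, inj, fun e he => Conn.of_covers_empty ?_, fun e he => Conn.of_covers_empty ?_, ?_⟩
    · exact eq_empty_iff_forall_notMem.2 fun K hK => hno e he K hK
    · exact eq_empty_iff_forall_notMem.2 fun K hK => hno e he K hK.1
    · rintro e X he heX ⟨e', he', hlt, hle⟩
      have : e < X := lt_of_le_of_ne heX (by
        rintro rfl
        rw [CovBy.eq_of_le' he' he hle] at hlt
        exact lt_irrefl _ hlt)
      obtain ⟨K, hK, -⟩ := exists_covBy_le_of_lt this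
      exact absurd hK (hno e he K)
  | step _ _ fin inj κ t sh seg =>
    have hseg : ∀ e K, w ⋖ e → e ⋖ K → (Early w ρ K (ρ e) ↔ κ e K < t e) := by
      intro e K he hK
      rw [Early, seg e K he hK.le]
      constructor
      · rintro ⟨H, hH, hHt, hHK⟩
        rwa [CovBy.eq_of_le' hH hK hHK] at hHt
      · exact fun h => ⟨K, hK, h, le_rfl⟩
    refine ⟨fin, inj, fun e he => ?_, fun e he => ?_, fun e X he heX hX => ?_⟩
    · simpa using (sh e he).conn (hdeep e · he) (p := fun _ => True) (by simp)
    · refine (sh e he).conn (hdeep e · he) fun K K' hK hK' h hlt => ?_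
      rw [hseg e K he hK] at h
      rw [hseg e K' he hK']
      exact hlt.trans h
    · obtain ⟨K, hK, hKt, hKX⟩ := (seg e X he heX).1 hX
      exact ⟨K, hK, hKX, (hseg e K he hK).2 hKt⟩

/-- A numbering of `C` in which each element but the first is adjacent to an earlier one. -/
def ConnOrder (C : Finset α) (κ : α → ℕ) : Prop :=
  InjOn κ C ∧ (∀ K ∈ C, κ K < C.card) ∧
    ∀ K ∈ C, (∃ K' ∈ C, κ K' < κ K) → ∃ K' ∈ C, κ K' < κ K ∧ FaceAdj K K'

/-- A greedy choice: as long as `C` is not all of `B`, connectedness yields an element outside `C`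
that is adjacent to one inside, and it receives the next number. -/
theorem ConnOrder.extend [DecidableEq α] {B : Finset α} (hB : Conn (B : Set α)) (n : ℕ) :
    ∀ (C : Finset α) (κ : α → ℕ), C ⊆ B → (B \ C).card = n → ConnOrder C κ →
      ∃ κ', ConnOrder B κ' ∧ (∀ K ∈ C, κ' K = κ K) ∧ ∀ K ∈ B \ C, C.card ≤ κ' K := by
  induction n with
  | zero =>
    intro C κ hCB hn hκ
    rw [Finset.card_eq_zero, Finset.sdiff_eq_empty_iff_subset] at hn
    obtain rfl := Finset.Subset.antisymm hCB hn
    exact ⟨κ, hκ, fun _ _ => rfl, by simp⟩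
  | succ n ih =>
    intro C κ hCB hn hκ
    have hne : (B \ C).Nonempty := Finset.card_pos.1 (by omega)
    obtain ⟨y, hy, hadj⟩ : ∃ y ∈ B \ C, C.Nonempty → ∃ x ∈ C, FaceAdj x y := by
      rcases C.eq_empty_or_nonempty with rfl | hC
      · obtain ⟨y, hy⟩ := hne
        exact ⟨y, hy, fun h => absurd h Finset.not_nonempty_empty⟩
      · obtain ⟨x, hx, y, hy, hxy⟩ := hB C (by exact_mod_cast hCB) hC (by exact_mod_cast hne)
        exact ⟨y, by exact_mod_cast hy, fun _ => ⟨x, hx, hxy⟩⟩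
    obtain ⟨hyB, hyC⟩ := Finset.mem_sdiff.1 hy
    obtain ⟨h1, h2, h3⟩ := hκ
    have hupd : ∀ K ∈ C, Function.update κ y C.card K = κ K := fun K hK =>
      Function.update_of_ne (fun h : K = y => hyC (h ▸ hK)) _ _
    have hord : ConnOrder (insert y C) (Function.update κ y C.card) := by
      refine ⟨?_, ?_, ?_⟩
      · rw [Finset.coe_insert, injOn_insert (by exact_mod_cast hyC)]
        refine ⟨fun a ha b hb hab => h1 ha hb ?_, ?_⟩
        · rwa [hupd a ha, hupd b hb] at hab
        · rintro ⟨a, ha, hay⟩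
          rw [hupd a ha, Function.update_self] at hay
          exact (h2 a ha).ne hay
      · intro K hK
        rw [Finset.card_insert_of_notMem hyC]
        rcases Finset.mem_insert.1 hK with rfl | hK
        · rw [Function.update_self]; omega
        · rw [hupd K hK]; have := h2 K hK; omega
      · rintro K hK ⟨K', hK', hlt⟩
        rcases Finset.mem_insert.1 hK with rfl | hKC
        · rcases Finset.mem_insert.1 hK' with rfl | hK'
          · exact absurd hlt (lt_irrefl _)
          · obtain ⟨x, hx, hxy⟩ := hadj ⟨K', hK'⟩
            refine ⟨x, Finset.mem_insert_of_mem hx, ?_, hxy.symm⟩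
            rw [hupd x hx, Function.update_self]
            exact h2 x hx
        · rw [hupd K hKC] at hlt ⊢
          have hK'C : K' ∈ C := by
            rcases Finset.mem_insert.1 hK' with rfl | hK'
            · rw [Function.update_self] at hlt
              exact absurd (h2 K hKC) hlt.not_gt
            · exact hK'
          rw [hupd K' hK'C] at hlt
          obtain ⟨x, hx, hxK, hadjx⟩ := h3 K hKC ⟨K', hK'C, hlt⟩
          exact ⟨x, Finset.mem_insert_of_mem hx, by rwa [hupd x hx], hadjx⟩
    obtain ⟨κ', hκ', hag, hge⟩ := ih (insert y C) _ (Finset.insert_subset hyB hCB) (by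
      rw [Finset.sdiff_insert, Finset.card_erase_of_mem hy]; omega) hord
    refine ⟨κ', hκ', fun K hK => ?_, fun K hK => ?_⟩
    · rw [hag K (Finset.mem_insert_of_mem hK), hupd K hK]
    · by_cases hKy : K = y
      · rw [hKy, hag y (Finset.mem_insert_self y C), Function.update_self]
      · have := hge K (by
          rw [Finset.mem_sdiff, Finset.mem_insert, not_or]
          exact ⟨(Finset.mem_sdiff.1 hK).1, hKy, (Finset.mem_sdiff.1 hK).2⟩)
        rw [Finset.card_insert_of_notMem hyC] at this
        omega

/-- Numbering `B` first and then extending to `A` makes `B` an initial segment. -/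
theorem exists_connOrder {A B : Set α} (hA : A.Finite) (hBA : B ⊆ A) (hcA : Conn A)
    (hcB : Conn B) : ∃ (κ : α → ℝ) (t : ℝ), InjOn κ A ∧ (∀ K ∈ A, κ K < t ↔ K ∈ B) ∧
      ∀ K ∈ A, (∃ K' ∈ A, κ K' < κ K) → ∃ K' ∈ A, κ K' < κ K ∧ FaceAdj K K' := by
  classical
  lift A to Finset α using hA
  lift B to Finset α using A.finite_toSet.subset hBA
  obtain ⟨κ₁, h1, -, -⟩ := ConnOrder.extend hcB _ ∅ (fun _ => 0) (by simp) rfl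
    ⟨by simp, by simp, by simp⟩
  obtain ⟨κ, ⟨h2, h3, h4⟩, h5, h6⟩ := ConnOrder.extend hcA _ B κ₁ (by exact_mod_cast hBA) rfl h1
  refine ⟨fun K => κ K, B.card, fun a ha b hb hab => h2 ha hb (Nat.cast_injective hab),
    fun K hK => ?_, fun K hK hK' => ?_⟩
  · rw [Nat.cast_lt]
    constructor
    · intro hlt
      by_contra hKB
      exact (h6 K (Finset.mem_sdiff.2 ⟨hK, hKB⟩)).not_gt hlt
    · intro hKB
      rw [h5 K hKB]
      exact h1.2.1 K hKB
  · simp only [Nat.cast_lt] at hK' ⊢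
    exact h4 K hK hK'

/-- Dually `w` is a 3-polytope, `e` one of its facets, `K` an edge of this polygon, and the elements
between `K` and `⊤` are the endpoints of `K`. A polygon is shelled by an order of its edges in which
each but the first meets an earlier one, and an edge is shelled by any order of its endpoints. -/
theorem LinkShell.rshell [Finite α] {w : α} {ρ : α → ℝ} (h : LinkShell w ρ)
    (hco : ∀ e K Z, w ⋖ e → e ⋖ K → K < Z → Z < ⊤ → K ⋖ Z) : RShell w ρ := by
  classical
  have := Fintype.ofFinite α
  have hord : ∀ e, ∃ (κ : α → ℝ) (t : ℝ), w ⋖ e → InjOn κ {K | e ⋖ K} ∧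
      (∀ K, e ⋖ K → (κ K < t ↔ Early w ρ K (ρ e))) ∧
      ∀ K, e ⋖ K → (∃ K', e ⋖ K' ∧ κ K' < κ K) → ∃ K', e ⋖ K' ∧ κ K' < κ K ∧ FaceAdj K K' := by
    intro e
    by_cases he : w ⋖ e
    · obtain ⟨κ, t, h1, h2, h3⟩ := exists_connOrder (A := {K | e ⋖ K})
        (B := {K | e ⋖ K ∧ Early w ρ K (ρ e)}) (toFinite _) (fun K hK => hK.1) (h.conn e he)
        (h.conn_early e he)
      refine ⟨κ, t, fun _ => ⟨h1, fun K hK => ?_, h3⟩⟩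
      rw [h2 K hK]
      exact and_iff_right hK
    · exact ⟨0, 0, fun h => absurd h he⟩
  choose κ t hκ using hord
  refine .step w ρ h.fin h.inj κ t (fun e he => ?_) fun e X he heX => ?_
  · obtain ⟨h1, -, h3⟩ := hκ e he
    let idx : α → ℝ := fun b => (Fintype.equivFin α b : ℕ)
    have hidx0 : ∀ b, 0 ≤ idx b := fun b => Nat.cast_nonneg _
    have hidx : ∀ b, idx b < Fintype.card α := fun b => Nat.cast_lt.2 (Fintype.equivFin α b).2
    have hinj : Function.Injective idx := fun a b hab =>
      (Fintype.equivFin α).injective (Fin.ext (Nat.cast_injective hab))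
    let q : α → α → Prop := fun K b => ∃ K', e ⋖ K' ∧ κ e K' < κ e K ∧ K' ≤ b
    -- Adding the cardinality puts the endpoints that lie on no earlier edge behind the others.
    let κ₂ : α → α → ℝ := fun K b => if q K b then idx b else Fintype.card α + idx b
    have hq : ∀ K b, κ₂ K b < Fintype.card α ↔ q K b := by
      intro K b
      by_cases hb : q K b
      · simp only [κ₂, if_pos hb, hb, hidx b]
      · simp only [κ₂, if_neg hb, hb, iff_false, not_lt]
        linarith [hidx0 b]
    refine .step e (κ e) (toFinite _) h1 κ₂ (fun _ => Fintype.card α) (fun K hK => ?_)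
      fun K X hK hKX => ?_
    · refine .points K _ (toFinite _) ?_ fun b hb x y hbx hxy => ?_
      · intro a _ b _ hab
        by_cases ha : q K a <;> by_cases hb : q K b
        · simp only [κ₂, if_pos ha, if_pos hb] at hab
          exact hinj hab
        · simp only [κ₂, if_pos ha, if_neg hb] at hab
          linarith [hidx a, hidx0 b]
        · simp only [κ₂, if_neg ha, if_pos hb] at hab
          linarith [hidx b, hidx0 a]
        · simp only [κ₂, if_neg ha, if_neg hb] at hab
          exact hinj (add_left_cancel hab)
      · exact (hco e K x he hK (hb.1.trans hbx) (hxy.trans_le le_top)).2 hb.1 hbx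
    · simp only [hq]
      constructor
      · rintro ⟨K', hK', hlt, hle⟩
        -- At `⊤` connectedness has to supply a common endpoint; any other `X` over `K` and an
        -- earlier edge is one already.
        by_cases hX : X = ⊤
        · subst hX
          obtain ⟨K'', hK'', hlt'', Z, hZ, hKZ, hK''Z⟩ := h3 K hK ⟨K', hK', hlt⟩
          have hKZ' : K < Z := lt_of_le_of_ne hKZ (by
            rintro rfl
            rw [CovBy.eq_of_le' hK'' hK hK''Z] at hlt''
            exact lt_irrefl _ hlt'')
          exact ⟨Z, hco e K Z he hK hKZ' (lt_top_iff_ne_top.2 hZ), ⟨K'', hK'', hlt'', hK''Z⟩,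
            le_top⟩
        · have hKX' : K < X := lt_of_le_of_ne hKX (by
            rintro rfl
            rw [CovBy.eq_of_le' hK' hK hle] at hlt
            exact lt_irrefl _ hlt)
          exact ⟨X, hco e K X he hK hKX' (lt_top_iff_ne_top.2 hX), ⟨K', hK', hlt, hle⟩, le_rfl⟩
      · rintro ⟨b, -, ⟨K', hK', hlt, hle⟩, hbX⟩
        exact ⟨K', hK', hlt, hle.trans hbX⟩
  · obtain ⟨-, h2, -⟩ := hκ e he
    constructor
    · intro hX
      obtain ⟨K, hK, hKX, hearly⟩ := h.reach e X he heX hX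
      exact ⟨K, hK, (h2 K hK).2 hearly, hKX⟩
    · rintro ⟨K, hK, hKt, hKX⟩
      obtain ⟨e', he', hlt, hle⟩ := (h2 K hK).1 hKt
      exact ⟨e', he', hlt, hle.trans hKX⟩

end LinkShell

end Polytopal

namespace Polytopal
open Set

/-! ### Transfer of connectivity, and the place of the edge that is cut off. -/

variable {α β : Type*} [PartialOrder α] [OrderTop α] [PartialOrder β] [OrderTop β]

/-- The relation is a map of `I'` onto `I` under which adjacent elements with different images have
adjacent images, so the preimage of a separating part would separate `I'`. -/
theorem Conn.of_rel {I' : Set β} {I : Set α} (h : Conn I') (r : β → α → Prop)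
    (h1 : ∀ K ∈ I', ∃ x ∈ I, r K x) (h2 : ∀ x ∈ I, ∃ K ∈ I', r K x)
    (hf : ∀ K ∈ I', ∀ x y, r K x → r K y → x = y)
    (hadj : ∀ K ∈ I', ∀ K' ∈ I', ∀ x ∈ I, ∀ y ∈ I, r K x → r K' y → x ≠ y → FaceAdj K K' →
      FaceAdj x y) : Conn I := by
  rintro X hX ⟨x, hx⟩ ⟨y, hy⟩
  obtain ⟨K, hK, hKx⟩ := h2 x (hX hx)
  obtain ⟨K', hK', hKy⟩ := h2 y hy.1
  obtain ⟨K₁, ⟨hK₁, x₁, hx₁, hr₁⟩, K₂, ⟨hK₂, hK₂X⟩, hadj'⟩ :=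
    h {K | K ∈ I' ∧ ∃ x ∈ X, r K x} (fun K hK => hK.1) ⟨K, hK, x, hx, hKx⟩ ⟨K', hK', by
      rintro ⟨-, x', hx', hr⟩
      exact hy.2 (hf K' hK' x' y hr hKy ▸ hx')⟩
  obtain ⟨x₂, hx₂, hr₂⟩ := h1 K₂ hK₂
  have hx₂X : x₂ ∉ X := fun h => hK₂X ⟨hK₂, x₂, h, hr₂⟩
  refine ⟨x₁, hx₁, x₂, ⟨hx₂, hx₂X⟩, hadj K₁ hK₁ K₂ hK₂ x₁ (hX hx₁) x₂ hx₂ hr₁ hr₂ ?_ hadj'⟩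
  rintro rfl
  exact hx₂X hx₁

theorem Conn.insert {I : Set α} (h : Conn I) {x y : α} (hy : y ∈ I) (hxy : FaceAdj x y) :
    Conn (insert x I) := by
  intro X hX hXne hYne
  by_cases hxI : x ∈ I
  · rw [insert_eq_of_mem hxI] at *
    exact h X hX hXne hYne
  by_cases hxX : x ∈ X
  · by_cases hyX : y ∈ X
    · obtain ⟨p, hp, hpX⟩ := hYne
      have hpI : p ∈ I := hp.resolve_left fun h => hpX (h ▸ hxX)
      obtain ⟨a, ha, b, hb, hab⟩ := h (X ∩ I) inter_subset_right ⟨y, hyX, hy⟩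
        ⟨p, hpI, fun h => hpX h.1⟩
      exact ⟨a, ha.1, b, ⟨Or.inr hb.1, fun h => hb.2 ⟨h, hb.1⟩⟩, hab⟩
    · exact ⟨x, hxX, y, ⟨Or.inr hy, hyX⟩, hxy⟩
  · have hXI : X ⊆ I := fun p hp => (hX hp).resolve_left fun h => hxX (h ▸ hp)
    by_cases hyX : y ∈ X
    · exact ⟨y, hyX, x, ⟨Or.inl rfl, hxX⟩, hxy.symm⟩
    · obtain ⟨a, ha, b, hb, hab⟩ := h X hXI hXne ⟨y, hy, hyX⟩
      exact ⟨a, ha, b, ⟨Or.inr hb.1, hb.2⟩, hab⟩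

/-- If the neighbours of `x` are adjacent to each other, any passage through `x` can be bypassed. -/
theorem Conn.erase {I : Set α} (h : Conn I) {x : α} (hx : x ∈ I)
    (hadj : ∀ y ∈ I, ∀ y' ∈ I, y ≠ x → y' ≠ x → FaceAdj x y → FaceAdj x y' → FaceAdj y y') :
    Conn (I \ {x}) := by
  intro X hX hXne hYne
  by_contra hcon
  push Not at hcon
  have hxX : x ∉ X := fun h => (hX h).2 rfl
  obtain ⟨a, ha, b, hb, hab⟩ := h X (hX.trans sdiff_subset) hXne ⟨x, hx, hxX⟩
  have hbx : b = x := by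
    by_contra hbx
    exact hcon a ha b ⟨⟨hb.1, hbx⟩, hb.2⟩ hab
  subst hbx
  obtain ⟨p, hp, hpX⟩ := hYne
  obtain ⟨c, hc, e, he, hce⟩ := h (Insert.insert b X)
    (insert_subset hx (hX.trans sdiff_subset)) ⟨b, Or.inl rfl⟩
    ⟨p, hp.1, by rintro (h | h); exacts [hp.2 h, hpX h]⟩
  have heb : e ≠ b := fun h => he.2 (Or.inl h)
  have heX : e ∉ X := fun h => he.2 (Or.inr h)
  rcases hc with rfl | hc
  · exact hcon a ha e ⟨⟨he.1, heb⟩, heX⟩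
      (hadj a (hX ha).1 e he.1 (hX ha).2 heb hab.symm hce)
  · exact hcon c hc e ⟨⟨he.1, heb⟩, heX⟩ hce

theorem Conn.of_pairwise {I : Set α} (h : ∀ x ∈ I, ∀ y ∈ I, FaceAdj x y) : Conn I :=
  fun _ hX ⟨x, hx⟩ ⟨y, hy⟩ => ⟨x, hx, y, hy, h x (hX hx) y hy.1⟩

/-- How the faces over a vertex `w` of the cutting hyperplane change in a truncation. `Ev` is the
edge from `w` to the vertex that is cut off, `H i` are the 2-faces and `F i` the facets that
contain it. `N` maps the faces to their remaining parts, `Good` are the faces that are cut properly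
or not at all. The new edges at `w` are `z i`, the new 2-faces are `T i`; possibly `z i` is also an
old edge, and then `H i` is a triangle. -/
structure CornerLink (w : α) (w' : β) (N : α → β) (Good : α → Prop) (Ev : α) (H F : Fin 3 → α)
    (z T : Fin 3 → β) : Prop where
  ev : w ⋖ Ev
  ev_covBy : ∀ K, Ev ⋖ K ↔ ∃ i, K = H i
  H_le_F : ∀ i j, H i ≤ F j ↔ i ≠ j
  F_ne_top : ∀ j, F j ≠ ⊤
  F_le : ∀ i j k X, i ≠ j → i ≠ k → j ≠ k → H i ≤ X → H j ≤ X → F k ≤ X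
  le_H : ∀ X i, Ev < X → (∀ j, H j ≤ X → j = i) → X ≤ H i
  H_le_of_edges : ∀ e X i, w ⋖ e → e ≠ Ev → e ≤ H i → e ≤ X → Ev ≤ X → H i ≤ X
  edge_unique : ∀ e i j, w ⋖ e → e ≠ Ev → e ≤ H i → e ≤ H j → i = j
  covBy_of_le : ∀ e e' K, w ⋖ e → e ⋖ K → w ⋖ e' → e' ≤ K → e' ⋖ K
  coatom : ∀ e K Z, w ⋖ e → e ⋖ K → K < Z → Z < ⊤ → K ⋖ Z
  mono : ∀ X Y, X ≤ Y → N X ≤ N Y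
  map_top : N ⊤ = ⊤
  good_mono : ∀ X Y, X ≤ Y → Good X → Good Y
  good_le : ∀ X Y, Good X → N X ≤ N Y → X ≤ Y
  good_exists : ∀ X Z, Good X → N X ≤ Z → ∃ Y, X ≤ Y ∧ Z = N Y
  edge_le : ∀ e X, w ⋖ e → e ≠ Ev → N e ≤ N X → e ≤ X
  good_or : ∀ e, w ⋖ e → e ≠ Ev → Good e ∨ ∃ i, N e = z i
  good_ne : ∀ e i, Good e → N e ≠ z i
  special : ∀ e i, w ⋖ e → e ≠ Ev → N e = z i → i = 0 ∧ e ≤ H i ∧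
    (∀ e', w ⋖ e' → e' ≠ Ev → e' ≤ H i → e' = e) ∧ ¬ Good (H i) ∧ ∀ K, e ⋖ K → K = H i ∨ Good K
  covBy_iff : ∀ K, w' ⋖ K ↔ (∃ i, K = z i) ∨ ∃ e, w ⋖ e ∧ e ≠ Ev ∧ K = N e
  z_inj : ∀ i j, z i = z j → i = j
  z_le : ∀ i X, z i ≤ N X ↔ H i ≤ X ∨ ∃ e, w ⋖ e ∧ e ≠ Ev ∧ N e = z i ∧ e ≤ X
  z_le_T : ∀ i j, z i ≤ T j ↔ i ≠ j
  of_le_T : ∀ K j, w' ⋖ K → K ≤ T j → ∃ i, K = z i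
  T_le : ∀ i j X, T j ≤ N X → i ≠ j → H i ≤ X
  z_covBy_T : ∀ i j, i ≠ j → z i ⋖ T j
  z_covBy : ∀ i K, z i ⋖ K → (∀ e, w ⋖ e → e ≠ Ev → N e ≠ z i) →
    K = N (H i) ∨ ∃ j, i ≠ j ∧ K = T j
  edge_covBy : ∀ i e K, w ⋖ e → e ≠ Ev → N e = z i →
    (z i ⋖ K ↔ (∃ X, e ⋖ X ∧ Good X ∧ K = N X) ∨ ∃ j, i ≠ j ∧ K = T j)

/-- Below `X` there is an old edge other than `Ev` of rank less than `k`. -/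
def OldEarly (w Ev : α) (N : α → β) (ρ : β → ℝ) (X : α) (k : ℝ) : Prop :=
  ∃ e, w ⋖ e ∧ e ≠ Ev ∧ ρ (N e) < k ∧ e ≤ X

/-- A possible position `p` of `Ev` in the order of the edges: about the median of the positions of
the edges `z i`. -/
structure Placement (w Ev : α) (N : α → β) (Good : α → Prop) (H : Fin 3 → α) (z : Fin 3 → β)
    (ρ : β → ℝ) (a b c : Fin 3) (p : ℝ) : Prop where
  all : ∀ i, i = a ∨ i = b ∨ i = c
  ab : ρ (z a) < ρ (z b)
  bc : ρ (z b) < ρ (z c)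
  ap : ρ (z a) < p
  pc : p < ρ (z c)
  ne : ∀ e, w ⋖ e → e ≠ Ev → ρ (N e) ≠ p
  good : ∀ e, w ⋖ e → e ≠ Ev → Good e → (p < ρ (N e) ↔ ρ (z b) < ρ (N e)) ∧
    (ρ (N e) < p ↔ ρ (N e) < ρ (z b))
  side : ∀ e, w ⋖ e → e ≠ Ev → N e = z b →
    (p < ρ (z b) ∧ ∀ X, H b ≤ X → H c ≤ X → ¬ H a ≤ X → ¬ OldEarly w Ev N ρ X (ρ (z b))) ∨
    (ρ (z b) < p ∧ ∃ X, H b ≤ X ∧ ¬ H a ≤ X ∧ OldEarly w Ev N ρ X (ρ (z b)))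

theorem exists_gap {A : Set ℝ} (hA : A.Finite) (x : ℝ) :
    ∃ δ > 0, ∀ y ∈ A, y ≠ x → δ < |y - x| := by
  rcases (A \ {x}).eq_empty_or_nonempty with h | h
  · refine ⟨1, one_pos, fun y hy hyx => ?_⟩
    have : y ∈ A \ {x} := ⟨hy, hyx⟩
    rw [h] at this
    exact absurd this (notMem_empty y)
  · obtain ⟨m, hm, hmin⟩ := exists_min_image (A \ {x}) (fun y => |y - x|)
      (hA.subset sdiff_subset) h
    have hpos : 0 < |m - x| := abs_pos.2 (sub_ne_zero.2 hm.2)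
    refine ⟨|m - x| / 2, by positivity, fun y hy hyx => ?_⟩
    have : |m - x| ≤ |y - x| := hmin y ⟨hy, hyx⟩
    linarith

theorem exists_sorted_three {t : Fin 3 → ℝ} (ht : Function.Injective t) :
    ∃ a b c : Fin 3, (∀ i, i = a ∨ i = b ∨ i = c) ∧ t a < t b ∧ t b < t c := by
  have h01 : t 0 ≠ t 1 := fun h => absurd (ht h) (by decide)
  have h02 : t 0 ≠ t 2 := fun h => absurd (ht h) (by decide)
  have h12 : t 1 ≠ t 2 := fun h => absurd (ht h) (by decide)
  rcases lt_or_gt_of_ne h01 with h01 | h01 <;> rcases lt_or_gt_of_ne h02 with h02 | h02 <;>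
    rcases lt_or_gt_of_ne h12 with h12 | h12
  · exact ⟨0, 1, 2, by decide, h01, h12⟩
  · exact ⟨0, 2, 1, by decide, h02, h12⟩
  · exact absurd (h01.trans h12) h02.not_gt
  · exact ⟨2, 0, 1, by decide, h02, h01⟩
  · exact ⟨1, 0, 2, by decide, h01, h02⟩
  · exact absurd (h02.trans h12) h01.not_gt
  · exact ⟨1, 2, 0, by decide, h12, h02⟩
  · exact ⟨2, 1, 0, by decide, h12, h01⟩

namespace CornerLink

variable {w : α} {w' : β} {N : α → β} {Good : α → Prop} {Ev : α} {H F : Fin 3 → α}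
  {z T : Fin 3 → β} {ρ : β → ℝ}

theorem z_cover (L : CornerLink w w' N Good Ev H F z T) (i : Fin 3) : w' ⋖ z i :=
  (L.covBy_iff _).2 (Or.inl ⟨i, rfl⟩)

theorem edge_cover (L : CornerLink w w' N Good Ev H F z T) {e : α} (he : w ⋖ e) (hev : e ≠ Ev) :
    w' ⋖ N e :=
  (L.covBy_iff _).2 (Or.inr ⟨e, he, hev, rfl⟩)

theorem edge_inj (L : CornerLink w w' N Good Ev H F z T) {e e' : α} (he : w ⋖ e) (hev : e ≠ Ev)
    (he' : w ⋖ e') (h : N e = N e') : e = e' :=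
  CovBy.eq_of_le' he he' (L.edge_le e e' he hev h.le)

/-- If the median new edge `z b` is not an old edge, its rank can be reused. Otherwise `Ev` goes
right before or right after it, with no other edge in between: after it exactly if some face over `H
b` but not over `H a` has an old edge before `z b`. For the bound, note that the median is at least
`t` if two of the three are. If `z b` is old, then `b = 0`, so even the first new edge `z a` is at
least `t`, and the place before the median is safe too. -/
theorem exists_placement (L : CornerLink w w' N Good Ev H F z T) (S : LinkShell w' ρ) :
    ∃ a b c p, Placement w Ev N Good H z ρ a b c p ∧
      ∀ t, (∀ i, i ≠ 0 → t ≤ ρ (z i)) → t ≤ p := by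
  have hinj : Function.Injective fun i => ρ (z i) := fun i j hij =>
    L.z_inj i j (S.inj (L.z_cover i) (L.z_cover j) hij)
  obtain ⟨a, b, c, hall, hab, hbc⟩ := exists_sorted_three hinj
  have htb : ∀ t, (∀ i, i ≠ 0 → t ≤ ρ (z i)) → t ≤ ρ (z b) := by
    intro t ht
    by_cases hb : b = 0
    · have ha : a ≠ 0 := by
        rintro rfl
        rw [hb] at hab
        exact lt_irrefl _ hab
      exact (ht a ha).trans hab.le
    · exact ht b hb
  by_cases hy : ∃ y, w ⋖ y ∧ y ≠ Ev ∧ N y = z b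
  · obtain ⟨y, hy, hyev, hyz⟩ := hy
    obtain ⟨δ, hδ, hgap⟩ := exists_gap (S.fin.image ρ) (ρ (z b))
    have hgap' : ∀ K, w' ⋖ K → ρ K ≠ ρ (z b) → δ < |ρ K - ρ (z b)| := fun K hK =>
      hgap _ ⟨K, hK, rfl⟩
    have hga := hgap' _ (L.z_cover a) hab.ne
    have hgc := hgap' _ (L.z_cover c) hbc.ne'
    rw [abs_sub_comm, abs_of_pos (by linarith)] at hga
    rw [abs_of_pos (by linarith)] at hgc
    have hreal : ∀ e, w ⋖ e → e ≠ Ev → ρ (N e) ≠ ρ (z b) →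
        ρ (N e) < ρ (z b) - δ ∨ ρ (z b) + δ < ρ (N e) := by
      intro e he hev hne
      have h1 := hgap' _ (L.edge_cover he hev) hne
      rcases lt_abs.1 h1 with h2 | h2
      · right; linarith
      · left; linarith
    have hgne : ∀ e, w ⋖ e → e ≠ Ev → Good e → ρ (N e) ≠ ρ (z b) := fun e he hev hg heq =>
      L.good_ne e b hg (S.inj (L.edge_cover he hev) (L.z_cover b) heq)
    by_cases hX : ∃ X, H b ≤ X ∧ ¬ H a ≤ X ∧ OldEarly w Ev N ρ X (ρ (z b))
    · refine ⟨a, b, c, ρ (z b) + δ, ⟨hall, hab, hbc, by linarith, by linarith, ?_, ?_, ?_⟩,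
        fun t ht => by linarith [htb t ht]⟩
      · intro e he hev heq
        rcases hreal e he hev (by rw [heq]; linarith) with h | h <;> linarith
      · intro e he hev hg
        rcases hreal e he hev (hgne e he hev hg) with h | h <;>
          constructor <;> constructor <;> intro h' <;> linarith
      · exact fun e _ _ _ => Or.inr ⟨by linarith, hX⟩
    · push Not at hX
      refine ⟨a, b, c, ρ (z b) - δ, ⟨hall, hab, hbc, by linarith, by linarith, ?_, ?_, ?_⟩, ?_⟩
      · intro e he hev heq
        rcases hreal e he hev (by rw [heq]; linarith) with h | h <;> linarith
      · intro e he hev hg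
        rcases hreal e he hev (hgne e he hev hg) with h | h <;>
          constructor <;> constructor <;> intro h' <;> linarith
      · exact fun e _ _ _ => Or.inl ⟨by linarith, fun X h1 _ h3 => hX X h1 h3⟩
      · intro t ht
        have hb0 := (L.special y b hy hyev hyz).1
        have ha : a ≠ 0 := by
          rintro rfl
          rw [hb0] at hab
          exact lt_irrefl _ hab
        linarith [ht a ha]
  · push Not at hy
    refine ⟨a, b, c, ρ (z b), ⟨hall, hab, hbc, hab, hbc, ?_, fun _ _ _ _ => ⟨Iff.rfl, Iff.rfl⟩,
      fun e he hev heq => absurd heq (hy e he hev)⟩, htb⟩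
    intro e he hev heq
    exact hy e he hev (S.inj (L.edge_cover he hev) (L.z_cover b) heq)

theorem early_N (L : CornerLink w w' N Good Ev H F z T) {X : α} {k : ℝ} :
    Early w' ρ (N X) k ↔ OldEarly w Ev N ρ X k ∨ ∃ i, H i ≤ X ∧ ρ (z i) < k := by
  constructor
  · rintro ⟨K, hK, hKk, hKX⟩
    rcases (L.covBy_iff K).1 hK with ⟨i, rfl⟩ | ⟨e, he, hev, rfl⟩
    · rcases (L.z_le i X).1 hKX with h | ⟨e, he, hev, heq, heX⟩
      · exact Or.inr ⟨i, h, hKk⟩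
      · exact Or.inl ⟨e, he, hev, heq ▸ hKk, heX⟩
    · exact Or.inl ⟨e, he, hev, hKk, L.edge_le e X he hev hKX⟩
  · rintro (⟨e, he, hev, hk, heX⟩ | ⟨i, hi, hk⟩)
    · exact ⟨N e, L.edge_cover he hev, hk, L.mono _ _ heX⟩
    · exact ⟨z i, L.z_cover i, hk, (L.z_le i X).2 (Or.inl hi)⟩

theorem early_T (L : CornerLink w w' N Good Ev H F z T) {j : Fin 3} {k : ℝ} :
    Early w' ρ (T j) k ↔ ∃ i, i ≠ j ∧ ρ (z i) < k := by
  constructor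
  · rintro ⟨K, hK, hKk, hKT⟩
    obtain ⟨i, rfl⟩ := L.of_le_T K j hK hKT
    exact ⟨i, (L.z_le_T i j).1 hKT, hKk⟩
  · rintro ⟨i, hij, hk⟩
    exact ⟨z i, L.z_cover i, hk, (L.z_le_T i j).2 hij⟩

theorem H_inj (L : CornerLink w w' N Good Ev H F z T) {i j : Fin 3} (h : H i ≤ H j) : i = j := by
  by_contra hij
  have h1 := h.trans ((L.H_le_F j i).2 (Ne.symm hij))
  exact (L.H_le_F i i).1 h1 rfl

theorem ev_le_H (L : CornerLink w w' N Good Ev H F z T) (i : Fin 3) : Ev ⋖ H i :=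
  (L.ev_covBy _).2 ⟨i, rfl⟩

theorem eq_H_of_ev_le (L : CornerLink w w' N Good Ev H F z T) {e K : α} (he : w ⋖ e)
    (heK : e ⋖ K) (h : Ev ≤ K) : ∃ i, K = H i :=
  (L.ev_covBy K).1 (L.covBy_of_le e Ev K he heK L.ev h)

theorem eq_H_of_H_le (L : CornerLink w w' N Good Ev H F z T) {e K : α} (he : w ⋖ e)
    (heK : e ⋖ K) {i : Fin 3} (h : H i ≤ K) : K = H i := by
  obtain ⟨j, rfl⟩ := L.eq_H_of_ev_le he heK ((L.ev_le_H i).le.trans h)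
  rw [L.H_inj h]

/-- Two of the 2-faces at `Ev` generate `F k`, and the ranks leave no room between this facet and
`⊤`. -/
theorem eq_F (L : CornerLink w w' N Good Ev H F z T) {i j k : Fin 3} (hij : i ≠ j) (hik : i ≠ k)
    (hjk : j ≠ k) {X : α} (hi : H i ≤ X) (hj : H j ≤ X) (hX : X ≠ ⊤) : X = F k := by
  have hk := L.F_le i j k X hij hik hjk hi hj
  have h1 : H i < F k := lt_of_le_of_ne ((L.H_le_F i k).2 hik) fun h =>
    hij (L.H_inj (h ▸ (L.H_le_F j k).2 hjk)).symm
  have h2 := L.coatom Ev (H i) X L.ev (L.ev_le_H i) (h1.trans_le hk) (lt_top_iff_ne_top.2 hX)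
  exact (hk.eq_of_not_lt fun h => h2.2 h1 h).symm

/-! #### Old edges that are cut properly or not at all -/

theorem good_covBy (L : CornerLink w w' N Good Ev H F z T) {e K : α} (hg : Good e) (h : e ⋖ K) :
    N e ⋖ N K := by
  refine ⟨lt_of_le_of_ne (L.mono _ _ h.le) fun heq => ?_, fun Z h1 h2 => ?_⟩
  · exact h.1.not_ge (L.good_le K e (L.good_mono _ _ h.le hg) heq.ge)
  · obtain ⟨Y, hY, rfl⟩ := L.good_exists e Z hg h1.le
    refine h.2 (c := Y) (lt_of_le_of_ne hY ?_) (lt_of_le_not_ge ?_ ?_)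
    · rintro rfl; exact lt_irrefl _ h1
    · exact L.good_le Y K (L.good_mono _ _ hY hg) h2.le
    · exact fun hle => h2.not_ge (L.mono _ _ hle)

theorem exists_of_good_covBy (L : CornerLink w w' N Good Ev H F z T) {e : α} {K : β}
    (hg : Good e) (h : N e ⋖ K) : ∃ X, e ⋖ X ∧ K = N X := by
  obtain ⟨X, hX, rfl⟩ := L.good_exists e K hg h.le
  refine ⟨X, ⟨lt_of_le_of_ne hX ?_, fun c h1 h2 => ?_⟩, rfl⟩
  · rintro rfl; exact lt_irrefl _ h.1
  · have hgc := L.good_mono _ _ h1.le hg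
    refine h.2 (c := N c) (lt_of_le_not_ge (L.mono _ _ h1.le) ?_)
      (lt_of_le_not_ge (L.mono _ _ h2.le) ?_)
    · exact fun hle => h1.not_ge (L.good_le c e hgc hle)
    · exact fun hle => h2.not_ge (L.good_le X c (L.good_mono _ _ hX hg) hle)

theorem good_adj (L : CornerLink w w' N Good Ev H F z T) {X Y : α} (hX : Good X) (hY : Good Y)
    (h : FaceAdj (N X) (N Y)) : FaceAdj X Y := by
  obtain ⟨Z, hZ, h1, h2⟩ := h
  obtain ⟨W, hW, rfl⟩ := L.good_exists X Z hX h1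
  refine ⟨W, ?_, hW, L.good_le Y W hY h2⟩
  rintro rfl
  exact hZ L.map_top

theorem good_conn (L : CornerLink w w' N Good Ev H F z T) {e : α} (hg : Good e)
    {p : β → Prop} (h : Conn {K | N e ⋖ K ∧ p K}) : Conn {X | e ⋖ X ∧ p (N X)} := by
  refine h.of_rel (fun K X => e ⋖ X ∧ K = N X) ?_ ?_ ?_ ?_
  · rintro K ⟨hK, hpK⟩
    obtain ⟨X, hX, rfl⟩ := L.exists_of_good_covBy hg hK
    exact ⟨X, ⟨hX, hpK⟩, hX, rfl⟩
  · rintro X ⟨hX, hpX⟩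
    exact ⟨N X, ⟨L.good_covBy hg hX, hpX⟩, hX, rfl⟩
  · rintro K - X Y ⟨hX, rfl⟩ ⟨hY, heq⟩
    exact CovBy.eq_of_le' hX hY (L.good_le X Y (L.good_mono _ _ hX.le hg) heq.le)
  · rintro K - K' - X ⟨hX, -⟩ Y ⟨hY, -⟩ ⟨-, rfl⟩ ⟨-, rfl⟩ - hadj
    exact L.good_adj (L.good_mono _ _ hX.le hg) (L.good_mono _ _ hY.le hg) hadj

theorem good_reach (L : CornerLink w w' N Good Ev H F z T) (S : LinkShell w' ρ) {e X : α}
    (he : w ⋖ e) (hev : e ≠ Ev) (hg : Good e) (heX : e ≤ X)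
    (h : OldEarly w Ev N ρ X (ρ (N e)) ∨ ∃ i, H i ≤ X ∧ ρ (z i) < ρ (N e)) :
    ∃ K, e ⋖ K ∧ K ≤ X ∧ (OldEarly w Ev N ρ K (ρ (N e)) ∨ ∃ i, H i ≤ K ∧ ρ (z i) < ρ (N e)) := by
  obtain ⟨K, hK, hKX, hKe⟩ := S.reach (N e) (N X) (L.edge_cover he hev) (L.mono _ _ heX)
    (L.early_N.2 h)
  obtain ⟨Y, hY, rfl⟩ := L.exists_of_good_covBy hg hK
  exact ⟨Y, hY, L.good_le _ _ (L.good_mono _ _ hY.le hg) hKX, L.early_N.1 hKe⟩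

/-! #### The new edges -/

/-- If the first of the new edges is not an old one, then an earlier old edge can be found in
its 2-face. -/
theorem oldEarly_first (L : CornerLink w w' N Good Ev H F z T) (S : LinkShell w' ρ) {a b c : Fin 3}
    {p : ℝ} (P : Placement w Ev N Good H z ρ a b c p) (ha : ∀ e, w ⋖ e → e ≠ Ev → N e ≠ z a)
    {X : α} (hX : H a ≤ X) (h : OldEarly w Ev N ρ X (ρ (z a))) :
    OldEarly w Ev N ρ (H a) (ρ (z a)) := by
  have hmin : ∀ i, ¬ ρ (z i) < ρ (z a) := by
    intro i
    rcases P.all i with rfl | rfl | rfl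
    · exact lt_irrefl _
    · exact P.ab.not_gt
    · exact (P.ab.trans P.bc).not_gt
  obtain ⟨K, hK, hKX, hKe⟩ := S.reach (z a) (N X) (L.z_cover a) ((L.z_le a X).2 (Or.inl hX))
    (L.early_N.2 (Or.inl h))
  -- The covers of `z a` are `N (H a)` and the `T j`. The latter contain only new edges, and none of
  -- these precedes `z a`.
  rcases L.z_covBy a K hK ha with rfl | ⟨j, -, rfl⟩
  · rcases L.early_N.1 hKe with h1 | ⟨i, -, hi⟩
    · exact h1
    · exact absurd hi (hmin i)
  · obtain ⟨i, -, hi⟩ := L.early_T.1 hKe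
    exact absurd hi (hmin i)

/-- An early cover of `z b` below `N X` is `N (H b)` or some `T j`. As `H a` does not lie in `X`,
only `j = a` is possible, and `T a` contains no new edge before `z b`. -/
theorem oldEarly_median (L : CornerLink w w' N Good Ev H F z T) (S : LinkShell w' ρ) {a b c : Fin 3}
    {p : ℝ} (P : Placement w Ev N Good H z ρ a b c p) (hb : ∀ e, w ⋖ e → e ≠ Ev → N e ≠ z b)
    {X : α} (hX : H b ≤ X) (hXa : ¬ H a ≤ X) (h : OldEarly w Ev N ρ X (ρ (z b))) :
    OldEarly w Ev N ρ (H b) (ρ (z b)) := by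
  have hab : a ≠ b := by rintro rfl; exact lt_irrefl _ P.ab
  obtain ⟨K, hK, hKX, hKe⟩ := S.reach (z b) (N X) (L.z_cover b) ((L.z_le b X).2 (Or.inl hX))
    (L.early_N.2 (Or.inl h))
  rcases L.z_covBy b K hK hb with rfl | ⟨j, hj, rfl⟩
  · rcases L.early_N.1 hKe with h1 | ⟨i, hi, hib⟩
    · exact h1
    · rw [L.H_inj hi] at hib
      exact absurd hib (lt_irrefl _)
  · have hja : a = j := by
      by_contra hne
      exact hXa (L.T_le a j X hKX hne)
    obtain ⟨i, hi, hib⟩ := L.early_T.1 hKe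
    rcases P.all i with rfl | rfl | rfl
    · exact absurd hja hi
    · exact absurd hib (lt_irrefl _)
    · exact absurd hib P.bc.not_gt

/-- If some old edge in `X` precedes `z a`, then `oldEarly_first` applies. Otherwise consider the
first old edge `e` in `X`: a face at `e` inside `X` can be early only because of `z a`, so it is `H
a`, and `e` lies in `H a`. -/
theorem oldEarly_of_first (L : CornerLink w w' N Good Ev H F z T) (S : LinkShell w' ρ)
    (hfin : {e | w ⋖ e}.Finite) {a b c : Fin 3}
    {p : ℝ} (P : Placement w Ev N Good H z ρ a b c p) (ha : ∀ e, w ⋖ e → e ≠ Ev → N e ≠ z a)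
    {X : α} (hX : H a ≤ X) {k : ℝ} (hak : ρ (z a) < k) (hkb : k ≤ ρ (z b))
    (h : OldEarly w Ev N ρ X k) : OldEarly w Ev N ρ (H a) k := by
  by_cases h1 : OldEarly w Ev N ρ X (ρ (z a))
  · obtain ⟨e, he, hev, hlt, hle⟩ := L.oldEarly_first S P ha hX h1
    exact ⟨e, he, hev, hlt.trans hak, hle⟩
  · have hne : {e | w ⋖ e ∧ e ≠ Ev ∧ e ≤ X}.Nonempty := by
      obtain ⟨e, he, hev, -, hle⟩ := h
      exact ⟨e, he, hev, hle⟩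
    obtain ⟨e, ⟨he, hev, heX⟩, hmin⟩ := exists_min_image _ (fun e => ρ (N e))
      (hfin.subset fun e he => he.1) hne
    have hek : ρ (N e) < k := by
      obtain ⟨e', he', hev', hlt, hle⟩ := h
      exact (hmin e' ⟨he', hev', hle⟩).trans_lt hlt
    have hae : ρ (z a) < ρ (N e) := by
      refine lt_of_le_of_ne (not_lt.1 fun hlt => h1 ⟨e, he, hev, hlt, heX⟩) fun heq => ?_
      exact ha e he hev (S.inj (L.edge_cover he hev) (L.z_cover a) heq.symm)
    have hg : Good e := by
      rcases L.good_or e he hev with hg | ⟨i, hi⟩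
      · exact hg
      · rw [hi] at hek
        rcases P.all i with rfl | rfl | rfl
        · exact absurd hi (ha e he hev)
        · exact absurd hek hkb.not_gt
        · exact absurd (hek.trans_le hkb) P.bc.not_gt
    obtain ⟨K, hK, hKX, hKe⟩ := L.good_reach S he hev hg heX (Or.inr ⟨a, hX, hae⟩)
    rcases hKe with ⟨e', he', hev', hlt, hle⟩ | ⟨i, hi, hlt⟩
    · exact absurd hlt (hmin e' ⟨he', hev', hle.trans hKX⟩).not_gt
    · have hia : i = a := by
        rcases P.all i with rfl | rfl | rfl
        · rfl
        · exact absurd (hlt.trans hek) hkb.not_gt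
        · exact absurd ((hlt.trans hek).trans_le hkb) P.bc.not_gt
      subst hia
      rw [L.eq_H_of_H_le he hK hi] at hK
      exact ⟨e, he, hev, hek, hK.le⟩

end CornerLink

end Polytopal

namespace Polytopal
open Set

variable {α β : Type*} [PartialOrder α] [OrderTop α] [PartialOrder β] [OrderTop β]

/-! ### The restored order at the edge `Ev` and at the old edges that are cut properly or not at
all. -/

namespace CornerLink

variable {w : α} {w' : β} {N : α → β} {Good : α → Prop} {Ev : α} {H F : Fin 3 → α}
  {z T : Fin 3 → β} {ρ : β → ℝ}

open Classical in
/-- The order of the old edges at `w`. -/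
noncomputable def rank {α β : Type*} (Ev : α) (N : α → β) (ρ : β → ℝ) (p : ℝ) (e : α) : ℝ :=
  if e = Ev then p else ρ (N e)

theorem rank_ev {α β : Type*} {Ev : α} {N : α → β} {ρ : β → ℝ} {p : ℝ} : rank Ev N ρ p Ev = p := if_pos rfl

theorem rank_of_ne {α β : Type*} {Ev : α} {N : α → β} {ρ : β → ℝ} {p : ℝ} {e : α} (h : e ≠ Ev) : rank Ev N ρ p e = ρ (N e) := if_neg h

theorem early_rank (L : CornerLink w w' N Good Ev H F z T) {p : ℝ} {X : α} {k : ℝ} :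
    Early w (rank Ev N ρ p) X k ↔ OldEarly w Ev N ρ X k ∨ (Ev ≤ X ∧ p < k) := by
  constructor
  · rintro ⟨e, he, hk, hX⟩
    by_cases hev : e = Ev
    · subst hev
      rw [rank_ev] at hk
      exact Or.inr ⟨hX, hk⟩
    · rw [rank_of_ne hev] at hk
      exact Or.inl ⟨e, he, hev, hk, hX⟩
  · rintro (⟨e, he, hev, hk, hX⟩ | ⟨hX, hk⟩)
    · exact ⟨e, he, by rwa [rank_of_ne hev], hX⟩
    · exact ⟨Ev, L.ev, by rwa [rank_ev], hX⟩

theorem adj_H (L : CornerLink w w' N Good Ev H F z T) (i j : Fin 3) : FaceAdj (H i) (H j) := by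
  obtain ⟨k, hik, hjk⟩ : ∃ k, i ≠ k ∧ j ≠ k := by
    revert i j; decide
  exact ⟨F k, L.F_ne_top k, (L.H_le_F i k).2 hik, (L.H_le_F j k).2 hjk⟩

variable {a b c : Fin 3} {p : ℝ}

theorem ne_of_placement {α β : Type*} [PartialOrder α] {w : α} {N : α → β} {Good : α → Prop} {Ev : α}
    {H : Fin 3 → α} {z : Fin 3 → β} {ρ : β → ℝ} {a b c : Fin 3} {p : ℝ} (P : Placement w Ev N Good H z ρ a b c p) : a ≠ b ∧ a ≠ c ∧ b ≠ c := by
  refine ⟨?_, ?_, ?_⟩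
  · rintro rfl; exact lt_irrefl _ P.ab
  · rintro rfl; exact lt_irrefl _ (P.ab.trans P.bc)
  · rintro rfl; exact lt_irrefl _ P.bc

/-- Old edges that are not among the new edges keep their in-faces, up to the 2-face that contains
`Ev`. -/
theorem edge_good (L : CornerLink w w' N Good Ev H F z T) (S : LinkShell w' ρ)
    (hfin : {e | w ⋖ e}.Finite) (P : Placement w Ev N Good H z ρ a b c p) {e : α} (he : w ⋖ e)
    (hev : e ≠ Ev) (hg : Good e) :
    Conn {K | e ⋖ K ∧ Early w (rank Ev N ρ p) K (rank Ev N ρ p e)} ∧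
    ∀ X, e ≤ X → Early w (rank Ev N ρ p) X (rank Ev N ρ p e) →
      ∃ K, e ⋖ K ∧ K ≤ X ∧ Early w (rank Ev N ρ p) K (rank Ev N ρ p e) := by
  simp only [L.early_rank, rank_of_ne hev, (P.good e he hev hg).1]
  obtain ⟨hab, hac, hbc⟩ := ne_of_placement P
  have hconn := L.good_conn hg (S.conn_early (N e) (L.edge_cover he hev))
  simp only [L.early_N] at hconn
  have hreach := fun X => L.good_reach S he hev hg (X := X)
  have hne : Ev ≠ e := Ne.symm hev
  by_cases hH : ∃ i, e ≤ H i
  · obtain ⟨i, hi⟩ := hH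
    have hcov : e ⋖ H i := L.covBy_of_le Ev e (H i) L.ev (L.ev_le_H i) he hi
    have hev_iff : ∀ K, e ⋖ K → (Ev ≤ K ↔ K = H i) := by
      intro K hK
      constructor
      · intro h
        obtain ⟨j, rfl⟩ := L.eq_H_of_ev_le he hK h
        rw [L.edge_unique e i j he hev hi hK.le]
      · rintro rfl; exact (L.ev_le_H i).le
    have hz_iff : ∀ K, e ⋖ K → ((∃ j, H j ≤ K ∧ ρ (z j) < ρ (N e)) ↔
        K = H i ∧ ρ (z i) < ρ (N e)) := by
      intro K hK
      constructor
      · rintro ⟨j, hj, hlt⟩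
        have h1 := L.eq_H_of_H_le he hK hj
        have h2 := L.edge_unique e i j he hev hi (h1 ▸ hK.le)
        subst h2
        exact ⟨h1, hlt⟩
      · rintro ⟨rfl, hlt⟩; exact ⟨i, le_rfl, hlt⟩
    have hreach' : ∀ X, e ≤ X → OldEarly w Ev N ρ X (ρ (N e)) → ∃ K, e ⋖ K ∧ K ≤ X ∧
        (OldEarly w Ev N ρ K (ρ (N e)) ∨ K = H i ∧ ρ (z i) < ρ (N e)) := by
      intro X heX hX
      obtain ⟨K, hK, hKX, hKe⟩ := hreach X heX (Or.inl hX)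
      rw [hz_iff K hK] at hKe
      exact ⟨K, hK, hKX, hKe⟩
    have hI : {K | e ⋖ K ∧ (OldEarly w Ev N ρ K (ρ (N e)) ∨ Ev ≤ K ∧ ρ (z b) < ρ (N e))} =
        {K | e ⋖ K ∧ (OldEarly w Ev N ρ K (ρ (N e)) ∨ K = H i ∧ ρ (z b) < ρ (N e))} := by
      ext K
      refine and_congr_right fun hK => ?_
      rw [hev_iff K hK]
    have hI' : {K | e ⋖ K ∧ (OldEarly w Ev N ρ K (ρ (N e)) ∨ ∃ j, H j ≤ K ∧ ρ (z j) < ρ (N e))} =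
        {K | e ⋖ K ∧ (OldEarly w Ev N ρ K (ρ (N e)) ∨ K = H i ∧ ρ (z i) < ρ (N e))} := by
      ext K
      refine and_congr_right fun hK => ?_
      rw [hz_iff K hK]
    rw [hI'] at hconn
    rw [hI]
    -- The early faces at `e` in the two orders can differ only in `H i`: in the truncation it
    -- counts if `z i` precedes `e`, in the restored order if the median `z b` does, and in both if
    -- it has an earlier old edge.
    by_cases hbe : ρ (z b) < ρ (N e)
    · -- the new edge is late only if it is the last one
      have hadd : ∀ X, e ≤ X → (OldEarly w Ev N ρ X (ρ (N e)) ∨ Ev ≤ X ∧ ρ (z b) < ρ (N e)) →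
          ∃ K, e ⋖ K ∧ K ≤ X ∧ (OldEarly w Ev N ρ K (ρ (N e)) ∨ Ev ≤ K ∧ ρ (z b) < ρ (N e)) := by
        rintro X heX (hX | ⟨hX, -⟩)
        · obtain ⟨K, hK, hKX, hKe⟩ := hreach' X heX hX
          refine ⟨K, hK, hKX, hKe.imp_right fun h => ⟨?_, hbe⟩⟩
          rw [h.1]; exact (L.ev_le_H i).le
        · exact ⟨H i, hcov, L.H_le_of_edges e X i he hev hi heX hX,
            Or.inr ⟨(L.ev_le_H i).le, hbe⟩⟩
      refine ⟨?_, hadd⟩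
      by_cases hie : ρ (z i) < ρ (N e)
      · simpa only [hbe, hie, and_true] using hconn
      · have hic : i = c := by
          rcases P.all i with rfl | rfl | rfl
          · exact absurd (P.ab.trans hbe) hie
          · exact absurd hbe hie
          · rfl
        subst hic
        -- The additional early face `H i` has to be attached to the others. The facet `F b`
        -- contains it, and also an early face at `e`, since `H a` lies in `F b` and `z a` precedes
        -- `e`.
        obtain ⟨K, hK, hKF, hKe⟩ := hreach (F b)
          (hi.trans ((L.H_le_F _ _).2 (Ne.symm hbc)))
          (Or.inr ⟨a, (L.H_le_F _ _).2 hab, P.ab.trans hbe⟩)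
        rw [hz_iff K hK] at hKe
        have hadj : FaceAdj (H i) K :=
          ⟨F b, L.F_ne_top b, (L.H_le_F _ _).2 (Ne.symm hbc), hKF⟩
        convert hconn.insert ⟨hK, hKe⟩ hadj using 1
        ext M
        simp only [mem_ofPred_eq, Set.mem_insert_iff, hbe, hie, and_true, and_false, or_false]
        constructor
        · rintro ⟨h1, h2 | h2⟩
          · exact Or.inr ⟨h1, h2⟩
          · exact Or.inl h2
        · rintro (rfl | ⟨h1, h2⟩)
          · exact ⟨hcov, Or.inr rfl⟩
          · exact ⟨h1, Or.inl h2⟩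
    · simp only [hbe, and_false, or_false]
      by_cases hie : ρ (z i) < ρ (N e)
      · have hia : i = a := by
          rcases P.all i with rfl | rfl | rfl
          · rfl
          · exact absurd hie hbe
          · exact absurd (P.bc.trans hie) hbe
        subst hia
        -- Either `H i` stays early by an old edge, or no old edge at all precedes `e` and nothing
        -- is early.
        by_cases hold : OldEarly w Ev N ρ (H i) (ρ (N e))
        · have hall : ∀ K, (OldEarly w Ev N ρ K (ρ (N e)) ∨ K = H i ∧ ρ (z i) < ρ (N e)) ↔
              OldEarly w Ev N ρ K (ρ (N e)) := by
            intro K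
            refine ⟨?_, Or.inl⟩
            rintro (h | ⟨rfl, -⟩)
            · exact h
            · exact hold
          simp only [hall] at hconn hreach'
          exact ⟨hconn, hreach'⟩
        · have hnz : ∀ y, w ⋖ y → y ≠ Ev → N y ≠ z i := by
            intro y hy hyev heq
            refine hold ⟨y, hy, hyev, heq ▸ hie, (L.special y i hy hyev heq).2.1⟩
          have hnone : ¬ OldEarly w Ev N ρ ⊤ (ρ (N e)) := fun h =>
            hold (L.oldEarly_of_first S hfin P hnz le_top hie (not_lt.1 hbe) h)
          have hnone' : ∀ X, ¬ OldEarly w Ev N ρ X (ρ (N e)) := by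
            rintro X ⟨e', he', hev', hlt, -⟩
            exact hnone ⟨e', he', hev', hlt, le_top⟩
          refine ⟨Conn.of_covers_empty ?_, fun X _ hX => absurd hX (hnone' X)⟩
          exact eq_empty_iff_forall_notMem.2 fun K hK => hnone' K hK.2
      · simp only [hie, and_false, or_false] at hconn hreach'
        exact ⟨hconn, hreach'⟩
  · push Not at hH
    have hnoev : ∀ K, e ⋖ K → ¬ Ev ≤ K := by
      intro K hK h
      obtain ⟨j, rfl⟩ := L.eq_H_of_ev_le he hK h
      exact hH j hK.le
    have hnoz : ∀ K, e ⋖ K → ¬ ∃ j, H j ≤ K ∧ ρ (z j) < ρ (N e) := by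
      rintro K hK ⟨j, hj, -⟩
      exact hnoev K hK ((L.ev_le_H j).le.trans hj)
    constructor
    · convert hconn using 1
      ext K
      refine and_congr_right fun hK => ?_
      simp only [hnoev K hK, hnoz K hK, false_and]
    · rintro X heX hX
      have : OldEarly w Ev N ρ X (ρ (N e)) ∨ ∃ j, H j ≤ X ∧ ρ (z j) < ρ (N e) := by
        refine hX.imp_right ?_
        rintro ⟨hXev, hlt⟩
        by_cases ha : H a ≤ X
        · exact ⟨a, ha, P.ab.trans hlt⟩
        by_cases hb : H b ≤ X
        · exact ⟨b, hb, hlt⟩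
        -- Now `H c` is the only 2-face at `Ev` that can lie in `X`. Then `X ≤ H c`, and `e` would
        -- lie in `H c`.
        exfalso
        have hEvX : Ev < X := lt_of_le_of_ne hXev (by
          rintro rfl
          exact hev (CovBy.eq_of_le' he L.ev heX))
        refine hH c (heX.trans (L.le_H X c hEvX fun j hj => ?_))
        rcases P.all j with rfl | rfl | rfl
        · exact absurd hj ha
        · exact absurd hj hb
        · rfl
      obtain ⟨K, hK, hKX, hKe⟩ := hreach X heX this
      exact ⟨K, hK, hKX, Or.inl (hKe.resolve_right (hnoz K hK))⟩

/-- The 2-faces at `Ev` are pairwise adjacent, so only reachability is at stake: if a face over `Ev`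
contains an earlier old edge, one of its 2-faces `H i` must do so. The lemmas on the first and the
median new edge find it; when the median is an old edge, the side chosen in `Placement` decides. -/
theorem edge_ev (L : CornerLink w w' N Good Ev H F z T) (S : LinkShell w' ρ)
    (hfin : {e | w ⋖ e}.Finite) (P : Placement w Ev N Good H z ρ a b c p) :
    Conn {K | Ev ⋖ K ∧ Early w (rank Ev N ρ p) K (rank Ev N ρ p Ev)} ∧
    ∀ X, Ev ≤ X → Early w (rank Ev N ρ p) X (rank Ev N ρ p Ev) →
      ∃ K, Ev ⋖ K ∧ K ≤ X ∧ Early w (rank Ev N ρ p) K (rank Ev N ρ p Ev) := by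
  obtain ⟨hab, hac, hbc⟩ := ne_of_placement P
  constructor
  · refine Conn.of_pairwise fun x hx y hy => ?_
    obtain ⟨i, rfl⟩ := (L.ev_covBy x).1 hx.1
    obtain ⟨j, rfl⟩ := (L.ev_covBy y).1 hy.1
    exact L.adj_H i j
  simp only [L.early_rank, rank_ev, lt_irrefl, and_false, or_false]
  rintro X hX ⟨e, he, hev, hep, heX⟩
  suffices h : ∃ i, H i ≤ X ∧ OldEarly w Ev N ρ (H i) p by
    obtain ⟨i, hi, hi'⟩ := h
    exact ⟨H i, L.ev_le_H i, hi, hi'⟩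
  have hEvX : Ev < X := lt_of_le_of_ne hX (by
    rintro rfl
    exact hev (CovBy.eq_of_le' he L.ev heX))
  by_contra! hcon
  -- no face contains a single `H i`
  have hsingle : ∀ i, (∀ j, H j ≤ X → j = i) → False := by
    intro i hi
    obtain ⟨j, hj⟩ : ∃ j, H j ≤ X := by
      by_contra! hno
      exact hno i (L.H_le_of_edges e X i he hev
        (heX.trans (L.le_H X i hEvX hi)) heX hX)
    obtain rfl := hi j hj
    exact hcon j hj ⟨e, he, hev, hep, heX.trans (L.le_H X j hEvX hi)⟩
  have hy : ∀ y i, w ⋖ y → y ≠ Ev → N y = z i → H i ≤ X → p < ρ (z i) := by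
    intro y i hy hyev heq hi
    by_contra hlt
    refine hcon i hi ⟨y, hy, hyev, lt_of_le_of_ne (heq ▸ not_lt.1 hlt) (P.ne y hy hyev),
      (L.special y i hy hyev heq).2.1⟩
  have hold : OldEarly w Ev N ρ X (ρ (z b)) := by
    refine ⟨e, he, hev, ?_, heX⟩
    rcases L.good_or e he hev with hg | ⟨i, hi⟩
    · exact (P.good e he hev hg).2.1 hep
    · have h1 := (L.special e i he hev hi).2.1
      have := hy e i he hev hi (L.H_le_of_edges e X i he hev h1 heX hX)
      rw [hi] at hep
      exact absurd this hep.not_gt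
  have hup : ∀ i, (∀ e, w ⋖ e → e ≠ Ev → N e ≠ z i) → OldEarly w Ev N ρ (H i) (ρ (z b)) →
      OldEarly w Ev N ρ (H i) p := by
    rintro i hi ⟨e', he', hev', hlt, hle⟩
    refine ⟨e', he', hev', ?_, hle⟩
    rcases L.good_or e' he' hev' with hg | ⟨j, hj⟩
    · exact (P.good e' he' hev' hg).2.2 hlt
    · have h1 := (L.special e' j he' hev' hj).2.1
      rw [← L.edge_unique e' i j he' hev' hle h1] at hj
      exact absurd hj (hi e' he' hev')
  by_cases ha : H a ≤ X
  · have hna : ∀ e, w ⋖ e → e ≠ Ev → N e ≠ z a := fun e he hev heq =>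
      (hy e a he hev heq ha).not_gt P.ap
    exact hcon a ha (hup a hna (L.oldEarly_of_first S hfin P hna ha P.ab le_rfl hold))
  by_cases hb : H b ≤ X
  · by_cases hnb : ∀ e, w ⋖ e → e ≠ Ev → N e ≠ z b
    · exact hcon b hb (hup b hnb (L.oldEarly_median S P hnb hb ha hold))
    · push Not at hnb
      obtain ⟨y, hy', hyev, heq⟩ := hnb
      have hpb := hy y b hy' hyev heq hb
      rcases P.side y hy' hyev heq with ⟨-, h⟩ | ⟨h, -⟩
      · by_cases hc : H c ≤ X
        · exact h X hb hc ha hold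
        · refine hsingle b fun j hj => ?_
          rcases P.all j with rfl | rfl | rfl
          · exact absurd hj ha
          · rfl
          · exact absurd hj hc
      · exact hpb.not_gt h
  · refine hsingle c fun j hj => ?_
    rcases P.all j with rfl | rfl | rfl
    · exact absurd hj ha
    · exact absurd hj hb
    · rfl

end CornerLink

end Polytopal

namespace Polytopal
open Set

variable {α β : Type*} [PartialOrder α] [OrderTop α] [PartialOrder β] [OrderTop β]

/-! ### The restored order at an old edge that is also a new one. -/

namespace CornerLink

variable {w : α} {w' : β} {N : α → β} {Good : α → Prop} {Ev : α} {H F : Fin 3 → α}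
  {z T : Fin 3 → β} {ρ : β → ℝ} {a b c : Fin 3} {p : ℝ} {y : α} {i : Fin 3}

/-- At an old edge that is also a new one, the new 2-faces correspond to the triangle. -/
def Collapse (Good : α → Prop) (N : α → β) (H : Fin 3 → α) (T : Fin 3 → β) (y : α) (i : Fin 3)
    (K : β) (X : α) : Prop :=
  (y ⋖ X ∧ Good X ∧ K = N X) ∨ (X = H i ∧ ∃ j, i ≠ j ∧ K = T j)

theorem collapse_unique (L : CornerLink w w' N Good Ev H F z T) (hy : w ⋖ y) (hyev : y ≠ Ev)
    (hyz : N y = z i) {K : β} {X X' : α} (h : Collapse Good N H T y i K X)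
    (h' : Collapse Good N H T y i K X') : X = X' := by
  have hT : ∀ X j, y ⋖ X → Good X → i ≠ j → N X = T j → False := by
    intro X j hX hg hij heq
    rw [L.eq_H_of_H_le hy hX (L.T_le i j X heq.ge hij)] at hg
    exact (L.special y i hy hyev hyz).2.2.2.1 hg
  rcases h with ⟨h1, h2, rfl⟩ | ⟨rfl, j, hj, rfl⟩ <;>
    rcases h' with ⟨h1', h2', heq⟩ | ⟨rfl, j', hj', heq⟩
  · exact CovBy.eq_of_le' h1 h1' (L.good_le _ _ h2 heq.le)
  · exact absurd heq (fun h => hT X j' h1 h2 hj' h)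
  · exact absurd heq.symm (fun h => hT X' j h1' h2' hj h)
  · rfl

/-- If what is left of a face `W` contains `T j`, then `W` contains `H i`. So adjacency to any `T j`
becomes adjacency to the triangle. -/
theorem collapse_adj (L : CornerLink w w' N Good Ev H F z T) {K K' : β} {X X' : α}
    (h : Collapse Good N H T y i K X)
    (h' : Collapse Good N H T y i K' X') (hne : X ≠ X') (hadj : FaceAdj K K') : FaceAdj X X' := by
  have key : ∀ X j, Good X → i ≠ j → FaceAdj (N X) (T j) → FaceAdj X (H i) := by
    rintro X j hg hij ⟨Z, hZ, h1, h2⟩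
    obtain ⟨W, hW, rfl⟩ := L.good_exists X Z hg h1
    refine ⟨W, ?_, hW, L.T_le i j W h2 hij⟩
    rintro rfl
    exact hZ L.map_top
  rcases h with ⟨h1, h2, rfl⟩ | ⟨rfl, j, hj, rfl⟩ <;>
    rcases h' with ⟨h1', h2', rfl⟩ | ⟨rfl, j', hj', rfl⟩
  · exact L.good_adj h2 h2' hadj
  · exact key X j' h2 hj' hadj
  · exact (key X' j h2' hj hadj.symm).symm
  · exact absurd rfl hne

theorem conn_edge_collapse (L : CornerLink w w' N Good Ev H F z T) (S : LinkShell w' ρ)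
    (hy : w ⋖ y) (hyev : y ≠ Ev) (hyz : N y = z i) : Conn {K | y ⋖ K} := by
  obtain ⟨-, hyH, -, -, hcov⟩ := L.special y i hy hyev hyz
  have hyHc : y ⋖ H i := L.covBy_of_le Ev y (H i) L.ev (L.ev_le_H i) hy hyH
  have h := S.conn (z i) (L.z_cover i)
  refine h.of_rel (Collapse Good N H T y i) ?_ ?_ ?_ ?_
  · intro K hK
    rcases (L.edge_covBy i y K hy hyev hyz).1 hK with ⟨X, hX⟩ | hK
    · exact ⟨X, hX.1, Or.inl hX⟩
    · exact ⟨H i, hyHc, Or.inr ⟨rfl, hK⟩⟩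
  · intro X hX
    rcases hcov X hX with rfl | hg
    · obtain ⟨j, hj⟩ : ∃ j, i ≠ j := (exists_ne i).imp fun _ h => h.symm
      exact ⟨T j, L.z_covBy_T i j hj, Or.inr ⟨rfl, j, hj, rfl⟩⟩
    · exact ⟨N X, (L.edge_covBy i y _ hy hyev hyz).2 (Or.inl ⟨X, hX, hg, rfl⟩), Or.inl ⟨hX, hg, rfl⟩⟩
  · exact fun K _ X X' => L.collapse_unique hy hyev hyz
  · exact fun K _ K' _ X _ X' _ => L.collapse_adj

/-- If `Ev` precedes `y`, the triangle `H i` is early and stands for all `T j`. If `Ev` follows `y`,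
the triangle is not early, and an early `T j` has to be removed. This can only be `T c`, and only
when `y` is the median; its good neighbours all come from faces inside `F c`, so they stay connected
without it. -/
theorem edge_collapse (L : CornerLink w w' N Good Ev H F z T) (S : LinkShell w' ρ)
    (P : Placement w Ev N Good H z ρ a b c p)
    (hy : w ⋖ y) (hyev : y ≠ Ev) (hyz : N y = z i) :
    Conn {K | y ⋖ K ∧ Early w (rank Ev N ρ p) K (rank Ev N ρ p y)} ∧
    ∀ X, y ≤ X → Early w (rank Ev N ρ p) X (rank Ev N ρ p y) →
      ∃ K, y ⋖ K ∧ K ≤ X ∧ Early w (rank Ev N ρ p) K (rank Ev N ρ p y) := by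
  obtain ⟨hab, hac, hbc⟩ := ne_of_placement P
  obtain ⟨-, hyH, huniq, hnotgood, hcov⟩ := L.special y i hy hyev hyz
  have hyHc : y ⋖ H i := L.covBy_of_le Ev y (H i) L.ev (L.ev_le_H i) hy hyH
  simp only [L.early_rank, rank_of_ne hyev, hyz]
  have hpne : p ≠ ρ (z i) := fun h => P.ne y hy hyev (by rw [hyz, h])
  have hev_iff : ∀ K, y ⋖ K → (Ev ≤ K ↔ K = H i) := by
    intro K hK
    constructor
    · intro h
      obtain ⟨j, rfl⟩ := L.eq_H_of_ev_le hy hK h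
      rw [L.edge_unique y i j hy hyev hyH hK.le]
    · rintro rfl; exact (L.ev_le_H i).le
  have hHno : ¬ OldEarly w Ev N ρ (H i) (ρ (z i)) := by
    rintro ⟨e, he, hev, hlt, hle⟩
    rw [huniq e he hev hle, hyz] at hlt
    exact lt_irrefl _ hlt
  have hgoodE : ∀ X, y ⋖ X → Good X → (Early w' ρ (N X) (ρ (z i)) ↔
      OldEarly w Ev N ρ X (ρ (z i))) := by
    intro X hX hg
    rw [L.early_N]
    refine ⟨fun h => h.resolve_right ?_, Or.inl⟩
    rintro ⟨j, hj, -⟩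
    have h1 := L.eq_H_of_H_le hy hX hj
    have h2 := (hev_iff X hX).1 (h1 ▸ (L.ev_le_H j).le)
    exact hnotgood (h2 ▸ hg)
  have hconn := S.conn_early (z i) (L.z_cover i)
  have hreach := fun X (hyX : y ≤ X) (hX : OldEarly w Ev N ρ X (ρ (z i))) =>
    S.reach (z i) (N X) (L.z_cover i) (hyz ▸ L.mono _ _ hyX) (L.early_N.2 (Or.inl hX))
  by_cases hp : p < ρ (z i)
  · -- the triangle is an in-face
    have hia : i ≠ a := by rintro rfl; exact hp.not_gt P.ap
    obtain ⟨j, hij, hja⟩ : ∃ j, i ≠ j ∧ a ≠ j := by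
      clear * -
      revert i a; decide
    have hTj : Early w' ρ (T j) (ρ (z i)) := L.early_T.2 ⟨a, hja, P.ap.trans hp⟩
    constructor
    · refine hconn.of_rel (Collapse Good N H T y i) ?_ ?_ ?_ ?_
      · rintro K ⟨hK, hKe⟩
        rcases (L.edge_covBy i y K hy hyev hyz).1 hK with ⟨X, hX, hg, rfl⟩ | hK
        · exact ⟨X, ⟨hX, Or.inl ((hgoodE X hX hg).1 hKe)⟩, Or.inl ⟨hX, hg, rfl⟩⟩
        · exact ⟨H i, ⟨hyHc, Or.inr ⟨(L.ev_le_H i).le, hp⟩⟩, Or.inr ⟨rfl, hK⟩⟩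
      · rintro X ⟨hX, hXe⟩
        rcases hcov X hX with rfl | hg
        · exact ⟨T j, ⟨L.z_covBy_T i j hij, hTj⟩, Or.inr ⟨rfl, j, hij, rfl⟩⟩
        · have hXe' : OldEarly w Ev N ρ X (ρ (z i)) := by
            refine hXe.resolve_right fun h => ?_
            rw [(hev_iff X hX).1 h.1] at hg
            exact hnotgood hg
          exact ⟨N X, ⟨(L.edge_covBy i y _ hy hyev hyz).2 (Or.inl ⟨X, hX, hg, rfl⟩),
            (hgoodE X hX hg).2 hXe'⟩, Or.inl ⟨hX, hg, rfl⟩⟩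
      · exact fun K _ X X' => L.collapse_unique hy hyev hyz
      · exact fun K _ K' _ X _ X' _ => L.collapse_adj
    · intro X hyX hX
      have hHi : H i ≤ X → ∃ K, y ⋖ K ∧ K ≤ X ∧
          (OldEarly w Ev N ρ K (ρ (z i)) ∨ Ev ≤ K ∧ p < ρ (z i)) := fun h =>
        ⟨H i, hyHc, h, Or.inr ⟨(L.ev_le_H i).le, hp⟩⟩
      rcases hX with hX | ⟨hX, -⟩
      · obtain ⟨K, hK, hKX, hKe⟩ := hreach X hyX hX
        rcases (L.edge_covBy i y K hy hyev hyz).1 hK with ⟨Y, hY, hg, rfl⟩ | ⟨j', hj', rfl⟩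
        · exact ⟨Y, hY, L.good_le _ _ hg hKX, Or.inl ((hgoodE Y hY hg).1 hKe)⟩
        · exact hHi (L.T_le i j' X hKX hj')
      · exact hHi (L.H_le_of_edges y X i hy hyev hyH hyX hX)
  · -- the triangle is an out-face
    simp only [hp, and_false, or_false]
    have hib : ∀ j, i ≠ j → Early w' ρ (T j) (ρ (z i)) → i = b ∧ j = c := by
      intro j hj hTj
      obtain ⟨l, hlj, hl⟩ := L.early_T.1 hTj
      rcases P.all i with rfl | rfl | rfl
      · rcases P.all l with rfl | rfl | rfl
        · exact absurd hl (lt_irrefl _)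
        · exact absurd hl P.ab.not_gt
        · exact absurd hl (P.ab.trans P.bc).not_gt
      · refine ⟨rfl, ?_⟩
        have hla : l = a := by
          rcases P.all l with rfl | rfl | rfl
          · rfl
          · exact absurd hl (lt_irrefl _)
          · exact absurd hl P.bc.not_gt
        rcases P.all j with rfl | rfl | rfl
        · exact absurd hla hlj
        · exact absurd rfl hj
        · rfl
      · exact absurd P.pc hp
    set I'' := {K | z i ⋖ K ∧ Early w' ρ K (ρ (z i)) ∧ ∃ X, y ⋖ X ∧ Good X ∧ K = N X} with hI''
    -- The common bound comes from a face over `H a` and `H b`, which must be `F c`.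
    have hTadj : ∀ X, Good X → i = b → FaceAdj (T c) (N X) → X ≤ F c := by
      rintro X hg rfl ⟨Z, hZ, h1, h2⟩
      obtain ⟨W, hW, rfl⟩ := L.good_exists X Z hg h2
      have hWne : W ≠ ⊤ := by
        rintro rfl
        exact hZ L.map_top
      rwa [L.eq_F hab hac hbc (L.T_le a c W h1 hac) (L.T_le i c W h1 hbc) hWne] at hW
    have hconn'' : Conn I'' := by
      by_cases hTe : i = b ∧ Early w' ρ (T c) (ρ (z i))
      · obtain ⟨hib', hTe⟩ := hTe
        have hTmem : T c ∈ {K | z i ⋖ K ∧ Early w' ρ K (ρ (z i))} :=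
          ⟨L.z_covBy_T i c (hib' ▸ hbc), hTe⟩
        have hgood : ∀ K, z i ⋖ K → Early w' ρ K (ρ (z i)) → K ≠ T c →
            ∃ X, y ⋖ X ∧ Good X ∧ K = N X := by
          intro K hK hKe hKT
          rcases (L.edge_covBy i y K hy hyev hyz).1 hK with h | ⟨j, hj, rfl⟩
          · exact h
          · rw [(hib j hj hKe).2] at hKT
            exact absurd rfl hKT
        convert hconn.erase hTmem ?_ using 1
        · ext K
          constructor
          · rintro ⟨h1, h2, X, hX, hg, rfl⟩
            refine ⟨⟨h1, h2⟩, fun heq => ?_⟩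
            have := L.collapse_unique (X := X) (X' := H i) hy hyev hyz (Or.inl ⟨hX, hg, rfl⟩)
              (Or.inr ⟨rfl, c, hib' ▸ hbc, heq⟩)
            exact hnotgood (this ▸ hg)
          · rintro ⟨⟨h1, h2⟩, h3⟩
            exact ⟨h1, h2, hgood K h1 h2 h3⟩
        · rintro K ⟨hK, hKe⟩ K' ⟨hK', hKe'⟩ hne hne' hadj hadj'
          obtain ⟨X, hX, hg, rfl⟩ := hgood K hK hKe hne
          obtain ⟨X', hX', hg', rfl⟩ := hgood K' hK' hKe' hne'
          have h1 := hTadj X hg hib' hadj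
          have h2 := hTadj X' hg' hib' hadj'
          refine ⟨N (F c), fun h => L.F_ne_top c (top_le_iff.1 ?_), L.mono _ _ h1, L.mono _ _ h2⟩
          rw [← L.map_top] at h
          exact L.good_le ⊤ (F c) (L.good_mono _ _ le_top hg) h.ge
      · convert hconn using 1
        ext K
        refine and_congr_right fun hK => ⟨fun h => h.1, fun h => ⟨h, ?_⟩⟩
        rcases (L.edge_covBy i y K hy hyev hyz).1 hK with h' | ⟨j, hj, rfl⟩
        · exact h'
        · obtain ⟨h1, rfl⟩ := hib j hj h
          exact absurd ⟨h1, h⟩ hTe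
    constructor
    · refine hconn''.of_rel (Collapse Good N H T y i) ?_ ?_ ?_ ?_
      · rintro K ⟨hK, hKe, X, hX, hg, rfl⟩
        exact ⟨X, ⟨hX, (hgoodE X hX hg).1 hKe⟩, Or.inl ⟨hX, hg, rfl⟩⟩
      · rintro X ⟨hX, hXe⟩
        rcases hcov X hX with rfl | hg
        · exact absurd hXe hHno
        · exact ⟨N X, ⟨(L.edge_covBy i y _ hy hyev hyz).2 (Or.inl ⟨X, hX, hg, rfl⟩),
            (hgoodE X hX hg).2 hXe, X, hX, hg, rfl⟩, Or.inl ⟨hX, hg, rfl⟩⟩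
      · exact fun K _ X X' => L.collapse_unique hy hyev hyz
      · exact fun K _ K' _ X _ X' _ => L.collapse_adj
    · intro X hyX hX
      obtain ⟨K, hK, hKX, hKe⟩ := hreach X hyX hX
      rcases (L.edge_covBy i y K hy hyev hyz).1 hK with ⟨Y, hY, hg, rfl⟩ | ⟨j, hj, rfl⟩
      · exact ⟨Y, hY, L.good_le _ _ hg hKX, (hgoodE Y hY hg).1 hKe⟩
      · obtain ⟨hib', rfl⟩ := hib j hj hKe
        subst hib'
        -- If only `T c` was reached, the face `X₀` of the placement yields another early cover. By
        -- connectedness some early cover is adjacent to `T c`; it comes from a face inside `F c`,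
        -- hence inside `X`.
        rcases P.side y hy hyev hyz with ⟨h, -⟩ | ⟨-, X₀, hX₀, hX₀a, hX₀e⟩
        · exact absurd h hp
        obtain ⟨K₀, hK₀, hK₀X, hK₀e⟩ := hreach X₀ (hyH.trans hX₀) hX₀e
        have hK₀T : K₀ ≠ T j := by
          rintro rfl
          exact hX₀a (L.T_le a j X₀ hK₀X hac)
        obtain ⟨_, rfl, K₁, ⟨⟨hK₁, hK₁e⟩, hK₁T⟩, hadj⟩ := hconn {T j}
          (singleton_subset_iff.2 ⟨hK, hKe⟩) (singleton_nonempty _) ⟨K₀, ⟨hK₀, hK₀e⟩, hK₀T⟩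
        rcases (L.edge_covBy i y K₁ hy hyev hyz).1 hK₁ with ⟨Y, hY, hg, rfl⟩ | ⟨l, hl, rfl⟩
        · refine ⟨Y, hY, (hTadj Y hg rfl hadj).trans ?_, (hgoodE Y hY hg).1 hK₁e⟩
          exact L.F_le a i j X hab hac hbc (L.T_le a j X hKX hac) (L.T_le i j X hKX hbc)
        · rw [(hib l hl hK₁e).2] at hK₁T
          exact absurd rfl hK₁T

/-- If a truncation gets the shelling property at a vertex of the cutting hyperplane, then it was
there before. -/
theorem linkShell (L : CornerLink w w' N Good Ev H F z T) (S : LinkShell w' ρ)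
    (hfin : {e | w ⋖ e}.Finite) : ∃ ρ₀ : α → ℝ, LinkShell w ρ₀ ∧
      (∀ e, w ⋖ e → e ≠ Ev → ρ₀ e = ρ (N e)) ∧
      ∀ t, (∀ i, i ≠ 0 → t ≤ ρ (z i)) → t ≤ ρ₀ Ev := by
  obtain ⟨a, b, c, p, P, hp⟩ := L.exists_placement S
  refine ⟨rank Ev N ρ p, ⟨hfin, ?_, ?_, ?_, ?_⟩, fun e _ hev => rank_of_ne hev, fun t ht => by
    rw [rank_ev]; exact hp t ht⟩
  · intro e he e' he' heq
    by_cases hev : e = Ev <;> by_cases hev' : e' = Ev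
    · rw [hev, hev']
    · subst hev
      rw [rank_ev, rank_of_ne hev'] at heq
      exact absurd heq.symm (P.ne e' he' hev')
    · subst hev'
      rw [rank_ev, rank_of_ne hev] at heq
      exact absurd heq (P.ne e he hev)
    · rw [rank_of_ne hev, rank_of_ne hev'] at heq
      exact L.edge_inj he hev he' (S.inj (L.edge_cover he hev) (L.edge_cover he' hev') heq)
  · intro e he
    by_cases hev : e = Ev
    · subst hev
      refine Conn.of_pairwise fun x hx y hy => ?_
      obtain ⟨i, rfl⟩ := (L.ev_covBy x).1 hx
      obtain ⟨j, rfl⟩ := (L.ev_covBy y).1 hy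
      exact L.adj_H i j
    · rcases L.good_or e he hev with hg | ⟨i, hi⟩
      · have := S.conn (N e) (L.edge_cover he hev)
        simpa using L.good_conn hg (p := fun _ => True) (by simpa using this)
      · exact L.conn_edge_collapse S he hev hi
  · intro e he
    by_cases hev : e = Ev
    · subst hev; exact (L.edge_ev S hfin P).1
    · rcases L.good_or e he hev with hg | ⟨i, hi⟩
      · exact (L.edge_good S hfin P he hev hg).1
      · exact (L.edge_collapse S P he hev hi).1
  · intro e X he
    by_cases hev : e = Ev
    · subst hev; exact (L.edge_ev S hfin P).2 X
    · rcases L.good_or e he hev with hg | ⟨i, hi⟩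
      · exact (L.edge_good S hfin P he hev hg).2 X
      · exact (L.edge_collapse S P he hev hi).2 X

end CornerLink

end Polytopal

namespace Polytopal
open Set

/-! ### Ranks in dimension four, faces at a simple vertex and faces of the cutting simplex. -/

instance {d : ℕ} (P : Set (Fin d → ℝ)) : OrderTop (FaceLattice P) where
  top := ⟨P, IsExposed.refl P⟩
  le_top F := F.2.subset

@[simp] theorem coe_top_faceLattice {d : ℕ} (P : Set (Fin d → ℝ)) :
    (⊤ : FaceLattice P).1 = P := rfl

theorem faceDim_of_covBy_covBy {d : ℕ} {P : Set (Fin d → ℝ)} (h : IsHull P) {A e K : FaceLattice P}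
    (hA : faceDim A.1 = 0) (hne : A.1.Nonempty) (he : A ⋖ e) (hK : e ⋖ K) : faceDim K.1 = 2 := by
  rw [covBy_faceDim h hK (hne.mono he.le), covBy_faceDim h he hne, hA]

theorem covBy_of_le_of_covBy {d : ℕ} {P : Set (Fin d → ℝ)} (h : IsHull P)
    {A e e' K : FaceLattice P} (hne : A.1.Nonempty) (he : A ⋖ e) (hK : e ⋖ K) (he' : A ⋖ e')
    (hle : e' ≤ K) : e' ⋖ K := by
  refine covBy_of_faceDim hle (hne.mono he'.le) ?_
  rw [covBy_faceDim h hK (hne.mono he.le), covBy_faceDim h he hne, covBy_faceDim h he' hne]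

theorem covBy_of_lt_top {P : Set (Fin 4 → ℝ)} (h : IsHull P) (hdim : faceDim P = 4)
    {A e K Z : FaceLattice P} (hA : faceDim A.1 = 0) (hne : A.1.Nonempty) (he : A ⋖ e)
    (hK : e ⋖ K) (hKZ : K < Z) (hZ : Z < ⊤) : K ⋖ Z := by
  have hKne : K.1.Nonempty := hne.mono (he.le.trans hK.le)
  have h2 := faceDim_of_covBy_covBy h hA hne he hK
  have h3 := faceLattice_lt_faceDim hKZ hKne
  have h4 := faceLattice_lt_faceDim hZ (hKne.mono hKZ.le)
  rw [coe_top_faceLattice, hdim] at h4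
  exact covBy_of_faceDim hKZ.le hKne (by omega)

theorem exists_lt_top {P : Set (Fin 4 → ℝ)} (h : IsHull P) (hdim : faceDim P = 4)
    {A e K : FaceLattice P} (hA : faceDim A.1 = 0) (hne : A.1.Nonempty) (he : A ⋖ e)
    (hK : e ⋖ K) : ∃ Z, K < Z ∧ Z < ⊤ := by
  have h2 := faceDim_of_covBy_covBy h hA hne he hK
  obtain ⟨E, hE, h1, h3⟩ := h.exists_between K.2 (hne.mono (he.le.trans hK.le)) (by omega)
  exact ⟨⟨E, hE⟩, h1, h3⟩

namespace Corner

variable {P : Set (Fin 4 → ℝ)} (C : Corner P)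

/-- The face spanned by the vertex and its neighbours with index in `S`. -/
noncomputable def orthant (S : Finset (Fin 4)) : FaceLattice P :=
  ⟨{x | x ∈ P ∧ ∀ i, i ∉ S → C.mu i x = 0}, by
    choose m hm using C.exists_muLin
    have hval : ∀ x, (-∑ i ∈ Sᶜ, m i) x = (-∑ i ∈ Sᶜ, m i) C.v - ∑ i ∈ Sᶜ, C.mu i x := by
      intro x
      simp only [hm, LinearMap.neg_apply, LinearMap.sum_apply, Finset.sum_sub_distrib]
      ring
    have hnn : ∀ x ∈ P, ∀ i ∈ Sᶜ, 0 ≤ C.mu i x := fun x hx i _ => C.mu_nonneg hx i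
    convert isExposed_of_le (-∑ i ∈ Sᶜ, m i) ((-∑ i ∈ Sᶜ, m i) C.v) (fun x hx => by
      rw [hval]; linarith [Finset.sum_nonneg (hnn x hx)]) using 1
    ext x
    simp only [mem_ofPred_eq]
    refine and_congr_right fun hx => ?_
    rw [hval, sub_eq_self, Finset.sum_eq_zero_iff_of_nonneg (hnn x hx)]
    simp⟩

variable {C} {X Y : FaceLattice P} {S T : Finset (Fin 4)} {i j : Fin 4}

theorem v_mem_orthant : C.v ∈ (C.orthant S).1 := ⟨C.v_mem, fun _ _ => C.mu_v _⟩

theorem u_mem_orthant : C.u i ∈ (C.orthant S).1 ↔ i ∈ S := by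
  refine ⟨fun h => ?_, fun h => ⟨C.u_mem i, fun j hj => ?_⟩⟩
  · by_contra hi
    have := h.2 i hi
    rw [C.mu_u, if_pos rfl] at this
    exact one_ne_zero this
  · rw [C.mu_u, if_neg (by rintro rfl; exact hj h)]

theorem orthant_le (hv : C.v ∈ X.1) : C.orthant S ≤ X ↔ ∀ i ∈ S, C.u i ∈ X.1 := by
  refine ⟨fun h i hi => h (u_mem_orthant.2 hi), fun h x hx => ?_⟩
  obtain ⟨g, M, hg, hX⟩ := exists_functional X.2 ⟨_, hv⟩
  rw [hX] at hv h ⊢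
  refine ⟨hx.1, ?_⟩
  rw [C.apply_eq g x, hv.2, add_eq_left]
  refine Finset.sum_eq_zero fun i _ => ?_
  by_cases hi : i ∈ S
  · rw [(h i hi).2, sub_self, mul_zero]
  · rw [hx.2 i hi, zero_mul]

theorem le_orthant (hv : C.v ∈ X.1) : X ≤ C.orthant S ↔ ∀ i, C.u i ∈ X.1 → i ∈ S := by
  refine ⟨fun h i hi => u_mem_orthant.1 (h hi), fun h x hx => ⟨X.2.subset hx, fun i hi => ?_⟩⟩
  refine ((C.mu_nonneg (X.2.subset hx) i).eq_or_lt).elim Eq.symm fun hlt => ?_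
  exact absurd (h i (C.u_mem_face X.2 hv hx hlt)) hi

open Classical in
/-- The indices of the edges at the vertex in a face. -/
noncomputable def index (C : Corner P) (X : FaceLattice P) : Finset (Fin 4) :=
  Finset.univ.filter fun i => C.u i ∈ X.1

theorem mem_index : i ∈ C.index X ↔ C.u i ∈ X.1 := by simp [index]

theorem orthant_index (hv : C.v ∈ X.1) : C.orthant (C.index X) = X :=
  le_antisymm ((orthant_le hv).2 fun _ => mem_index.1) ((le_orthant hv).2 fun _ => mem_index.2)

theorem index_orthant : C.index (C.orthant S) = S := by
  ext i; rw [mem_index, u_mem_orthant]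

/-- The vertex figure at a simple vertex is a simplex: the faces over `v` correspond to arbitrary
sets of edges at `v`. -/
theorem intervalEmbedding_index {V : FaceLattice P} (hV : V.1 = {C.v}) :
    IntervalEmbedding C.index V := by
  have hle : ∀ {X}, V ≤ X ↔ C.v ∈ X.1 := fun {X} => by
    rw [← Subtype.coe_le_coe, hV]; exact singleton_subset_iff
  refine ⟨fun X Y hX hY => ?_, fun X S _ _ _ => ⟨C.orthant S, hle.2 v_mem_orthant, index_orthant⟩⟩
  rw [← orthant_index (hle.1 hX), orthant_le (hle.1 hY), index_orthant]
  exact ⟨fun h i hi => mem_index.1 (h hi), fun h i hi => mem_index.2 (h i hi)⟩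

theorem orthant_covBy_iff : C.orthant S ⋖ X ↔ ∃ i, i ∉ S ∧ X = C.orthant (insert i S) := by
  have hV : IsExposed ℝ P {C.v} := C.isHull.isExposed_singleton.2 C.v_vertex
  have h := intervalEmbedding_index (C := C) (V := ⟨{C.v}, hV⟩) rfl
  have hS : (⟨{C.v}, hV⟩ : FaceLattice P) ≤ C.orthant S := singleton_subset_iff.2 v_mem_orthant
  constructor
  · intro hc
    have hX := hS.trans hc.le
    obtain ⟨i, hi, hin⟩ := Finset.covBy_iff_exists_insert.1 ((h.covBy_iff hS hX).2 hc)
    rw [index_orthant] at hi hin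
    exact ⟨i, hi, by rw [hin, orthant_index (singleton_subset_iff.1 hX)]⟩
  · rintro ⟨i, hi, rfl⟩
    refine (h.covBy_iff hS (singleton_subset_iff.2 v_mem_orthant)).1 ?_
    rw [index_orthant, index_orthant]
    exact Finset.covBy_insert hi

theorem coe_orthant_singleton (i : Fin 4) : (C.orthant {i}).1 = segment ℝ C.v (C.nb i) := by
  have hv : C.v ∈ segment ℝ C.v (C.nb i) := left_mem_segment ℝ _ _
  refine Eq.trans ?_ (congrArg Subtype.val
    (orthant_index (C := C) (X := ⟨_, (C.isEdge_nb i).2⟩) hv))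
  congr 2
  ext j
  rw [mem_index, Finset.mem_singleton]
  refine ⟨?_, fun h => ?_⟩
  · rintro h; rw [h]; exact C.u_mem_segment i
  have h1 := C.nb_mem_of_u_mem (C.isEdge_nb i).2 h
  have h2 : C.nb j ∈ segment ℝ C.v (C.nb i) ∩ P.extremePoints ℝ := ⟨h1, C.nb_vertex j⟩
  rw [(C.isEdge_nb i).vertices] at h2
  rcases h2 with h2 | h2
  · exact absurd h2 (C.nb_ne_v j)
  · exact C.nb_injective (mem_singleton_iff.1 h2)

/-! ### The faces of the cutting face -/

/-- The faces of the cutting face as faces of the truncated polytope. -/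
def triFace (C : Corner P) (S : Finset (Fin 4)) : FaceLattice C.cut := ⟨C.tri S, C.isExposed_tri S⟩

/-- What the truncation leaves of a face. -/
def restrict (C : Corner P) (X : FaceLattice P) : FaceLattice C.cut :=
  ⟨X.1 ∩ C.cut, C.isExposed_inter_cut X.2⟩

/-- Faces that the cutting hyperplane does not bound. -/
def Proper (C : Corner P) (X : FaceLattice P) : Prop := ∃ x ∈ X.1, 1 < C.ht x

theorem triFace_le {Z : FaceLattice C.cut} : C.triFace S ≤ Z ↔ ∀ i ∈ S, C.u i ∈ Z.1 := by
  refine ⟨fun h i hi => h (C.u_mem_tri.2 hi), fun h x hx => ?_⟩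
  refine convexHull_min ?_ (Z.2.convex C.convex_cut) (C.tri_subset S hx)
  rintro _ ⟨i, hi, rfl⟩
  exact h i hi

theorem triFace_le_triFace : C.triFace S ≤ C.triFace T ↔ S ⊆ T := by
  rw [triFace_le]
  exact ⟨fun h i hi => C.u_mem_tri.1 (h i hi), fun h i hi => C.u_mem_tri.2 (h hi)⟩

theorem triFace_injective : Function.Injective C.triFace := fun _ _ h =>
  subset_antisymm (triFace_le_triFace.1 h.le) (triFace_le_triFace.1 h.ge)

theorem triFace_or_restrict (Z : FaceLattice C.cut) (hne : Z.1.Nonempty) :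
    (∃ S, S.Nonempty ∧ Z = C.triFace S) ∨ ∃ X, Z = C.restrict X ∧ C.Proper X ∧
      ∃ x ∈ Z.1, 1 < C.ht x := by
  rcases C.face_cut Z.2 hne with ⟨S, hS, h⟩ | ⟨F, hF, h, x, hx, hlt⟩
  · exact Or.inl ⟨S, hS, Subtype.ext h⟩
  · exact Or.inr ⟨⟨F, hF⟩, Subtype.ext h, ⟨x, (h ▸ hx : x ∈ F ∩ C.cut).1, hlt⟩, x, hx, hlt⟩

theorem Proper.exists_restrict (h : C.Proper X) : ∃ x ∈ (C.restrict X).1, 1 < C.ht x := by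
  obtain ⟨x, hx, hlt⟩ := h
  exact ⟨x, ⟨hx, X.2.subset hx, hlt.le⟩, hlt⟩

theorem not_le_triFace {Z : FaceLattice C.cut} (h : ∃ x ∈ Z.1, 1 < C.ht x) :
    ¬ Z ≤ C.triFace S := fun hle => by
  obtain ⟨x, hx, hlt⟩ := h
  exact hlt.ne' (hle hx).2.1

theorem triFace_covBy (hS : S.Nonempty) (hST : S ⋖ T) : C.triFace S ⋖ C.triFace T := by
  refine ⟨lt_of_le_not_ge (triFace_le_triFace.2 hST.le) fun h =>
    hST.lt.not_ge (triFace_le_triFace.1 h), fun Z h1 h2 => ?_⟩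
  obtain ⟨i, hi⟩ := hS
  rcases triFace_or_restrict Z ⟨_, h1.le (C.u_mem_tri.2 hi)⟩ with ⟨R, -, rfl⟩ | ⟨X, -, -, hX⟩
  · exact hST.2 (lt_of_le_not_ge (triFace_le_triFace.1 h1.le) fun h =>
      h1.not_ge (triFace_le_triFace.2 h)) (lt_of_le_not_ge (triFace_le_triFace.1 h2.le) fun h =>
      h2.not_ge (triFace_le_triFace.2 h))
  · exact not_le_triFace hX h2.le

theorem restrict_mono (h : X ≤ Y) : C.restrict X ≤ C.restrict Y := inter_subset_inter_left _ h

theorem restrict_top : C.restrict ⊤ = ⊤ := Subtype.ext (inter_eq_right.2 C.cut_subset)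

theorem le_of_restrict_le (h : C.v ∉ X.1 ∨ C.Proper X) (hle : C.restrict X ≤ C.restrict Y) :
    X ≤ Y :=
  C.subset_of_inter_cut_subset X.2 Y.2 h fun _ hx => (hle hx).1

theorem coe_restrict_of_notMem (hv : C.v ∉ X.1) : (C.restrict X).1 = X.1 :=
  inter_eq_left.2 (C.face_subset_cut X.2 hv)

theorem triFace_le_restrict : C.triFace S ≤ C.restrict X ↔ ∀ i ∈ S, C.u i ∈ X.1 :=
  triFace_le.trans ⟨fun h i hi => (h i hi).1, fun h i hi => ⟨h i hi, C.u_mem_cut i⟩⟩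

/-- Nothing changes above a face that rises over the hyperplane, because no face over it lies in the
cutting simplex. -/
theorem intervalEmbedding_restrict (h : C.Proper X) : IntervalEmbedding C.restrict X := by
  refine ⟨fun Y Z hY _ => ⟨le_of_restrict_le (Or.inr ?_), restrict_mono⟩, fun Y Z hY hZ _ => ?_⟩
  · exact h.imp fun x hx => ⟨hY hx.1, hx.2⟩
  · obtain ⟨x, hx, hlt⟩ := h.exists_restrict
    rcases triFace_or_restrict Z ⟨x, hZ hx⟩ with ⟨S, -, rfl⟩ | ⟨W, rfl, -, -⟩
    · exact absurd hZ (not_le_triFace h.exists_restrict)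
    · exact ⟨W, le_of_restrict_le (Or.inr h) hZ, rfl⟩

end Corner
end Polytopal

namespace Polytopal
open Set

/-! ### Edges at a neighbour in the cutting hyperplane. -/

namespace Corner

variable {P : Set (Fin 4 → ℝ)} {C : Corner P} {X Y e e' K : FaceLattice P} {p : Fin 4}
  {σ : Fin 3 → Fin 4} {i j : Fin 3}

/-- A neighbour of the corner as a face. -/
def nbFace (C : Corner P) (p : Fin 4) : FaceLattice P :=
  ⟨{C.nb p}, C.isHull.isExposed_singleton.2 (C.nb_vertex p)⟩

/-- A neighbour of the corner as a face of the truncated polytope. -/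
def nbFaceCut (C : Corner P) (p : Fin 4) : FaceLattice C.cut :=
  ⟨{C.nb p}, C.isHull_cut.isExposed_singleton.2 (C.vertex_cut (C.nb_vertex p) (C.nb_ne_v p))⟩

/-- `p` is the index of a neighbour in the cutting hyperplane, and `σ` lists the others, first the
one that is also in the hyperplane. -/
def BaseIndex (p : Fin 4) (σ : Fin 3 → Fin 4) : Prop :=
  (p = 0 ∧ σ = ![1, 2, 3]) ∨ (p = 1 ∧ σ = ![0, 2, 3])

namespace BaseIndex

theorem injective (h : BaseIndex p σ) : Function.Injective σ := by
  rcases h with ⟨rfl, rfl⟩ | ⟨rfl, rfl⟩ <;> decide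

theorem ne (h : BaseIndex p σ) : ∀ i, σ i ≠ p := by
  rcases h with ⟨rfl, rfl⟩ | ⟨rfl, rfl⟩ <;> decide

theorem cases (h : BaseIndex p σ) : ∀ l, l = p ∨ ∃ i, l = σ i := by
  rcases h with ⟨rfl, rfl⟩ | ⟨rfl, rfl⟩ <;> decide

theorem lt_two (h : BaseIndex p σ) : p < 2 := by
  rcases h with ⟨rfl, rfl⟩ | ⟨rfl, rfl⟩ <;> decide

theorem two_le_iff (h : BaseIndex p σ) : ∀ i, 2 ≤ σ i ↔ i ≠ 0 := by
  rcases h with ⟨rfl, rfl⟩ | ⟨rfl, rfl⟩ <;> decide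

theorem exists_compl (h : BaseIndex p σ) :
    ∀ i l, l ∉ ({p, σ i} : Finset (Fin 4)) → ∃ j, i ≠ j ∧ insert l {p, σ i} = ({σ j}ᶜ : Finset _) := by
  rcases h with ⟨rfl, rfl⟩ | ⟨rfl, rfl⟩ <;> decide

theorem exists_insert (h : BaseIndex p σ) :
    ∀ i j, i ≠ j → ∃ l, l ∉ ({p, σ i} : Finset (Fin 4)) ∧ ({σ j}ᶜ : Finset _) = insert l {p, σ i} := by
  rcases h with ⟨rfl, rfl⟩ | ⟨rfl, rfl⟩ <;> decide

theorem exists_two_le (h : BaseIndex p σ) : ∀ j, ∃ l, l ∈ ({σ j}ᶜ : Finset (Fin 4)) ∧ 2 ≤ l := by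
  rcases h with ⟨rfl, rfl⟩ | ⟨rfl, rfl⟩ <;> decide

theorem lt_two_of_mem (h : BaseIndex p σ) : ∀ l ∈ ({p, σ 0} : Finset (Fin 4)), l < 2 := by
  rcases h with ⟨rfl, rfl⟩ | ⟨rfl, rfl⟩ <;> decide

theorem mem_of_lt_two (h : BaseIndex p σ) : ∀ l < 2, l ∈ ({p, σ 0} : Finset (Fin 4)) := by
  rcases h with ⟨rfl, rfl⟩ | ⟨rfl, rfl⟩ <;> decide

theorem covBy (h : BaseIndex p σ) (hij : i ≠ j) : ({p, σ i} : Finset (Fin 4)) ⋖ {σ j}ᶜ := by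
  obtain ⟨l, hl, h⟩ := h.exists_insert i j hij
  rw [h]
  exact Finset.covBy_insert hl

theorem u_eq (h : BaseIndex p σ) (C : Corner P) : C.u p = C.nb p := C.u_eq_nb h.lt_two

end BaseIndex

theorem nbFace_covBy_orthant : C.nbFace p ⋖ C.orthant {p} :=
  (singleton_covBy_iff C.isHull rfl).2
    ⟨C.v, (C.isEdge_nb p).symm, by rw [coe_orthant_singleton, segment_symm]⟩

theorem v_notMem_edge (he : C.nbFace p ⋖ e) (hev : e ≠ C.orthant {p}) : C.v ∉ e.1 := by
  obtain ⟨y, hy, hey⟩ := (singleton_covBy_iff C.isHull rfl).1 he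
  intro hv
  have h2 : C.v ∈ segment ℝ (C.nb p) y ∩ P.extremePoints ℝ := ⟨hey ▸ hv, C.v_vertex⟩
  rw [hy.vertices] at h2
  rcases h2 with h2 | h2
  · exact C.nb_ne_v p h2.symm
  · refine hev (Subtype.ext ?_)
    rw [hey, coe_orthant_singleton, ← mem_singleton_iff.1 h2, segment_symm]

theorem exists_mu_pos (he : C.nbFace p ⋖ e) (hev : e ≠ C.orthant {p})
    (hH : e ≤ C.orthant {p, σ i}) : ∃ x ∈ e.1, 0 < C.mu (σ i) x := by
  by_contra hcon
  push Not at hcon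
  have hle : e ≤ C.orthant {p} := fun x hx => by
    refine ⟨(hH hx).1, fun l hl => ?_⟩
    rw [Finset.mem_singleton] at hl
    by_cases hli : l = σ i
    · rw [hli]; exact le_antisymm (hcon x hx) (C.mu_nonneg (hH hx).1 _)
    · exact (hH hx).2 l (by simp [hl, hli])
  exact hev (CovBy.eq_of_le' he nbFace_covBy_orthant hle)

theorem exists_edge (h0 : C.nb 0 ∈ X.1) (h1 : C.nb 1 ∈ X.1) (hv : C.v ∉ X.1) (hσ : BaseIndex p σ) :
    ∃ e, C.nbFace p ⋖ e ∧ e ≠ C.orthant {p} ∧ C.restrict e = C.triFace {p, σ 0} ∧ e ≤ X := by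
  have hedge := C.isEdge_nb_nb X.2 hv h0 h1
  have key : IsEdge P (C.u p) (C.u (σ 0)) ∧ C.u p ∈ X.1 ∧ C.u (σ 0) ∈ X.1 := by
    rcases hσ with ⟨rfl, rfl⟩ | ⟨rfl, rfl⟩
    · simp only [Matrix.cons_val_zero, C.u_eq_nb (i := 0) (by decide),
        C.u_eq_nb (i := 1) (by decide)]
      exact ⟨hedge, h0, h1⟩
    · simp only [Matrix.cons_val_zero, C.u_eq_nb (i := 0) (by decide),
        C.u_eq_nb (i := 1) (by decide)]
      exact ⟨hedge.symm, h1, h0⟩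
  have hle : segment ℝ (C.u p) (C.u (σ 0)) ⊆ X.1 :=
    (X.2.convex C.isHull.convex).segment_subset key.2.1 key.2.2
  have hv' : C.v ∉ segment ℝ (C.u p) (C.u (σ 0)) := fun h => hv (hle h)
  refine ⟨⟨_, key.1.2⟩, (singleton_covBy_iff C.isHull rfl).2 ⟨C.u (σ 0), ?_, ?_⟩, ?_, ?_, hle⟩
  · rw [← hσ.u_eq]; exact key.1
  · rw [← hσ.u_eq]
  · rintro h
    have := h ▸ v_mem_orthant (C := C) (S := {p})
    exact hv' this
  · refine Subtype.ext ?_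
    rw [coe_restrict_of_notMem hv']
    exact (C.tri_pair _ _).symm

theorem proper_or (hσ : BaseIndex p σ) (he : C.nbFace p ⋖ e) (hev : e ≠ C.orthant {p}) :
    C.Proper e ∨ ∃ i, C.restrict e = C.triFace {p, σ i} := by
  have hv := v_notMem_edge he hev
  obtain ⟨y, hy, hey⟩ := (singleton_covBy_iff C.isHull rfl).1 he
  have hye : y ∈ e.1 := hey ▸ right_mem_segment ℝ _ _
  have hyv : y ≠ C.v := fun h => hv (h ▸ hye)
  rcases (C.one_le_ht_of_vertex hy.right_mem hyv).eq_or_lt with h1 | h1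
  · right
    obtain ⟨l, -, rfl⟩ := C.mem_tri_vertex (S := Finset.univ) (C.vertex_cut hy.right_mem hyv)
      ⟨hy.right_mem.1, h1.symm, by simp⟩
    rcases hσ.cases l with rfl | ⟨i, rfl⟩
    · exact absurd (hσ.u_eq C) hy.1.symm
    · refine ⟨i, Subtype.ext ?_⟩
      rw [coe_restrict_of_notMem hv, hey, ← hσ.u_eq]
      exact (C.tri_pair _ _).symm
  · exact Or.inl ⟨y, hye, h1⟩

theorem u_mem_of_restrict_eq (hez : C.restrict e = C.triFace {p, σ i}) :
    C.u p ∈ e.1 ∧ C.u (σ i) ∈ e.1 := by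
  have := triFace_le_restrict.1 hez.ge
  exact ⟨this p (by simp), this _ (by simp)⟩

theorem eq_zero_of_restrict_eq (hσ : BaseIndex p σ) (he : C.nbFace p ⋖ e)
    (hev : e ≠ C.orthant {p}) (hez : C.restrict e = C.triFace {p, σ i}) : i = 0 := by
  by_contra hi
  exact v_notMem_edge he hev
    (C.v_mem_of_u_mem e.2 ((hσ.two_le_iff i).2 hi) (u_mem_of_restrict_eq hez).2)

theorem nb_mem_of_u_mem' (hσ : BaseIndex p σ) (h1 : C.u p ∈ X.1) (h2 : C.u (σ 0) ∈ X.1) :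
    C.nb 0 ∈ X.1 ∧ C.nb 1 ∈ X.1 := by
  have h1 := C.nb_mem_of_u_mem X.2 h1
  have h2 := C.nb_mem_of_u_mem X.2 h2
  rcases hσ with ⟨rfl, rfl⟩ | ⟨rfl, rfl⟩
  · exact ⟨h1, h2⟩
  · exact ⟨h2, h1⟩

theorem isEdge_of_restrict_eq (hσ : BaseIndex p σ) (he : C.nbFace p ⋖ e)
    (hev : e ≠ C.orthant {p}) (hez : C.restrict e = C.triFace {p, σ 0}) :
    IsEdge P (C.nb 0) (C.nb 1) := by
  obtain ⟨h1, h2⟩ := u_mem_of_restrict_eq hez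
  obtain ⟨h1, h2⟩ := nb_mem_of_u_mem' hσ h1 h2
  exact C.isEdge_nb_nb e.2 (v_notMem_edge he hev) h1 h2

theorem not_proper_orthant (hσ : BaseIndex p σ) (h : IsEdge P (C.nb 0) (C.nb 1)) :
    ¬ C.Proper (C.orthant {p, σ 0}) := by
  rintro ⟨x, hx, hlt⟩
  refine hlt.not_ge (C.ht_le_one h (C.orthant {p, σ 0}).2 v_mem_orthant (fun l hl => ?_) hx)
  exact hσ.lt_two_of_mem l (u_mem_orthant.1 hl)

/-- A face without `v` that does not rise over the hyperplane has all its vertices in it. These are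
among `nb 0` and `nb 1`, so the face is no larger than the edge `e`. -/
theorem v_mem_of_not_proper (hσ : BaseIndex p σ)
    (hez : C.restrict e = C.triFace {p, σ 0}) (hlt : e < X) (hX : ¬ C.Proper X) : C.v ∈ X.1 := by
  by_contra hv
  refine hlt.not_ge ((C.isHull.face_subset_iff X.2 e.2).2 fun x hx hxX => ?_)
  have hxv : x ≠ C.v := fun h => hv (h ▸ hxX)
  have h1 : C.ht x = 1 :=
    le_antisymm (not_lt.1 fun h => hX ⟨x, hxX, h⟩) (C.one_le_ht_of_vertex hx hxv)
  obtain ⟨l, -, rfl⟩ := C.mem_tri_vertex (S := Finset.univ) (C.vertex_cut hx hxv)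
    ⟨hx.1, h1, by simp⟩
  exact triFace_le_restrict.1 hez.ge l (hσ.mem_of_lt_two l (C.u_lt_two_of_vertex hx))

/-- For `i ≠ 0` the neighbour `nb (σ i)` has height 2. For `i = 0` the height is at most 1 on the
face, and where it is 1 there is a face that contains `nb 0` and `nb 1` but not `v`, so these are
adjacent. -/
theorem exists_edge_of_restrict_le (hσ : BaseIndex p σ)
    (h : ¬ C.Proper (C.orthant {p, σ i})) :
    i = 0 ∧ ∃ e, C.nbFace p ⋖ e ∧ e ≠ C.orthant {p} ∧ C.restrict e = C.triFace {p, σ 0} := by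
  have hi : i = 0 := by
    by_contra hi
    refine h ⟨C.nb (σ i), C.nb_mem_of_u_mem (C.orthant _).2 (u_mem_orthant.2 (by simp)), ?_⟩
    rw [C.ht_nb, k_eq_two ((hσ.two_le_iff i).2 hi)]
    norm_num
  subst hi
  refine ⟨rfl, ?_⟩
  obtain ⟨g, hg⟩ := C.exists_htLin
  have hle : ∀ x ∈ (C.orthant {p, σ 0}).1, g x ≤ g C.v + 1 := fun x hx => by
    have := not_lt.1 fun h' => h ⟨x, hx, h'⟩
    rw [hg] at this
    linarith
  have hE := C.isHull.face_trans (C.orthant {p, σ 0}).2 (isExposed_of_le g _ hle)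
  have hu : ∀ l ∈ ({p, σ 0} : Finset (Fin 4)), C.u l ∈
      {x | x ∈ (C.orthant {p, σ 0}).1 ∧ g x = g C.v + 1} := fun l hl => by
    refine ⟨u_mem_orthant.2 hl, ?_⟩
    have := C.ht_u l
    rw [hg] at this
    linarith
  obtain ⟨h0, h1⟩ := nb_mem_of_u_mem' (X := ⟨_, hE⟩) hσ (hu p (by simp)) (hu _ (by simp))
  have hv : C.v ∉ {x | x ∈ (C.orthant {p, σ 0}).1 ∧ g x = g C.v + 1} := fun h => by
    linarith [h.2]
  obtain ⟨e, h1, h2, h3, -⟩ := exists_edge (X := ⟨_, hE⟩) h0 h1 hv hσ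
  exact ⟨e, h1, h2, h3⟩

end Corner
end Polytopal

namespace Polytopal
open Set

theorem CovBy.eq_of_lt_of_le {α : Type*} [PartialOrder α] {a b c : α} (h : a ⋖ b)
    (hac : a < c) (hcb : c ≤ b) : c = b :=
  hcb.eq_of_not_lt (h.2 hac)

/-! ### The faces over such a neighbour before and after the truncation. -/

namespace Corner

variable {P : Set (Fin 4 → ℝ)} {C : Corner P} {X Y e e' K : FaceLattice P} {p : Fin 4}
  {σ : Fin 3 → Fin 4} {i j : Fin 3}

theorem faceDim_eq_four (h : IsPolytope P) : faceDim P = 4 := by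
  rw [faceDim, ← direction_affineSpan, h.2, AffineSubspace.direction_top, finrank_top]
  simp

theorem restrict_eq_unique (hσ : BaseIndex p σ) (he : C.nbFace p ⋖ e) (hev : e ≠ C.orthant {p})
    (hez : C.restrict e = C.triFace {p, σ 0}) (he' : C.nbFace p ⋖ e') (hev' : e' ≠ C.orthant {p})
    (hH : e' ≤ C.orthant {p, σ 0}) : e' = e := by
  rcases proper_or hσ he' hev' with ⟨x, hx, hlt⟩ | ⟨i, hi⟩
  · exact absurd ⟨x, hH hx, hlt⟩ (not_proper_orthant hσ (isEdge_of_restrict_eq hσ he hev hez))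
  · obtain rfl := eq_zero_of_restrict_eq hσ he' hev' hi
    exact le_antisymm (le_of_restrict_le (Or.inl (v_notMem_edge he' hev')) (hi.trans hez.symm).le)
      (le_of_restrict_le (Or.inl (v_notMem_edge he hev)) (hez.trans hi.symm).le)

theorem lt_orthant_of_restrict_eq (he : C.nbFace p ⋖ e) (hev : e ≠ C.orthant {p})
    (hez : C.restrict e = C.triFace {p, σ i}) : e < C.orthant {p, σ i} := by
  refine lt_of_le_not_ge (le_of_restrict_le (Or.inl (v_notMem_edge he hev)) ?_) fun h =>
    v_notMem_edge he hev (h v_mem_orthant)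
  rw [hez]
  exact triFace_le_restrict.2 fun l hl => u_mem_orthant.2 hl

theorem orthant_le_of_u_mem (hv : C.v ∈ X.1) (h1 : C.u p ∈ X.1) (h2 : C.u (σ i) ∈ X.1) :
    C.orthant {p, σ i} ≤ X := (orthant_le hv).2 fun l hl => by
  rw [Finset.mem_insert, Finset.mem_singleton] at hl
  rcases hl with rfl | rfl <;> assumption

theorem eq_orthant_or_proper (hσ : BaseIndex p σ) (he : C.nbFace p ⋖ e) (hev : e ≠ C.orthant {p})
    (hez : C.restrict e = C.triFace {p, σ 0}) (hK : e ⋖ K) :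
    K = C.orthant {p, σ 0} ∨ C.Proper K := by
  by_cases hp : C.Proper K
  · exact Or.inr hp
  · left
    have hv := v_mem_of_not_proper hσ hez hK.lt hp
    obtain ⟨h1, h2⟩ := u_mem_of_restrict_eq hez
    have hle := orthant_le_of_u_mem (σ := σ) (i := 0) hv (hK.le h1) (hK.le h2)
    exact (CovBy.eq_of_lt_of_le hK (lt_orthant_of_restrict_eq he hev hez) hle).symm

theorem triFace_covBy_cases (hσ : BaseIndex p σ) {Z : FaceLattice C.cut}
    (hZ : C.triFace {p, σ i} ⋖ Z) :
    (∃ j, i ≠ j ∧ Z = C.triFace {σ j}ᶜ) ∨ ∃ X, Z = C.restrict X ∧ C.Proper X := by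
  rcases triFace_or_restrict Z ⟨C.u p, hZ.le (C.u_mem_tri.2 (by simp))⟩ with ⟨S, -, rfl⟩ |
    ⟨X, hX, hp, -⟩
  · left
    have hlt := lt_of_le_not_ge (triFace_le_triFace.1 hZ.le) fun h => hZ.lt.not_ge
      (triFace_le_triFace.2 h)
    obtain ⟨l, hl, hlS⟩ := (Finset.ssubset_iff_exists_cons_subset).1 hlt
    rw [Finset.cons_eq_insert] at hlS
    obtain ⟨j, hij, hj⟩ := hσ.exists_compl i l hl
    refine ⟨j, hij, ?_⟩
    rw [hj] at hlS
    exact (CovBy.eq_of_lt_of_le hZ (triFace_covBy ⟨p, by simp⟩ (hσ.covBy hij)).lt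
      (triFace_le_triFace.2 hlS)).symm
  · exact Or.inr ⟨X, hX, hp⟩

/-- If the two neighbours in the hyperplane are adjacent, the 2-face that they span with `v` is
reduced to the edge between them, and two triangles of the cutting simplex replace it. The other
2-faces at this edge rise over the hyperplane and persist. -/
theorem edge_covBy_iff (hσ : BaseIndex p σ) (he : C.nbFace p ⋖ e) (hev : e ≠ C.orthant {p})
    (hez : C.restrict e = C.triFace {p, σ 0}) {Z : FaceLattice C.cut} :
    C.triFace {p, σ 0} ⋖ Z ↔ (∃ X, e ⋖ X ∧ C.Proper X ∧ Z = C.restrict X) ∨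
      ∃ j, 0 ≠ j ∧ Z = C.triFace {σ j}ᶜ := by
  have hv := v_notMem_edge he hev
  have hedge := isEdge_of_restrict_eq hσ he hev hez
  have hnH := not_proper_orthant hσ hedge
  have heH := lt_orthant_of_restrict_eq he hev hez
  have hne : ¬ C.Proper e := fun ⟨x, hx, hlt⟩ => hnH ⟨x, heH.le hx, hlt⟩
  constructor
  · intro hZ
    rcases triFace_covBy_cases hσ hZ with h | ⟨X, rfl, hp⟩
    · exact Or.inr h
    refine Or.inl ⟨X, ?_, hp, rfl⟩
    rw [← hez] at hZ
    have heX : e ≤ X := le_of_restrict_le (Or.inl hv) hZ.le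
    refine ⟨lt_of_le_of_ne heX (by rintro rfl; exact hne hp), fun Y h1 h2 => ?_⟩
    by_cases hY : C.Proper Y
    · refine hZ.2 (c := C.restrict Y) (lt_of_le_not_ge (restrict_mono h1.le) fun h => ?_)
        (lt_of_le_not_ge (restrict_mono h2.le) fun h => ?_)
      · exact h1.not_ge (le_of_restrict_le (Or.inr hY) h)
      · exact h2.not_ge (le_of_restrict_le (Or.inr hp) h)
    -- A face in between that does not rise over the hyperplane contains `v`. Then `X` contains a
    -- further edge at `v`, and a triangle of the cutting simplex would lie below what is left of
    -- `X`.
    · have hvX := h2.le (v_mem_of_not_proper hσ hez h1 hY)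
      have hu : ∃ l, l ∉ ({p, σ 0} : Finset (Fin 4)) ∧ C.u l ∈ X.1 := by
        by_contra hcon
        push Not at hcon
        have hle := (le_orthant (S := {p, σ 0}) hvX).2 fun l hl => by_contra fun h => hcon l h hl
        exact hnH (hp.imp fun x hx => ⟨hle hx.1, hx.2⟩)
      obtain ⟨l, hl, hlX⟩ := hu
      have hlt := triFace_covBy (C := C) ⟨p, by simp⟩ (Finset.covBy_insert hl)
      have hle : C.triFace (insert l {p, σ 0}) ≤ C.restrict X := triFace_le_restrict.2 fun m hm => by
        rcases Finset.mem_insert.1 hm with rfl | hm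
        · exact hlX
        · exact triFace_le_restrict.1 (hez.ge.trans hZ.le) m hm
      rw [hez] at hZ
      exact not_le_triFace hp.exists_restrict (CovBy.eq_of_lt_of_le hZ hlt.lt hle).ge
  · rintro (⟨X, hX, hp, rfl⟩ | ⟨j, hj, rfl⟩)
    · rw [← hez]
      refine ⟨lt_of_le_not_ge (restrict_mono hX.le) fun h => ?_, fun Z h1 h2 => ?_⟩
      · rw [hez] at h
        exact not_le_triFace hp.exists_restrict h
      have heu := u_mem_of_restrict_eq hez
      rcases triFace_or_restrict Z ⟨C.u p, h1.le (hez.ge (C.u_mem_tri.2 (by simp)))⟩ with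
        ⟨S, -, rfl⟩ | ⟨F, rfl, hF, -⟩
      · rw [hez] at h1
        obtain ⟨l, hl, hlS⟩ := Finset.ssubset_iff_exists_cons_subset.1 (lt_of_le_not_ge
          (triFace_le_triFace.1 h1.le) fun h => h1.not_ge (triFace_le_triFace.2 h))
        have hlX := triFace_le_restrict.1 h2.le l (hlS (Finset.mem_cons_self l _))
        have hl2 : 2 ≤ l := not_lt.1 fun h => hl (hσ.mem_of_lt_two l h)
        have hvX := C.v_mem_of_u_mem X.2 hl2 hlX
        refine hX.2 heH (lt_of_le_not_ge
          (orthant_le_of_u_mem hvX (hX.le heu.1) (hX.le heu.2)) fun h => ?_)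
        exact hl (u_mem_orthant.1 (h hlX))
      · have h3 : e ≤ F := le_of_restrict_le (Or.inl hv) h1.le
        have h4 : F ≤ X := le_of_restrict_le (Or.inr hF) h2.le
        rcases hX.eq_or_eq h3 h4 with rfl | rfl
        · exact h1.false
        · exact h2.false
    · exact triFace_covBy ⟨p, by simp⟩ (hσ.covBy hj)

theorem nbFaceCut_covBy_iff (hσ : BaseIndex p σ) {Z : FaceLattice C.cut} : C.nbFaceCut p ⋖ Z ↔
    (∃ i, Z = C.triFace {p, σ i}) ∨ ∃ e, C.nbFace p ⋖ e ∧ e ≠ C.orthant {p} ∧ Z = C.restrict e := by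
  rw [singleton_covBy_iff C.isHull_cut (w := C.nb p) rfl]
  constructor
  · rintro ⟨y, hy, hZ⟩
    rcases C.isEdge_cut_iff.1 hy with ⟨h, -, hyv⟩ | ⟨k, l, hkl, hk, rfl⟩ | ⟨k, hk, ⟨h, -⟩ | ⟨h, -⟩⟩
    · right
      have hc : C.nbFace p ⋖ (⟨_, h.2⟩ : FaceLattice P) :=
        (singleton_covBy_iff C.isHull rfl).2 ⟨y, h, rfl⟩
      have hev : (⟨_, h.2⟩ : FaceLattice P) ≠ C.orthant {p} := fun heq => hyv <| by
        have h1 : y ∈ (C.orthant {p}).1 ∩ P.extremePoints ℝ :=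
          heq ▸ ⟨right_mem_segment ℝ _ _, h.right_mem⟩
        rw [coe_orthant_singleton, (C.isEdge_nb p).vertices] at h1
        exact h1.resolve_right fun h2 => h.1 (mem_singleton_iff.1 h2).symm
      exact ⟨_, hc, hev, Subtype.ext (by rw [coe_restrict_of_notMem (v_notMem_edge hc hev), hZ])⟩
    · left
      rw [← hσ.u_eq] at hk
      obtain rfl := C.u_injective hk
      rcases hσ.cases l with rfl | ⟨i, rfl⟩
      · exact absurd rfl hkl
      · exact ⟨i, Subtype.ext (by rw [hZ, ← hσ.u_eq]; exact (C.tri_pair _ _).symm)⟩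
    · exact absurd hσ.lt_two (not_lt.2 (C.nb_injective h ▸ hk))
    · exact absurd h.symm (C.u_ne_nb hk p)
  · rintro (⟨i, rfl⟩ | ⟨e, he, hev, rfl⟩)
    · refine ⟨C.u (σ i), C.isEdge_cut_iff.2 (Or.inr (Or.inl ⟨p, σ i, (hσ.ne i).symm,
        (hσ.u_eq C).symm, rfl⟩)), ?_⟩
      rw [← hσ.u_eq]; exact C.tri_pair _ _
    · have hv := v_notMem_edge he hev
      obtain ⟨y, hy, hey⟩ := (singleton_covBy_iff C.isHull rfl).1 he
      refine ⟨y, C.isEdge_cut_iff.2 (Or.inl ⟨hy, C.nb_ne_v p, ?_⟩), ?_⟩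
      · rintro rfl
        exact hv (hey ▸ right_mem_segment ℝ _ _)
      · rw [coe_restrict_of_notMem hv, hey]

/-- Two facts carry most of the fields: faces at `v` are determined by their sets of edges at `v`,
and `restrict` reflects the order on faces that avoid `v` or rise over the hyperplane. The index 0
is special because only `σ 0` belongs to a vertex of the old polytope in the hyperplane. -/
theorem cornerLink (hσ : BaseIndex p σ) : CornerLink (C.nbFace p) (C.nbFaceCut p) C.restrict
    C.Proper (C.orthant {p}) (fun i => C.orthant {p, σ i}) (fun j => C.orthant {σ j}ᶜ)
    (fun i => C.triFace {p, σ i}) (fun j => C.triFace {σ j}ᶜ) where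
  ev := nbFace_covBy_orthant
  ev_covBy K := by
    rw [orthant_covBy_iff]
    constructor
    · rintro ⟨l, hl, rfl⟩
      rcases hσ.cases l with rfl | ⟨i, rfl⟩
      · simp at hl
      · exact ⟨i, by rw [Finset.pair_comm]⟩
    · rintro ⟨i, rfl⟩
      exact ⟨σ i, by simpa using hσ.ne i, by rw [Finset.pair_comm]⟩
  H_le_F i j := by
    rw [orthant_le v_mem_orthant]
    simp only [u_mem_orthant, Finset.mem_insert, Finset.mem_singleton, forall_eq_or_imp, forall_eq,
      Finset.mem_compl, hσ.injective.eq_iff]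
    exact ⟨fun h => h.2, fun h => ⟨fun h => hσ.ne j h.symm, h⟩⟩
  F_ne_top j h := by
    have : C.u (σ j) ∈ (C.orthant {σ j}ᶜ).1 := h ▸ C.u_mem _
    simp [u_mem_orthant] at this
  F_le i j k X hij hik hjk h1 h2 := by
    refine (orthant_le (h1 v_mem_orthant)).2 fun l hl => ?_
    rcases hσ.cases l with rfl | ⟨m, rfl⟩
    · exact h1 (u_mem_orthant.2 (by simp))
    have hmk : m ≠ k := by rintro rfl; simp at hl
    have hm : m = i ∨ m = j := by omega
    rcases hm with rfl | rfl
    · exact h1 (u_mem_orthant.2 (by simp))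
    · exact h2 (u_mem_orthant.2 (by simp))
  le_H X i hX h := by
    have hv := hX.le v_mem_orthant
    refine (le_orthant hv).2 fun l hl => ?_
    rcases hσ.cases l with rfl | ⟨m, rfl⟩
    · simp
    · obtain rfl := h m (orthant_le_of_u_mem hv (hX.le (u_mem_orthant.2 (by simp))) hl)
      simp
  H_le_of_edges e X i he hev heH heX hX := by
    obtain ⟨x, hx, hpos⟩ := exists_mu_pos he hev heH
    have hv := hX v_mem_orthant
    exact orthant_le_of_u_mem hv (hX (u_mem_orthant.2 (by simp)))
      (C.u_mem_face X.2 hv (heX hx) hpos)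
  edge_unique e i j he hev hi hj := by
    obtain ⟨x, hx, hpos⟩ := exists_mu_pos he hev hi
    by_contra hij
    refine hpos.ne' ((hj hx).2 _ ?_)
    simp [hσ.ne i, hσ.injective.eq_iff, hij]
  covBy_of_le e e' K he hK he' hle :=
    covBy_of_le_of_covBy (A := C.nbFace p) C.isHull (singleton_nonempty (C.nb p)) he hK he' hle
  coatom e K Z he hK hKZ hZ := covBy_of_lt_top (A := C.nbFace p) (e := e) C.isHull
    (faceDim_eq_four C.isPolytope) (faceDim_singleton (C.nb p)) (singleton_nonempty (C.nb p)) he hK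
    hKZ hZ
  mono X Y h := restrict_mono h
  map_top := restrict_top
  good_mono X Y h := Exists.imp fun x hx => ⟨h hx.1, hx.2⟩
  good_le X Y h := le_of_restrict_le (Or.inr h)
  good_exists X Z h hZ := by
    obtain ⟨Y, hY, hYZ⟩ := (intervalEmbedding_restrict h).2 ⊤ Z le_top hZ
      (restrict_top (C := C) ▸ le_top)
    exact ⟨Y, hY, hYZ.symm⟩
  edge_le e X he hev := le_of_restrict_le (Or.inl (v_notMem_edge he hev))
  good_or e := proper_or hσ
  good_ne e i h heq := not_le_triFace h.exists_restrict heq.le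
  special e i he hev hez := by
    obtain rfl := eq_zero_of_restrict_eq hσ he hev hez
    exact ⟨rfl, (lt_orthant_of_restrict_eq he hev hez).le,
      fun e' he' hev' => restrict_eq_unique hσ he hev hez he' hev',
      not_proper_orthant hσ (isEdge_of_restrict_eq hσ he hev hez),
      fun K => eq_orthant_or_proper hσ he hev hez⟩
  covBy_iff K := nbFaceCut_covBy_iff hσ
  z_inj i j h := by
    have h1 : σ i ∈ ({p, σ j} : Finset (Fin 4)) := triFace_injective h ▸ by simp
    simpa [hσ.ne i, hσ.injective.eq_iff] using h1
  z_le i X := by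
    constructor
    · intro h
      have h1 := triFace_le_restrict.1 h p (by simp)
      have h2 := triFace_le_restrict.1 h (σ i) (by simp)
      by_cases hv : C.v ∈ X.1
      · exact Or.inl (orthant_le_of_u_mem hv h1 h2)
      · have hi : i = 0 := by
          by_contra hi
          exact hv (C.v_mem_of_u_mem X.2 ((hσ.two_le_iff i).2 hi) h2)
        subst hi
        obtain ⟨h3, h4⟩ := nb_mem_of_u_mem' hσ h1 h2
        exact Or.inr (exists_edge h3 h4 hv hσ)
    · rintro (h | ⟨e, -, -, hez, heX⟩)
      · exact triFace_le_restrict.2 fun l hl => h (u_mem_orthant.2 hl)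
      · exact hez.ge.trans (restrict_mono heX)
  z_le_T i j := by
    rw [triFace_le_triFace]
    simp only [Finset.subset_iff, Finset.mem_insert, Finset.mem_singleton, forall_eq_or_imp,
      forall_eq, Finset.mem_compl, hσ.injective.eq_iff]
    exact ⟨fun h => h.2, fun h => ⟨fun h => hσ.ne j h.symm, h⟩⟩
  of_le_T K j hK hKT := by
    obtain ⟨y, hy, hKy⟩ := (singleton_covBy_iff C.isHull_cut rfl).1 hK
    obtain ⟨l, -, rfl⟩ := C.mem_tri_vertex hy.right_mem
      (hKT (hKy ▸ right_mem_segment ℝ _ _))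
    rcases hσ.cases l with rfl | ⟨i, rfl⟩
    · exact absurd (hσ.u_eq C) hy.1.symm
    · exact ⟨i, Subtype.ext (by rw [hKy, ← hσ.u_eq]; exact (C.tri_pair _ _).symm)⟩
  T_le i j X h hij := by
    have h1 := triFace_le_restrict.1 h
    obtain ⟨l, hl, hl2⟩ := hσ.exists_two_le j
    refine orthant_le_of_u_mem (C.v_mem_of_u_mem X.2 hl2 (h1 l hl)) (h1 p ?_) (h1 _ ?_)
    · simpa using (hσ.ne j).symm
    · simpa [hσ.injective.eq_iff] using hij
  z_covBy_T i j hij := triFace_covBy ⟨p, by simp⟩ (hσ.covBy hij)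
  z_covBy i K hK hno := by
    rcases triFace_covBy_cases hσ hK with h | ⟨X, rfl, hp⟩
    · exact Or.inr h
    left
    have hgood : C.Proper (C.orthant {p, σ i}) := by
      by_contra hcon
      obtain ⟨rfl, e, he, hev, hez⟩ := exists_edge_of_restrict_le hσ hcon
      exact hno e he hev hez
    have h1 := triFace_le_restrict.1 hK.le p (by simp)
    have h2 := triFace_le_restrict.1 hK.le (σ i) (by simp)
    have hv : C.v ∈ X.1 := by
      by_contra hv
      have hi : i = 0 := by
        by_contra hi
        exact hv (C.v_mem_of_u_mem X.2 ((hσ.two_le_iff i).2 hi) h2)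
      subst hi
      obtain ⟨h3, h4⟩ := nb_mem_of_u_mem' hσ h1 h2
      obtain ⟨e, he, hev, hez, -⟩ := exists_edge h3 h4 hv hσ
      exact hno e he hev hez
    refine (CovBy.eq_of_lt_of_le hK ?_ (restrict_mono (orthant_le_of_u_mem hv h1 h2))).symm
    refine lt_of_le_not_ge (triFace_le_restrict.2 fun l hl => u_mem_orthant.2 hl) fun h => ?_
    exact not_le_triFace hgood.exists_restrict h
  edge_covBy i e K he hev hez := by
    obtain rfl := eq_zero_of_restrict_eq hσ he hev hez
    exact edge_covBy_iff hσ he hev hez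

end Corner
end Polytopal

namespace Polytopal
open Set

theorem IsEdge.eq_of_segment_eq {d : ℕ} {P : Set (Fin d → ℝ)} {w x y : Fin d → ℝ}
    (hx : IsEdge P w x) (h : segment ℝ w x = segment ℝ w y) : x = y := by
  have h1 : x ∈ (segment ℝ w y).extremePoints ℝ := by
    rw [← h, extremePoints_segment]; simp
  rw [extremePoints_segment] at h1
  exact mem_singleton_iff.1 (h1.resolve_left fun h2 => hx.1 h2.symm)

/-! ### Local shellings descend along a truncation. -/

namespace PolytopalDigraph

variable {G : PolytopalDigraph 4} {C : Corner G.carrier} {hac : G.IsAcyclic}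
  {hno : ¬ Relation.TransGen G.arc (C.nb 1) (C.nb 0)}

theorem exists_arc_iff {d : ℕ} {G : PolytopalDigraph d} {w y : Fin d → ℝ}
    (hy : IsEdge G.carrier w y) :
    (∃ x, G.arc x w ∧ segment ℝ w y = segment ℝ w x) ↔ G.arc y w := by
  refine ⟨?_, fun h => ⟨y, h, rfl⟩⟩
  rintro ⟨x, hx, h⟩
  rwa [hy.eq_of_segment_eq h]

theorem truncArc_nb_iff (hno : ¬ Relation.TransGen G.arc (C.nb 1) (C.nb 0)) {w y : Fin 4 → ℝ}
    (h : IsEdge G.carrier w y) (hw : w ≠ C.v) (hy : y ≠ C.v) : truncArc C y w ↔ G.arc y w := by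
  refine ⟨?_, fun h => Or.inl ⟨h, hy, hw⟩⟩
  rintro (h' | ⟨i, j, hij, rfl, rfl⟩ | ⟨i, hi, rfl, rfl⟩)
  · exact h'.1
  · have hi := C.u_lt_two_of_vertex h.right_mem
    have hj := C.u_lt_two_of_vertex h.left_mem
    obtain rfl : i = 0 := by omega
    obtain rfl : j = 1 := by omega
    rw [C.u_eq_nb hi, C.u_eq_nb hj] at *
    exact (arc_or_arc h).resolve_left fun h => hno (.single h)
  · exact absurd h.left_mem (C.u_not_vertex hi)

/-- The faces over `w` only get restricted. If `w` is adjacent to `v`, the edge to `v` is shortened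
to the edge to some `u i`, and both are out-edges. -/
theorem localShell_of_one_lt_ht (hsink : G.IsSink G.carrier C.v) {w : Fin 4 → ℝ}
    (hw : w ∈ G.vertexSet) (hlt : 1 < C.ht w) (h : (truncate hac hno).LocalShell w) :
    G.LocalShell w := by
  obtain ⟨κ, t, h⟩ := h
  have hwv : w ≠ C.v := by
    rintro rfl
    rw [C.ht_v] at hlt
    norm_num at hlt
  refine ⟨κ ∘ C.restrict, t, fun A hA => ?_⟩
  have hp : C.Proper A := ⟨w, by rw [hA]; rfl, hlt⟩
  have hAB : (C.restrict A).1 = {w} := by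
    rw [Corner.coe_restrict_of_notMem (by rw [hA]; exact fun h => hwv (mem_singleton_iff.1 h).symm), hA]
  obtain ⟨hsh, hin⟩ := h (C.restrict A) hAB
  have hemb := Corner.intervalEmbedding_restrict hp
  refine ⟨hsh.pullback C.restrict A rfl hemb, fun e he => ?_⟩
  refine (hin _ ((hemb.covBy_iff le_rfl he.le).2 he)).trans ?_
  obtain ⟨y, hy, hey⟩ := (singleton_covBy_iff G.isHull hA).1 he
  by_cases hyv : y = C.v
  · subst hyv
    obtain ⟨i, rfl⟩ := C.exists_eq_nb hy.symm
    have hi : 2 ≤ i := by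
      by_contra hi
      rw [C.ht_nb, Corner.k_eq_one (not_le.1 hi)] at hlt
      exact hlt.false
    have h1 : (C.restrict e).1 = segment ℝ (C.nb i) (C.u i) := by
      rw [segment_symm, ← C.segment_inter_cut hi, segment_symm, ← hey]; rfl
    have hedge : IsEdge (truncate hac hno).carrier (C.nb i) (C.u i) :=
      C.isEdge_cut_iff.2 (Or.inr (Or.inr ⟨i, hi, Or.inl ⟨rfl, rfl⟩⟩))
    rw [h1, hey, exists_arc_iff hedge, exists_arc_iff hy]
    refine iff_of_false (fun h => ?_) (hsink.2.2 _ hw.1 · |>.elim)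
    exact C.u_ne_nb (by decide) i (truncArc_u hi h).2.symm
  · have hv : C.v ∉ e.1 := fun hv => by
      have h2 : C.v ∈ segment ℝ w y ∩ G.carrier.extremePoints ℝ := ⟨hey ▸ hv, C.v_vertex⟩
      rw [hy.vertices] at h2
      exact h2.elim (fun h => hwv h.symm) fun h => hyv (mem_singleton_iff.1 h).symm
    have hedge : IsEdge (truncate hac hno).carrier w y :=
      C.isEdge_cut_iff.2 (Or.inl ⟨hy, hwv, hyv⟩)
    rw [Corner.coe_restrict_of_notMem hv, hey, exists_arc_iff hedge, exists_arc_iff hy]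
    exact truncArc_nb_iff hno hy hwv hyv

/-- The polar facet is a simplex, for which any order will do. All edges at the sink are in-edges,
so the threshold 1 is put above all ranks, which are at most 0. -/
theorem localShell_v (hsink : G.IsSink G.carrier C.v) : G.LocalShell C.v := by
  set κ : Finset (Fin 4) → ℝ := fun S => -(Encodable.encode S : ℝ) with hκ
  have hinj : Function.Injective κ := fun S T h => by
    have : (Encodable.encode S : ℝ) = Encodable.encode T := neg_injective h
    exact Encodable.encode_injective (Nat.cast_injective this)
  refine ⟨κ ∘ C.index, 1, fun A hA => ⟨(rshell_finset _ _ κ rfl hinj.injOn).pullback C.index A rfl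
    (Corner.intervalEmbedding_index hA), fun e he => ?_⟩⟩
  obtain ⟨y, hy, hey⟩ := (singleton_covBy_iff G.isHull hA).1 he
  obtain ⟨i, rfl⟩ := C.exists_eq_nb hy
  refine iff_of_true ?_ ⟨_, arc_nb hsink i, hey⟩
  have : (0 : ℝ) ≤ (Encodable.encode (C.index e) : ℝ) := Nat.cast_nonneg _
  simp only [hκ, Function.comp_apply]
  linarith

/-- The old edges other than the one to `v` keep the ranks of their remainders, so their in-edges
are right. The edges to `u 2` and `u 3` are out-edges, hence not below the threshold, and then the
place of the edge to `v` is not below it either; this edge is an out-edge because `v` is the sink.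
-/
theorem localShell_nb (hsink : G.IsSink G.carrier C.v) {p : Fin 4} {σ : Fin 3 → Fin 4}
    (hσ : Corner.BaseIndex p σ) (h : (truncate hac hno).LocalShell (C.nb p)) :
    G.LocalShell (C.nb p) := by
  obtain ⟨κ, t, h⟩ := h
  obtain ⟨hsh, hin⟩ := h (C.nbFaceCut p) rfl
  have := G.isHull.finite_faceLattice
  have : Finite (FaceLattice C.cut) := C.isHull_cut.finite_faceLattice
  have hlink : LinkShell (C.nbFaceCut p) κ := RShell.linkShell hsh fun e K he hK =>
    exists_lt_top (A := C.nbFaceCut p) (e := e) C.isHull_cut (Corner.faceDim_eq_four C.isPolytope_cut)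
      (faceDim_singleton (C.nb p)) (singleton_nonempty (C.nb p)) he hK
  obtain ⟨ρ, hρ, hold, hev⟩ := (Corner.cornerLink hσ).linkShell hlink (toFinite _)
  refine ⟨ρ, t, fun A hA => ?_⟩
  obtain rfl : A = C.nbFace p := Subtype.ext hA
  refine ⟨hρ.rshell fun e K Z he hK hKZ hZ => covBy_of_lt_top (A := C.nbFace p) (e := e) C.isHull
    (Corner.faceDim_eq_four C.isPolytope) (faceDim_singleton (C.nb p))
    (singleton_nonempty (C.nb p)) he hK hKZ hZ, fun e he => ?_⟩
  obtain ⟨y, hy, hey⟩ := (singleton_covBy_iff G.isHull hA).1 he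
  rw [hey, exists_arc_iff hy]
  by_cases hee : e = C.orthant {p}
  · obtain rfl : y = C.v := hy.eq_of_segment_eq (by
      rw [← hey, hee, Corner.coe_orthant_singleton, segment_symm])
    refine iff_of_false (not_lt.2 ?_) (hsink.2.2 _ (C.nb_vertex p).1)
    rw [hee]
    refine hev t fun i hi => not_lt.1 fun hlt => ?_
    have hi2 := (hσ.two_le_iff i).2 hi
    have hcov := (Corner.cornerLink hσ).covBy_iff (C.triFace {p, σ i}) |>.2 (Or.inl ⟨i, rfl⟩)
    obtain ⟨x, hx, hzx⟩ := (hin _ hcov).1 hlt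
    have hedge : IsEdge (truncate hac hno).carrier (C.nb p) (C.u (σ i)) :=
      C.isEdge_cut_iff.2 (Or.inr (Or.inl ⟨p, σ i, (hσ.ne i).symm, (hσ.u_eq C).symm, rfl⟩))
    obtain rfl : C.u (σ i) = x := hedge.eq_of_segment_eq (by
      rw [← hzx, ← hσ.u_eq]; exact (C.tri_pair _ _).symm)
    exact C.u_ne_nb (by decide) p (truncArc_u hi2 hx).2.symm
  · have hv := Corner.v_notMem_edge he hee
    have hyv : y ≠ C.v := fun h => hv (h ▸ hey ▸ right_mem_segment ℝ _ _)
    have hedge : IsEdge (truncate hac hno).carrier (C.nb p) y :=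
      C.isEdge_cut_iff.2 (Or.inl ⟨hy, C.nb_ne_v p, hyv⟩)
    rw [hold e he hee, ← truncArc_nb_iff hno hy (C.nb_ne_v p) hyv]
    refine (hin _ ((Corner.nbFaceCut_covBy_iff hσ).2 (Or.inr ⟨e, he, hee, rfl⟩))).trans ?_
    rw [Corner.coe_restrict_of_notMem hv, hey, exists_arc_iff hedge]
    rfl

theorem localShell_of_truncate (hsink : G.IsSink G.carrier C.v)
    (h : ∀ w ∈ (truncate hac hno).vertexSet, (truncate hac hno).LocalShell w) :
    ∀ w ∈ G.vertexSet, G.LocalShell w := by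
  intro w hw
  by_cases hwv : w = C.v
  · exact hwv ▸ localShell_v hsink
  have hw' := C.vertex_cut hw hwv
  rcases (C.one_le_ht_of_vertex hw hwv).eq_or_lt with h1 | h1
  · obtain ⟨l, -, rfl⟩ := C.mem_tri_vertex (S := Finset.univ) hw' ⟨hw.1, h1.symm, by simp⟩
    have hl := C.u_lt_two_of_vertex hw
    have hσ : ∃ σ, Corner.BaseIndex l σ := by
      rcases (by omega : l = 0 ∨ l = 1) with rfl | rfl
      · exact ⟨_, Or.inl ⟨rfl, rfl⟩⟩
      · exact ⟨_, Or.inr ⟨rfl, rfl⟩⟩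
    obtain ⟨σ, hσ⟩ := hσ
    rw [C.u_eq_nb hl] at *
    exact localShell_nb hsink hσ (h _ hw')
  · exact localShell_of_one_lt_ht hsink hw h1 (h _ hw')

theorem isXType_truncate (hsink : G.IsSink G.carrier C.v) (h : G.IsXType) :
    (truncate hac hno).IsXType := by
  refine ⟨isAcyclic_truncate hac hno, isUSO_truncate hac hno h.2.1 hsink,
    holtKlee_truncate hac hno h.2.2.1 hsink, fun hs => h.2.2.2 ?_⟩
  exact shellingProperty_of_localShell hac h.2.1
    (localShell_of_truncate hsink (localShell_of_shellingProperty (by decide) hs))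

/-! ### Iteration of the two operations. -/

theorem exists_truncations {G₀ : PolytopalDigraph 4} (hX : G₀.IsXType) {v : Fin 4 → ℝ}
    (hsink : G₀.IsSink G₀.carrier v) (hsimple : IsSimpleVertex G₀.carrier v) (k : ℕ) :
    ∃ G : PolytopalDigraph 4, G.vertexSet.ncard = G₀.vertexSet.ncard + k ∧ G.IsXType ∧
      G₀.Extends 4 G ∧ ∃ v, G.IsSink G.carrier v ∧ IsSimpleVertex G.carrier v := by
  induction k with
  | zero => exact ⟨G₀, rfl, hX, .refl, v, hsink, hsimple⟩
  | succ k ih =>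
    obtain ⟨G, hn, hG, hext, v, hv, hvs⟩ := ih
    obtain ⟨C, rfl, hno⟩ := exists_corner_of_isSimpleVertex hG.1 hvs
    refine ⟨truncate hG.1 hno, ?_, isXType_truncate hv hG, .truncation hext
      (isTruncation_truncate hG.1 hno hG.2.1 hv hvs), C.u 3, isSink_truncate_u hG.1 hno,
      isSimpleVertex_truncate_u hG.1 hno⟩
    rw [ncard_vertexSet_truncate, hn, add_assoc]

theorem exists_pyramids {G₀ G : PolytopalDigraph 4} (hX : G.IsXType) (hext : G₀.Extends 4 G)
    {d : ℕ} (hd : 4 ≤ d) : ∃ G' : PolytopalDigraph d,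
      G'.vertexSet.ncard = G.vertexSet.ncard + (d - 4) ∧ G'.IsXType ∧ G₀.Extends d G' := by
  induction d, hd using Nat.le_induction with
  | base => exact ⟨G, rfl, hX, hext⟩
  | succ d hd ih =>
    obtain ⟨G', hn, hG', hext'⟩ := ih
    have hne := carrier_nonempty G' (by omega)
    refine ⟨G'.pyramid hne, ?_, isXType_pyramid (by omega) hG', .pyramid hext' G'.isPyramid_pyramid⟩
    rw [ncard_vertexSet_pyramid, hn]
    omega

end PolytopalDigraph

end Polytopal

theorem theorem2 (G₀ : Polytopal.PolytopalDigraph 4) (n₀ : ℕ) (hn₀ : G₀.vertexSet.ncard = n₀)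
    (hX : G₀.IsXType) (v : Fin 4 → ℝ) (hsink : G₀.IsSink G₀.carrier v)
    (hsimple : Polytopal.IsSimpleVertex G₀.carrier v) :
    ∀ d n : ℕ, 4 ≤ d → n₀ + (d - 4) ≤ n →
      ∃ G : Polytopal.PolytopalDigraph d,
        G.vertexSet.ncard = n ∧ G.IsXType ∧ G₀.Extends d G := by
  intro d n hd hn
  obtain ⟨G, hG, hGX, hext, -⟩ :=
    Polytopal.PolytopalDigraph.exists_truncations hX hsink hsimple (n - (n₀ + (d - 4)))
  obtain ⟨G', hG', hGX', hext'⟩ := Polytopal.PolytopalDigraph.exists_pyramids hGX hext hd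
  exact ⟨G', by omega, hGX', hext'⟩
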